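/- Let $n\ge 1$ and $q\in(0,1)$. **Notation.** Operators on a complex Hilbert space are possibly unbounded; products, sums and restrictions carry their natural domains, and equalities and inclusions of operators include domains. A *$q$-normal operator* is a densely defined closed operator $z$ with $zz^*=q^2z^*z$. A closed subspace $M$ *reduces* an operator $T$ if $T$ is the orthogonal sum of an operator in $M$ and an operator in $M^\perp$. **Well-behaved representations.** A well-behaved $*$-representation of the $n$-dimensional quantum complex plane $\mathcal O(\mathbb C_q^n)$ on a complex Hilbert space $\mathcal H$ consists of densely defined closed operators $z_1,\dots,z_n$ on $\mathcal H$ and a dense subspace $D$, contained in the domains of all $z_j,z_j^*$ and invariant under them, such that on $D$ $$z_jz_i=q\,z_iz_j\ (j>i),\qquad z_jz_i^*=q\,z_i^*z_j\ (j\ne i),\qquad z_iz_i^*=q^2z_i^*z_i-(1-q^2)\sum_{j>i}z_j^*z_j\ (1\le i\le n),$$ and such that, for $j,k\in\{1,\dots,n\}$: 1. $D$ is a core for $z_j$ and $z_j^*$, and the closure $Q_k$ of $\sum_{l\ge k}z_l^*z_l$ on $D$ is self-adjoint; let $E_k$ be the projection-valued measure with $Q_k=\int\lambda\,dE_k(\lambda)$.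 2. $Q_j$ and $Q_k$ strongly commute. 3. $E_j(S)D\subset D$ for every Borel set $S\subset\mathbb R$. 4. For every bounded Borel function $f:\mathbb R\to\mathbb C$: $f(Q_k)z_j\subset z_jf(Q_k)$ and $f(Q_k)z_j^*\subset z_j^*f(Q_k)$ if $j<k$; $f(Q_k)z_j\subset z_jf(q^{-2}Q_k)$ and $f(Q_k)z_j^*\subset z_j^*f(q^{2}Q_k)$ if $j\ge k$. 5. $z_n$ is $q$-normal and, for $k<n$, the restriction of $z_k$ to $\ker(Q_{k+1})$ is $q$-normal. 6. For $j<k$, on $\ker(Q_k)^\perp$ the products $Q_{j+1}^{-1/2}z_j$ and $z_jQ_{j+1}^{-1/2}$ have the same closure $w_j$, which is a densely defined closed operator with $w_jw_j^*=q^2w_j^*w_j-(1-q^2)$. The representation is *irreducible* if $\mathcal H\ne\{0\}$ and no closed subspace other than $\{0\}$ and $\mathcal H$ reduces all $z_j$ and $z_j^*$. **Models.** Let $\mathcal K_0,\mathcal K_1,\dots,\mathcal K_n$ be complex Hilbert spaces (possibly zero) and, for $k=1,\dots,n$, let $A_k$ be a bounded self-adjoint operator on $\mathcal K_k$ with $\mathrm{spec}(A_k)\subset[q,1]$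 such that $q$ is not an eigenvalue of $A_k$. Put $\mathcal H_0=\mathcal K_0$ and, for $k\ge1$, $$\mathcal H_k=\overline{\bigoplus_{i_1,\dots,i_{k-1}\in\{1,2,\dots\}}\ \bigoplus_{i_k\in\mathbb Z}}\ \mathcal G_{i_1,\dots,i_k},\qquad \mathcal G_{i_1,\dots,i_k}=\mathcal K_k ,$$ write $h_{i_1,\dots,i_k}$ for $h\in\mathcal K_k$ regarded as an element of $\mathcal G_{i_1,\dots,i_k}$, and let $D_{\rm alg}\subset\mathcal H_0\oplus\dots\oplus\mathcal H_n$ be the algebraic direct sum of $\mathcal H_0$ and of all the $\mathcal G_{i_1,\dots,i_k}$, $k\geq 1$. On $D_{\rm alg}$ define: $z_1=\dots=z_n=0$ on $\mathcal H_0$, and on $\mathcal H_k$ ($k\ge1$) $$z_{k+1}=\dots=z_n=0,\qquad z_kh_{i_1,\dots,i_k}=q^{-i_k}(A_kh)_{i_1,\dots,i_{k-1},i_k+1},$$ $$z_jh_{i_1,\dots,i_k}=\sqrt{q^{-2i_j}-1}\;q^{-(i_{j+1}+\dots+i_k)}(A_kh)_{i_1,\dots,i_j+1,\dots,i_k}\qquad(1\le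 j<k).$$ The model operators $z_1,\dots,z_n$ on $\mathcal H_0\oplus\dots\oplus\mathcal H_n$ are the closures of these. **Theorem.** (a) Every well-behaved $*$-representation of $\mathcal O(\mathbb C_q^n)$ is unitarily equivalent to a model: the unitary carries each closed operator $z_j$ to that of the model. Under this identification all $\mathcal H_k$, $k=0,\dots,n$, reduce all $z_j$ and $z_j^*$, and $\ker(Q_k)=\mathcal H_0\oplus\dots\oplus\mathcal H_{k-1}$ for $k=1,\dots,n$. (b) Conversely, every model is a well-behaved $*$-representation with the common dense domain $D=D_{\rm alg}$; all $\mathcal H_k$ reduce it, and $\ker(Q_k)=\mathcal H_0\oplus\dots\oplus\mathcal H_{k-1}$ for $k=1,\dots,n$. (c) A model is irreducible if and only if $\mathcal K_k\ne\{0\}$ for exactly one $k\in\{0,\dots,n\}$ and $\dim\mathcal K_k=1$ for this $k$, i.e. $\mathcal H_0=\mathbb C$ or $\mathcal K_k=\mathbb C$. Moreover, if $k\ge1$ and $\dim\mathcal K_k=1$, then $A_k$ is multiplication by a real number in $(q,1]$. -/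

import Mathlib

universe u

noncomputable section

namespace QuantumPlane

open MeasureTheory Filter Topology
open scoped ENNReal InnerProductSpace

variable {H : Type u} [NormedAddCommGroup H] [InnerProductSpace ℂ H] [CompleteSpace H]

/-- A projection-valued measure on the Borel sets of the real line: values on Borel sets are
orthogonal projections, `E(ℝ) = 1`, `E(M ∩ N) = E(M) E(N)`, and `E` is strongly countably additive.
(Values on sets that are not Borel are irrelevant.) -/
structure PVM (H : Type u) [NormedAddCommGroup H] [InnerProductSpace ℂ H] [CompleteSpace H] where
  /-- the projections -/
  proj : Set ℝ → H →L[ℂ] H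
  isStarProjection : ∀ s, MeasurableSet s → IsStarProjection (proj s)
  univ : proj Set.univ = 1
  inter : ∀ s t, MeasurableSet s → MeasurableSet t → proj (s ∩ t) = proj s * proj t
  hasSum_iUnion : ∀ s : ℕ → Set ℝ, (∀ i, MeasurableSet (s i)) →
    Pairwise (Function.onFun Disjoint s) →
    ∀ x : H, HasSum (fun i => proj (s i) x) (proj (⋃ i, s i) x)

namespace PVM

variable (E : PVM H)

lemma proj_empty : E.proj ∅ = 0 := by
  ext x
  have h := E.hasSum_iUnion (fun _ => ∅) (fun _ => MeasurableSet.empty)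
    (fun _ _ _ => by simp [Function.onFun]) x
  have h2 := h.summable.tendsto_atTop_zero
  simpa using tendsto_nhds_unique tendsto_const_nhds h2

lemma inner_proj {s t : Set ℝ} (hs : MeasurableSet s) (ht : MeasurableSet t) (x y : H) :
    ⟪E.proj s x, E.proj t y⟫_ℂ = ⟪x, E.proj (s ∩ t) y⟫_ℂ := by
  rw [E.inter s t hs ht, mul_apply_eq_comp]
  conv_lhs => rw [← (E.isStarProjection s hs).isSelfAdjoint.star_eq]
  rw [ContinuousLinearMap.star_eq_adjoint, ContinuousLinearMap.adjoint_inner_left]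

lemma inner_proj_self {s : Set ℝ} (hs : MeasurableSet s) (x : H) :
    ⟪x, E.proj s x⟫_ℂ = ((‖E.proj s x‖ ^ 2 : ℝ) : ℂ) := by
  have := E.inner_proj hs hs x x
  rw [Set.inter_self] at this
  rw [← this, inner_self_eq_norm_sq_to_K]
  simp

lemma hasSum_norm_sq (s : ℕ → Set ℝ) (hs : ∀ i, MeasurableSet (s i))
    (hd : Pairwise (Function.onFun Disjoint s)) (x : H) :
    HasSum (fun i => ‖E.proj (s i) x‖ ^ 2) (‖E.proj (⋃ i, s i) x‖ ^ 2) := by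
  have h := (E.hasSum_iUnion s hs hd x).mapL (innerSL ℂ x)
  simp only [innerSL_apply_apply, E.inner_proj_self (hs _),
    E.inner_proj_self (MeasurableSet.iUnion hs)] at h
  exact_mod_cast h

/-- The scalar spectral measure `M ↦ ‖E(M) x‖² = ⟪x, E(M) x⟫`. -/
def measure (x : H) : Measure ℝ :=
  Measure.ofMeasurable (fun s _ => ENNReal.ofReal (‖E.proj s x‖ ^ 2))
    (by simp [E.proj_empty])
    (fun s hs hd => by
      have h := E.hasSum_norm_sq s hs hd x
      rw [← h.tsum_eq, ENNReal.ofReal_tsum_of_nonneg (fun _ => by positivity) h.summable])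

lemma measure_apply (x : H) {s : Set ℝ} (hs : MeasurableSet s) :
    E.measure x s = ENNReal.ofReal (‖E.proj s x‖ ^ 2) :=
  Measure.ofMeasurable_apply s hs

instance (x : H) : IsFiniteMeasure (E.measure x) :=
  ⟨by rw [E.measure_apply x MeasurableSet.univ]; exact ENNReal.ofReal_lt_top⟩

lemma proj_union {s t : Set ℝ} (hs : MeasurableSet s) (ht : MeasurableSet t)
    (hd : Disjoint s t) (x : H) : E.proj (s ∪ t) x = E.proj s x + E.proj t x := by
  classical
  let v : VectorMeasure ℝ H :=
    { measureOf' := fun s => if MeasurableSet s then E.proj s x else 0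
      empty' := by simp [E.proj_empty]
      not_measurable' := fun s hs => by simp [hs]
      m_iUnion' := fun s hs hd => by
        have := E.hasSum_iUnion s hs hd x
        simpa [hs, MeasurableSet.iUnion hs] using this }
  have hv : ∀ s, MeasurableSet s → v s = E.proj s x := fun s hs => by
    change (if MeasurableSet s then E.proj s x else 0) = _
    simp [hs]
  have := VectorMeasure.of_union (v := v) hd hs ht
  rwa [hv _ hs, hv _ ht, hv _ (hs.union ht)] at this

/-- The integral `∑ c • E(g = c)` of a simple function. -/
def simpleIntegral (g : SimpleFunc ℝ ℂ) : H →L[ℂ] H :=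
  ∑ c ∈ g.range, c • E.proj (g ⁻¹' {c})

lemma simpleIntegral_sub (g h : SimpleFunc ℝ ℂ) (x : H) :
    E.simpleIntegral (g - h) x = E.simpleIntegral g x - E.simpleIntegral h x := by
  let T : Set ℝ → ℂ →L[ℝ] H := fun s =>
    ((ContinuousLinearMap.id ℂ ℂ).smulRight (E.proj s x)).restrictScalars ℝ
  have hT : FinMeasAdditive (E.measure x) T := by
    intro s t hs ht _ _ hd
    ext
    simp [T, E.proj_union hs ht hd x]
  have key : ∀ k : SimpleFunc ℝ ℂ, E.simpleIntegral k x = k.setToSimpleFunc T := by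
    intro k
    simp [simpleIntegral, SimpleFunc.setToSimpleFunc, T]
  rw [key, key, key]
  exact SimpleFunc.setToSimpleFunc_sub T hT (SimpleFunc.integrable_of_isFiniteMeasure g)
    (SimpleFunc.integrable_of_isFiniteMeasure h)

lemma norm_simpleIntegral_sq (g : SimpleFunc ℝ ℂ) (x : H) :
    ENNReal.ofReal (‖E.simpleIntegral g x‖ ^ 2) = ∫⁻ t, ‖g t‖ₑ ^ 2 ∂E.measure x := by
  have hm : ∀ c, MeasurableSet (g ⁻¹' {c}) := fun c => g.measurableSet_fiber c
  have h1 : ‖E.simpleIntegral g x‖ ^ 2 = ∑ c ∈ g.range, ‖c‖ ^ 2 * ‖E.proj (g ⁻¹' {c}) x‖ ^ 2 := by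
    have : ⟪E.simpleIntegral g x, E.simpleIntegral g x⟫_ℂ =
        ∑ c ∈ g.range, ((‖c‖ ^ 2 * ‖E.proj (g ⁻¹' {c}) x‖ ^ 2 : ℝ) : ℂ) := by
      simp only [simpleIntegral, _root_.sum_apply, sum_inner, inner_sum,
        _root_.smul_apply, inner_smul_left, inner_smul_right]
      refine Finset.sum_congr rfl fun c hc => ?_
      rw [Finset.sum_eq_single c]
      · rw [E.inner_proj (hm c) (hm c), Set.inter_self, E.inner_proj_self (hm c), ← mul_assoc,
          Complex.mul_conj']
        push_cast
        ring
      · intro d _ hdc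
        rw [E.inner_proj (hm d) (hm c), ← Set.preimage_inter,
          Set.singleton_inter_eq_empty.mpr (by simpa using hdc), Set.preimage_empty, E.proj_empty]
        simp
      · exact fun h => absurd hc h
    rw [inner_self_eq_norm_sq_to_K] at this
    exact Complex.ofReal_injective (by push_cast at this ⊢; exact this)
  have h2 : (fun t => ‖g t‖ₑ ^ 2) = g.map (fun c => ‖c‖ₑ ^ 2) := by
    ext; simp
  rw [h1, h2, SimpleFunc.lintegral_eq_lintegral, SimpleFunc.map_lintegral,
    ENNReal.ofReal_sum_of_nonneg (fun _ _ => by positivity)]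
  refine Finset.sum_congr rfl fun c _ => ?_
  rw [E.measure_apply x (hm c), ENNReal.ofReal_mul (by positivity),
    ENNReal.ofReal_pow (norm_nonneg c), ofReal_norm]

/-- The vectors `x` with `∫ |f|² d‖E(·)x‖² < ∞`: the domain of `∫ f dE`. -/
def integralDomain (f : ℝ → ℂ) : Submodule ℂ H where
  carrier := {x | ∫⁻ t, ‖f t‖ₑ ^ 2 ∂E.measure x < ∞}
  zero_mem' := by
    have : E.measure (0 : H) = 0 := by
      ext s hs
      simp [E.measure_apply _ hs]
    simp [this]
  add_mem' := by
    intro x y hx hy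
    have hle : E.measure (x + y) ≤ (2 : ℝ≥0∞) • (E.measure x + E.measure y) := by
      refine Measure.le_iff.2 fun s hs => ?_
      simp only [Measure.smul_apply, Measure.add_apply, E.measure_apply _ hs, smul_eq_mul]
      rw [← ENNReal.ofReal_add (by positivity) (by positivity),
        show (2 : ℝ≥0∞) = ENNReal.ofReal 2 by simp, ← ENNReal.ofReal_mul (by norm_num)]
      refine ENNReal.ofReal_le_ofReal ?_
      rw [map_add]
      have := norm_add_le (E.proj s x) (E.proj s y)
      nlinarith [sq_nonneg (‖E.proj s x‖ - ‖E.proj s y‖), norm_nonneg (E.proj s x + E.proj s y)]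
    refine (lintegral_mono' hle le_rfl).trans_lt ?_
    rw [lintegral_smul_measure, lintegral_add_measure]
    exact ENNReal.mul_lt_top (by simp) (ENNReal.add_lt_top.2 ⟨hx, hy⟩)
  smul_mem' := by
    intro c x hx
    have hEq : E.measure (c • x) = (‖c‖ₑ ^ 2) • E.measure x := by
      ext s hs
      simp only [Measure.smul_apply, E.measure_apply _ hs, smul_eq_mul, map_smul, norm_smul,
        mul_pow]
      rw [ENNReal.ofReal_mul (by positivity), ENNReal.ofReal_pow (norm_nonneg c),
        ofReal_norm]
    change ∫⁻ t, ‖f t‖ₑ ^ 2 ∂E.measure (c • x) < ∞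
    rw [hEq, lintegral_smul_measure]
    exact ENNReal.mul_lt_top (by finiteness) hx

/-- Mathlib's standard simple functions `fₘ` with `fₘ → f` pointwise (and in `L²`). -/
def approx (f : ℝ → ℂ) (hf : Measurable f) (m : ℕ) : SimpleFunc ℝ ℂ :=
  SimpleFunc.approxOn f hf (Set.range f ∪ {0}) 0 (by simp) m

lemma exists_tendsto_simpleIntegral (f : ℝ → ℂ) (hf : Measurable f) {x : H}
    (hx : x ∈ E.integralDomain f) :
    ∃ y, Tendsto (fun m => E.simpleIntegral (approx f hf m) x) atTop (𝓝 y) := by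
  have hL : ∀ g : ℝ → ℂ, eLpNorm g 2 (E.measure x) =
      (∫⁻ t, ‖g t‖ₑ ^ 2 ∂E.measure x) ^ (1 / 2 : ℝ) := by
    intro g
    rw [eLpNorm_eq_lintegral_rpow_enorm_toReal (by simp) (by simp)]
    simp
  have hfin : eLpNorm f 2 (E.measure x) < ∞ := by
    rw [hL]
    exact ENNReal.rpow_lt_top_of_nonneg (by norm_num) (ne_of_lt hx)
  have ht := SimpleFunc.tendsto_approxOn_range_Lp_eLpNorm (p := 2) (by simp) hf hfin
  have hS : ∀ g : SimpleFunc ℝ ℂ, ‖E.simpleIntegral g x‖ₑ = eLpNorm g 2 (E.measure x) := by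
    intro g
    rw [hL, ← E.norm_simpleIntegral_sq, ENNReal.ofReal_pow (norm_nonneg _), ofReal_norm,
      ← ENNReal.rpow_natCast, ← ENNReal.rpow_mul]
    simp
  refine cauchySeq_tendsto_of_complete ?_
  rw [EMetric.cauchySeq_iff]
  intro ε hε
  have h2 := (ENNReal.tendsto_nhds_zero.1 ht) (ε / 3) (by
    exact ENNReal.div_pos hε.ne' (by simp))
  obtain ⟨N, hN⟩ := eventually_atTop.1 h2
  refine ⟨N, fun m hm n hn => ?_⟩
  by_cases htop : ε = ∞
  · rw [htop]; exact edist_lt_top _ _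
  rw [edist_eq_enorm_sub, ← E.simpleIntegral_sub, hS]
  have hsplit : (⇑(approx f hf m - approx f hf n) : ℝ → ℂ) =
      (⇑(approx f hf m) - f) - (⇑(approx f hf n) - f) := by
    ext t; simp
  rw [hsplit]
  calc eLpNorm ((⇑(approx f hf m) - f) - (⇑(approx f hf n) - f)) 2 (E.measure x)
      ≤ eLpNorm (⇑(approx f hf m) - f) 2 (E.measure x)
        + eLpNorm (⇑(approx f hf n) - f) 2 (E.measure x) :=
        eLpNorm_sub_le ((approx f hf m).measurable.sub hf).aestronglyMeasurable
          ((approx f hf n).measurable.sub hf).aestronglyMeasurable (by norm_num)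
    _ ≤ ε / 3 + ε / 3 := add_le_add (hN m hm) (hN n hn)
    _ < ε := by
        rw [← ENNReal.add_div, ← two_mul]
        refine ENNReal.div_lt_of_lt_mul ?_
        rw [mul_comm]
        exact ENNReal.mul_lt_mul_right hε.ne' htop (by norm_num)

/-- The operator `∫ f dE`, with domain `{x | ∫ |f|² d‖E(·)x‖² < ∞}` and values the limits of the
integrals of simple functions approximating `f`. -/
def integral (f : ℝ → ℂ) (hf : Measurable f) : H →ₗ.[ℂ] H where
  domain := E.integralDomain f
  toFun :=
    { toFun := fun x => limUnder atTop fun m => E.simpleIntegral (approx f hf m) (x : H)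
      map_add' := fun x y => by
        have hx := tendsto_nhds_limUnder (E.exists_tendsto_simpleIntegral f hf x.2)
        have hy := tendsto_nhds_limUnder (E.exists_tendsto_simpleIntegral f hf y.2)
        refine Tendsto.limUnder_eq ((hx.add hy).congr fun m => ?_)
        simp
      map_smul' := fun c x => by
        have hx := tendsto_nhds_limUnder (E.exists_tendsto_simpleIntegral f hf x.2)
        refine Tendsto.limUnder_eq ((hx.const_smul c).congr fun m => ?_)
        simp }

end PVM

/-! Unbounded operators -/

/-- The product `S T` of unbounded operators, on its natural domain
`{x ∈ dom T | T x ∈ dom S}`. -/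
def pcomp (S T : H →ₗ.[ℂ] H) : H →ₗ.[ℂ] H where
  domain := (S.domain.comap T.toFun).map T.domain.subtype
  toFun := S.toFun ∘ₗ LinearMap.codRestrict S.domain
    (T.toFun ∘ₗ Submodule.inclusion (Submodule.map_subtype_le _ _)) (by
      rintro ⟨_, ⟨x, hx, rfl⟩⟩
      exact hx)

/-- The identity operator, as an everywhere defined partial map. -/
def pone : H →ₗ.[ℂ] H := LinearMap.id.toPMap ⊤

/-- The kernel of an unbounded operator, as a subspace of the Hilbert space. -/
def kernel (T : H →ₗ.[ℂ] H) : Submodule ℂ H :=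
  (LinearMap.ker T.toFun).map T.domain.subtype

set_option linter.unusedSectionVars false in
lemma mem_kernel_iff (T : H →ₗ.[ℂ] H) (x : H) : x ∈ kernel T ↔ (x, (0 : H)) ∈ T.graph := by
  simp [kernel, LinearPMap.mem_graph_iff]

lemma kernel_isClosed {T : H →ₗ.[ℂ] H} (hT : T.IsClosed) : IsClosed (kernel T : Set H) := by
  have : (kernel T : Set H) = (fun x : H => (x, (0 : H))) ⁻¹' (T.graph : Set (H × H)) := by
    ext x
    exact mem_kernel_iff T x
  rw [this]
  exact IsClosed.preimage (by fun_prop) hT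

lemma kernel_complete {T : H →ₗ.[ℂ] H} (hT : T.IsClosed) : CompleteSpace (kernel T) :=
  (kernel_isClosed hT).completeSpace_coe

/-- The restriction of `T` to a subspace `M`, as an operator in `M`, with domain
`{x ∈ M ∩ dom T | T x ∈ M}`. -/
def restrict (T : H →ₗ.[ℂ] H) (M : Submodule ℂ H) : M →ₗ.[ℂ] M where
  domain := ((M.comap T.toFun).map T.domain.subtype).comap M.subtype
  toFun := LinearMap.codRestrict M
    (T.toFun ∘ₗ LinearMap.codRestrict T.domain
      (M.subtype ∘ₗ Submodule.subtype _) (by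
        rintro ⟨x, ⟨y, hy, hyx⟩⟩
        change (x : H) ∈ T.domain
        have : (y : H) = x := hyx
        rw [← this]
        exact y.2)) (by
      rintro ⟨x, ⟨y, hy, hyx⟩⟩
      have h2 : y = ⟨(x : H), by have : (y : H) = x := hyx; rw [← this]; exact y.2⟩ :=
        Subtype.ext hyx
      rw [h2] at hy
      exact hy)

/-- A closed subspace `M` reduces `T`: `T` is the orthogonal sum of an operator in `M` and an
operator in `Mᗮ`, that is, with every `(x, y)` the graph of `T` contains the pair of
components of `x` and `y` in `M` (hence also that of the components in `Mᗮ`). -/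
def Reduces (M : Submodule ℂ H) (T : H →ₗ.[ℂ] H) : Prop :=
  IsClosed (M : Set H) ∧ ∀ x y : H, (x, y) ∈ T.graph →
    ∃ a ∈ M, ∃ b ∈ M, x - a ∈ Mᗮ ∧ y - b ∈ Mᗮ ∧ (a, b) ∈ T.graph

/-- The unitary `U` carries `S` to `T`, i.e. `U S U⁻¹ = T` including domains. -/
def Intertwines {H' : Type u} [NormedAddCommGroup H'] [InnerProductSpace ℂ H']
    (U : H ≃ₗᵢ[ℂ] H') (S : H →ₗ.[ℂ] H) (T : H' →ₗ.[ℂ] H') : Prop :=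
  ∀ x y : H, (x, y) ∈ S.graph ↔ (U x, U y) ∈ T.graph

/-- `q`-normal operators: densely defined, closed, and `z z* = q² z* z` as operators. -/
structure IsQNormal (q : ℝ) (z : H →ₗ.[ℂ] H) : Prop where
  dense : Dense (z.domain : Set H)
  isClosed : z.IsClosed
  eq : pcomp z z.adjoint = ((q : ℂ) ^ 2) • pcomp z.adjoint z

/-- Densely defined closed operators with `w w* = q² w* w - (1 - q²)` as operators. -/
structure IsQHyperbolic (q : ℝ) (w : H →ₗ.[ℂ] H) : Prop where
  dense : Dense (w.domain : Set H)
  isClosed : w.IsClosed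
  eq : pcomp w w.adjoint =
    ((q : ℂ) ^ 2) • pcomp w.adjoint w - (1 - (q : ℂ) ^ 2) • pone

/-! Representations. The generators `z_1, …, z_n` are indexed by `Fin n`: the element `j : Fin n`
stands for the index `j + 1`. -/

variable {n : ℕ}

/-- A *-representation of the coordinate ring of the quantum complex plane: closed operators
`z_1, …, z_n` and a dense subspace `D`, contained in the domains of all `z_j`, `z_j*` and invariant
under them, on which the defining relations hold. For the last generator the sum in `rel_diag`
is empty. -/
structure IsStarRep (q : ℝ) (z : Fin n → H →ₗ.[ℂ] H) (D : Submodule ℂ H) : Prop where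
  dense : Dense (D : Set H)
  isClosed : ∀ j, (z j).IsClosed
  le_domain : ∀ j, D ≤ (z j).domain
  le_domain_adjoint : ∀ j, D ≤ (z j).adjoint.domain
  map_mem : ∀ j (x : (z j).domain), (x : H) ∈ D → z j x ∈ D
  map_adjoint_mem : ∀ j (x : (z j).adjoint.domain), (x : H) ∈ D → (z j).adjoint x ∈ D
  rel_zz : ∀ i j, i < j →
    (pcomp (z j) (z i)).domRestrict D = ((q : ℂ) • pcomp (z i) (z j)).domRestrict D
  rel_zz_adjoint : ∀ i j, i ≠ j →
    (pcomp (z j) (z i).adjoint).domRestrict D =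
      ((q : ℂ) • pcomp (z i).adjoint (z j)).domRestrict D
  rel_diag : ∀ i,
    (pcomp (z i) (z i).adjoint).domRestrict D =
      (((q : ℂ) ^ 2) • pcomp (z i).adjoint (z i) -
        (1 - (q : ℂ) ^ 2) • ∑ l ∈ Finset.Ioi i, pcomp (z l).adjoint (z l)).domRestrict D

/-- `Q_k`: the closure of `∑_{l ≥ k} z_l* z_l` on `D`. -/
def Q (z : Fin n → H →ₗ.[ℂ] H) (D : Submodule ℂ H) (k : Fin n) : H →ₗ.[ℂ] H :=
  ((∑ l ∈ Finset.Ici k, pcomp (z l).adjoint (z l)).domRestrict D).closure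

/-- The conditions on a *-representation that involve the spectral measures `E_k` of the `Q_k`. -/
structure SpectralConditions (q : ℝ) (z : Fin n → H →ₗ.[ℂ] H) (D : Submodule ℂ H)
    (E : Fin n → PVM H) : Prop where
  /-- `Q_k = ∫ λ dE_k(λ)` -/
  eq_integral : ∀ k, Q z D k = (E k).integral (fun t => (t : ℂ)) Complex.measurable_ofReal
  /-- `Q_j` and `Q_k` strongly commute -/
  commute : ∀ j k, ∀ s t : Set ℝ, MeasurableSet s → MeasurableSet t →
    Commute ((E j).proj s) ((E k).proj t)
  /-- the spectral projections leave `D` invariant -/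
  proj_mem : ∀ j, ∀ s : Set ℝ, MeasurableSet s → ∀ x ∈ D, (E j).proj s x ∈ D
  /-- `f(Q_k) z_j ⊂ z_j f(Q_k)` and `f(Q_k) z_j* ⊂ z_j* f(Q_k)` for `j < k` -/
  rel_lt : ∀ (f : ℝ → ℂ) (hf : Measurable f), (∃ C, ∀ t, ‖f t‖ ≤ C) → ∀ j k, j < k →
    pcomp ((E k).integral f hf) (z j) ≤ pcomp (z j) ((E k).integral f hf) ∧
    pcomp ((E k).integral f hf) (z j).adjoint ≤ pcomp (z j).adjoint ((E k).integral f hf)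
  /-- `f(Q_k) z_j ⊂ z_j f(q⁻² Q_k)` and `f(Q_k) z_j* ⊂ z_j* f(q² Q_k)` for `j ≥ k` -/
  rel_ge : ∀ (f : ℝ → ℂ) (hf : Measurable f), (∃ C, ∀ t, ‖f t‖ ≤ C) → ∀ j k, k ≤ j →
    pcomp ((E k).integral f hf) (z j) ≤
      pcomp (z j) ((E k).integral (fun t => f ((q ^ 2)⁻¹ * t))
        (hf.comp (measurable_const_mul _))) ∧
    pcomp ((E k).integral f hf) (z j).adjoint ≤
      pcomp (z j).adjoint ((E k).integral (fun t => f (q ^ 2 * t))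
        (hf.comp (measurable_const_mul _)))
  /-- on `ker(Q_k)ᗮ` and for `j < k`, the products of `z_j` and `Q_{j+1}^(-1/2)` in either order
  have the same closure `w`, and this is a densely defined closed operator with
  `w w* = q² w* w - (1 - q²)` -/
  hyperbolic : ∀ j j' k : Fin n, (j : ℕ) + 1 = j' → j < k →
    ∃ w : (kernel (Q z D k))ᗮ →ₗ.[ℂ] (kernel (Q z D k))ᗮ,
      (pcomp
        (restrict ((E j').integral (fun t => (((√t)⁻¹ : ℝ) : ℂ))
          (by fun_prop)) (kernel (Q z D k))ᗮ)
        (restrict (z j) (kernel (Q z D k))ᗮ)).closure = w ∧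
      (pcomp
        (restrict (z j) (kernel (Q z D k))ᗮ)
        (restrict ((E j').integral (fun t => (((√t)⁻¹ : ℝ) : ℂ))
          (by fun_prop)) (kernel (Q z D k))ᗮ)).closure = w ∧
      IsQHyperbolic q w

/-- Well-behaved *-representations. -/
structure IsWellBehaved (q : ℝ) (z : Fin n → H →ₗ.[ℂ] H) (D : Submodule ℂ H) : Prop
    extends IsStarRep q z D where
  core : ∀ j, (z j).HasCore D
  core_adjoint : ∀ j, (z j).adjoint.HasCore D
  isSelfAdjoint_Q : ∀ k, IsSelfAdjoint (Q z D k)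
  exists_spectral : ∃ E : Fin n → PVM H, SpectralConditions q z D E
  qnormal_last : ∀ j : Fin n, (j : ℕ) + 1 = n → IsQNormal q (z j)
  qnormal_kernel : ∀ j j' : Fin n, (j : ℕ) + 1 = j' →
    haveI : CompleteSpace (kernel (Q z D j')) := kernel_complete (isSelfAdjoint_Q j').isClosed
    IsQNormal q (restrict (z j) (kernel (Q z D j')))

/-- Irreducible representations: the space is not zero, and it is not the orthogonal sum of two
non-trivial subspaces that reduce the representation. -/
def IsIrreducible (z : Fin n → H →ₗ.[ℂ] H) : Prop :=
  Nontrivial H ∧ ∀ M : Submodule ℂ H,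
    (∀ j, Reduces M (z j) ∧ Reduces M (z j).adjoint) → M = ⊥ ∨ M = ⊤

/-! The explicit representations. The summands `H_0, …, H_n` are indexed by `Fin (n + 1)`. -/

/-- The multi-indices `(i_1, …, i_{k-1}, i_k)` with `i_1, …, i_{k-1} ∈ {1, 2, …}` and `i_k ∈ ℤ`,
padded with zeros to length `n`. For `k = 0` there is exactly one (the empty one). -/
abbrev MultiIndex (n : ℕ) (k : Fin (n + 1)) : Type :=
  {i : Fin n → ℤ // ∀ l : Fin n,
    ((l : ℕ) + 1 < k → 1 ≤ i l) ∧ ((k : ℕ) < (l : ℕ) + 1 → i l = 0)}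

/-- The index set of all the summands `G_{i_1,…,i_k}` of `H_0 ⊕ … ⊕ H_n`. -/
abbrev Index (n : ℕ) : Type := Σ k : Fin (n + 1), MultiIndex n k

/-- Raise `i_j` by one. (If `j > k`, where `z_j` is zero on `H_k`, the index is left unchanged.) -/
def shift (j : Fin n) {k : Fin (n + 1)} (i : MultiIndex n k) : MultiIndex n k :=
  if h : (j : ℕ) + 1 ≤ k then
    ⟨i.1 + Pi.single j 1, fun l => by
      refine ⟨fun hl => ?_, fun hl => ?_⟩
      · have h1 := (i.2 l).1 hl
        have h2 : (0 : ℤ) ≤ (Pi.single j 1 : Fin n → ℤ) l := by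
          by_cases hlj : l = j
          · subst hlj; simp
          · simp [Pi.single_eq_of_ne hlj]
        simp only [Pi.add_apply]
        omega
      · have h1 := (i.2 l).2 hl
        have hlj : l ≠ j := by
          rintro rfl
          omega
        simp [h1, Pi.single_eq_of_ne hlj]⟩
  else i

/-- The weight of `z_j` at `(i_1, …, i_k)`: `√(q^(-2 i_j) - 1) q^(-(i_{j+1} + ⋯ + i_k))` for `j < k`,
`q^(-i_k)` for `j = k`, and `0` for `j > k`. -/
def weight (q : ℝ) (j : Fin n) {k : Fin (n + 1)} (i : MultiIndex n k) : ℝ :=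
  if (j : ℕ) + 1 < k then √(q ^ (-2 * i.1 j) - 1) * q ^ (-∑ l ∈ Finset.Ioi j, i.1 l)
  else if (j : ℕ) + 1 = k then q ^ (-i.1 j)
  else 0

/-- The data of an explicit representation: the Hilbert spaces `K_0 = H_0` and `K_1, …, K_n`, and for
`k = 1, …, n` a bounded self-adjoint operator `A_k` on `K_k` with spectrum in `[q, 1]` of which `q`
is not an eigenvalue. (`A k` and `K k.succ` belong to the index `k + 1`.) -/
structure Model (n : ℕ) (q : ℝ) where
  K : Fin (n + 1) → Type u
  [instNormedAddCommGroup : ∀ k, NormedAddCommGroup (K k)]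
  [instInnerProductSpace : ∀ k, InnerProductSpace ℂ (K k)]
  [instCompleteSpace : ∀ k, CompleteSpace (K k)]
  A : ∀ k : Fin n, K k.succ →L[ℂ] K k.succ
  isSelfAdjoint : ∀ k, IsSelfAdjoint (A k)
  spectrum_subset : ∀ k, spectrum ℂ (A k) ⊆ (fun t : ℝ => (t : ℂ)) '' Set.Icc q 1
  not_eigenvalue : ∀ k, ∀ h, A k h = (q : ℂ) • h → h = 0

attribute [instance] Model.instNormedAddCommGroup Model.instInnerProductSpace
  Model.instCompleteSpace

namespace Model

variable {q : ℝ} (M : Model.{u} n q)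

/-- The Hilbert space `H_0 ⊕ … ⊕ H_n`, each `H_k` being the Hilbert sum of copies of `K_k`. -/
abbrev Space : Type u := lp (fun p : Index n => M.K p.1) 2

/-- The vector `h_{i_1,…,i_k}` with the only component `h ∈ K_k` in position `(i_1, …, i_k)`. -/
def single {k : Fin (n + 1)} (i : MultiIndex n k) : M.K k →ₗ[ℂ] M.Space :=
  lp.lsingle (E := fun p : Index n => M.K p.1) 2 ⟨k, i⟩

/-- `A_k` for `k ≥ 1`; zero for `k = 0` (where all the weights vanish). -/
def coeff : ∀ k : Fin (n + 1), M.K k →L[ℂ] M.K k :=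
  Fin.cases 0 M.A

/-- The algebraic direct sum `D` of the summands. -/
def dom : Submodule ℂ M.Space where
  carrier := {f | {p | f p ≠ 0}.Finite}
  zero_mem' := by simp
  add_mem' := by
    intro f g hf hg
    refine (hf.union hg).subset fun p hp => ?_
    by_contra h
    simp only [Set.mem_union, Set.mem_ofPred_eq, not_or, not_not] at h
    exact hp (by simp [h.1, h.2])
  smul_mem' := by
    intro c f hf
    refine hf.subset fun p hp h => hp ?_
    simp only [lp.coeFn_smul, Pi.smul_apply, h, smul_zero]

/-- `z_j` on `D`: the linear map with
`h_{i_1,…,i_k} ↦ (weight) • (A_k h)_{i_1,…,i_j + 1,…,i_k}`. -/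
def opCore (j : Fin n) : M.Space →ₗ.[ℂ] M.Space where
  domain := M.dom
  toFun :=
    { toFun := fun f => ∑ᶠ p : Index n,
        (weight q j p.2 : ℂ) • M.single (shift j p.2) (M.coeff p.1 ((f : M.Space) p))
      map_add' := fun f g => by
        rw [← finsum_add_distrib]
        · refine finsum_congr fun p => ?_
          rw [← smul_add, ← map_add, ← map_add]
          rfl
        · refine f.2.subset fun p hp h => hp ?_
          simp only [h, map_zero, smul_zero]
        · refine g.2.subset fun p hp h => hp ?_
          simp only [h, map_zero, smul_zero]
      map_smul' := fun c f => by
        rw [RingHom.id_apply, smul_finsum' c]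
        · refine finsum_congr fun p => ?_
          change _ • M.single _ (M.coeff _ (c • (f : M.Space) p)) = _
          rw [map_smul, map_smul, smul_comm]
        · refine f.2.subset fun p hp h => hp ?_
          simp only [h, map_zero, smul_zero] }

lemma single_mem_dom {k : Fin (n + 1)} (i : MultiIndex n k) (h : M.K k) :
    M.single i h ∈ M.dom := by
  refine (Set.finite_singleton (⟨k, i⟩ : Index n)).subset fun p hp => ?_
  by_contra hne
  exact hp (lp.single_apply_ne (E := fun p : Index n => M.K p.1) 2 ⟨k, i⟩ h hne)

lemma opCore_single (j : Fin n) {k : Fin (n + 1)} (i : MultiIndex n k) (h : M.K k) :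
    M.opCore j ⟨M.single i h, M.single_mem_dom i h⟩ =
      (weight q j i : ℂ) • M.single (shift j i) (M.coeff k h) := by
  change (∑ᶠ p : Index n,
    (weight q j p.2 : ℂ) • M.single (shift j p.2) (M.coeff p.1 (M.single i h p))) = _
  rw [finsum_eq_single _ (⟨k, i⟩ : Index n)]
  · have : M.single i h ⟨k, i⟩ = h :=
      lp.single_apply_self (E := fun p : Index n => M.K p.1) 2 ⟨k, i⟩ h
    rw [this]
  · intro p hp
    have : M.single i h p = 0 :=
      lp.single_apply_ne (E := fun p : Index n => M.K p.1) 2 ⟨k, i⟩ h hp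
    rw [this, map_zero, map_zero, smul_zero]

/-- The closed operator `z_j`: the closure of its restriction to `D`. -/
def op (j : Fin n) : M.Space →ₗ.[ℂ] M.Space := (M.opCore j).closure

/-- The orthogonal sum of the `H_k` with `k ∈ S`, as a subspace of `H_0 ⊕ … ⊕ H_n`. -/
def part (S : Set (Fin (n + 1))) : Submodule ℂ M.Space where
  carrier := {f | ∀ p : Index n, p.1 ∉ S → f p = 0}
  zero_mem' := by simp
  add_mem' := by
    intro f g hf hg p hp
    simp [hf p hp, hg p hp]
  smul_mem' := by
    intro c f hf p hp
    simp only [lp.coeFn_smul, Pi.smul_apply, hf p hp, smul_zero]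

end Model

end QuantumPlane

end

/-! Everything is reduced to weighted shifts between the summands of a Hilbert sum. A maximal
operator with at most one entry in each row and column is closed, has the algebraic direct sum as a
core and the transposed operator as its adjoint, and its products with the adjoint, on their natural
domains, are maximal diagonal operators (`blockOp`, `closure_eq_blockOp`, `adjoint_eq_blockOp`,
`pcomp_swap_self`). For a model, identities between unbounded operators thus become identities
between scalar weights. Put N_l = i_l + ... + i_k. On the summand with index (i_1, ..., i_k) the
operator Q_l is q^(-2 N_l) A_k² for l ≤ k and zero for l > k, and the squared weight of z_j is the
difference of the coefficients of Q_j and Q_{j+1} (`weight_sq`, `sum_weight_sq`). This gives (b)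
(`Model.isWellBehaved`).

For (a), cut [0, ∞) into {0} and the intervals (q^(2-2N), q^(-2N)], and consider the joint spectral
subspaces of Q_1, ..., Q_n for products of these pieces. By the commutation rules z_j raises the
exponents N_l with l ≤ j by one and keeps the others (`SpectralConditions.mem_joint_raise`). On such
a subspace the Q_l are bounded, z_j* z_j = Q_j - Q_{j+1} and z_j z_j* = q² Q_j - Q_{j+1}
(`IsStarRep.exists_op_of_mem_joint`, `IsStarRep.exists_adjoint_of_mem_joint`). Positivity of these
products forces the exponents of a non-zero subspace to decrease strictly until the piece {0} is
reached, after which it persists; such sequences are exactly the tail sums N_l of multi-indices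
(`IsStarRep.slice_succ_lt`, `exists_sliceOf_eq`).

The lowering by z_j* must stop: where N_j = N_{j+1} + 1 it would leave the admissible exponents, so
z_j* vanishes and Q_{j+1} = q² Q_j there. This rigidity propagates upwards to Q_j = q^(-2 i_j)
Q_{j+1} for j < k (`IsStarRep.sliceQ_eq_smul_aux`). Let A be the function `phase` of Q_k, where t =
q^(-2N) `phase`(t)² on the N-th interval; then Q_l = q^(-2 N_l) A² for all l ≤ k
(`IsStarRep.sliceQ_eq_level`). Since `phase` takes values in (q, 1] and is invariant under t ↦ q² t,
A has the spectral properties asked for, is invertible, and commutes with the generators. Hence z_j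
A⁻¹ divided by the weight is a unitary between neighbouring subspaces
(`IsStarRep.exists_shift_equiv`). These unitaries commute, because the weights absorb the factor q
in z_j z_i = q z_i z_j, so all the subspaces with the same k are identified coherently with a single
K_k (`exists_trivialization`, `IsStarRep.exists_summand_equiv`). Finally `eq_blockOp` shows that the
closed operators z_j, and not just their values on the summands, are those of the model
(`IsStarRep.exists_model`).

For (c), the projection onto a reducing subspace commutes with all z_j and z_j*. If dim K_k = 1 and
the other K_l vanish, its matrix entry between two multi-indices is zero unless their weights have
the same squares for all j ≤ k, which forces them to be equal (`eq_of_weight_sq`); the diagonal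
entries are constant along shifts. Conversely, the H_k and the A_k-invariant closed subspaces of K_k
produce reducing subspaces, and a self-adjoint operator without non-trivial closed invariant
subspaces is a scalar (`eq_smul_one_of_invariant`). -/

noncomputable section

namespace QuantumPlane

open MeasureTheory Filter Topology
open scoped ENNReal InnerProductSpace

/-! ### Spectral integrals against a projection-valued measure -/

namespace PVM

section Calculus

variable {H : Type u} [NormedAddCommGroup H] [InnerProductSpace ℂ H] [CompleteSpace H]
variable {H' : Type u} [NormedAddCommGroup H'] [InnerProductSpace ℂ H'] [CompleteSpace H']
variable (E : PVM H)

/-- `y` is the value at `x` of the integral `∫ f dE`: it is the limit of the integrals of simple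
functions converging to `f` in `L²(E_x)`. -/
def HasInt (f : ℝ → ℂ) (x y : H) : Prop :=
  ∃ g : ℕ → SimpleFunc ℝ ℂ,
    Tendsto (fun m => eLpNorm (⇑(g m) - f) 2 (E.measure x)) atTop (𝓝 0) ∧
    Tendsto (fun m => E.simpleIntegral (g m) x) atTop (𝓝 y)

variable {E}

lemma eLpNorm_two_eq (μ : Measure ℝ) (g : ℝ → ℂ) :
    eLpNorm g 2 μ = (∫⁻ t, ‖g t‖ₑ ^ 2 ∂μ) ^ (1 / 2 : ℝ) := by
  rw [eLpNorm_eq_lintegral_rpow_enorm_toReal (by simp) (by simp)]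
  simp

lemma enorm_simpleIntegral (g : SimpleFunc ℝ ℂ) (x : H) :
    ‖E.simpleIntegral g x‖ₑ = eLpNorm g 2 (E.measure x) := by
  rw [eLpNorm_two_eq, ← E.norm_simpleIntegral_sq, ENNReal.ofReal_pow (norm_nonneg _), ofReal_norm,
    ← ENNReal.rpow_natCast, ← ENNReal.rpow_mul]
  simp

lemma mem_integralDomain_iff {f : ℝ → ℂ} {x : H} :
    x ∈ E.integralDomain f ↔ eLpNorm f 2 (E.measure x) < ∞ := by
  rw [eLpNorm_two_eq, ENNReal.rpow_lt_top_iff_of_pos (by norm_num)]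
  rfl

lemma tendsto_approx {f : ℝ → ℂ} (hf : Measurable f) {x : H} (hx : x ∈ E.integralDomain f) :
    Tendsto (fun m => eLpNorm (⇑(approx f hf m) - f) 2 (E.measure x)) atTop (𝓝 0) :=
  SimpleFunc.tendsto_approxOn_range_Lp_eLpNorm (p := 2) (by simp) hf (mem_integralDomain_iff.1 hx)

lemma eLpNorm_sub_le_of_tendsto {μ : Measure ℝ} {f : ℝ → ℂ} (hf : Measurable f)
    {g g' : ℕ → SimpleFunc ℝ ℂ}
    (hg : Tendsto (fun m => eLpNorm (⇑(g m) - f) 2 μ) atTop (𝓝 0))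
    (hg' : Tendsto (fun m => eLpNorm (⇑(g' m) - f) 2 μ) atTop (𝓝 0)) :
    Tendsto (fun m => eLpNorm (⇑(g m) - ⇑(g' m)) 2 μ) atTop (𝓝 0) := by
  have h := hg.add hg'
  rw [add_zero] at h
  refine tendsto_of_tendsto_of_tendsto_of_le_of_le tendsto_const_nhds h (fun _ => zero_le) ?_
  intro m
  have hs : (⇑(g m) - ⇑(g' m) : ℝ → ℂ) = (⇑(g m) - f) - (⇑(g' m) - f) := by
    ext t; simp
  change eLpNorm (⇑(g m) - ⇑(g' m)) 2 μ ≤ _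
  rw [hs]
  exact eLpNorm_sub_le ((g m).measurable.sub hf).aestronglyMeasurable
    ((g' m).measurable.sub hf).aestronglyMeasurable (by norm_num)

/-- Integration of simple functions is isometric from `L²` of the scalar measure of `x` to `H`, so
sequences with a common `L²` limit have integrals with a common limit. This makes `HasInt`
independent of the approximating sequence. -/
lemma tendsto_simpleIntegral_of_tendsto {f : ℝ → ℂ} (hf : Measurable f) {x y : H}
    {g g' : ℕ → SimpleFunc ℝ ℂ}
    (hg : Tendsto (fun m => eLpNorm (⇑(g m) - f) 2 (E.measure x)) atTop (𝓝 0))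
    (hy : Tendsto (fun m => E.simpleIntegral (g m) x) atTop (𝓝 y))
    (hg' : Tendsto (fun m => eLpNorm (⇑(g' m) - f) 2 (E.measure x)) atTop (𝓝 0)) :
    Tendsto (fun m => E.simpleIntegral (g' m) x) atTop (𝓝 y) := by
  have h := eLpNorm_sub_le_of_tendsto hf hg' hg
  have h2 : Tendsto (fun m => E.simpleIntegral (g' m) x - E.simpleIntegral (g m) x) atTop
      (𝓝 0) := by
    rw [tendsto_zero_iff_enorm_tendsto_zero]
    refine h.congr fun m => ?_
    rw [← simpleIntegral_sub, enorm_simpleIntegral, SimpleFunc.coe_sub]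
  simpa using h2.add hy

lemma HasInt.mem_integralDomain {f : ℝ → ℂ} (hf : Measurable f) {x y : H} (h : E.HasInt f x y) :
    x ∈ E.integralDomain f := by
  obtain ⟨g, hg, -⟩ := h
  rw [mem_integralDomain_iff]
  obtain ⟨m, hm⟩ := ((ENNReal.tendsto_nhds_zero.1 hg) 1 (by norm_num)).exists
  have hs : f = ⇑(g m) - (⇑(g m) - f) := by
    ext t; simp
  rw [hs]
  refine (eLpNorm_sub_le (g m).measurable.aestronglyMeasurable
    ((g m).measurable.sub hf).aestronglyMeasurable (by norm_num)).trans_lt ?_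
  refine ENNReal.add_lt_top.2 ⟨?_, hm.trans_lt (by simp)⟩
  rw [← enorm_simpleIntegral]
  exact enorm_lt_top

lemma HasInt.tendsto {f : ℝ → ℂ} (hf : Measurable f) {x y : H} (h : E.HasInt f x y)
    {g : ℕ → SimpleFunc ℝ ℂ}
    (hg : Tendsto (fun m => eLpNorm (⇑(g m) - f) 2 (E.measure x)) atTop (𝓝 0)) :
    Tendsto (fun m => E.simpleIntegral (g m) x) atTop (𝓝 y) := by
  obtain ⟨g', hg', hy⟩ := h
  exact tendsto_simpleIntegral_of_tendsto hf hg' hy hg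

/-- Frees later arguments from the particular sequence `approx` in the definition of the integral:
any approximation in `L²` may be used. -/
lemma mem_graph_integral {f : ℝ → ℂ} (hf : Measurable f) {x y : H} :
    (x, y) ∈ (E.integral f hf).graph ↔ E.HasInt f x y := by
  rw [LinearPMap.mem_graph_iff]
  have key : ∀ hx : x ∈ E.integralDomain f,
      Tendsto (fun m => E.simpleIntegral (approx f hf m) x) atTop
        (𝓝 (E.integral f hf ⟨x, hx⟩)) := fun hx =>
    tendsto_nhds_limUnder (E.exists_tendsto_simpleIntegral f hf hx)
  constructor
  · rintro ⟨⟨x', hx⟩, rfl, rfl⟩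
    exact ⟨approx f hf, tendsto_approx hf hx, key hx⟩
  · intro h
    have hx := h.mem_integralDomain hf
    exact ⟨⟨x, hx⟩, rfl, tendsto_nhds_unique (key hx) (h.tendsto hf (tendsto_approx hf hx))⟩

lemma exists_hasInt {f : ℝ → ℂ} (hf : Measurable f) {x : H} (hx : x ∈ E.integralDomain f) :
    ∃ y, E.HasInt f x y :=
  ⟨E.integral f hf ⟨x, hx⟩, (mem_graph_integral hf).1 ((E.integral f hf).mem_graph ⟨x, hx⟩)⟩

lemma HasInt.unique {f : ℝ → ℂ} (hf : Measurable f) {x y z : H} (h : E.HasInt f x y)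
    (h' : E.HasInt f x z) : y = z := by
  obtain ⟨g, hg, hy⟩ := h
  exact tendsto_nhds_unique hy (h'.tendsto hf hg)

/-- The isometry on simple functions passes to the limit, because convergence of `eLpNorm` of the
differences is convergence in the normed space `Lp`. -/
lemma HasInt.enorm_eq {f : ℝ → ℂ} (hf : Measurable f) {x y : H} (h : E.HasInt f x y) :
    ‖y‖ₑ = eLpNorm f 2 (E.measure x) := by
  have hx := h.mem_integralDomain hf
  have ht := h.tendsto hf (tendsto_approx hf hx)
  have h1 := ht.enorm
  simp only [enorm_simpleIntegral] at h1
  refine tendsto_nhds_unique h1 ?_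
  have hM : MemLp f 2 (E.measure x) := ⟨hf.aestronglyMeasurable, mem_integralDomain_iff.1 hx⟩
  have hM' : ∀ m, MemLp (approx f hf m) 2 (E.measure x) := fun m =>
    ⟨(approx f hf m).measurable.aestronglyMeasurable, by
      rw [← enorm_simpleIntegral]; exact enorm_lt_top⟩
  have h2 := (Lp.tendsto_Lp_iff_tendsto_eLpNorm'' _ hM' f hM).2 (tendsto_approx hf hx)
  have h3 := h2.enorm
  simpa only [Lp.enorm_toLp] using h3

lemma HasInt.norm_sq_eq {f : ℝ → ℂ} (hf : Measurable f) {x y : H} (h : E.HasInt f x y) :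
    ‖y‖ ^ 2 = ∫ t, ‖f t‖ ^ 2 ∂E.measure x := by
  have h1 := h.enorm_eq hf
  have h2 := mem_integralDomain_iff.1 (h.mem_integralDomain hf)
  have hM : MemLp f 2 (E.measure x) := ⟨hf.aestronglyMeasurable, h2⟩
  rw [hM.eLpNorm_eq_integral_rpow_norm (by simp) (by simp), ← ofReal_norm,
    ENNReal.ofReal_eq_ofReal_iff (norm_nonneg _) (by positivity)] at h1
  rw [h1, ← Real.rpow_natCast, ← Real.rpow_mul (integral_nonneg fun _ => by positivity)]
  simp

lemma simpleIntegral_add (g h : SimpleFunc ℝ ℂ) (x : H) :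
    E.simpleIntegral (g + h) x = E.simpleIntegral g x + E.simpleIntegral h x := by
  have := E.simpleIntegral_sub (g + h) h x
  rw [add_sub_cancel_right] at this
  rw [this]; abel

lemma HasInt.add {f g : ℝ → ℂ} (hf : Measurable f) (hg : Measurable g) {x y z : H}
    (h : E.HasInt f x y) (h' : E.HasInt g x z) : E.HasInt (f + g) x (y + z) := by
  obtain ⟨a, ha, hy⟩ := h
  obtain ⟨b, hb, hz⟩ := h'
  refine ⟨fun m => a m + b m, ?_, ?_⟩
  · have hh := ha.add hb
    rw [add_zero] at hh
    refine tendsto_of_tendsto_of_tendsto_of_le_of_le tendsto_const_nhds hh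
      (fun _ => zero_le) fun m => ?_
    have hs : (⇑(a m + b m) - (f + g) : ℝ → ℂ) = (⇑(a m) - f) + (⇑(b m) - g) := by
      ext t; simp; ring
    change eLpNorm (⇑(a m + b m) - (f + g)) 2 _ ≤ _
    rw [hs]
    exact eLpNorm_add_le ((a m).measurable.sub hf).aestronglyMeasurable
      ((b m).measurable.sub hg).aestronglyMeasurable (by norm_num)
  · simpa only [simpleIntegral_add] using hy.add hz

lemma hasInt_simple (g : SimpleFunc ℝ ℂ) (x : H) : E.HasInt g x (E.simpleIntegral g x) :=
  ⟨fun _ => g, by simp, tendsto_const_nhds⟩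

lemma HasInt.congr_ae {f g : ℝ → ℂ} {x y : H} (h : E.HasInt f x y)
    (hfg : f =ᵐ[E.measure x] g) : E.HasInt g x y := by
  obtain ⟨a, ha, hy⟩ := h
  refine ⟨a, ha.congr fun m => eLpNorm_congr_ae ?_, hy⟩
  filter_upwards [hfg] with t ht
  simp [ht]

lemma inner_proj_comm {S : Set ℝ} (hS : MeasurableSet S) (x y : H) :
    ⟪E.proj S x, y⟫_ℂ = ⟪x, E.proj S y⟫_ℂ := by
  have := (E.isStarProjection S hS).isSelfAdjoint
  rw [← ContinuousLinearMap.adjoint_inner_left, ← ContinuousLinearMap.star_eq_adjoint,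
    this.star_eq]

lemma simpleIntegral_indicator {S : Set ℝ} (hS : MeasurableSet S) (x : H) :
    E.simpleIntegral (SimpleFunc.piecewise S hS (SimpleFunc.const ℝ 1) (SimpleFunc.const ℝ 0)) x
      = E.proj S x := by
  set g := SimpleFunc.piecewise S hS (SimpleFunc.const ℝ (1 : ℂ)) (SimpleFunc.const ℝ 0) with hg
  have hval : ∀ t, g t = S.indicator (fun _ => 1) t := fun t => by
    simp [hg, SimpleFunc.coe_piecewise, Set.piecewise, Set.indicator]
  simp only [simpleIntegral, _root_.sum_apply, _root_.smul_apply]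
  have hpre : g ⁻¹' {1} = S := by
    ext t
    simp only [Set.mem_preimage, Set.mem_singleton_iff, hval, Set.indicator]
    split_ifs with h <;> simp [h]
  by_cases h1 : (1 : ℂ) ∈ g.range
  · rw [Finset.sum_eq_single_of_mem 1 h1, hpre, one_smul]
    intro b hb hb1
    obtain ⟨t, rfl⟩ := SimpleFunc.mem_range.1 hb
    have : g t = 0 := by
      rw [hval, Set.indicator] at hb1 ⊢
      split_ifs with h
      · simp [h] at hb1
      · rfl
    simp [this]
  · have hSe : S = ∅ := by
      by_contra hne
      obtain ⟨t, ht⟩ := Set.nonempty_iff_ne_empty.2 hne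
      exact h1 (SimpleFunc.mem_range.2 ⟨t, by simp [hval, ht]⟩)
    rw [hSe, E.proj_empty]
    simp only [_root_.zero_apply]
    refine Finset.sum_eq_zero fun b hb => ?_
    obtain ⟨t, rfl⟩ := SimpleFunc.mem_range.1 hb
    have : g t = 0 := by simp [hval, hSe]
    simp [this]

lemma hasInt_indicator {S : Set ℝ} (hS : MeasurableSet S) (x : H) :
    E.HasInt (S.indicator fun _ => 1) x (E.proj S x) := by
  have := E.hasInt_simple
    (SimpleFunc.piecewise S hS (SimpleFunc.const ℝ (1 : ℂ)) (SimpleFunc.const ℝ 0)) x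
  rw [simpleIntegral_indicator] at this
  convert this using 1
  ext t
  simp [SimpleFunc.coe_piecewise, Set.piecewise, Set.indicator]

lemma inner_simpleIntegral (g : SimpleFunc ℝ ℂ) (x : H) :
    ⟪x, E.simpleIntegral g x⟫_ℂ = ∫ t, g t ∂E.measure x := by
  rw [SimpleFunc.integral_eq_sum _ (SimpleFunc.integrable_of_isFiniteMeasure g)]
  simp only [simpleIntegral, _root_.sum_apply, _root_.smul_apply, inner_sum, inner_smul_right]
  refine Finset.sum_congr rfl fun c _ => ?_
  rw [E.inner_proj_self (g.measurableSet_fiber c), Measure.real,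
    E.measure_apply x (g.measurableSet_fiber c), ENNReal.toReal_ofReal (by positivity), mul_comm,
    Complex.real_smul]

lemma HasInt.integrable {f : ℝ → ℂ} (hf : Measurable f) {x y : H} (h : E.HasInt f x y) :
    Integrable f (E.measure x) :=
  MemLp.integrable (q := 2) (by norm_num)
    ⟨hf.aestronglyMeasurable, mem_integralDomain_iff.1 (h.mem_integralDomain hf)⟩

/-- The identity is clear for simple functions. The measure is finite, so convergence in `L²`
implies convergence in `L¹` and the integrals converge as well. -/
lemma HasInt.inner_eq {f : ℝ → ℂ} (hf : Measurable f) {x y : H} (h : E.HasInt f x y) :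
    ⟪x, y⟫_ℂ = ∫ t, f t ∂E.measure x := by
  have hx := h.mem_integralDomain hf
  have ht := h.tendsto hf (tendsto_approx hf hx)
  have h1 : Tendsto (fun m => ⟪x, E.simpleIntegral (approx f hf m) x⟫_ℂ) atTop (𝓝 ⟪x, y⟫_ℂ) :=
    tendsto_const_nhds.inner ht
  simp only [inner_simpleIntegral] at h1
  refine tendsto_nhds_unique h1 ?_
  refine tendsto_integral_of_L1' f (h.integrable hf).aestronglyMeasurable
    (Eventually.of_forall fun m => SimpleFunc.integrable_of_isFiniteMeasure _) ?_
  have hb : ∀ m, eLpNorm (⇑(approx f hf m) - f) 1 (E.measure x) ≤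
      eLpNorm (⇑(approx f hf m) - f) 2 (E.measure x) *
        (E.measure x Set.univ) ^ (1 / (1 : ℝ≥0∞).toReal - 1 / (2 : ℝ≥0∞).toReal) := fun m =>
    eLpNorm_le_eLpNorm_mul_rpow_measure_univ (by norm_num)
      ((approx f hf m).measurable.sub hf).aestronglyMeasurable
  refine tendsto_of_tendsto_of_tendsto_of_le_of_le tendsto_const_nhds ?_ (fun _ => zero_le) hb
  have h3 := ENNReal.Tendsto.mul_const
    (b := (E.measure x Set.univ) ^ (1 / (1 : ℝ≥0∞).toReal - 1 / (2 : ℝ≥0∞).toReal))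
    (tendsto_approx hf hx) (Or.inr (by
      refine ENNReal.rpow_ne_top_of_nonneg ?_ (measure_ne_top _ _)
      norm_num))
  simpa using h3

variable {E' : PVM H'}

/-- `L` need not be isometric, so only an inequality is available; it is enough to carry `L²`
convergence from the measure of `x` to that of `L x`. -/
lemma measure_map_le {L : H →L[ℂ] H'} {φ : ℝ → ℝ} (hφ : Measurable φ)
    (hL : ∀ S, MeasurableSet S → ∀ x, E'.proj S (L x) = L (E.proj (φ ⁻¹' S) x)) (x : H) :
    E'.measure (L x) ≤ ENNReal.ofReal (‖L‖ ^ 2) • (E.measure x).map φ := by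
  refine Measure.le_iff.2 fun S hS => ?_
  rw [Measure.smul_apply, Measure.map_apply hφ hS, measure_apply _ _ hS, measure_apply _ _ (hφ hS),
    hL S hS, smul_eq_mul, ← ENNReal.ofReal_mul (by positivity), ← mul_pow]
  exact ENNReal.ofReal_le_ofReal (pow_le_pow_left₀ (norm_nonneg _) (L.le_opNorm _) 2)

lemma simpleIntegral_eq_sum (g : SimpleFunc ℝ ℂ) {s : Finset ℂ} (hs : g.range ⊆ s) (x : H) :
    E.simpleIntegral g x = ∑ c ∈ s, c • E.proj (g ⁻¹' {c}) x := by
  simp only [simpleIntegral, _root_.sum_apply, _root_.smul_apply]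
  refine Finset.sum_subset hs fun c _ hc => ?_
  have : g ⁻¹' {c} = ∅ := (SimpleFunc.preimage_eq_empty_iff g c).2 hc
  rw [this, E.proj_empty]
  simp

lemma simpleIntegral_transfer {L : H →L[ℂ] H'} {φ : ℝ → ℝ} (hφ : Measurable φ)
    (hL : ∀ S, MeasurableSet S → ∀ x, E'.proj S (L x) = L (E.proj (φ ⁻¹' S) x))
    (g : SimpleFunc ℝ ℂ) (x : H) :
    E'.simpleIntegral g (L x) = L (E.simpleIntegral (g.comp φ hφ) x) := by
  rw [simpleIntegral_eq_sum g subset_rfl, simpleIntegral_eq_sum (g.comp φ hφ)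
    (SimpleFunc.range_comp_subset_range g hφ), map_sum]
  refine Finset.sum_congr rfl fun c _ => ?_
  rw [hL _ (g.measurableSet_fiber c), map_smul]
  rfl

/-- Operators that intertwine spectral measures intertwine the integrals. -/
lemma HasInt.transfer {L : H →L[ℂ] H'} {φ : ℝ → ℝ} (hφ : Measurable φ)
    (hL : ∀ S, MeasurableSet S → ∀ x, E'.proj S (L x) = L (E.proj (φ ⁻¹' S) x))
    {f : ℝ → ℂ} (hf : Measurable f) {x y : H} (h : E.HasInt (fun t => f (φ t)) x y) :
    E'.HasInt f (L x) (L y) := by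
  have hx := h.mem_integralDomain (hf.comp hφ)
  have hdom : eLpNorm f 2 ((E.measure x).map φ) < ∞ := by
    rw [eLpNorm_map_measure hf.aestronglyMeasurable hφ.aemeasurable]
    exact mem_integralDomain_iff.1 hx
  -- The approximation is chosen for the pushed-forward measure, so that one sequence serves both
  -- sides: composed with `φ` it computes the integral at `x`, and by `measure_map_le` it also
  -- computes the one at `L x`.
  have ht := SimpleFunc.tendsto_approxOn_range_Lp_eLpNorm (p := 2) (by simp) hf hdom
  have ht2 : Tendsto (fun m => eLpNorm (⇑((approx f hf m).comp φ hφ) - fun t => f (φ t)) 2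
      (E.measure x)) atTop (𝓝 0) := by
    refine ht.congr fun m => ?_
    change eLpNorm (⇑(approx f hf m) - f) 2 _ = _
    rw [eLpNorm_map_measure ((approx f hf m).measurable.sub hf).aestronglyMeasurable
      hφ.aemeasurable]
    rfl
  refine ⟨approx f hf, ?_, ?_⟩
  · have hb : ∀ m, eLpNorm (⇑(approx f hf m) - f) 2 (E'.measure (L x)) ≤
        ENNReal.ofReal (‖L‖ ^ 2) ^ (1 / (2 : ℝ≥0∞)).toReal *
          eLpNorm (⇑(approx f hf m) - f) 2 ((E.measure x).map φ) := by
      intro m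
      refine (eLpNorm_mono_measure _ (measure_map_le hφ hL x)).trans_eq ?_
      rw [eLpNorm_smul_measure_of_ne_top (by simp)]
      rfl
    refine tendsto_of_tendsto_of_tendsto_of_le_of_le tendsto_const_nhds ?_ (fun _ => zero_le) hb
    have h3 := ENNReal.Tendsto.const_mul (a := ENNReal.ofReal (‖L‖ ^ 2) ^ (1 / (2 : ℝ≥0∞)).toReal)
      ht (Or.inr (ENNReal.rpow_ne_top_of_nonneg (by positivity) (by simp)))
    rw [mul_zero] at h3
    exact h3
  · have h4 := h.tendsto (hf.comp hφ) ht2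
    have h5 := (L.continuous.tendsto y).comp h4
    refine h5.congr fun m => ?_
    rw [simpleIntegral_transfer hφ hL]
    rfl

lemma HasInt.of_commute {L : H →L[ℂ] H'}
    (hL : ∀ S, MeasurableSet S → ∀ x, E'.proj S (L x) = L (E.proj S x))
    {f : ℝ → ℂ} (hf : Measurable f) {x y : H} (h : E.HasInt f x y) :
    E'.HasInt f (L x) (L y) :=
  HasInt.transfer (φ := id) measurable_id (fun S hS x => hL S hS x) hf h

lemma proj_comm {S T : Set ℝ} (hS : MeasurableSet S) (hT : MeasurableSet T) (x : H) :
    E.proj S (E.proj T x) = E.proj T (E.proj S x) := by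
  rw [← mul_apply_eq_comp, ← mul_apply_eq_comp, ← E.inter S T hS hT, ← E.inter T S hT hS,
    Set.inter_comm]

lemma HasInt.proj {f : ℝ → ℂ} (hf : Measurable f) {x y : H} (h : E.HasInt f x y) {S : Set ℝ}
    (hS : MeasurableSet S) : E.HasInt f (E.proj S x) (E.proj S y) :=
  HasInt.of_commute (fun _ hT x => proj_comm hT hS x) hf h

variable (E)

lemma mem_integralDomain_of_bounded {f : ℝ → ℂ} {C : ℝ} (hC : ∀ t, ‖f t‖ ≤ C) (x : H) :
    x ∈ E.integralDomain f := by
  refine (lintegral_mono (g := fun _ => ENNReal.ofReal C ^ 2) fun t => ?_).trans_lt ?_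
  · change ‖f t‖ₑ ^ 2 ≤ _
    rw [← ofReal_norm]
    exact pow_le_pow_left₀ zero_le (ENNReal.ofReal_le_ofReal (hC t)) 2
  · rw [lintegral_const]
    exact ENNReal.mul_lt_top (by finiteness) (measure_lt_top _ _)

lemma measure_univ (x : H) : E.measure x Set.univ = ENNReal.ofReal (‖x‖ ^ 2) := by
  rw [measure_apply _ _ MeasurableSet.univ, E.univ]
  rfl

lemma HasInt.norm_le {E : PVM H} {f : ℝ → ℂ} (hf : Measurable f) {C : ℝ} (hC : ∀ t, ‖f t‖ ≤ C)
    {x y : H} (h : E.HasInt f x y) : ‖y‖ ≤ C * ‖x‖ := by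
  have hC0 : 0 ≤ C := (norm_nonneg _).trans (hC 0)
  refine le_of_sq_le_sq ?_ (by positivity)
  rw [h.norm_sq_eq hf]
  calc ∫ t, ‖f t‖ ^ 2 ∂E.measure x ≤ ∫ _, C ^ 2 ∂E.measure x := by
        refine integral_mono_of_nonneg (Eventually.of_forall fun _ => by positivity)
          (integrable_const _) (Eventually.of_forall fun t => ?_)
        exact pow_le_pow_left₀ (norm_nonneg _) (hC t) 2
    _ = (C * ‖x‖) ^ 2 := by
        rw [integral_const, Measure.real, measure_univ, ENNReal.toReal_ofReal (by positivity)]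
        simp [mul_pow, mul_comm]

/-- The bounded operator `∫ f dE` for a bounded function `f`. -/
def bint (f : ℝ → ℂ) (hf : Measurable f) (hb : ∃ C, ∀ t, ‖f t‖ ≤ C) : H →L[ℂ] H :=
  LinearMap.mkContinuous
    { toFun := fun x => E.integral f hf ⟨x, E.mem_integralDomain_of_bounded hb.choose_spec x⟩
      map_add' := fun x y => (E.integral f hf).map_add ⟨x, _⟩ ⟨y, _⟩
      map_smul' := fun c x => (E.integral f hf).map_smul c ⟨x, _⟩ } hb.choose
    (fun x => HasInt.norm_le hf hb.choose_spec
      ((mem_graph_integral hf).1 ((E.integral f hf).mem_graph ⟨x, _⟩)))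

variable {E}

lemma hasInt_bint {f : ℝ → ℂ} (hf : Measurable f) (hb : ∃ C, ∀ t, ‖f t‖ ≤ C) (x : H) :
    E.HasInt f x (E.bint f hf hb x) :=
  (mem_graph_integral hf).1 ((E.integral f hf).mem_graph
    ⟨x, E.mem_integralDomain_of_bounded hb.choose_spec x⟩)

lemma bint_eq {f : ℝ → ℂ} (hf : Measurable f) (hb : ∃ C, ∀ t, ‖f t‖ ≤ C) {x y : H}
    (h : E.HasInt f x y) : E.bint f hf hb x = y :=
  (hasInt_bint hf hb x).unique hf h

lemma bint_transfer {L : H →L[ℂ] H'}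
    (hL : ∀ S, MeasurableSet S → ∀ x, E'.proj S (L x) = L (E.proj S x))
    {f : ℝ → ℂ} (hf : Measurable f) (hb : ∃ C, ∀ t, ‖f t‖ ≤ C) (x : H) :
    E'.bint f hf hb (L x) = L (E.bint f hf hb x) :=
  bint_eq hf hb ((hasInt_bint hf hb x).of_commute hL hf)

lemma proj_bint {f : ℝ → ℂ} (hf : Measurable f) (hb : ∃ C, ∀ t, ‖f t‖ ≤ C) {S : Set ℝ}
    (hS : MeasurableSet S) (x : H) :
    E.proj S (E.bint f hf hb x) = E.bint f hf hb (E.proj S x) :=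
  (bint_transfer (fun _ hT x => proj_comm hT hS x) hf hb x).symm

lemma bint_comm {f g : ℝ → ℂ} (hf : Measurable f) (hb : ∃ C, ∀ t, ‖f t‖ ≤ C)
    (hg : Measurable g) (hb' : ∃ C, ∀ t, ‖g t‖ ≤ C) (x : H) :
    E.bint f hf hb (E.bint g hg hb' x) = E.bint g hg hb' (E.bint f hf hb x) :=
  bint_transfer (fun _ hT x => proj_bint hg hb' hT x) hf hb x

section Real

variable {f g : ℝ → ℝ} (hf : Measurable f) (hb : ∃ C, ∀ t, ‖f t‖ ≤ C)
  (hg : Measurable g) (hb' : ∃ C, ∀ t, ‖g t‖ ≤ C)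

variable (E) in
/-- The bounded self-adjoint operator `∫ f dE` for a bounded real function `f`. -/
def rint (f : ℝ → ℝ) (hf : Measurable f) (hb : ∃ C, ∀ t, ‖f t‖ ≤ C) : H →L[ℂ] H :=
  E.bint (fun t => (f t : ℂ)) (Complex.measurable_ofReal.comp hf) (by simpa using hb)

include hf in
lemma measurable_coe : Measurable fun t => (f t : ℂ) := Complex.measurable_ofReal.comp hf

lemma hasInt_rint (x : H) : E.HasInt (fun t => (f t : ℂ)) x (E.rint f hf hb x) :=
  hasInt_bint _ _ x

lemma inner_rint (x : H) : ⟪x, E.rint f hf hb x⟫_ℂ = ((∫ t, f t ∂E.measure x : ℝ) : ℂ) := by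
  rw [(hasInt_rint hf hb x).inner_eq (measurable_coe hf), integral_complex_ofReal]

lemma rint_isSymmetric : (E.rint f hf hb : H →ₗ[ℂ] H).IsSymmetric := by
  rw [LinearMap.isSymmetric_iff_inner_map_self_real]
  intro x
  change (starRingEnd ℂ) ⟪E.rint f hf hb x, x⟫_ℂ = ⟪E.rint f hf hb x, x⟫_ℂ
  rw [← inner_conj_symm (E.rint f hf hb x) x, inner_rint]
  simp

lemma inner_rint_left (x y : H) : ⟪E.rint f hf hb x, y⟫_ℂ = ⟪x, E.rint f hf hb y⟫_ℂ :=
  rint_isSymmetric hf hb x y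

omit [CompleteSpace H] in
lemma eq_of_inner_self {S T : H →L[ℂ] H} (h : ∀ x, ⟪x, S x⟫_ℂ = ⟪x, T x⟫_ℂ) :
    S = T := by
  have := (ext_inner_map (S : H →ₗ[ℂ] H) (T : H →ₗ[ℂ] H)).1 fun x => by
    change ⟪S x, x⟫_ℂ = ⟪T x, x⟫_ℂ
    rw [← inner_conj_symm, h, inner_conj_symm]
  exact ContinuousLinearMap.coe_injective this

/-- Both sides are determined by their quadratic forms, and by symmetry and the norm formula the
form of the left side at `x` is ‖∫ f dE x‖² = ∫ f² dE_x. -/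
lemma rint_rint_self (hb2 : ∃ C, ∀ t, ‖f t ^ 2‖ ≤ C) (x : H) :
    E.rint f hf hb (E.rint f hf hb x) = E.rint (fun t => f t ^ 2) (hf.pow_const 2) hb2 x := by
  have : (E.rint f hf hb) ∘L (E.rint f hf hb) = E.rint (fun t => f t ^ 2) (hf.pow_const 2) hb2 := by
    refine eq_of_inner_self fun x => ?_
    rw [inner_rint, ContinuousLinearMap.comp_apply, ← inner_rint_left, inner_self_eq_norm_sq_to_K]
    have h := (hasInt_rint hf hb x).norm_sq_eq (E := E) (measurable_coe hf)
    simp only [Complex.norm_real, Real.norm_eq_abs, sq_abs] at h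
    rw [← h]
    simp
  exact congrArg (· x) this

lemma rint_add (hb2 : ∃ C, ∀ t, ‖f t + g t‖ ≤ C) (x : H) :
    E.rint (fun t => f t + g t) (hf.add hg) hb2 x = E.rint f hf hb x + E.rint g hg hb' x := by
  refine bint_eq _ _ ?_
  have h := (hasInt_rint (E := E) hf hb x).add (measurable_coe hf)
    (measurable_coe hg) (hasInt_rint hg hb' x)
  convert h using 1
  ext t
  simp

-- Polarization: comparing the square of `f + g` with the squares of `f` and `g`, all known from
-- `rint_rint_self`, leaves twice the mixed term, since the two integrals commute.
include hf hg in
lemma rint_mul (hb2 : ∃ C, ∀ t, ‖f t * g t‖ ≤ C) (x : H) :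
    E.rint f hf hb (E.rint g hg hb' x) = E.rint (fun t => f t * g t) (hf.mul hg) hb2 x := by
  obtain ⟨C, hC⟩ := hb
  obtain ⟨C', hC'⟩ := hb'
  obtain ⟨C₂, hC₂⟩ := hb2
  have h0 : 0 ≤ C := (norm_nonneg _).trans (hC 0)
  have h0' : 0 ≤ C' := (norm_nonneg _).trans (hC' 0)
  have hbs : ∃ C, ∀ t, ‖f t + g t‖ ≤ C :=
    ⟨C + C', fun t => (norm_add_le _ _).trans (add_le_add (hC t) (hC' t))⟩
  have hbf : ∃ C, ∀ t, ‖f t ^ 2‖ ≤ C := ⟨C ^ 2, fun t => by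
    rw [norm_pow]; exact pow_le_pow_left₀ (norm_nonneg _) (hC t) 2⟩
  have hbg : ∃ C, ∀ t, ‖g t ^ 2‖ ≤ C := ⟨C' ^ 2, fun t => by
    rw [norm_pow]; exact pow_le_pow_left₀ (norm_nonneg _) (hC' t) 2⟩
  have hbfg : ∃ C, ∀ t, ‖(f t + g t) ^ 2‖ ≤ C := ⟨(C + C') ^ 2, fun t => by
    rw [norm_pow]
    exact pow_le_pow_left₀ (norm_nonneg _)
      ((norm_add_le _ _).trans (add_le_add (hC t) (hC' t))) 2⟩
  have h1 := rint_rint_self (E := E) (hf.add hg) hbs hbfg x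
  change E.rint (fun t => f t + g t) (hf.add hg) hbs
      (E.rint (fun t => f t + g t) (hf.add hg) hbs x) = _ at h1
  have hcomm : E.rint g hg ⟨C', hC'⟩ (E.rint f hf ⟨C, hC⟩ x) =
      E.rint f hf ⟨C, hC⟩ (E.rint g hg ⟨C', hC'⟩ x) := bint_comm _ _ _ _ x
  have e1 : E.rint (fun t => f t + g t) (hf.add hg) hbs
      (E.rint (fun t => f t + g t) (hf.add hg) hbs x) =
      E.rint f hf ⟨C, hC⟩ (E.rint f hf ⟨C, hC⟩ x) + E.rint g hg ⟨C', hC'⟩ (E.rint g hg ⟨C', hC'⟩ x)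
      + (2 : ℂ) • E.rint f hf ⟨C, hC⟩ (E.rint g hg ⟨C', hC'⟩ x) := by
    simp only [rint_add hf ⟨C, hC⟩ hg ⟨C', hC'⟩, map_add, hcomm, two_smul]
    abel
  have e2 : E.rint (fun t => (f t + g t) ^ 2) ((hf.add hg).pow_const 2) hbfg x =
      E.rint (fun t => f t ^ 2) (hf.pow_const 2) hbf x +
      E.rint (fun t => g t ^ 2) (hg.pow_const 2) hbg x +
      (2 : ℂ) • E.rint (fun t => f t * g t) (hf.mul hg) ⟨C₂, hC₂⟩ x := by
    refine bint_eq _ _ ?_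
    have hm := hasInt_rint (E := E) (hf.mul hg) ⟨C₂, hC₂⟩ x
    have hm2 := hm.add (measurable_coe (hf.mul hg))
      (measurable_coe (hf.mul hg)) hm
    have h3 := ((hasInt_rint (E := E) (hf.pow_const 2) hbf x).add
      (measurable_coe (hf.pow_const 2))
      (measurable_coe (hg.pow_const 2)) (hasInt_rint (hg.pow_const 2) hbg x)).add
      ((measurable_coe (hf.pow_const 2)).add
      (measurable_coe (hg.pow_const 2)))
      ((measurable_coe (hf.mul hg)).add
      (measurable_coe (hf.mul hg))) hm2
    rw [two_smul]
    refine (congrArg (fun k => E.HasInt k x _) ?_).mp h3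
    ext t
    simp
    ring
  have h2 : (2 : ℂ) • E.rint f hf ⟨C, hC⟩ (E.rint g hg ⟨C', hC'⟩ x) =
      (2 : ℂ) • E.rint (fun t => f t * g t) (hf.mul hg) ⟨C₂, hC₂⟩ x := by
    have h4 := e1.symm.trans (h1.trans e2)
    rw [rint_rint_self hf ⟨C, hC⟩ hbf, rint_rint_self hg ⟨C', hC'⟩ hbg] at h4
    exact add_left_cancel h4
  exact smul_right_injective H (two_ne_zero (α := ℂ)) h2

end Real

/-- The image of a projection-valued measure under a measurable map. -/
def map (E : PVM H) (φ : ℝ → ℝ) (hφ : Measurable φ) : PVM H where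
  proj s := E.proj (φ ⁻¹' s)
  isStarProjection s hs := E.isStarProjection _ (hφ hs)
  univ := by rw [Set.preimage_univ, E.univ]
  inter s t hs ht := by rw [Set.preimage_inter, E.inter _ _ (hφ hs) (hφ ht)]
  hasSum_iUnion s hs hd x := by
    rw [Set.preimage_iUnion]
    exact E.hasSum_iUnion _ (fun i => hφ (hs i)) (fun i j hij => (hd hij).preimage φ) x

lemma HasInt.map {φ : ℝ → ℝ} (hφ : Measurable φ) {f : ℝ → ℂ} (hf : Measurable f) {x y : H}
    (h : E.HasInt (fun t => f (φ t)) x y) : (E.map φ hφ).HasInt f x y :=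
  HasInt.transfer (L := ContinuousLinearMap.id ℂ H) hφ (fun _ _ _ => rfl) hf h

end Calculus

end PVM

/-! ### From representations of `C(X)` to spectral measures on the line -/

section BorelCalculus

set_option linter.unusedSectionVars false

variable {H : Type u} [NormedAddCommGroup H] [InnerProductSpace ℂ H] [CompleteSpace H]
variable {X : Type*} [MetricSpace X] [CompactSpace X] [MeasurableSpace X] [BorelSpace X]
variable (Φ : C(X, ℂ) →⋆ₐ[ℂ] (H →L[ℂ] H))

lemma norm_sq_rep (g : C(X, ℂ)) (x : H) :
    ‖Φ g x‖ ^ 2 = (⟪x, Φ (star g * g) x⟫_ℂ).re := by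
  rw [map_mul, map_star, mul_apply_eq_comp, ContinuousLinearMap.star_eq_adjoint,
    ContinuousLinearMap.adjoint_inner_right, inner_self_eq_norm_sq_to_K]
  norm_cast

/-- The positive functional `g ↦ ⟪x, Φ(g) x⟫` on real functions. -/
def repFunctional (x : H) : CompactlySupportedContinuousMap X ℝ →ₚ[ℝ] ℝ :=
  PositiveLinearMap.mk₀
    { toFun := fun g => (⟪x, Φ ⟨fun t => (g t : ℂ), by fun_prop⟩ x⟫_ℂ).re
      map_add' := fun g h => by
        rw [← Complex.add_re, ← inner_add_right, ← _root_.add_apply, ← map_add]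
        congr 4
        ext t
        simp
      map_smul' := fun c g => by
        have : (⟨fun t => ((c • g) t : ℂ), by fun_prop⟩ : C(X, ℂ)) =
            (c : ℂ) • ⟨fun t => (g t : ℂ), by fun_prop⟩ := by
          ext t
          simp
        rw [this, map_smul, _root_.smul_apply, inner_smul_right]
        simp }
    (fun g hg => by
      have h0 : ∀ t, 0 ≤ g t := fun t => hg t
      -- Positivity comes from writing `g` as star h * h with h = √g, which turns the functional
      -- into ‖Φ(h) x‖².
      have : (⟨fun t => (g t : ℂ), by fun_prop⟩ : C(X, ℂ)) =
          star (⟨fun t => ((√(g t) : ℝ) : ℂ), by fun_prop⟩ : C(X, ℂ)) *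
            ⟨fun t => ((√(g t) : ℝ) : ℂ), by fun_prop⟩ := by
        ext t
        simp only [ContinuousMap.coe_mk, ContinuousMap.mul_apply, ContinuousMap.star_apply,
          RCLike.star_def, Complex.conj_ofReal]
        rw [← Complex.ofReal_mul, Real.mul_self_sqrt (h0 t)]
      change 0 ≤ (⟪x, Φ ⟨fun t => (g t : ℂ), by fun_prop⟩ x⟫_ℂ).re
      rw [this, ← norm_sq_rep]
      positivity)

/-- The measure representing `g ↦ ⟪x, Φ(g) x⟫`. -/
def repMeasure (x : H) : Measure X := RealRMK.rieszMeasure (repFunctional Φ x)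

instance (x : H) : IsFiniteMeasure (repMeasure Φ x) := by
  unfold repMeasure
  infer_instance

lemma integral_norm_sq_repMeasure (g : C(X, ℂ)) (x : H) :
    ∫ t, ‖g t‖ ^ 2 ∂repMeasure Φ x = ‖Φ g x‖ ^ 2 := by
  let k : CompactlySupportedContinuousMap X ℝ :=
    CompactlySupportedContinuousMap.continuousMapEquiv ⟨fun t => ‖g t‖ ^ 2, by fun_prop⟩
  have h := RealRMK.integral_rieszMeasure (repFunctional Φ x) k
  refine h.trans ?_
  rw [norm_sq_rep]
  change (⟪x, Φ ⟨fun t => ((‖g t‖ ^ 2 : ℝ) : ℂ), _⟩ x⟫_ℂ).re = _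
  congr 4
  ext t
  simp [Complex.conj_mul']

lemma memLp_continuous {μ : Measure X} [IsFiniteMeasure μ] (g : C(X, ℂ)) : MemLp g 2 μ :=
  MemLp.of_bound g.continuous.aestronglyMeasurable ‖g‖
    (Eventually.of_forall fun t => g.norm_coe_le_norm t)

lemma enorm_rep (g : C(X, ℂ)) (x : H) : ‖Φ g x‖ₑ = eLpNorm g 2 (repMeasure Φ x) := by
  rw [(memLp_continuous g).eLpNorm_eq_integral_rpow_norm (by simp) (by simp), ← ofReal_norm,
    ENNReal.ofReal_eq_ofReal_iff (norm_nonneg _) (by positivity)]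
  have := integral_norm_sq_repMeasure Φ g x
  simp only [ENNReal.toReal_ofNat, Real.rpow_ofNat]
  rw [this, ← Real.rpow_natCast, ← Real.rpow_mul (norm_nonneg _)]
  simp

/-- The map `g ↦ Φ(g) x`. -/
def repOrbit (x : H) : C(X, ℂ) →ₗ[ℂ] H where
  toFun g := Φ g x
  map_add' g h := by rw [map_add]; rfl
  map_smul' c g := by rw [map_smul]; rfl

/-- The inclusion of continuous functions in `L²`. -/
def continuousToLp (μ : Measure X) [IsFiniteMeasure μ] : C(X, ℂ) →ₗ[ℂ] Lp ℂ 2 μ :=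
  (ContinuousMap.toLp (E := ℂ) 2 μ ℂ).toLinearMap

/-- The isometry `L²(E_x) → H` extending `g ↦ Φ(g) x`. -/
def repExtend (x : H) : Lp ℂ 2 (repMeasure Φ x) →L[ℂ] H :=
  LinearMap.extendOfNorm (repOrbit Φ x) (continuousToLp (repMeasure Φ x))

lemma enorm_toLp_continuous {μ : Measure X} [IsFiniteMeasure μ] (g : C(X, ℂ)) :
    ‖ContinuousMap.toLp (E := ℂ) 2 μ ℂ g‖ₑ = eLpNorm g 2 μ := by
  rw [Lp.enorm_def]
  exact eLpNorm_congr_ae (ContinuousMap.coeFn_toLp μ g)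

lemma norm_rep (g : C(X, ℂ)) (x : H) :
    ‖Φ g x‖ = ‖ContinuousMap.toLp (E := ℂ) 2 (repMeasure Φ x) ℂ g‖ := by
  have h := (enorm_rep Φ g x).trans (enorm_toLp_continuous g).symm
  rwa [← ofReal_norm, ← ofReal_norm,
    ENNReal.ofReal_eq_ofReal_iff (norm_nonneg _) (norm_nonneg _)] at h

lemma repExtend_toLp (g : C(X, ℂ)) (x : H) :
    repExtend Φ x (ContinuousMap.toLp 2 (repMeasure Φ x) ℂ g) = Φ g x := by
  have hd : DenseRange (continuousToLp (repMeasure Φ x)) :=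
    ContinuousMap.toLp_denseRange ℂ _ ℂ (by simp)
  have hb : ∀ g : C(X, ℂ), ‖repOrbit Φ x g‖ ≤ 1 * ‖continuousToLp (repMeasure Φ x) g‖ := by
    intro g
    rw [one_mul]
    exact (norm_rep Φ g x).le
  exact LinearMap.extendOfNorm_eq hd ⟨1, hb⟩ g

lemma norm_repExtend (x : H) (f : Lp ℂ 2 (repMeasure Φ x)) : ‖repExtend Φ x f‖ = ‖f‖ := by
  refine (ContinuousMap.toLp_denseRange ℂ (repMeasure Φ x) ℂ (p := 2) (by simp)).induction
    (P := fun f => ‖repExtend Φ x f‖ = ‖f‖) ?_ ?_ f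
  · rintro _ ⟨g, rfl⟩
    rw [repExtend_toLp, norm_rep]
  · exact isClosed_eq (by fun_prop) (by fun_prop)

open Classical in
/-- The vector `f(Φ) x` for `f ∈ L²(E_x)`. -/
def repVal (x : H) (f : X → ℂ) : H :=
  if h : MemLp f 2 (repMeasure Φ x) then repExtend Φ x (h.toLp f) else 0

variable {Φ}

lemma repVal_of_memLp {x : H} {f : X → ℂ} (h : MemLp f 2 (repMeasure Φ x)) :
    repVal Φ x f = repExtend Φ x (h.toLp f) := dif_pos h

lemma repVal_continuous (g : C(X, ℂ)) (x : H) : repVal Φ x g = Φ g x := by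
  rw [repVal_of_memLp (memLp_continuous g), ← repExtend_toLp]
  congr 1

lemma enorm_repVal {x : H} {f : X → ℂ} (h : MemLp f 2 (repMeasure Φ x)) :
    ‖repVal Φ x f‖ₑ = eLpNorm f 2 (repMeasure Φ x) := by
  rw [repVal_of_memLp h, ← ofReal_norm, norm_repExtend, ofReal_norm, Lp.enorm_toLp]

lemma repVal_add {x : H} {f g : X → ℂ} (h : MemLp f 2 (repMeasure Φ x))
    (h' : MemLp g 2 (repMeasure Φ x)) :
    repVal Φ x (f + g) = repVal Φ x f + repVal Φ x g := by
  rw [repVal_of_memLp h, repVal_of_memLp h', repVal_of_memLp (h.add h'), ← map_add]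
  rfl

lemma repVal_smul {x : H} {f : X → ℂ} (h : MemLp f 2 (repMeasure Φ x)) (c : ℂ) :
    repVal Φ x (c • f) = c • repVal Φ x f := by
  rw [repVal_of_memLp h, repVal_of_memLp (h.const_smul c), ← map_smul]
  rfl

lemma repVal_sub {x : H} {f g : X → ℂ} (h : MemLp f 2 (repMeasure Φ x))
    (h' : MemLp g 2 (repMeasure Φ x)) :
    repVal Φ x (f - g) = repVal Φ x f - repVal Φ x g := by
  rw [repVal_of_memLp h, repVal_of_memLp h', repVal_of_memLp (h.sub h'), ← map_sub]
  rfl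

lemma tendsto_repVal {x : H} {f : X → ℂ} (h : MemLp f 2 (repMeasure Φ x)) {g : ℕ → X → ℂ}
    (hg : ∀ n, MemLp (g n) 2 (repMeasure Φ x))
    (hl : Tendsto (fun n => eLpNorm (g n - f) 2 (repMeasure Φ x)) atTop (𝓝 0)) :
    Tendsto (fun n => repVal Φ x (g n)) atTop (𝓝 (repVal Φ x f)) := by
  rw [tendsto_iff_edist_tendsto_0]
  refine hl.congr fun n => ?_
  rw [edist_eq_enorm_sub, ← repVal_sub (hg n) h, enorm_repVal ((hg n).sub h)]

lemma tendsto_rep {x : H} {f : X → ℂ} (h : MemLp f 2 (repMeasure Φ x)) {g : ℕ → C(X, ℂ)}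
    (hl : Tendsto (fun n => eLpNorm (⇑(g n) - f) 2 (repMeasure Φ x)) atTop (𝓝 0)) :
    Tendsto (fun n => Φ (g n) x) atTop (𝓝 (repVal Φ x f)) := by
  simpa only [repVal_continuous] using tendsto_repVal h (fun n => memLp_continuous (g n)) hl

omit [CompactSpace X] in
lemma exists_continuous_approx [CompactSpace X] (ν : Measure X) [IsFiniteMeasure ν] {f : X → ℂ}
    (hf : MemLp f 2 ν) :
    ∃ g : ℕ → C(X, ℂ), Tendsto (fun n => eLpNorm (⇑(g n) - f) 2 ν) atTop (𝓝 0) := by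
  have h : ∀ n : ℕ, ∃ g : C(X, ℂ), eLpNorm (⇑g - f) 2 ν ≤ ((n : ℝ≥0∞) + 1)⁻¹ := fun n => by
    obtain ⟨g, hg, -⟩ := hf.exists_boundedContinuous_eLpNorm_sub_le (by simp)
      (ε := ((n : ℝ≥0∞) + 1)⁻¹) (by simp)
    refine ⟨g.toContinuousMap, ?_⟩
    rw [eLpNorm_sub_comm]
    exact hg
  choose g hg using h
  refine ⟨g, tendsto_of_tendsto_of_tendsto_of_le_of_le tendsto_const_nhds ?_
    (fun _ => zero_le) hg⟩
  have := ENNReal.tendsto_inv_nat_nhds_zero.comp (tendsto_add_atTop_nat 1)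
  refine this.congr fun n => ?_
  simp

lemma tendsto_eLpNorm_of_le {μ ν : Measure X} (h : μ ≤ ν) {f : X → ℂ} {g : ℕ → C(X, ℂ)}
    (hl : Tendsto (fun n => eLpNorm (⇑(g n) - f) 2 ν) atTop (𝓝 0)) :
    Tendsto (fun n => eLpNorm (⇑(g n) - f) 2 μ) atTop (𝓝 0) :=
  tendsto_of_tendsto_of_tendsto_of_le_of_le tendsto_const_nhds hl (fun _ => zero_le)
    (fun _ => eLpNorm_mono_measure _ h)

lemma memLp_indicator {S : Set X} (hS : MeasurableSet S) (μ : Measure X) [IsFiniteMeasure μ] :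
    MemLp (S.indicator fun _ => (1 : ℂ)) 2 μ :=
  memLp_indicator_const 2 hS 1 (Or.inr (measure_ne_top _ _))

variable (Φ) in
/-- The spectral projection `E(S)`. -/
def repProj (S : Set X) (x : H) : H := repVal Φ x (S.indicator fun _ => (1 : ℂ))

/-- Each value is defined through a measure depending on its own vector, so additivity is not
formal. Continuous functions that approximate the indicator in the sum of the three measures
approximate it in each of them, and for continuous functions the claim is linearity of `Φ`. -/
lemma repProj_add {S : Set X} (hS : MeasurableSet S) (x y : H) :
    repProj Φ S (x + y) = repProj Φ S x + repProj Φ S y := by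
  obtain ⟨g, hg⟩ := exists_continuous_approx
    (repMeasure Φ x + repMeasure Φ y + repMeasure Φ (x + y)) (memLp_indicator hS _)
  have h1 := tendsto_rep (memLp_indicator hS _) (tendsto_eLpNorm_of_le (μ := repMeasure Φ x)
    ((Measure.le_add_right le_rfl).trans (Measure.le_add_right le_rfl)) hg)
  have h2 := tendsto_rep (memLp_indicator hS _) (tendsto_eLpNorm_of_le (μ := repMeasure Φ y)
    ((Measure.le_add_left le_rfl).trans (Measure.le_add_right le_rfl)) hg)
  have h3 := tendsto_rep (memLp_indicator hS _) (tendsto_eLpNorm_of_le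
    (μ := repMeasure Φ (x + y)) (Measure.le_add_left le_rfl) hg)
  refine tendsto_nhds_unique h3 ((h1.add h2).congr fun n => ?_)
  rw [map_add]

lemma repProj_smul {S : Set X} (hS : MeasurableSet S) (c : ℂ) (x : H) :
    repProj Φ S (c • x) = c • repProj Φ S x := by
  obtain ⟨g, hg⟩ := exists_continuous_approx
    (repMeasure Φ x + repMeasure Φ (c • x)) (memLp_indicator hS _)
  have h1 := tendsto_rep (memLp_indicator hS _) (tendsto_eLpNorm_of_le (μ := repMeasure Φ x)
    (Measure.le_add_right le_rfl) hg)
  have h3 := tendsto_rep (memLp_indicator hS _) (tendsto_eLpNorm_of_le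
    (μ := repMeasure Φ (c • x)) (Measure.le_add_left le_rfl) hg)
  refine tendsto_nhds_unique h3 ((h1.const_smul c).congr fun n => ?_)
  rw [map_smul]

lemma enorm_repProj {S : Set X} (hS : MeasurableSet S) (x : H) :
    ‖repProj Φ S x‖ₑ ^ 2 = repMeasure Φ x S := by
  rw [repProj, enorm_repVal (memLp_indicator hS _), eLpNorm_indicator_const hS (by simp) (by simp),
    ← ENNReal.rpow_natCast, enorm_one, one_mul, ← ENNReal.rpow_mul]
  simp

lemma repProj_univ (x : H) : repProj Φ Set.univ x = x := by
  have : ((Set.univ : Set X).indicator fun _ => (1 : ℂ)) = ⇑(1 : C(X, ℂ)) := by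
    ext t; simp
  rw [repProj, this, repVal_continuous, map_one]
  rfl

lemma norm_repProj_le {S : Set X} (hS : MeasurableSet S) (x : H) : ‖repProj Φ S x‖ ≤ ‖x‖ := by
  have h1 := enorm_repProj (Φ := Φ) hS x
  have h2 := enorm_repProj (Φ := Φ) MeasurableSet.univ x
  rw [repProj_univ] at h2
  have h3 : ‖repProj Φ S x‖ₑ ^ 2 ≤ ‖x‖ₑ ^ 2 := by
    rw [h1, h2]; exact measure_mono (Set.subset_univ _)
  have h4 := (ENNReal.pow_le_pow_left_iff (n := 2) (by norm_num)).1 h3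
  rwa [← ofReal_norm, ← ofReal_norm, ENNReal.ofReal_le_ofReal_iff (norm_nonneg _)] at h4

/-- The indicator is real, so the conjugates of its continuous approximants approximate it too, and
`Φ` turns conjugates into adjoints. -/
lemma inner_repProj {S : Set X} (hS : MeasurableSet S) (x y : H) :
    ⟪repProj Φ S x, y⟫_ℂ = ⟪x, repProj Φ S y⟫_ℂ := by
  obtain ⟨g, hg⟩ := exists_continuous_approx
    (repMeasure Φ x + repMeasure Φ y) (memLp_indicator hS _)
  have hg' : Tendsto (fun n => eLpNorm (⇑(star (g n)) - S.indicator fun _ => (1 : ℂ)) 2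
      (repMeasure Φ x + repMeasure Φ y)) atTop (𝓝 0) := by
    refine hg.congr fun n => eLpNorm_congr_norm_ae (Eventually.of_forall fun t => ?_)
    simp only [Pi.sub_apply, ContinuousMap.star_apply, RCLike.star_def]
    rw [← RCLike.norm_conj, map_sub]
    congr 2
    by_cases ht : t ∈ S <;> simp [ht]
  have h1 := tendsto_rep (memLp_indicator hS _) (tendsto_eLpNorm_of_le (μ := repMeasure Φ x)
    (Measure.le_add_right le_rfl) hg')
  have h2 := tendsto_rep (memLp_indicator hS _) (tendsto_eLpNorm_of_le (μ := repMeasure Φ y)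
    (Measure.le_add_left le_rfl) hg)
  have h3 : Tendsto (fun n => ⟪Φ (star (g n)) x, y⟫_ℂ) atTop (𝓝 ⟪repProj Φ S x, y⟫_ℂ) :=
    h1.inner tendsto_const_nhds
  have h4 : Tendsto (fun n => ⟪x, Φ (g n) y⟫_ℂ) atTop (𝓝 ⟪x, repProj Φ S y⟫_ℂ) :=
    tendsto_const_nhds.inner h2
  refine tendsto_nhds_unique h3 (h4.congr fun n => ?_)
  rw [map_star, ContinuousLinearMap.star_eq_adjoint, ContinuousLinearMap.adjoint_inner_left]

/-- Multiplication by the bounded function `g` preserves `L²` convergence of the approximants of the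
indicator. This is the mixed case needed for multiplicativity of the projections. -/
lemma rep_repProj (g : C(X, ℂ)) {S : Set X} (hS : MeasurableSet S) (x : H) :
    Φ g (repProj Φ S x) = repVal Φ x (⇑g * S.indicator fun _ => (1 : ℂ)) := by
  have hM : MemLp (⇑g * S.indicator fun _ => (1 : ℂ)) 2 (repMeasure Φ x) := by
    refine MemLp.of_bound (g.continuous.aestronglyMeasurable.mul
      (memLp_indicator hS _).1) ‖g‖ (Eventually.of_forall fun t => ?_)
    by_cases ht : t ∈ S <;> simp [ht, g.norm_coe_le_norm t]
  obtain ⟨k, hk⟩ := exists_continuous_approx (repMeasure Φ x) (memLp_indicator hS _)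
  have h1 := ((Φ g).continuous.tendsto _).comp (tendsto_rep (memLp_indicator hS _) hk)
  have h2 : Tendsto (fun n => Φ (g * k n) x) atTop
      (𝓝 (repVal Φ x (⇑g * S.indicator fun _ => (1 : ℂ)))) := by
    refine tendsto_rep hM ?_
    have h3 := ENNReal.Tendsto.const_mul (a := ENNReal.ofReal ‖g‖) hk (Or.inr (by simp))
    rw [mul_zero] at h3
    refine tendsto_of_tendsto_of_tendsto_of_le_of_le tendsto_const_nhds h3
      (fun _ => zero_le) fun n => ?_
    refine eLpNorm_le_mul_eLpNorm_of_ae_le_mul (Eventually.of_forall fun t => ?_) 2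
    simp only [Pi.sub_apply, ContinuousMap.coe_mul, Pi.mul_apply, ← mul_sub, norm_mul]
    gcongr
    exact g.norm_coe_le_norm t
  refine tendsto_nhds_unique h1 (h2.congr fun n => ?_)
  rw [map_mul]
  rfl

lemma repProj_inter {S T : Set X} (hS : MeasurableSet S) (hT : MeasurableSet T) (x : H) :
    repProj Φ (S ∩ T) x = repProj Φ S (repProj Φ T x) := by
  obtain ⟨g, hg⟩ := exists_continuous_approx
    (repMeasure Φ x + repMeasure Φ (repProj Φ T x)) (memLp_indicator hS _)
  have h1 := tendsto_rep (memLp_indicator hS _)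
    (tendsto_eLpNorm_of_le (μ := repMeasure Φ (repProj Φ T x)) (Measure.le_add_left le_rfl) hg)
  have h2 := tendsto_eLpNorm_of_le (μ := repMeasure Φ x) (Measure.le_add_right le_rfl) hg
  refine tendsto_nhds_unique ?_ h1
  simp only [rep_repProj _ hT]
  refine tendsto_repVal (memLp_indicator (hS.inter hT) _) (fun n => ?_) ?_
  · refine MemLp.of_bound ((g n).continuous.aestronglyMeasurable.mul
      (memLp_indicator hT _).1) ‖g n‖ (Eventually.of_forall fun t => ?_)
    by_cases ht : t ∈ T <;> simp [ht, (g n).norm_coe_le_norm t]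
  · refine tendsto_of_tendsto_of_tendsto_of_le_of_le tendsto_const_nhds h2
      (fun _ => zero_le) fun n => eLpNorm_mono fun t => ?_
    by_cases ht : t ∈ T <;> by_cases hs : t ∈ S <;> simp [ht, hs]

lemma repProj_union {S T : Set X} (hS : MeasurableSet S) (hT : MeasurableSet T)
    (hd : Disjoint S T) (x : H) :
    repProj Φ (S ∪ T) x = repProj Φ S x + repProj Φ T x := by
  rw [repProj, Set.indicator_union_of_disjoint hd]
  exact repVal_add (memLp_indicator hS _) (memLp_indicator hT _)

lemma repProj_empty (x : H) : repProj Φ ∅ x = 0 := by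
  have := repProj_union (Φ := Φ) MeasurableSet.empty MeasurableSet.empty (Set.disjoint_empty _) x
  rw [Set.union_empty] at this
  simpa using this

lemma repProj_biUnion {S : ℕ → Set X} (hS : ∀ i, MeasurableSet (S i))
    (hd : Pairwise (Function.onFun Disjoint S)) (x : H) (F : Finset ℕ) :
    repProj Φ (⋃ i ∈ F, S i) x = ∑ i ∈ F, repProj Φ (S i) x := by
  classical
  induction F using Finset.induction_on with
  | empty => simp [repProj_empty]
  | insert a F ha ih =>
    rw [Finset.set_biUnion_insert, Finset.sum_insert ha, ← ih]
    refine repProj_union (hS a) (Finset.measurableSet_biUnion _ fun i _ => hS i) ?_ x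
    rw [Set.disjoint_iUnion₂_right]
    intro i hi
    exact hd (by rintro rfl; exact ha hi)

/-- The difference between the limit and a partial sum is the projection of `x` for the remaining
set. Its squared norm is the measure of that set, which tends to zero. -/
lemma hasSum_repProj {S : ℕ → Set X} (hS : ∀ i, MeasurableSet (S i))
    (hd : Pairwise (Function.onFun Disjoint S)) (x : H) :
    HasSum (fun i => repProj Φ (S i) x) (repProj Φ (⋃ i, S i) x) := by
  have hU := MeasurableSet.iUnion hS
  have hsplit : ∀ F : Finset ℕ, repProj Φ ((⋃ i, S i) \ ⋃ i ∈ F, S i) x =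
      repProj Φ (⋃ i, S i) x - ∑ i ∈ F, repProj Φ (S i) x := by
    intro F
    have hF : MeasurableSet (⋃ i ∈ F, S i) := Finset.measurableSet_biUnion _ fun i _ => hS i
    have h := repProj_union (Φ := Φ) hF (hU.diff hF) Set.disjoint_sdiff_right x
    rw [Set.union_sdiff_cancel (Set.iUnion₂_subset fun i _ => Set.subset_iUnion S i)] at h
    rw [h, repProj_biUnion hS hd]
    abel
  have hμ : HasSum (fun i => (repMeasure Φ x).real (S i)) ((repMeasure Φ x).real (⋃ i, S i)) := by
    rw [Measure.real, measure_iUnion hd hS, ENNReal.tsum_toReal_eq fun _ => measure_ne_top _ _]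
    refine (ENNReal.summable_toReal ?_).hasSum
    rw [← measure_iUnion hd hS]
    exact measure_ne_top _ _
  rw [HasSum, SummationFilter.unconditional_filter, tendsto_iff_norm_sub_tendsto_zero]
  have h2 : Tendsto (fun F : Finset ℕ =>
      √((repMeasure Φ x).real (⋃ i, S i) - ∑ i ∈ F, (repMeasure Φ x).real (S i))) atTop (𝓝 0) := by
    have h3 : Tendsto (fun F : Finset ℕ => (repMeasure Φ x).real (⋃ i, S i) -
        ∑ i ∈ F, (repMeasure Φ x).real (S i)) atTop (𝓝 0) := by
      have := hμ
      rw [HasSum, SummationFilter.unconditional_filter] at this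
      simpa using this.const_sub ((repMeasure Φ x).real (⋃ i, S i))
    simpa using h3.sqrt
  refine h2.congr fun F => ?_
  have hF : MeasurableSet (⋃ i ∈ F, S i) := Finset.measurableSet_biUnion _ fun i _ => hS i
  rw [norm_sub_rev, ← hsplit]
  have h4 := enorm_repProj (Φ := Φ) (hU.diff hF) x
  have h5 : ‖repProj Φ ((⋃ i, S i) \ ⋃ i ∈ F, S i) x‖ ^ 2 =
      (repMeasure Φ x).real ((⋃ i, S i) \ ⋃ i ∈ F, S i) := by
    rw [Measure.real, ← h4, ENNReal.toReal_pow, toReal_enorm]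
  rw [measureReal_sdiff (Set.iUnion₂_subset fun i _ => Set.subset_iUnion S i) hF,
    measureReal_biUnion_finset (fun i _ j _ hij => hd hij) (fun i _ => hS i)] at h5
  rw [← h5, Real.sqrt_sq (norm_nonneg _)]

variable (Φ) in
/-- The spectral projection `E(S)` as a bounded operator. -/
def repProjL (S : Set X) (hS : MeasurableSet S) : H →L[ℂ] H :=
  LinearMap.mkContinuous
    { toFun := repProj Φ S
      map_add' := repProj_add hS
      map_smul' := repProj_smul hS } 1 (fun x => by rw [one_mul]; exact norm_repProj_le hS x)

open Classical in
variable (Φ) in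
/-- The image on the real line, under `ρ`, of the spectral measure of a representation of
`C(X)`. -/
def repPVM (ρ : X → ℝ) (hρ : Measurable ρ) : PVM H where
  proj S := if hS : MeasurableSet S then repProjL Φ (ρ ⁻¹' S) (hρ hS) else 0
  isStarProjection S hS := by
    rw [dif_pos hS]
    refine ⟨?_, ?_⟩
    · ext x
      change repProj Φ _ (repProj Φ _ x) = repProj Φ _ x
      rw [← repProj_inter (hρ hS) (hρ hS), Set.inter_self]
    · rw [ContinuousLinearMap.isSelfAdjoint_iff_isSymmetric]
      exact fun x y => inner_repProj (hρ hS) x y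
  univ := by
    rw [dif_pos MeasurableSet.univ]
    ext x
    exact repProj_univ x
  inter S T hS hT := by
    rw [dif_pos hS, dif_pos hT, dif_pos (hS.inter hT)]
    ext x
    exact repProj_inter (hρ hS) (hρ hT) x
  hasSum_iUnion S hS hd x := by
    simp only [dif_pos (hS _), dif_pos (MeasurableSet.iUnion hS)]
    have := hasSum_repProj (Φ := Φ) (fun i => hρ (hS i)) (fun i j hij => (hd hij).preimage ρ) x
    rwa [← Set.preimage_iUnion] at this

variable {ρ : X → ℝ} {hρ : Measurable ρ}

lemma repPVM_proj {S : Set ℝ} (hS : MeasurableSet S) (x : H) :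
    (repPVM Φ ρ hρ).proj S x = repProj Φ (ρ ⁻¹' S) x := by
  classical
  change (if hS : MeasurableSet S then repProjL Φ (ρ ⁻¹' S) (hρ hS) else 0) x = _
  rw [dif_pos hS]
  rfl

lemma repPVM_measure (x : H) :
    (repPVM Φ ρ hρ).measure x = (repMeasure Φ x).map ρ := by
  ext S hS
  rw [PVM.measure_apply _ _ hS, Measure.map_apply hρ hS, repPVM_proj hS,
    ← enorm_repProj (hρ hS), ENNReal.ofReal_pow (norm_nonneg _), ofReal_norm]

lemma repPVM_simpleIntegral (g : SimpleFunc ℝ ℂ) (x : H) :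
    (repPVM Φ ρ hρ).simpleIntegral g x = repVal Φ x (g ∘ ρ) := by
  have hm : ∀ c, MemLp ((ρ ⁻¹' (g ⁻¹' {c})).indicator fun _ => (1 : ℂ)) 2 (repMeasure Φ x) :=
    fun c => memLp_indicator (hρ (g.measurableSet_fiber c)) _
  have hsum : ∀ F : Finset ℂ, MemLp (∑ c ∈ F, c • (ρ ⁻¹' (g ⁻¹' {c})).indicator fun _ => (1 : ℂ)) 2
      (repMeasure Φ x) ∧ repVal Φ x (∑ c ∈ F, c • (ρ ⁻¹' (g ⁻¹' {c})).indicator fun _ => (1 : ℂ)) =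
      ∑ c ∈ F, c • repProj Φ (ρ ⁻¹' (g ⁻¹' {c})) x := by
    classical
    intro F
    induction F using Finset.induction_on with
    | empty =>
      refine ⟨by simp, ?_⟩
      have h := repProj_empty (Φ := Φ) x
      rw [repProj, Set.indicator_empty] at h
      rw [Finset.sum_empty, Finset.sum_empty]
      exact h
    | insert a F ha ih =>
      rw [Finset.sum_insert ha, Finset.sum_insert ha]
      exact ⟨((hm a).const_smul a).add ih.1, by
        rw [repVal_add ((hm a).const_smul a) ih.1, ih.2, repVal_smul (hm a)]; rfl⟩
  rw [PVM.simpleIntegral_eq_sum g subset_rfl]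
  simp only [repPVM_proj (g.measurableSet_fiber _)]
  rw [← (hsum g.range).2]
  congr 1
  ext t
  rw [Finset.sum_apply, Finset.sum_eq_single (g (ρ t))]
  · simp
  · intro c _ hc
    have : t ∉ ρ ⁻¹' (g ⁻¹' {c}) := fun h => hc (by simpa using h.symm)
    simp [this]
  · intro h
    exact absurd (g.mem_range_self _) h

/-- Both values are `L²` limits along the same simple functions, transported by `ρ`; for a
continuous function the extension of `Φ` gives back `Φ`. -/
lemma repPVM_hasInt {f : ℝ → ℂ} (hf : Measurable f) (g : C(X, ℂ)) (hg : ∀ t, g t = f (ρ t))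
    (x : H) : (repPVM Φ ρ hρ).HasInt f x (Φ g x) := by
  have hg' : f ∘ ρ = g := funext fun t => (hg t).symm
  have hmem : x ∈ (repPVM Φ ρ hρ).integralDomain f := by
    rw [PVM.mem_integralDomain_iff, repPVM_measure,
      eLpNorm_map_measure hf.aestronglyMeasurable hρ.aemeasurable, hg']
    exact (memLp_continuous g).2
  refine ⟨_, PVM.tendsto_approx hf hmem, ?_⟩
  have h1 := PVM.tendsto_approx hf hmem
  simp only [repPVM_simpleIntegral]
  rw [← repVal_continuous]
  refine tendsto_repVal (memLp_continuous g) (fun n => ?_) ?_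
  · have := SimpleFunc.memLp_of_isFiniteMeasure (μ := (repMeasure Φ x).map ρ)
      (PVM.approx f hf n) 2
    exact this.comp_of_map hρ.aemeasurable
  · refine h1.congr fun n => ?_
    rw [repPVM_measure, eLpNorm_map_measure
      ((PVM.approx f hf n).measurable.sub hf).aestronglyMeasurable hρ.aemeasurable]
    rw [← hg']
    rfl

end BorelCalculus

/-- The spectral theorem for bounded self-adjoint operators. -/
lemma exists_spectral_measure {H : Type u} [NormedAddCommGroup H] [InnerProductSpace ℂ H]
    [CompleteSpace H] {A : H →L[ℂ] H} (hA : IsSelfAdjoint A) :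
    ∃ F : PVM H, (∀ x, F.HasInt (fun t => (t : ℂ)) x (A x)) ∧
      ∀ S : Set ℝ, MeasurableSet S → (∀ c ∈ spectrum ℂ A, ∃ t ∈ S, (t : ℂ) = c) →
        F.proj S = 1 := by
  have hn : IsStarNormal A := hA.isStarNormal
  let Φ : C(spectrum ℂ A, ℂ) →⋆ₐ[ℂ] (H →L[ℂ] H) := cfcHom hn
  -- The continuous calculus lives on the complex spectrum, which is real here, so taking real parts
  -- moves the measure to the line without loss.
  have hρ : Measurable fun t : spectrum ℂ A => (t : ℂ).re := by fun_prop
  refine ⟨repPVM Φ (fun t => (t : ℂ).re) hρ, fun x => ?_, fun S hS h => ?_⟩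
  · have h := repPVM_hasInt (Φ := Φ) (hρ := hρ) Complex.measurable_ofReal
      ((ContinuousMap.id ℂ).restrict (spectrum ℂ A)) (fun t => hA.mem_spectrum_eq_re t.2) x
    rwa [cfcHom_id] at h
  · ext x
    rw [repPVM_proj hS]
    have : (fun t : spectrum ℂ A => (t : ℂ).re) ⁻¹' S = Set.univ := by
      ext t
      obtain ⟨s, hs, hst⟩ := h t t.2
      simp [← hst, hs]
    rw [this, repProj_univ]
    rfl

/-! ### Graphs of sums, products and restrictions of unbounded operators -/

section Graphs

set_option linter.unusedSectionVars false

variable {H : Type u} [NormedAddCommGroup H] [InnerProductSpace ℂ H]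

lemma mem_graph_pcomp (S T : H →ₗ.[ℂ] H) (x w : H) :
    (x, w) ∈ (pcomp S T).graph ↔ ∃ y, (x, y) ∈ T.graph ∧ (y, w) ∈ S.graph := by
  constructor
  · intro h
    obtain ⟨⟨_, ⟨x', hx', rfl⟩⟩, h1, h2⟩ := (LinearPMap.mem_graph_iff _).1 h
    have h1' : (x' : H) = x := h1
    subst h1'
    refine ⟨T x', T.mem_graph x', ?_⟩
    rw [← show pcomp S T ⟨_, ⟨x', hx', rfl⟩⟩ = w from h2]
    exact S.mem_graph ⟨T x', hx'⟩
  · rintro ⟨y, h1, h2⟩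
    obtain ⟨x', rfl, rfl⟩ := (LinearPMap.mem_graph_iff _).1 h1
    obtain ⟨y', hy', rfl⟩ := (LinearPMap.mem_graph_iff _).1 h2
    have hx' : T x' ∈ S.domain := by
      rw [← show (y' : H) = T x' from hy']; exact y'.2
    refine (LinearPMap.mem_graph_iff _).2 ⟨⟨x', ⟨x', hx', rfl⟩⟩, rfl, ?_⟩
    change S ⟨T x', hx'⟩ = S y'
    congr 1
    exact Subtype.ext hy'.symm

lemma mem_graph_restrict (T : H →ₗ.[ℂ] H) (M : Submodule ℂ H) (x y : M) :
    (x, y) ∈ (restrict T M).graph ↔ ((x : H), (y : H)) ∈ T.graph := by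
  constructor
  · intro h
    obtain ⟨⟨x', hx'⟩, rfl, rfl⟩ := (LinearPMap.mem_graph_iff _).1 h
    obtain ⟨a, ha, hax⟩ := hx'
    have hx0 : (x' : H) ∈ T.domain := by
      rw [← show (a : H) = x' from hax]; exact a.2
    exact T.mem_graph ⟨(x' : H), hx0⟩
  · intro h
    obtain ⟨x', hx', hy'⟩ := (LinearPMap.mem_graph_iff _).1 h
    have hy2 : T x' = (y : H) := hy'
    have hx2 : (x' : H) = (x : H) := hx'
    refine (LinearPMap.mem_graph_iff _).2 ⟨⟨x, ⟨x', ?_, hx2⟩⟩, rfl, ?_⟩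
    · change T x' ∈ M
      rw [hy2]; exact y.2
    · apply Subtype.ext
      refine Eq.trans ?_ hy2
      change T ⟨(x : H), _⟩ = T x'
      congr 1
      exact Subtype.ext hx2.symm

lemma mem_graph_domRestrict (T : H →ₗ.[ℂ] H) (D : Submodule ℂ H) (x y : H) :
    (x, y) ∈ (T.domRestrict D).graph ↔ x ∈ D ∧ (x, y) ∈ T.graph := by
  constructor
  · intro h
    obtain ⟨x', rfl, rfl⟩ := (LinearPMap.mem_graph_iff _).1 h
    refine ⟨x'.2.1, ?_⟩
    change ((x' : H), T.domRestrict D x') ∈ T.graph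
    rw [LinearPMap.domRestrict_apply (y := (⟨x', x'.2.2⟩ : T.domain)) rfl]
    exact T.mem_graph ⟨x', x'.2.2⟩
  · rintro ⟨hx, h⟩
    obtain ⟨x', rfl, rfl⟩ := (LinearPMap.mem_graph_iff _).1 h
    refine (LinearPMap.mem_graph_iff _).2 ⟨⟨x', ⟨hx, x'.2⟩⟩, rfl, ?_⟩
    exact LinearPMap.domRestrict_apply rfl

lemma mem_graph_smul (T : H →ₗ.[ℂ] H) (c : ℂ) (x y : H) :
    (x, y) ∈ (c • T).graph ↔ ∃ v, (x, v) ∈ T.graph ∧ y = c • v := by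
  constructor
  · intro h
    obtain ⟨x', rfl, rfl⟩ := (LinearPMap.mem_graph_iff _).1 h
    exact ⟨T x', T.mem_graph x', rfl⟩
  · rintro ⟨v, h, rfl⟩
    obtain ⟨x', rfl, rfl⟩ := (LinearPMap.mem_graph_iff _).1 h
    exact (LinearPMap.mem_graph_iff _).2 ⟨x', rfl, rfl⟩

lemma mem_graph_add (S T : H →ₗ.[ℂ] H) (x y : H) :
    (x, y) ∈ (S + T).graph ↔ ∃ v w, (x, v) ∈ S.graph ∧ (x, w) ∈ T.graph ∧ y = v + w := by
  constructor
  · intro h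
    obtain ⟨x', rfl, rfl⟩ := (LinearPMap.mem_graph_iff _).1 h
    exact ⟨_, _, S.mem_graph ⟨x', x'.2.1⟩, T.mem_graph ⟨x', x'.2.2⟩, rfl⟩
  · rintro ⟨v, w, h, h', rfl⟩
    obtain ⟨x', rfl, rfl⟩ := (LinearPMap.mem_graph_iff _).1 h
    obtain ⟨y', hy', rfl⟩ := (LinearPMap.mem_graph_iff _).1 h'
    have hy2 : (y' : H) = x' := hy'
    have hx : (x' : H) ∈ T.domain := hy2 ▸ y'.2
    refine (LinearPMap.mem_graph_iff _).2 ⟨⟨x', ⟨x'.2, hx⟩⟩, rfl, ?_⟩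
    change S x' + T ⟨x', hx⟩ = S x' + T y'
    congr 2
    exact Subtype.ext hy2.symm

lemma mem_graph_sub (S T : H →ₗ.[ℂ] H) (x y : H) :
    (x, y) ∈ (S - T).graph ↔ ∃ v w, (x, v) ∈ S.graph ∧ (x, w) ∈ T.graph ∧ y = v - w := by
  constructor
  · intro h
    obtain ⟨x', rfl, rfl⟩ := (LinearPMap.mem_graph_iff _).1 h
    exact ⟨_, _, S.mem_graph ⟨x', x'.2.1⟩, T.mem_graph ⟨x', x'.2.2⟩, rfl⟩
  · rintro ⟨v, w, h, h', rfl⟩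
    obtain ⟨x', rfl, rfl⟩ := (LinearPMap.mem_graph_iff _).1 h
    obtain ⟨y', hy', rfl⟩ := (LinearPMap.mem_graph_iff _).1 h'
    have hy2 : (y' : H) = x' := hy'
    have hx : (x' : H) ∈ T.domain := hy2 ▸ y'.2
    refine (LinearPMap.mem_graph_iff _).2 ⟨⟨x', ⟨x'.2, hx⟩⟩, rfl, ?_⟩
    change S x' - T ⟨x', hx⟩ = S x' - T y'
    congr 2
    exact Subtype.ext hy2.symm

lemma mem_graph_pone (x y : H) : (x, y) ∈ (pone : H →ₗ.[ℂ] H).graph ↔ y = x := by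
  constructor
  · intro h
    obtain ⟨x', rfl, rfl⟩ := (LinearPMap.mem_graph_iff _).1 h
    rfl
  · rintro rfl
    exact (LinearPMap.mem_graph_iff _).2 ⟨⟨y, trivial⟩, rfl, rfl⟩

lemma mem_graph_sum {κ : Type*} (F : Finset κ) (T : κ → H →ₗ.[ℂ] H) (x y : H) :
    (x, y) ∈ (∑ l ∈ F, T l).graph ↔
      ∃ v : κ → H, (∀ l ∈ F, (x, v l) ∈ (T l).graph) ∧ y = ∑ l ∈ F, v l := by
  classical
  induction F using Finset.induction_on generalizing y with
  | empty =>
    simp only [Finset.sum_empty, Finset.notMem_empty, IsEmpty.forall_iff, implies_true, true_and,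
      exists_const]
    constructor
    · intro h
      obtain ⟨x', rfl, rfl⟩ := (LinearPMap.mem_graph_iff _).1 h
      rfl
    · rintro rfl
      exact (LinearPMap.mem_graph_iff _).2 ⟨⟨x, trivial⟩, rfl, rfl⟩
  | insert a F ha ih =>
    rw [Finset.sum_insert ha, mem_graph_add]
    constructor
    · rintro ⟨v, w, hv, hw, rfl⟩
      obtain ⟨u, hu, rfl⟩ := (ih w).1 hw
      refine ⟨Function.update u a v, fun l hl => ?_, ?_⟩
      · by_cases hla : l = a
        · subst hla; simpa using hv
        · rw [Function.update_of_ne hla]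
          exact hu l ((Finset.mem_insert.1 hl).resolve_left hla)
      · rw [Finset.sum_insert ha, Function.update_self]
        congr 1
        refine Finset.sum_congr rfl fun l hl => ?_
        rw [Function.update_of_ne]
        rintro rfl
        exact ha hl
    · rintro ⟨v, hv, rfl⟩
      rw [Finset.sum_insert ha]
      exact ⟨v a, _, hv a (Finset.mem_insert_self _ _), (ih _).2
        ⟨v, fun l hl => hv l (Finset.mem_insert_of_mem hl), rfl⟩, rfl⟩

lemma pmap_ext {S T : H →ₗ.[ℂ] H} (h : ∀ x y, (x, y) ∈ S.graph ↔ (x, y) ∈ T.graph) : S = T :=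
  LinearPMap.eq_of_eq_graph (Submodule.ext fun p => h p.1 p.2)

lemma pmap_le {S T : H →ₗ.[ℂ] H} (h : ∀ x y, (x, y) ∈ S.graph → (x, y) ∈ T.graph) : S ≤ T :=
  LinearPMap.le_of_le_graph fun p hp => h p.1 p.2 hp

end Graphs

/-! ### Operators with at most one entry per row and column in a Hilbert sum -/

section Block

set_option linter.unusedSectionVars false

variable {ι : Type*} {ε : Type*} {G : ι → Type*} [∀ i, NormedAddCommGroup (G i)]
  [∀ i, InnerProductSpace ℂ (G i)]
variable {H : Type u} [NormedAddCommGroup H] [InnerProductSpace ℂ H]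
variable (e : H ≃ₗᵢ[ℂ] lp G 2)

/-- The components of a vector in a Hilbert sum. -/
def coord (i : ι) : H →L[ℂ] G i :=
  LinearMap.mkContinuous
    { toFun := fun x => e x i
      map_add' := fun x y => by rw [map_add]; rfl
      map_smul' := fun c x => by rw [map_smul]; rfl } 1 (fun x => by
        rw [one_mul, ← e.norm_map x]
        exact lp.norm_apply_le_norm (by simp) (e x) i)

lemma continuous_coord (i : ι) : Continuous fun x => e x i := (coord e i).continuous

lemma coord_ext {x y : H} (h : ∀ i, e x i = e y i) : x = y :=
  e.injective (lp.ext (funext h))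

lemma coord_zero (i : ι) : e (0 : H) i = 0 := by simp

lemma coord_add (x y : H) (i : ι) : e (x + y) i = e x i + e y i := by simp

lemma coord_sub (x y : H) (i : ι) : e (x - y) i = e x i - e y i := by simp

lemma coord_smul (c : ℂ) (x : H) (i : ι) : e (c • x) i = c • e x i := by simp

section

variable [DecidableEq ι]

/-- The vector with the only component `h` in position `i`. -/
def bsingle (i : ι) (h : G i) : H := e.symm (lp.single 2 i h)

lemma coord_bsingle (i j : ι) (h : G i) : e (bsingle e i h) j = Pi.single i h j := by
  simp [bsingle]

lemma coord_bsingle_self (i : ι) (h : G i) : e (bsingle e i h) i = h := by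
  rw [coord_bsingle, Pi.single_eq_same]

lemma coord_bsingle_ne {i j : ι} (hij : j ≠ i) (h : G i) : e (bsingle e i h) j = 0 := by
  rw [coord_bsingle, Pi.single_eq_of_ne hij]

lemma bsingle_zero (i : ι) : bsingle e i 0 = 0 := by simp [bsingle]

lemma hasSum_bsingle (x : H) : HasSum (fun i => bsingle e i (e x i)) x := by
  have := (lp.hasSum_single (p := 2) (by simp) (e x)).mapL
    (e.symm.toContinuousLinearEquiv : lp G 2 →L[ℂ] H)
  simpa [bsingle] using this

lemma inner_bsingle (i : ι) (h : G i) (x : H) : ⟪bsingle e i h, x⟫_ℂ = ⟪h, e x i⟫_ℂ := by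
  rw [← e.inner_map_map, bsingle, e.apply_symm_apply, lp.inner_single_left]

lemma hasSum_inner_coord (x y : H) : HasSum (fun i => ⟪e x i, e y i⟫_ℂ) ⟪x, y⟫_ℂ := by
  rw [← e.inner_map_map]
  exact lp.hasSum_inner (e x) (e y)

lemma dense_of_bsingle_mem {D : Submodule ℂ H} (h : ∀ i g, bsingle e i g ∈ D) :
    Dense (D : Set H) := by
  intro x
  refine mem_closure_of_tendsto (hasSum_bsingle e x) (Eventually.of_forall fun F => ?_)
  exact D.sum_mem fun i _ => h i _

end

variable (s t : ε → ι) (T : ∀ a, G (s a) →L[ℂ] G (t a))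

/-- The graph of a closed operator with at most one entry in each row and column: the edge `a`
carries the entry `T a` from component `s a` to component `t a`. -/
def blockRel : Submodule ℂ (H × H) where
  carrier := {p | (∀ a, e p.2 (t a) = T a (e p.1 (s a))) ∧ ∀ i, i ∉ Set.range t → e p.2 i = 0}
  zero_mem' := by simp
  add_mem' := by
    rintro p p' ⟨h1, h2⟩ ⟨h1', h2'⟩
    exact ⟨fun a => by simp [h1 a, h1' a], fun i hi => by simp [h2 i hi, h2' i hi]⟩
  smul_mem' := by
    rintro c p ⟨h1, h2⟩
    exact ⟨fun a => by simp [h1 a], fun i hi => by simp [h2 i hi]⟩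

/-- The maximal operator with the given entries. -/
def blockOp : H →ₗ.[ℂ] H := (blockRel e s t T).toLinearPMap

/-- Each component of `y` is prescribed, by an entry or as zero, so the relation is single-valued
and therefore is the graph of an operator. -/
lemma mem_graph_blockOp {x y : H} :
    (x, y) ∈ (blockOp e s t T).graph ↔
      (∀ a, e y (t a) = T a (e x (s a))) ∧ ∀ i, i ∉ Set.range t → e y i = 0 := by
  rw [blockOp, Submodule.toLinearPMap_graph_eq]
  · rfl
  · rintro ⟨x, y⟩ ⟨h1, h2⟩ h0
    simp only at h0 h1 h2
    subst h0
    refine coord_ext e fun i => ?_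
    by_cases hi : i ∈ Set.range t
    · obtain ⟨a, rfl⟩ := hi
      rw [h1]
      simp
    · rw [h2 i hi]
      simp

lemma blockOp_isClosed : (blockOp e s t T).IsClosed := by
  have : ((blockOp e s t T).graph : Set (H × H)) =
      (⋂ a, {p | e p.2 (t a) = T a (e p.1 (s a))}) ∩
        ⋂ i, ⋂ (_ : i ∉ Set.range t), {p : H × H | e p.2 i = 0} := by
    ext ⟨x, y⟩
    simp only [SetLike.mem_coe, mem_graph_blockOp, Set.mem_inter_iff, Set.mem_iInter,
      Set.mem_ofPred_eq]
  rw [LinearPMap.IsClosed, this]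
  refine IsClosed.inter (isClosed_iInter fun a => ?_)
    (isClosed_iInter fun i => isClosed_iInter fun _ => ?_)
  · exact isClosed_eq ((continuous_coord e _).comp continuous_snd)
      ((T a).continuous.comp ((continuous_coord e _).comp continuous_fst))
  · exact isClosed_eq ((continuous_coord e _).comp continuous_snd) continuous_const

variable {s t T}

section

variable [DecidableEq ι]

lemma bsingle_mem_graph_blockOp (hs : Function.Injective s) (ht : Function.Injective t) (a : ε)
    (h : G (s a)) :
    (bsingle e (s a) h, bsingle e (t a) (T a h)) ∈ (blockOp e s t T).graph := by
  rw [mem_graph_blockOp]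
  refine ⟨fun b => ?_, fun i hi => coord_bsingle_ne e (fun h' => hi ⟨a, h'.symm⟩) _⟩
  by_cases hab : b = a
  · subst hab
    rw [coord_bsingle_self, coord_bsingle_self]
  · rw [coord_bsingle_ne e (fun h' => hab (ht h')), coord_bsingle_ne e (fun h' => hab (hs h')),
      map_zero]

lemma bsingle_mem_graph_blockOp_zero {i : ι} (hi : i ∉ Set.range s) (h : G i) :
    (bsingle e i h, (0 : H)) ∈ (blockOp e s t T).graph := by
  rw [mem_graph_blockOp]
  refine ⟨fun b => ?_, fun i _ => coord_zero e i⟩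
  rw [coord_zero, coord_bsingle_ne e (fun h' => hi ⟨b, h'⟩), map_zero]

/-- By injectivity of `s` and `t`, the images of the components of `x` are, up to reindexing and
zeros, the components of `y`, each occurring once. -/
lemma hasSum_blockOp (hs : Function.Injective s) (ht : Function.Injective t) {x y : H}
    (h : (x, y) ∈ (blockOp e s t T).graph) {v : ι → H}
    (hv : ∀ i, (bsingle e i (e x i), v i) ∈ (blockOp e s t T).graph) : HasSum v y := by
  obtain ⟨h1, h2⟩ := (mem_graph_blockOp e s t T).1 h
  have hva : ∀ a, v (s a) = bsingle e (t a) (e y (t a)) := fun a => by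
    rw [h1 a]
    exact LinearPMap.mem_graph_snd_inj _ (hv (s a))
      (bsingle_mem_graph_blockOp e hs ht a _) rfl
  have hv0 : ∀ i, i ∉ Set.range s → v i = 0 := fun i hi =>
    LinearPMap.mem_graph_snd_inj _ (hv i) (bsingle_mem_graph_blockOp_zero e hi _) rfl
  rw [← hs.hasSum_iff hv0]
  have h3 := hasSum_bsingle e y
  rw [← ht.hasSum_iff (fun i hi => by rw [h2 i hi, bsingle_zero])] at h3
  refine h3.congr_fun fun a => ?_
  exact hva a

/-- The expansion of a vector of the maximal domain into its components converges in the graph norm.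
So every restriction that is defined on the single components already has the maximal operator as
its closure. -/
lemma closure_eq_blockOp (hs : Function.Injective s) (ht : Function.Injective t)
    {S : H →ₗ.[ℂ] H} (hle : S ≤ blockOp e s t T) (hS : ∀ i h, bsingle e i h ∈ S.domain) :
    S.closure = blockOp e s t T := by
  have hcl : S.IsClosable := (blockOp_isClosed e s t T).isClosable.leIsClosable hle
  apply LinearPMap.eq_of_eq_graph
  rw [← hcl.graph_closure_eq_closure_graph]
  apply le_antisymm
  · exact Submodule.topologicalClosure_minimal _ (LinearPMap.le_graph_of_le hle)
      (blockOp_isClosed e s t T)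
  · rintro ⟨x, y⟩ h
    have hv : ∀ i, (bsingle e i (e x i), S ⟨_, hS i (e x i)⟩) ∈ S.graph := fun i =>
      S.mem_graph ⟨_, hS i (e x i)⟩
    have hsum := (hasSum_bsingle e x).prodMk (hasSum_blockOp e hs ht h fun i =>
      LinearPMap.le_graph_of_le hle (hv i))
    refine mem_closure_of_tendsto hsum (Eventually.of_forall fun F => ?_)
    exact S.graph.sum_mem fun i _ => hv i

variable [∀ i, CompleteSpace (G i)] [CompleteSpace H]

/-- Testing against single components yields the entries of the adjoint. Conversely the transposed
entries suffice, since both inner products expand into series over the edges with equal terms. -/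
lemma adjoint_eq_blockOp (hs : Function.Injective s) (ht : Function.Injective t)
    {S : H →ₗ.[ℂ] H} (hle : S ≤ blockOp e s t T) (hS : ∀ i h, bsingle e i h ∈ S.domain) :
    S.adjoint = blockOp e t s (fun a => (T a).adjoint) := by
  apply pmap_ext
  intro u v
  rw [LinearPMap.adjoint_graph_eq_graph_adjoint (dense_of_bsingle_mem e hS),
    Submodule.mem_adjoint_iff, mem_graph_blockOp]
  have hval : ∀ i (h : G i), (bsingle e i h, S ⟨_, hS i h⟩) ∈ S.graph := fun i h =>
    S.mem_graph ⟨_, hS i h⟩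
  constructor
  · intro hu
    refine ⟨fun a => ?_, fun i hi => ?_⟩
    · refine ext_inner_left ℂ fun h => ?_
      have h1 := hu _ _ (hval (s a) h)
      have h2 : S ⟨_, hS (s a) h⟩ = bsingle e (t a) (T a h) :=
        LinearPMap.mem_graph_snd_inj _ (LinearPMap.le_graph_of_le hle (hval (s a) h))
          (bsingle_mem_graph_blockOp e hs ht a h) rfl
      rw [h2, inner_bsingle, inner_bsingle, sub_eq_zero] at h1
      rw [ContinuousLinearMap.adjoint_inner_right, h1]
    · refine ext_inner_left ℂ fun h => ?_
      have h1 := hu _ _ (hval i h)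
      have h2 : S ⟨_, hS i h⟩ = 0 :=
        LinearPMap.mem_graph_snd_inj _ (LinearPMap.le_graph_of_le hle (hval i h))
          (bsingle_mem_graph_blockOp_zero e hi h) rfl
      rw [h2, inner_bsingle, inner_zero_left, sub_eq_zero] at h1
      rw [inner_zero_right]
      exact h1.symm
  · rintro ⟨h1, h2⟩ a b hab
    obtain ⟨h3, h4⟩ := (mem_graph_blockOp e s t T).1 (LinearPMap.le_graph_of_le hle hab)
    have e1 := hasSum_inner_coord e b u
    have e2 := hasSum_inner_coord e a v
    rw [← ht.hasSum_iff (fun i hi => by rw [h4 i hi, inner_zero_left])] at e1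
    rw [← hs.hasSum_iff (fun i hi => by rw [h2 i hi, inner_zero_right])] at e2
    rw [sub_eq_zero]
    refine e1.unique (e2.congr_fun fun c => ?_)
    simp only [Function.comp_apply]
    rw [h1 c, h3 c, ContinuousLinearMap.adjoint_inner_right]

lemma blockOp_bsingle_mem_domain (hs : Function.Injective s) (ht : Function.Injective t) (i : ι)
    (h : G i) : bsingle e i h ∈ (blockOp e s t T).domain := by
  by_cases hi : i ∈ Set.range s
  · obtain ⟨a, rfl⟩ := hi
    exact LinearPMap.mem_domain_of_mem_graph (bsingle_mem_graph_blockOp e hs ht a h)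
  · exact LinearPMap.mem_domain_of_mem_graph (bsingle_mem_graph_blockOp_zero e hi h)

lemma blockOp_dense (hs : Function.Injective s) (ht : Function.Injective t) :
    Dense ((blockOp e s t T).domain : Set H) :=
  dense_of_bsingle_mem e (blockOp_bsingle_mem_domain e hs ht)

lemma blockOp_adjoint (hs : Function.Injective s) (ht : Function.Injective t) :
    (blockOp e s t T).adjoint = blockOp e t s (fun a => (T a).adjoint) :=
  adjoint_eq_blockOp e hs ht le_rfl (blockOp_bsingle_mem_domain e hs ht)

lemma blockOp_hasCore (hs : Function.Injective s) (ht : Function.Injective t)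
    {D : Submodule ℂ H} (hD : D ≤ (blockOp e s t T).domain) (h : ∀ i g, bsingle e i g ∈ D) :
    (blockOp e s t T).HasCore D :=
  ⟨hD, closure_eq_blockOp e hs ht LinearPMap.domRestrict_le
    fun i g => ⟨h i g, hD (h i g)⟩⟩

end

/-- The maximal diagonal operator. -/
def diagOp (C : ∀ i, G i →L[ℂ] G i) : H →ₗ.[ℂ] H := blockOp e id id C

lemma mem_graph_diagOp {C : ∀ i, G i →L[ℂ] G i} {x y : H} :
    (x, y) ∈ (diagOp e C).graph ↔ ∀ i, e y i = C i (e x i) := by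
  rw [diagOp, mem_graph_blockOp]
  simp

lemma mem_kernel_diagOp [CompleteSpace H] {C : ∀ i, G i →L[ℂ] G i} {x : H} :
    x ∈ kernel (diagOp e C) ↔ ∀ i, C i (e x i) = 0 := by
  rw [mem_kernel_iff, mem_graph_diagOp]
  simp [eq_comm]

lemma smul_diagOp {C : ∀ i, G i →L[ℂ] G i} {c : ℂ} (hc : c ≠ 0) :
    c • diagOp e C = diagOp e (fun i => c • C i) := by
  apply pmap_ext
  intro x y
  rw [mem_graph_smul]
  simp only [mem_graph_diagOp]
  constructor
  · rintro ⟨v, hv, rfl⟩ i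
    simp [hv i]
  · intro h
    refine ⟨c⁻¹ • y, fun i => ?_, by rw [smul_inv_smul₀ hc]⟩
    rw [coord_smul, h i, _root_.smul_apply, inv_smul_smul₀ hc]

lemma diagOp_sub_smul_pone {C : ∀ i, G i →L[ℂ] G i} {c : ℂ} :
    diagOp e C - c • (pone : H →ₗ.[ℂ] H) =
      diagOp e (fun i => C i - c • ContinuousLinearMap.id ℂ (G i)) := by
  apply pmap_ext
  intro x y
  simp only [mem_graph_sub, mem_graph_smul, mem_graph_pone, mem_graph_diagOp]
  constructor
  · rintro ⟨v, _, hv, ⟨_, rfl, rfl⟩, rfl⟩ i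
    rw [coord_sub, coord_smul, hv i]
    simp
  · intro h
    refine ⟨y + c • x, c • x, fun i => ?_, ⟨x, rfl, rfl⟩, by abel⟩
    rw [coord_add, coord_smul, h i]
    simp

section Complete

variable [∀ i, CompleteSpace (G i)]

/-- The issue is the domain. If the diagonal operator maps `x` to a vector `w`, then ∑ ‖T a (x (s
a))‖² is part of the convergent series for ⟪x, w⟫, so the intermediate family is square summable and
the product is defined at `x`. -/
lemma pcomp_swap_self {T : ∀ a, G (s a) →L[ℂ] G (t a)} (hs : Function.Injective s)
    (ht : Function.Injective t) {C : ∀ i, G i →L[ℂ] G i}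
    (hC : ∀ a x, C (s a) x = (T a).adjoint (T a x))
    (hC0 : ∀ i, i ∉ Set.range s → ∀ x, C i x = 0) :
    pcomp (blockOp e t s (fun a => (T a).adjoint)) (blockOp e s t T) = diagOp e C := by
  apply pmap_ext
  intro x w
  rw [mem_graph_pcomp, mem_graph_diagOp]
  simp only [mem_graph_blockOp]
  constructor
  · rintro ⟨y, ⟨h1, -⟩, h3, h4⟩ i
    by_cases hi : i ∈ Set.range s
    · obtain ⟨a, rfl⟩ := hi
      rw [h3, h1, hC]
    · rw [h4 i hi, hC0 i hi]
  · intro hw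
    classical
    -- The intermediate vector. Its component at `t a` is the image under `T a`, transported along
    -- an equality of indices; injectivity of `t` makes the choice of the edge irrelevant.
    let f : ∀ i, G i := fun i =>
      if h : ∃ a, t a = i then h.choose_spec ▸ T h.choose (e x (s h.choose)) else 0
    have hf : ∀ a, f (t a) = T a (e x (s a)) := by
      intro a
      have hex : ∃ b, t b = t a := ⟨a, rfl⟩
      have key : ∀ b (hb : t b = t a), (hb ▸ T b (e x (s b)) : G (t a)) = T a (e x (s a)) := by
        intro b hb
        have := ht hb
        subst this
        rfl
      simp only [f, dif_pos hex]
      exact key _ hex.choose_spec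
    have hf0 : ∀ i, i ∉ Set.range t → f i = 0 := by
      intro i hi
      have : ¬∃ a, t a = i := hi
      simp only [f, dif_neg this]
    have hmem : Memℓp f 2 := by
      rw [memℓp_gen_iff (by simp)]
      rw [← ht.summable_iff (fun i hi => by rw [hf0 i hi]; simp)]
      have h1 := (lp.summable_inner (𝕜 := ℂ) (e x) (e w))
      have hs' : Summable fun i => (⟪e x i, C i (e x i)⟫_ℂ).re := by
        simp only [hw] at h1
        exact (Complex.hasSum_re h1.hasSum).summable
      refine (hs'.comp_injective hs).congr fun a => ?_
      simp only [Function.comp_apply, hf, hC]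
      rw [ContinuousLinearMap.adjoint_inner_right, inner_self_eq_norm_sq_to_K]
      simp [← Complex.ofReal_pow]
    refine ⟨e.symm ⟨f, hmem⟩, ⟨fun a => ?_, fun i hi => ?_⟩, fun a => ?_, fun i hi => ?_⟩
    · rw [e.apply_symm_apply]; exact hf a
    · rw [e.apply_symm_apply]; exact hf0 i hi
    · rw [e.apply_symm_apply, hw, hC]
      congr 1
      exact (hf a).symm
    · rw [hw, hC0 i hi]

end Complete

section Sub

/-- The vectors whose components vanish outside `P`. -/
def sub (P : Set ι) : Submodule ℂ H where
  carrier := {x | ∀ i, i ∉ P → e x i = 0}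
  zero_mem' := by simp
  add_mem' := fun hx hy i hi => by rw [coord_add, hx i hi, hy i hi, add_zero]
  smul_mem' := fun c x hx i hi => by rw [coord_smul, hx i hi, smul_zero]

lemma mem_sub {P : Set ι} {x : H} : x ∈ sub e P ↔ ∀ i, i ∉ P → e x i = 0 := Iff.rfl

lemma sub_isClosed (P : Set ι) : IsClosed (sub e P : Set H) := by
  have : (sub e P : Set H) = ⋂ i, ⋂ (_ : i ∉ P), {x | e x i = 0} := by
    ext x
    simp [mem_sub]
  rw [this]
  exact isClosed_iInter fun i => isClosed_iInter fun _ =>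
    isClosed_eq (continuous_coord e _) continuous_const

open Classical in
/-- The component of a vector in `sub e P`. -/
def subProj (P : Set ι) (x : H) : H :=
  e.symm ⟨fun i => if i ∈ P then e x i else 0,
    (lp.memℓp (e x)).mono' fun i => by split_ifs <;> simp⟩

lemma coord_subProj_of_mem {P : Set ι} {i : ι} (hi : i ∈ P) (x : H) :
    e (subProj e P x) i = e x i := by
  rw [subProj, e.apply_symm_apply]
  exact if_pos hi

lemma coord_subProj_of_notMem {P : Set ι} {i : ι} (hi : i ∉ P) (x : H) :
    e (subProj e P x) i = 0 := by
  rw [subProj, e.apply_symm_apply]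
  exact if_neg hi

lemma subProj_mem (P : Set ι) (x : H) : subProj e P x ∈ sub e P :=
  fun _ hi => coord_subProj_of_notMem e hi x

lemma sub_orthogonal (P : Set ι) : (sub e P)ᗮ = sub e Pᶜ := by
  classical
  ext x
  rw [Submodule.mem_orthogonal]
  constructor
  · intro h i hi
    have hi' : i ∈ P := by simpa using hi
    refine ext_inner_left ℂ fun g => ?_
    rw [← inner_bsingle, inner_zero_right]
    exact h _ fun j hj => coord_bsingle_ne e (by rintro rfl; exact hj hi') g
  · intro h u hu
    have h1 := hasSum_inner_coord e u x
    refine h1.unique ?_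
    convert hasSum_zero with i
    by_cases hi : i ∈ P
    · rw [h i (by simpa using hi), inner_zero_right]
    · rw [hu i hi, inner_zero_left]

lemma sub_subProj_mem (P : Set ι) (x : H) : x - subProj e P x ∈ (sub e P)ᗮ := by
  rw [sub_orthogonal]
  intro i hi
  rw [coord_sub, coord_subProj_of_mem e (by simpa using hi), sub_self]

lemma reduces_blockOp {T : ∀ a, G (s a) →L[ℂ] G (t a)} {P : Set ι}
    (hP : ∀ a, s a ∈ P ↔ t a ∈ P) : Reduces (sub e P) (blockOp e s t T) := by
  refine ⟨sub_isClosed e P, fun x y h => ⟨subProj e P x, subProj_mem e P x, subProj e P y,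
    subProj_mem e P y, sub_subProj_mem e P x, sub_subProj_mem e P y, ?_⟩⟩
  rw [mem_graph_blockOp] at h ⊢
  refine ⟨fun a => ?_, fun i hi => ?_⟩
  · by_cases ha : s a ∈ P
    · rw [coord_subProj_of_mem e ha, coord_subProj_of_mem e ((hP a).1 ha), h.1]
    · rw [coord_subProj_of_notMem e ha, coord_subProj_of_notMem e (fun h' => ha ((hP a).2 h')),
        map_zero]
  · by_cases ha : i ∈ P
    · rw [coord_subProj_of_mem e ha, h.2 i hi]
    · rw [coord_subProj_of_notMem e ha]

lemma sub_memℓp (P : Set ι) (x : H) : Memℓp (fun i : P => e x i) 2 := by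
  have h := lp.memℓp (e x)
  rw [memℓp_gen_iff (by simp)] at h ⊢
  exact h.comp_injective Subtype.val_injective

/-- The Hilbert sum of the components in `P`. -/
def subEquiv (P : Set ι) : sub e P ≃ₗᵢ[ℂ] lp (fun i : P => G i) 2 :=
  LinearIsometryEquiv.ofSurjective
    { toFun := fun x => ⟨fun i : P => e x i, sub_memℓp e P x⟩
      map_add' := fun x y => by
        ext i
        change e (((x + y : sub e P)) : H) i = e (x : H) i + e (y : H) i
        rw [← coord_add]
        rfl
      map_smul' := fun c x => by
        ext i
        change e ((c • x : sub e P) : H) i = c • e (x : H) i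
        rw [← coord_smul]
        rfl
      norm_map' := fun x => by
        have h1 := lp.norm_rpow_eq_tsum (p := 2) (by simp) (e (x : H))
        have h2 := lp.norm_rpow_eq_tsum (p := 2) (by simp)
          (⟨fun i : P => e x i, sub_memℓp e P x⟩ : lp (fun i : P => G i) 2)
        have h3 : ∑' i : P, ‖e (x : H) i‖ ^ (2 : ℝ≥0∞).toReal =
            ∑' i, ‖e (x : H) i‖ ^ (2 : ℝ≥0∞).toReal := by
          refine tsum_subtype_eq_of_support_subset
            (f := fun i => ‖e (x : H) i‖ ^ (2 : ℝ≥0∞).toReal) fun i hi => ?_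
          by_contra hiP
          exact hi (by simp [x.2 i hiP])
        have h4 := h2.trans (h3.trans h1.symm)
        rw [e.norm_map] at h4
        exact Real.rpow_left_injOn (x := (2 : ℝ≥0∞).toReal) (by simp) (norm_nonneg _)
          (norm_nonneg _) h4 }
    (fun f => by
      classical
      have hm : Memℓp (fun i => if h : i ∈ P then f ⟨i, h⟩ else 0) 2 := by
        have h := lp.memℓp f
        rw [memℓp_gen_iff (by simp)] at h ⊢
        rw [← Subtype.val_injective.summable_iff (f := fun i => ‖(if h : i ∈ P then f ⟨i, h⟩ else 0 : G i)‖ ^ (2 : ℝ≥0∞).toReal) (g := ((↑) : P → ι))]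
        · refine h.congr fun i => ?_
          simp
        · intro i hi
          have : i ∉ P := fun h => hi ⟨⟨i, h⟩, rfl⟩
          simp [this]
      refine ⟨⟨e.symm ⟨_, hm⟩, fun i hi => ?_⟩, ?_⟩
      · rw [e.apply_symm_apply]
        exact dif_neg hi
      · ext i
        change e (e.symm ⟨_, hm⟩) i = _
        rw [e.apply_symm_apply]
        exact dif_pos i.2)

lemma subEquiv_apply (P : Set ι) (x : sub e P) (i : P) : subEquiv e P x i = e (x : H) i := rfl

/-- No edge joins `P` to its complement, so the restriction is again an operator of the same kind
and all the results on block operators apply to it. -/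
lemma restrict_blockOp {T : ∀ a, G (s a) →L[ℂ] G (t a)} {P : Set ι}
    (hP : ∀ a, s a ∈ P ↔ t a ∈ P) :
    restrict (blockOp e s t T) (sub e P) =
      blockOp (G := fun i : P => G i) (subEquiv e P)
        (fun a : {a // s a ∈ P} => ⟨s a, a.2⟩) (fun a => ⟨t a, (hP a).1 a.2⟩) (fun a => T a) := by
  apply pmap_ext
  intro x y
  rw [mem_graph_restrict, mem_graph_blockOp, mem_graph_blockOp]
  simp only [subEquiv_apply]
  constructor
  · rintro ⟨h1, h2⟩
    refine ⟨fun a => h1 a, fun i hi => h2 i ?_⟩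
    rintro ⟨a, ha⟩
    exact hi ⟨⟨a, (hP a).2 (ha ▸ i.2)⟩, Subtype.ext ha⟩
  · rintro ⟨h1, h2⟩
    refine ⟨fun a => ?_, fun i hi => ?_⟩
    · by_cases ha : s a ∈ P
      · exact h1 ⟨a, ha⟩
      · rw [x.2 _ ha, y.2 _ (fun h => ha ((hP a).2 h)), map_zero]
    · by_cases hiP : i ∈ P
      · refine h2 ⟨i, hiP⟩ ?_
        rintro ⟨a, ha⟩
        exact hi ⟨a, congrArg Subtype.val ha⟩
      · exact y.2 _ hiP

end Sub

end Block

/-! ### Direct sums of projection-valued measures -/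

section DirectSum

set_option linter.unusedSectionVars false

variable {ι : Type} {G : ι → Type u} [∀ i, NormedAddCommGroup (G i)]
  [∀ i, InnerProductSpace ℂ (G i)] [∀ i, CompleteSpace (G i)] (F : ∀ i, PVM (G i))

lemma PVM.norm_proj_le {H : Type u} [NormedAddCommGroup H] [InnerProductSpace ℂ H]
    [CompleteSpace H] (E : PVM H) {S : Set ℝ} (hS : MeasurableSet S) (x : H) :
    ‖E.proj S x‖ ≤ ‖x‖ := by
  have h1 := E.inner_proj_self hS x
  have h2 : ‖E.proj S x‖ ^ 2 ≤ ‖x‖ * ‖E.proj S x‖ := by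
    have := norm_inner_le_norm (𝕜 := ℂ) x (E.proj S x)
    rwa [h1, Complex.norm_real, Real.norm_of_nonneg (by positivity)] at this
  nlinarith [norm_nonneg (E.proj S x), norm_nonneg x]

/-- The direct sum of projections. -/
def sumProj (S : Set ℝ) (hS : MeasurableSet S) : lp G 2 →L[ℂ] lp G 2 :=
  LinearMap.mkContinuous
    { toFun := fun f => ⟨fun i => (F i).proj S (f i),
        (lp.memℓp f).mono' fun i => (F i).norm_proj_le hS _⟩
      map_add' := fun f g => lp.ext (funext fun i => map_add ((F i).proj S) (f i) (g i))
      map_smul' := fun c f => lp.ext (funext fun i => map_smul ((F i).proj S) c (f i)) } 1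
    (fun f => by
      rw [one_mul]
      exact lp.norm_mono (by simp) fun i => (F i).norm_proj_le hS _)

lemma sumProj_apply (S : Set ℝ) (hS : MeasurableSet S) (f : lp G 2) (i : ι) :
    sumProj F S hS f i = (F i).proj S (f i) := rfl

/-- Dominated convergence for the series of squared coordinate errors, with the squared norms of the
coordinates of `x` as the majorant. -/
lemma hasSum_lp_of_coord {f : ℕ → lp G 2} {g x : lp G 2}
    (h : ∀ i, HasSum (fun m => f m i) (g i))
    (hb : ∀ (s : Finset ℕ) i, ‖g i - ∑ m ∈ s, f m i‖ ≤ ‖x i‖) : HasSum f g := by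
  have key : ∀ s : Finset ℕ, ‖g - ∑ m ∈ s, f m‖ ^ 2 = ∑' i, ‖g i - ∑ m ∈ s, f m i‖ ^ 2 := by
    intro s
    have := lp.norm_rpow_eq_tsum (p := 2) (by simp) (g - ∑ m ∈ s, f m)
    simp only [ENNReal.toReal_ofNat, Real.rpow_ofNat] at this
    rw [this]
    refine tsum_congr fun i => ?_
    rw [lp.coeFn_sub, Pi.sub_apply, lp.coeFn_sum, Finset.sum_apply]
  have hx : Summable fun i => ‖x i‖ ^ 2 := by
    have := lp.memℓp x
    rw [memℓp_gen_iff (by simp)] at this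
    simpa using this
  have ht : Tendsto (fun s : Finset ℕ => ∑' i, ‖g i - ∑ m ∈ s, f m i‖ ^ 2) atTop
      (𝓝 (∑' _ : ι, (0 : ℝ))) := by
    refine tendsto_tsum_of_dominated_convergence hx (fun i => ?_) (Eventually.of_forall ?_)
    · have h1 := h i
      rw [HasSum, SummationFilter.unconditional_filter] at h1
      have h2 := (h1.const_sub (g i)).norm.pow 2
      simpa using h2
    · intro s i
      rw [Real.norm_of_nonneg (by positivity)]
      exact pow_le_pow_left₀ (norm_nonneg _) (hb s i) 2
  rw [HasSum, SummationFilter.unconditional_filter, tendsto_iff_norm_sub_tendsto_zero]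
  have h3 := (ht.congr fun s => (key s).symm).sqrt
  simp only [tsum_zero, Real.sqrt_zero] at h3
  refine h3.congr fun s => ?_
  rw [Real.sqrt_sq (norm_nonneg _), norm_sub_rev]

open Classical in
/-- The direct sum of projection-valued measures. -/
def sumPVM : PVM (lp G 2) where
  proj S := if hS : MeasurableSet S then sumProj F S hS else 0
  isStarProjection S hS := by
    rw [dif_pos hS]
    refine ⟨?_, ?_⟩
    · refine ContinuousLinearMap.ext fun f => lp.ext (funext fun i => ?_)
      exact congrArg (· (f i)) ((F i).isStarProjection S hS).isIdempotentElem
    · rw [ContinuousLinearMap.isSelfAdjoint_iff_isSymmetric]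
      intro f g
      change ⟪sumProj F S hS f, g⟫_ℂ = ⟪f, sumProj F S hS g⟫_ℂ
      rw [lp.inner_eq_tsum, lp.inner_eq_tsum]
      refine tsum_congr fun i => ?_
      exact PVM.inner_proj_comm hS _ _
  univ := by
    rw [dif_pos MeasurableSet.univ]
    refine ContinuousLinearMap.ext fun f => lp.ext (funext fun i => ?_)
    exact congrArg (· (f i)) (F i).univ
  inter S T hS hT := by
    rw [dif_pos hS, dif_pos hT, dif_pos (hS.inter hT)]
    refine ContinuousLinearMap.ext fun f => lp.ext (funext fun i => ?_)
    exact congrArg (· (f i)) ((F i).inter S T hS hT)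
  hasSum_iUnion S hS hd f := by
    have hU := MeasurableSet.iUnion hS
    simp only [dif_pos (hS _), dif_pos hU]
    refine hasSum_lp_of_coord (x := f) (fun i => (F i).hasSum_iUnion S hS hd (f i)) ?_
    intro s i
    simp only [sumProj_apply]
    have hsF : MeasurableSet (⋃ m ∈ s, S m) := Finset.measurableSet_biUnion _ fun m _ => hS m
    have h1 : ∀ s : Finset ℕ, (F i).proj (⋃ m ∈ s, S m) (f i) = ∑ m ∈ s, (F i).proj (S m) (f i) := by
      intro s
      induction s using Finset.induction_on with
      | empty => simp [(F i).proj_empty]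
      | insert a s ha ih =>
        rw [Finset.set_biUnion_insert, Finset.sum_insert ha, ← ih]
        refine (F i).proj_union (hS a) (Finset.measurableSet_biUnion _ fun m _ => hS m) ?_ _
        rw [Set.disjoint_iUnion₂_right]
        intro m hm
        exact hd (by rintro rfl; exact ha hm)
    have h2 := (F i).proj_union hsF (hU.diff hsF) Set.disjoint_sdiff_right (f i)
    rw [Set.union_sdiff_cancel (Set.iUnion₂_subset fun i _ => Set.subset_iUnion S i)] at h2
    rw [h2, ← h1, add_sub_cancel_left]
    exact (F i).norm_proj_le (hU.diff hsF) _

lemma sumPVM_proj {S : Set ℝ} (hS : MeasurableSet S) (f : lp G 2) (i : ι) :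
    (sumPVM F).proj S f i = (F i).proj S (f i) := by
  classical
  change (if hS : MeasurableSet S then sumProj F S hS else 0) f i = _
  rw [dif_pos hS]
  rfl

lemma sumPVM_measure (f : lp G 2) :
    (sumPVM F).measure f = Measure.sum fun i => (F i).measure (f i) := by
  ext S hS
  rw [Measure.sum_apply _ hS, PVM.measure_apply _ _ hS]
  simp only [PVM.measure_apply _ _ hS]
  have := lp.norm_rpow_eq_tsum (p := 2) (by simp) ((sumPVM F).proj S f)
  simp only [ENNReal.toReal_ofNat, Real.rpow_ofNat] at this
  rw [this, ENNReal.ofReal_tsum_of_nonneg (fun _ => by positivity)]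
  · simp only [sumPVM_proj F hS]
  · have := lp.memℓp ((sumPVM F).proj S f)
    rw [memℓp_gen_iff (by simp)] at this
    simpa using this

variable {F}

/-- The scalar measure of `f` is the sum of those of its components, so square summability of the
values `g i` puts `f` in the domain; the value is then identified coordinate by coordinate. -/
lemma sumPVM_hasInt {h : ℝ → ℂ} (hh : Measurable h) {f g : lp G 2} :
    (sumPVM F).HasInt h f g ↔ ∀ i, (F i).HasInt h (f i) (g i) := by
  have hcoord : ∀ {f g : lp G 2}, (sumPVM F).HasInt h f g → ∀ i, (F i).HasInt h (f i) (g i) := by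
    intro f g hfg i
    exact hfg.of_commute (L := coord (LinearIsometryEquiv.refl ℂ (lp G 2)) i)
      (fun S hS x => (sumPVM_proj F hS x i).symm) hh
  refine ⟨hcoord, fun H => ?_⟩
  have hmem : f ∈ (sumPVM F).integralDomain h := by
    change ∫⁻ t, ‖h t‖ₑ ^ 2 ∂(sumPVM F).measure f < ∞
    rw [sumPVM_measure, lintegral_sum_measure]
    have h1 : ∀ i, ∫⁻ t, ‖h t‖ₑ ^ 2 ∂(F i).measure (f i) = ENNReal.ofReal (‖g i‖ ^ 2) := by
      intro i
      have h2 := (H i).enorm_eq hh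
      rw [PVM.eLpNorm_two_eq] at h2
      rw [ENNReal.ofReal_pow (norm_nonneg _), ofReal_norm, h2, ← ENNReal.rpow_natCast,
        ← ENNReal.rpow_mul]
      simp
    simp only [h1]
    rw [← ENNReal.ofReal_tsum_of_nonneg (fun _ => by positivity)]
    · exact ENNReal.ofReal_lt_top
    · have := lp.memℓp g
      rw [memℓp_gen_iff (by simp)] at this
      simpa using this
  obtain ⟨g', hg'⟩ := PVM.exists_hasInt hh hmem
  have : g' = g := lp.ext (funext fun i => (hcoord hg' i).unique hh (H i))
  rwa [← this]

end DirectSum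

/-! Functional calculus for contractions with spectrum in `[a, 1]`. -/

section Positive

variable {H : Type u} [NormedAddCommGroup H] [InnerProductSpace ℂ H] [CompleteSpace H]
variable {F : PVM H} {A : H →L[ℂ] H}

lemma PVM.ae_mem {S : Set ℝ} (hS : MeasurableSet S) {x : H} (hx : F.proj S x = x) :
    ∀ᵐ t ∂F.measure x, t ∈ S := by
  have h1 := F.proj_union hS hS.compl disjoint_compl_right x
  rw [Set.union_compl_self, F.univ, hx] at h1
  have h2 : F.proj Sᶜ x = 0 := by
    have : x + F.proj Sᶜ x = x := h1.symm
    simpa using this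
  change F.measure x Sᶜ = 0
  rw [F.measure_apply _ hS.compl, h2]
  simp

/-- Truncation of the identity function to `[a, 1]`. -/
def clamp (a t : ℝ) : ℝ := max a (min t 1)

lemma measurable_clamp (a : ℝ) : Measurable (clamp a) := by unfold clamp; fun_prop

lemma clamp_bound (a : ℝ) : ∃ C, ∀ t, ‖clamp a t‖ ≤ C := by
  refine ⟨max |a| 1, fun t => ?_⟩
  rw [Real.norm_eq_abs, clamp, abs_le]
  constructor
  · have := neg_abs_le a
    have h2 := le_max_left |a| 1
    have h3 := le_max_left a (min t 1)
    linarith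
  · exact max_le ((le_abs_self a).trans (le_max_left _ _)) ((min_le_right _ _).trans (le_max_right _ _))

lemma clamp_of_mem {a t : ℝ} (ht : t ∈ Set.Icc a 1) : clamp a t = t := by
  rw [clamp, min_eq_left ht.2, max_eq_right ht.1]

lemma le_clamp (a t : ℝ) : a ≤ clamp a t := le_max_left _ _

variable (hA : ∀ x, F.HasInt (fun t => (t : ℂ)) x (A x)) {a : ℝ} (hF : F.proj (Set.Icc a 1) = 1)

include hF in
lemma ae_mem_Icc (x : H) : ∀ᵐ t ∂F.measure x, t ∈ Set.Icc a 1 :=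
  PVM.ae_mem measurableSet_Icc (by rw [hF]; rfl)

include hA hF in
lemma rint_clamp (x : H) : F.rint (clamp a) (measurable_clamp a) (clamp_bound a) x = A x := by
  refine PVM.bint_eq _ _ ((hA x).congr_ae ?_)
  filter_upwards [ae_mem_Icc hF x] with t ht
  rw [clamp_of_mem ht]

include hA hF in
lemma hasInt_sq (x : H) : F.HasInt (fun t => ((t ^ 2 : ℝ) : ℂ)) x (A (A x)) := by
  obtain ⟨C, hC⟩ := clamp_bound a
  have hb : ∃ C, ∀ t, ‖clamp a t ^ 2‖ ≤ C := ⟨C ^ 2, fun t => by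
    rw [norm_pow]; exact pow_le_pow_left₀ (norm_nonneg _) (hC t) 2⟩
  have h := PVM.rint_rint_self (E := F) (measurable_clamp a) ⟨C, hC⟩ hb x
  rw [rint_clamp hA hF, rint_clamp hA hF] at h
  rw [h]
  refine (PVM.hasInt_rint ((measurable_clamp a).pow_const 2) hb x).congr_ae ?_
  filter_upwards [ae_mem_Icc hF x] with t ht
  rw [clamp_of_mem ht]

include hA in
lemma proj_commute_of_hasInt {S : Set ℝ} (hS : MeasurableSet S) (x : H) :
    F.proj S (A x) = A (F.proj S x) :=
  ((hA x).proj Complex.measurable_ofReal hS).unique Complex.measurable_ofReal (hA _)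

-- Clamping makes the reciprocal bounded by a⁻¹ on the whole line without changing anything almost
-- everywhere, so the inverse is the integral of a bounded function.
include hA hF in
lemma exists_inverse (ha : 0 < a) :
    ∃ B : H →L[ℂ] H, (∀ x, A (B x) = x) ∧ (∀ x, B (A x) = x) ∧
      ∀ x, F.HasInt (fun t => ((t⁻¹ : ℝ) : ℂ)) x (B x) := by
  have hm : Measurable fun t => (clamp a t)⁻¹ := (measurable_clamp a).inv
  have hb : ∃ C, ∀ t, ‖(clamp a t)⁻¹‖ ≤ C := ⟨a⁻¹, fun t => by
    have := le_clamp a t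
    rw [norm_inv, Real.norm_of_nonneg (ha.le.trans this)]
    exact inv_anti₀ ha this⟩
  have h1 : ∀ t, clamp a t * (clamp a t)⁻¹ = 1 := fun t =>
    mul_inv_cancel₀ (ha.trans_le (le_clamp a t)).ne'
  have hb1 : ∃ C, ∀ t, ‖clamp a t * (clamp a t)⁻¹‖ ≤ C := ⟨1, fun t => by rw [h1]; simp⟩
  have key : ∀ x, A (F.rint _ hm hb x) = x := by
    intro x
    rw [← rint_clamp hA hF, PVM.rint_mul (measurable_clamp a) (clamp_bound a) hm hb hb1]
    refine PVM.bint_eq _ _ ?_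
    have h2 := PVM.hasInt_indicator (E := F) MeasurableSet.univ x
    rw [F.univ] at h2
    refine h2.congr_ae (Eventually.of_forall fun t => ?_)
    simp [h1]
  refine ⟨F.rint _ hm hb, key, fun x => ?_, fun x => ?_⟩
  · conv_rhs => rw [← key x]
    rw [← rint_clamp hA hF, ← rint_clamp hA hF]
    exact (PVM.bint_comm _ _ _ _ x).symm
  · refine (PVM.hasInt_rint hm hb x).congr_ae ?_
    filter_upwards [ae_mem_Icc hF x] with t ht
    rw [clamp_of_mem ht]

end Positive

/-! ### Multi-indices, levels and weights -/

section Indices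

variable {n : ℕ} {q : ℝ}

/-- The sum `i_l + i_{l+1} + ⋯` of the entries of a multi-index from position `l` on. -/
def tailSum (l : ℕ) (i : Fin n → ℤ) : ℤ := ∑ m ∈ Finset.univ.filter (fun m : Fin n => l ≤ (m : ℕ)), i m

lemma tailSum_eq (j : Fin n) (i : Fin n → ℤ) : tailSum j i = i j + tailSum (j + 1) i := by
  have : (Finset.univ.filter fun m : Fin n => (j : ℕ) ≤ m) =
      insert j (Finset.univ.filter fun m : Fin n => (j : ℕ) + 1 ≤ m) := by
    ext m
    simp only [Finset.mem_filter, Finset.mem_univ, true_and, Finset.mem_insert, Fin.ext_iff]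
    omega
  rw [tailSum, this, Finset.sum_insert (by simp), tailSum]

lemma tailSum_Ioi (j : Fin n) (i : Fin n → ℤ) : tailSum (j + 1) i = ∑ l ∈ Finset.Ioi j, i l := by
  refine Finset.sum_congr ?_ fun _ _ => rfl
  ext m
  simp only [Finset.mem_filter, Finset.mem_univ, true_and, Finset.mem_Ioi, Fin.lt_def]
  omega

lemma tailSum_add_single (l : ℕ) (i : Fin n → ℤ) (j : Fin n) :
    tailSum l (i + Pi.single j 1) = tailSum l i + if l ≤ (j : ℕ) then 1 else 0 := by
  simp only [tailSum, Pi.add_apply, Finset.sum_add_distrib]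
  congr 1
  simp

/-- The action of `z_j` on the indices of the summands. -/
abbrev shiftIdx (j : Fin n) (p : Index n) : Index n := ⟨p.1, shift j p.2⟩

lemma shift_val {j : Fin n} {k : Fin (n + 1)} (h : (j : ℕ) < k) (i : MultiIndex n k) :
    (shift j i).1 = i.1 + Pi.single j 1 := by
  rw [shift, dif_pos (by omega)]

lemma shift_of_le {j : Fin n} {k : Fin (n + 1)} (h : (k : ℕ) ≤ j) (i : MultiIndex n k) :
    shift j i = i := by
  rw [shift, dif_neg (by omega)]

lemma shift_injective (j : Fin n) {k : Fin (n + 1)} :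
    Function.Injective (shift j : MultiIndex n k → MultiIndex n k) := by
  intro i i' h
  rcases lt_or_ge (j : ℕ) k with hj | hj
  · have := congrArg Subtype.val h
    rw [shift_val hj, shift_val hj] at this
    exact Subtype.ext (add_right_cancel this)
  · rwa [shift_of_le hj, shift_of_le hj] at h

lemma shiftIdx_injective (j : Fin n) : Function.Injective (shiftIdx (n := n) j) := by
  rintro ⟨k, i⟩ ⟨k', i'⟩ h
  obtain rfl : k = k' := congrArg Sigma.fst h
  have : shift j i = shift j i' := eq_of_heq (Sigma.mk.inj h).2
  rw [shift_injective j this]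

lemma shift_comm (i j : Fin n) {k : Fin (n + 1)} (p : MultiIndex n k) :
    shift i (shift j p) = shift j (shift i p) := by
  rcases lt_or_ge (i : ℕ) k with hi | hi
  · rcases lt_or_ge (j : ℕ) k with hj | hj
    · apply Subtype.ext
      rw [shift_val hi, shift_val hj, shift_val hj, shift_val hi, add_right_comm]
    · rw [shift_of_le hj, shift_of_le hj]
  · rw [shift_of_le hi, shift_of_le hi]

/-- A multi-index is of the form `shift j i` unless `i_j = 1` and `j < k`. -/
lemma mem_range_shift {j : Fin n} {k : Fin (n + 1)} (i : MultiIndex n k)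
    (h : (j : ℕ) + 1 < k → 2 ≤ i.1 j) : ∃ i', shift j i' = i := by
  rcases lt_or_ge (j : ℕ) k with hj | hj
  · refine ⟨⟨i.1 - Pi.single j 1, fun l => ⟨fun hl => ?_, fun hl => ?_⟩⟩, ?_⟩
    · have h1 := (i.2 l).1 hl
      by_cases hlj : l = j
      · subst hlj
        have := h hl
        simp only [Pi.sub_apply, Pi.single_eq_same]
        omega
      · simp [Pi.single_eq_of_ne hlj, h1]
    · have hlj : l ≠ j := by
        rintro rfl
        omega
      simp [(i.2 l).2 hl, Pi.single_eq_of_ne hlj]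
    · apply Subtype.ext
      rw [shift_val hj]
      simp
  · exact ⟨i, shift_of_le hj i⟩

lemma shift_apply_self {j : Fin n} {k : Fin (n + 1)} (h : (j : ℕ) < k) (i : MultiIndex n k) :
    (shift j i).1 j = i.1 j + 1 := by
  rw [shift_val h]
  simp

lemma shift_apply_ne {j l : Fin n} {k : Fin (n + 1)} (h : l ≠ j) (i : MultiIndex n k) :
    (shift j i).1 l = i.1 l := by
  rcases lt_or_ge (j : ℕ) k with hj | hj
  · rw [shift_val hj]
    simp [Pi.single_eq_of_ne h]
  · rw [shift_of_le hj]

lemma notMem_range_shiftIdx {j : Fin n} {p : Index n} (h : p ∉ Set.range (shiftIdx j)) :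
    (j : ℕ) + 1 < p.1 ∧ p.2.1 j = 1 := by
  by_contra h'
  refine h ?_
  obtain ⟨i', hi'⟩ := mem_range_shift (j := j) p.2 (fun hj => by
    have := (p.2.2 j).1 hj
    by_contra h2
    exact h' ⟨hj, by omega⟩)
  exact ⟨⟨p.1, i'⟩, by rw [shiftIdx, hi']⟩

/-- Membership in the range of the `i`-th shift depends on the `i`-th entry alone, which the `j`-th
shift leaves unchanged. -/
lemma mem_range_shiftIdx_shiftIdx {i j : Fin n} (hij : i ≠ j) {p : Index n} :
    shiftIdx j p ∈ Set.range (shiftIdx i) → p ∈ Set.range (shiftIdx i) := by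
  intro h
  by_contra hp
  obtain ⟨h1, h2⟩ := notMem_range_shiftIdx hp
  obtain ⟨⟨k, r⟩, hr⟩ := h
  obtain rfl : k = p.1 := congrArg Sigma.fst hr
  have hr2 : shift i r = shift j p.2 := eq_of_heq (Sigma.mk.inj hr).2
  have h3 := shift_apply_ne hij p.2
  rw [← hr2, shift_apply_self (by omega)] at h3
  have := (r.2 i).1 h1
  omega

/-- Induction over multi-indices. -/
lemma multiIndex_induction {k : Fin (n + 1)} {P : MultiIndex n k → Prop} {b : MultiIndex n k}
    (hb : ∀ l : Fin n, b.1 l = if (l : ℕ) + 1 < k then 1 else 0) (hP : P b)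
    (h : ∀ j : Fin n, (j : ℕ) < k → ∀ i, P i ↔ P (shift j i)) (i : MultiIndex n k) : P i := by
  -- Induction on the ℓ¹ distance to `b`. An entry that differs from that of `b` is moved towards it
  -- by a shift or by undoing one; undoing is possible because an entry bounded below exceeds its
  -- minimum 1 when it exceeds that of `b`.
  have key : ∀ N : ℕ, ∀ i : MultiIndex n k, ∑ l, (i.1 l - b.1 l).natAbs = N → P i := by
    intro N
    induction N with
    | zero =>
      intro i hi
      convert hP
      apply Subtype.ext
      funext l
      have := (Finset.sum_eq_zero_iff.1 hi) l (Finset.mem_univ _)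
      omega
    | succ N ih =>
      intro i hi
      obtain ⟨l, -, hl⟩ : ∃ l ∈ Finset.univ, (i.1 l - b.1 l).natAbs ≠ 0 := by
        by_contra! hcon
        rw [Finset.sum_eq_zero hcon] at hi
        omega
      have hlk : (l : ℕ) < k := by
        by_contra hlk
        have h1 := (i.2 l).2 (by omega)
        have h2 := hb l
        rw [if_neg (by omega)] at h2
        omega
      have hsum : ∀ r r' : MultiIndex n k, (∀ m, m ≠ l → r.1 m = r'.1 m) →
          (r.1 l - b.1 l).natAbs = (r'.1 l - b.1 l).natAbs + 1 →
          ∑ m, (r.1 m - b.1 m).natAbs = ∑ m, (r'.1 m - b.1 m).natAbs + 1 := by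
        intro r r' h1 h2
        rw [← Finset.add_sum_erase _ _ (Finset.mem_univ l),
          ← Finset.add_sum_erase _ (fun m => (r'.1 m - b.1 m).natAbs) (Finset.mem_univ l), h2,
          Finset.sum_congr rfl (fun m hm => by rw [h1 m (Finset.ne_of_mem_erase hm)])]
        omega
      rcases lt_or_gt_of_ne (show i.1 l ≠ b.1 l by omega) with hlt | hgt
      · rw [h l hlk]
        apply ih
        have := hsum i (shift l i) (fun m hm => (shift_apply_ne hm i).symm)
          (by rw [shift_apply_self hlk]; omega)
        omega
      · obtain ⟨i', rfl⟩ := mem_range_shift (j := l) i (fun hl' => by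
          have := hb l
          rw [if_pos hl'] at this
          omega)
        rw [← h l hlk]
        apply ih
        have := hsum (shift l i') i' (fun m hm => shift_apply_ne hm i')
          (by rw [shift_apply_self hlk] at hgt ⊢; omega)
        omega
  exact key _ i rfl

/-- The multi-index `(1, …, 1, 0)`. -/
def baseIndex (k : Fin (n + 1)) : MultiIndex n k :=
  ⟨fun l => if (l : ℕ) + 1 < k then 1 else 0, fun l => ⟨fun h => by simp [h], fun h =>
    if_neg (by omega)⟩⟩

/-- `Q_{l+1}` acts on the summand with index `p` as `level q l p` times the square of `A_k`. -/
def level (q : ℝ) (l : ℕ) (p : Index n) : ℝ :=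
  if l < (p.1 : ℕ) then q ^ (-2 * tailSum l p.2.1) else 0

lemma level_of_lt {l : ℕ} {p : Index n} (h : l < p.1) :
    level q l p = q ^ (-2 * tailSum l p.2.1) := if_pos h

lemma level_of_le {l : ℕ} {p : Index n} (h : (p.1 : ℕ) ≤ l) : level q l p = 0 :=
  if_neg (by omega)

lemma level_nonneg (hq : 0 < q) (l : ℕ) (p : Index n) : 0 ≤ level q l p := by
  unfold level
  split_ifs <;> positivity

lemma level_pos (hq : 0 < q) {l : ℕ} {p : Index n} (h : l < p.1) : 0 < level q l p := by
  rw [level_of_lt h]; positivity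

lemma level_shift_lt {j : Fin n} {l : ℕ} (h : (j : ℕ) < l) (p : Index n) :
    level q l (shiftIdx j p) = level q l p := by
  rcases lt_or_ge (j : ℕ) p.1 with hj | hj
  · simp only [level, shiftIdx, shift_val hj, tailSum_add_single, if_neg (not_le.2 h), add_zero]
  · simp only [shiftIdx, shift_of_le hj]

lemma level_shift_le (hq : 0 < q) {j : Fin n} {l : ℕ} (h : l ≤ j) {p : Index n}
    (hj : (j : ℕ) < p.1) : level q l p = q ^ 2 * level q l (shiftIdx j p) := by
  have hl : l < p.1 := by omega
  rw [level_of_lt hl, level_of_lt (show l < (shiftIdx j p).1 from hl)]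
  simp only [shiftIdx, shift_val hj, tailSum_add_single, if_pos h]
  rw [← zpow_natCast, ← zpow_add₀ hq.ne']
  congr 1
  push_cast
  ring

lemma weight_of_le {j : Fin n} {p : Index n} (h : (p.1 : ℕ) ≤ j) : weight q j p.2 = 0 := by
  rw [weight, if_neg (by omega), if_neg (by omega)]

lemma weight_shift_lt {i j : Fin n} (hij : i < j) (p : Index n) :
    weight q j (shiftIdx i p).2 = weight q j p.2 := by
  have h1 : (shift i p.2).1 j = p.2.1 j := shift_apply_ne hij.ne' _
  have h2 : ∑ l ∈ Finset.Ioi j, (shift i p.2).1 l = ∑ l ∈ Finset.Ioi j, p.2.1 l :=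
    Finset.sum_congr rfl fun l hl =>
      shift_apply_ne ((hij.trans (Finset.mem_Ioi.1 hl)).ne') _
  simp only [weight, shiftIdx, h1, h2]

lemma weight_shift_gt (hq : 0 < q) {i j : Fin n} (hij : i < j) {p : Index n}
    (hj : (j : ℕ) < p.1) : weight q i p.2 = q * weight q i (shiftIdx j p).2 := by
  have hi : (i : ℕ) + 1 < p.1 := by
    have := Fin.lt_def.1 hij
    omega
  have h1 : (shift j p.2).1 i = p.2.1 i := shift_apply_ne hij.ne _
  have h2 : ∑ l ∈ Finset.Ioi i, (shift j p.2).1 l = ∑ l ∈ Finset.Ioi i, p.2.1 l + 1 := by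
    rw [← tailSum_Ioi, ← tailSum_Ioi, shift_val hj, tailSum_add_single,
      if_pos (by have := Fin.lt_def.1 hij; omega)]
  simp only [weight, shiftIdx, h1, h2, if_pos hi]
  rw [neg_add, zpow_add₀ hq.ne', zpow_neg_one]
  field_simp

lemma zpow_neg_two_mul (a : ℤ) : q ^ (-2 * a) = (q ^ (-a)) ^ 2 := by
  rw [← zpow_natCast, ← zpow_mul]
  congr 1
  push_cast
  ring

lemma one_le_zpow_neg_two (hq : 0 < q) (hq1 : q < 1) {a : ℤ} (ha : 0 ≤ a) :
    1 ≤ q ^ (-2 * a) := by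
  rw [show -2 * a = -(2 * a) by ring, zpow_neg]
  exact (one_le_inv₀ (by positivity)).2 (zpow_le_one₀ hq hq1.le (by omega))

/-- The scalar form of z_j* z_j = Q_j - Q_{j+1}: the tail sums at `j` and `j + 1` differ by i_j, so
the difference of levels is (q^(-2 i_j) - 1) times the lower one. For `j` below the last position
i_j ≥ 1, so the square root in the weight is honest. -/
lemma weight_sq (hq : 0 < q) (hq1 : q < 1) (j : Fin n) (p : Index n) :
    weight q j p.2 ^ 2 = level q j p - level q (j + 1) p := by
  rcases lt_trichotomy ((j : ℕ) + 1) p.1 with h | h | h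
  · rw [weight, if_pos h, level_of_lt (by omega), level_of_lt h, tailSum_eq, mul_pow,
      Real.sq_sqrt, mul_add, zpow_add₀ hq.ne', ← tailSum_Ioi, ← zpow_neg_two_mul]
    · ring
    · have := (p.2.2 j).1 h
      exact sub_nonneg.2 (one_le_zpow_neg_two hq hq1 (by omega))
  · have h0 : tailSum ((j : ℕ) + 1) p.2.1 = 0 :=
      Finset.sum_eq_zero fun (l : Fin n) hl => (p.2.2 l).2 (by
        have := (Finset.mem_filter.1 hl).2
        omega)
    rw [weight, if_neg (by omega), if_pos h, level_of_lt (by omega), level_of_le (by omega),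
      tailSum_eq, h0, add_zero, zpow_neg_two_mul, sub_zero]
  · rw [weight_of_le (by omega), level_of_le (by omega), level_of_le (by omega)]
    ring

/-- The scalar form of z_j z_j* = q² Q_j - Q_{j+1}, read at the target of the shift: there the level
at `j` has been multiplied by q⁻² and the level at `j + 1` is unchanged. -/
lemma weight_sq_shift (hq : 0 < q) (hq1 : q < 1) (j : Fin n) (p : Index n) :
    weight q j p.2 ^ 2 = q ^ 2 * level q j (shiftIdx j p) - level q (j + 1) (shiftIdx j p) := by
  rw [weight_sq hq hq1]
  rcases lt_or_ge (j : ℕ) p.1 with hj | hj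
  · rw [level_shift_lt (Nat.lt_succ_self _), level_shift_le hq le_rfl hj]
  · rw [level_shift_lt (Nat.lt_succ_self _), level_of_le hj,
      level_of_le (show (p.1 : ℕ) ≤ (j : ℕ) + 1 by omega),
      level_of_le (show ((shiftIdx j p).1 : ℕ) ≤ j from hj)]
    ring

/-- Outside the range of the shift i_j = 1, so the level at `j` is q⁻² times the next one. The
coefficient of z_j z_j* vanishes exactly where no edge arrives; this is why these indices start at
1. -/
lemma level_notMem_range (hq : 0 < q) {j : Fin n} {p : Index n}
    (h : p ∉ Set.range (shiftIdx j)) : q ^ 2 * level q j p - level q (j + 1) p = 0 := by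
  obtain ⟨h1, h2⟩ := notMem_range_shiftIdx h
  rw [level_of_lt (by omega), level_of_lt h1, tailSum_eq, h2, mul_add, zpow_add₀ hq.ne']
  rw [show (-2 * 1 : ℤ) = -(2 : ℕ) by norm_num, zpow_neg, zpow_natCast]
  field_simp
  ring

/-- A telescoping sum, whose last term is the level at `n`, and that is zero. -/
lemma sum_weight_sq (hq : 0 < q) (hq1 : q < 1) (j : Fin n) (p : Index n) :
    ∑ l ∈ Finset.Ici j, weight q l p.2 ^ 2 = level q j p := by
  have h1 : ∑ l ∈ Finset.Ici j, weight q l p.2 ^ 2 =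
      ∑ l ∈ Finset.Ico (j : ℕ) n, (level q l p - level q (l + 1) p) := by
    refine Finset.sum_bij (fun (l : Fin n) _ => (l : ℕ)) (fun l hl => ?_)
      (fun _ _ _ _ h => Fin.ext h) (fun l hl => ?_) (fun l _ => weight_sq hq hq1 l p)
    · exact Finset.mem_Ico.2 ⟨Fin.le_def.1 (Finset.mem_Ici.1 hl), l.2⟩
    · obtain ⟨h1, h2⟩ := Finset.mem_Ico.1 hl
      exact ⟨⟨l, h2⟩, Finset.mem_Ici.2 h1, rfl⟩
  rw [h1, Finset.sum_Ico_eq_sum_range]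
  have := Finset.sum_range_sub' (fun l => level q ((j : ℕ) + l) p) (n - j)
  simp only [← add_assoc, add_zero] at this
  rw [this, Nat.add_sub_cancel' (by omega), level_of_le (show (p.1 : ℕ) ≤ n by omega), sub_zero]

lemma sum_weight_sq_Ioi (hq : 0 < q) (hq1 : q < 1) (j : Fin n) (p : Index n) :
    ∑ l ∈ Finset.Ioi j, weight q l p.2 ^ 2 = level q (j + 1) p := by
  have h := sum_weight_sq hq hq1 j p
  rw [← Finset.Ioi_insert, Finset.sum_insert (by simp), weight_sq hq hq1] at h
  linarith

lemma weight_nonneg (hq : 0 < q) (j : Fin n) {k : Fin (n + 1)} (i : MultiIndex n k) :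
    0 ≤ weight q j i := by
  unfold weight
  split_ifs <;> positivity

lemma weight_pos (hq : 0 < q) (hq1 : q < 1) {j : Fin n} {p : Index n} (h : (j : ℕ) < p.1) :
    0 < weight q j p.2 := by
  refine lt_of_le_of_ne (weight_nonneg hq j p.2) fun h0 => ?_
  have h1 := weight_sq hq hq1 j p
  rw [← h0] at h1
  rcases Nat.lt_or_ge ((j : ℕ) + 1) p.1 with h2 | h2
  · have h3 := (p.2.2 j).1 h2
    rw [level_of_lt h, level_of_lt h2, tailSum_eq, mul_add, zpow_add₀ hq.ne'] at h1
    have h4 : 1 < q ^ (-2 * p.2.1 j) := by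
      rw [show -2 * p.2.1 j = -(2 * p.2.1 j) by ring, zpow_neg]
      refine (one_lt_inv₀ (by positivity)).2 ?_
      exact zpow_lt_one₀ hq hq1 (by omega)
    have h5 : 0 < q ^ (-2 * tailSum ((j : ℕ) + 1) p.2.1) := by positivity
    nlinarith
  · have h3 := level_pos hq h
    rw [level_of_le h2] at h1
    nlinarith

/-- The relation z_j z_i = q z_i z_j at the level of weights. For i < j, raising i_i does not affect
the weight of z_j, while raising i_j divides the weight of z_i by q. -/
lemma weight_mul_weight (hq : 0 < q) {i j : Fin n} (hij : i < j) (p : Index n) :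
    weight q j (shiftIdx i p).2 * weight q i p.2 =
      q * (weight q i (shiftIdx j p).2 * weight q j p.2) := by
  rcases lt_or_ge (j : ℕ) p.1 with hj | hj
  · rw [weight_shift_lt hij, weight_shift_gt hq hij hj]
    ring
  · rw [weight_shift_lt hij, weight_of_le hj]
    ring

lemma weight_mul_weight_shift (hq : 0 < q) {i j : Fin n} (hij : i ≠ j) (p : Index n) :
    weight q j p.2 * weight q i p.2 =
      q * (weight q i (shiftIdx j p).2 * weight q j (shiftIdx i p).2) := by
  rcases lt_or_gt_of_ne hij with h | h
  · rw [weight_shift_lt h]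
    rcases lt_or_ge (j : ℕ) p.1 with hj | hj
    · rw [weight_shift_gt hq h hj]
      ring
    · rw [weight_of_le hj]
      ring
  · rw [weight_shift_lt h]
    rcases lt_or_ge (i : ℕ) p.1 with hj | hj
    · rw [weight_shift_gt hq h hj]
      ring
    · rw [weight_of_le hj]
      ring

end Indices

/-! ### Scalar multiples of spectral integrals, and inclusions of products -/

section Calculus

variable {H : Type u} [NormedAddCommGroup H] [InnerProductSpace ℂ H] [CompleteSpace H]

lemma PVM.simpleIntegral_smul (E : PVM H) (c : ℂ) (g : SimpleFunc ℝ ℂ) (x : H) :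
    E.simpleIntegral (c • g) x = c • E.simpleIntegral g x := by
  let T : Set ℝ → ℂ →L[ℝ] H := fun s =>
    ((ContinuousLinearMap.id ℂ ℂ).smulRight (E.proj s x)).restrictScalars ℝ
  have hT : FinMeasAdditive (E.measure x) T := by
    intro s t hs ht _ _ hd
    ext
    simp [T, E.proj_union hs ht hd x]
  have key : ∀ k : SimpleFunc ℝ ℂ, E.simpleIntegral k x = k.setToSimpleFunc T := by
    intro k
    simp [simpleIntegral, SimpleFunc.setToSimpleFunc, T]
  rw [key, key]
  exact SimpleFunc.setToSimpleFunc_smul T hT (fun c s x => by simp [T, mul_smul]) c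
    (SimpleFunc.integrable_of_isFiniteMeasure g)

lemma PVM.HasInt.smul {E : PVM H} {f : ℝ → ℂ} {x y : H} (h : E.HasInt f x y) (c : ℂ) :
    E.HasInt (fun t => c * f t) x (c • y) := by
  obtain ⟨a, ha, hy⟩ := h
  refine ⟨fun m => c • a m, ?_, ?_⟩
  · have h1 := ENNReal.Tendsto.const_mul (a := ‖c‖ₑ) ha (Or.inr (by simp))
    rw [mul_zero] at h1
    refine h1.congr fun m => ?_
    rw [← eLpNorm_const_smul]
    congr 1
    ext t
    simp [mul_sub]
  · simpa only [PVM.simpleIntegral_smul] using hy.const_smul c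

/-- Both products are computed componentwise, so the inclusion follows from one implication per
edge. Boundedness of `g` makes the integral on the right everywhere defined, hence no domain
condition remains; components that no edge reaches are zero on both sides. -/
lemma pcomp_integral_blockOp_le {ι ε : Type} {G : ι → Type u} [∀ i, NormedAddCommGroup (G i)]
    [∀ i, InnerProductSpace ℂ (G i)] [∀ i, CompleteSpace (G i)] (F : ∀ i, PVM (G i))
    {s t : ε → ι} {T : ∀ a, G (s a) →L[ℂ] G (t a)} {f g : ℝ → ℂ} (hf : Measurable f)
    (hg : Measurable g) (hgb : ∃ C, ∀ t, ‖g t‖ ≤ C)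
    (h : ∀ a v w, (F (s a)).HasInt g v w → (F (t a)).HasInt f (T a v) (T a w)) :
    pcomp ((sumPVM F).integral f hf)
        (blockOp (LinearIsometryEquiv.refl ℂ (lp G 2)) s t T) ≤
      pcomp (blockOp (LinearIsometryEquiv.refl ℂ (lp G 2)) s t T)
        ((sumPVM F).integral g hg) := by
  refine pmap_le fun x w hxw => ?_
  obtain ⟨y, h1, h2⟩ := (mem_graph_pcomp _ _ _ _).1 hxw
  rw [mem_graph_blockOp] at h1
  rw [PVM.mem_graph_integral, sumPVM_hasInt hf] at h2
  refine (mem_graph_pcomp _ _ _ _).2 ⟨(sumPVM F).bint g hg hgb x,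
    (PVM.mem_graph_integral hg).2 (PVM.hasInt_bint hg hgb x), ?_⟩
  have hu := (sumPVM_hasInt hg).1 (PVM.hasInt_bint (E := sumPVM F) hg hgb x)
  rw [mem_graph_blockOp]
  refine ⟨fun a => ?_, fun i hi => ?_⟩
  · have h3 := h2 (t a)
    have h4 := h1.1 a
    simp only [LinearIsometryEquiv.coe_refl, id_eq] at h4 ⊢
    rw [h4] at h3
    exact h3.unique hf (h a _ _ (hu (s a)))
  · have h3 := h2 i
    have h4 := h1.2 i hi
    simp only [LinearIsometryEquiv.coe_refl, id_eq] at h4 ⊢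
    rw [h4] at h3
    have h5 := h3.norm_sq_eq hf
    have h6 : (F i).measure (0 : G i) = 0 := by
      ext S hS
      simp [PVM.measure_apply _ _ hS]
    rw [h6] at h5
    simpa using h5

end Calculus

/-! ### `q`-normal and `q`-hyperbolic block operators -/

section BlockRelations

set_option linter.unusedSectionVars false

variable {ι ε : Type} {G : ι → Type u} [∀ i, NormedAddCommGroup (G i)]
  [∀ i, InnerProductSpace ℂ (G i)] [∀ i, CompleteSpace (G i)]
variable {H : Type u} [NormedAddCommGroup H] [InnerProductSpace ℂ H] [CompleteSpace H]
variable (e : H ≃ₗᵢ[ℂ] lp G 2) [DecidableEq ι] {s t : ε → ι} {T : ∀ a, G (s a) →L[ℂ] G (t a)}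
  (hs : Function.Injective s) (ht : Function.Injective t) {C C' : ∀ i, G i →L[ℂ] G i}

include hs ht

lemma pcomp_self_swap (hC' : ∀ a x, C' (t a) x = T a ((T a).adjoint x))
    (hC0' : ∀ i, i ∉ Set.range t → ∀ x, C' i x = 0) :
    pcomp (blockOp e s t T) (blockOp e s t T).adjoint = diagOp e C' := by
  rw [blockOp_adjoint e hs ht]
  have h := pcomp_swap_self e (s := t) (t := s) (T := fun a => (T a).adjoint) ht hs
    (C := C') (fun a x => by rw [ContinuousLinearMap.adjoint_adjoint, hC']) hC0'
  simpa only [ContinuousLinearMap.adjoint_adjoint] using h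

/-- Both products with the adjoint are maximal diagonal operators, so the operator identity, domains
included, is a comparison of diagonal entries. The entry is zero where no edge leaves, respectively
arrives. -/
lemma isQNormal_blockOp {q : ℝ} (hq : q ≠ 0)
    (hC : ∀ a x, C (s a) x = (T a).adjoint (T a x))
    (hC0 : ∀ i, i ∉ Set.range s → ∀ x, C i x = 0)
    (hC' : ∀ a x, (q : ℂ) ^ 2 • C (t a) x = T a ((T a).adjoint x))
    (hC0' : ∀ i, i ∉ Set.range t → ∀ x, C i x = 0) :
    IsQNormal q (blockOp e s t T) where
  dense := blockOp_dense e hs ht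
  isClosed := blockOp_isClosed e s t T
  eq := by
    rw [pcomp_self_swap e hs ht (C' := fun i => (q : ℂ) ^ 2 • C i) (fun a x => hC' a x)
      (fun i hi x => by rw [_root_.smul_apply, hC0' i hi, smul_zero]),
      blockOp_adjoint e hs ht, pcomp_swap_self e hs ht hC hC0,
      smul_diagOp e (by simpa using hq)]

lemma isQHyperbolic_blockOp {q : ℝ} (hq : q ≠ 0)
    (hC : ∀ a x, C (s a) x = (T a).adjoint (T a x))
    (hC0 : ∀ i, i ∉ Set.range s → ∀ x, C i x = 0)
    (hC' : ∀ a x, (q : ℂ) ^ 2 • C (t a) x - (1 - (q : ℂ) ^ 2) • x = T a ((T a).adjoint x))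
    (hC0' : ∀ i, i ∉ Set.range t → ∀ x, (q : ℂ) ^ 2 • C i x = (1 - (q : ℂ) ^ 2) • x) :
    IsQHyperbolic q (blockOp e s t T) where
  dense := blockOp_dense e hs ht
  isClosed := blockOp_isClosed e s t T
  eq := by
    rw [pcomp_self_swap e hs ht (C' := fun i => (q : ℂ) ^ 2 • C i -
        (1 - (q : ℂ) ^ 2) • ContinuousLinearMap.id ℂ (G i)) (fun a x => hC' a x)
      (fun i hi x => sub_eq_zero.2 (hC0' i hi x)),
      blockOp_adjoint e hs ht, pcomp_swap_self e hs ht hC hC0,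
      smul_diagOp e (by simpa using hq), diagOp_sub_smul_pone]

end BlockRelations

/-! ### The defining relations in a model -/

namespace Model

variable {n : ℕ} {q : ℝ} (M : Model.{u} n q)

/-- The Hilbert space of a model as a Hilbert sum. -/
abbrev idEquiv : M.Space ≃ₗᵢ[ℂ] lp (fun p : Index n => M.K p.1) 2 :=
  LinearIsometryEquiv.refl ℂ M.Space

lemma coeff_zero : M.coeff 0 = 0 := rfl

lemma coeff_isSelfAdjoint (k : Fin (n + 1)) : IsSelfAdjoint (M.coeff k) := by
  induction k using Fin.cases with
  | zero => exact IsSelfAdjoint.zero _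
  | succ k => exact M.isSelfAdjoint k

lemma coeff_adjoint (k : Fin (n + 1)) : (M.coeff k).adjoint = M.coeff k := by
  rw [← ContinuousLinearMap.star_eq_adjoint, (M.coeff_isSelfAdjoint k).star_eq]

/-- The entry of `z_j` from the summand with index `p` to the one with index `shiftIdx j p`. -/
def entry (j : Fin n) (p : Index n) : M.K p.1 →L[ℂ] M.K p.1 :=
  (weight q j p.2 : ℂ) • M.coeff p.1

lemma entry_apply (j : Fin n) (p : Index n) (h : M.K p.1) :
    M.entry j p h = (weight q j p.2 : ℂ) • M.coeff p.1 h := rfl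

lemma entry_adjoint (j : Fin n) (p : Index n) : (M.entry j p).adjoint = M.entry j p := by
  rw [entry, map_smulₛₗ, coeff_adjoint, Complex.conj_ofReal]

/-- The closed operator with the entries of `z_j`. -/
abbrev blk (j : Fin n) : M.Space →ₗ.[ℂ] M.Space :=
  blockOp (G := fun p : Index n => M.K p.1) M.idEquiv id (shiftIdx j) (fun p => M.entry j p)

section Dom

variable {X Y : M.Space →ₗ.[ℂ] M.Space} {v : ∀ p : Index n, M.K p.1 → M.Space}

lemma eq_sum_single {x : M.Space} (hx : x ∈ M.dom) :
    x = ∑ p ∈ Set.Finite.toFinset hx, M.single p.2 (x p) := by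
  have h1 : HasSum (fun p : Index n => M.single p.2 (x p)) x := hasSum_bsingle M.idEquiv x
  refine h1.unique (hasSum_sum_of_ne_finset_zero fun p hp => ?_)
  have : x p = 0 := by
    by_contra h0
    exact hp ((Set.Finite.mem_toFinset _).2 h0)
  rw [this, map_zero]

lemma mem_graph_of_mem_dom (hX : ∀ p h, (M.single p.2 h, v p h) ∈ X.graph) {x : M.Space}
    (hx : x ∈ M.dom) : (x, ∑ p ∈ Set.Finite.toFinset hx, v p (x p)) ∈ X.graph := by
  have h1 := X.graph.sum_mem (t := Set.Finite.toFinset hx) fun p _ => hX p (x p)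
  convert h1 using 1
  rw [Prod.mk.injEq, Prod.fst_sum, Prod.snd_sum]
  exact ⟨M.eq_sum_single hx, rfl⟩

lemma domRestrict_le_of_single (hX : ∀ p h, (M.single p.2 h, v p h) ∈ X.graph)
    (hY : ∀ p h, (M.single p.2 h, v p h) ∈ Y.graph) : X.domRestrict M.dom ≤ Y := by
  refine pmap_le fun x y hxy => ?_
  obtain ⟨hx, hxy⟩ := (mem_graph_domRestrict _ _ _ _).1 hxy
  rw [LinearPMap.mem_graph_snd_inj _ hxy (M.mem_graph_of_mem_dom hX hx) rfl]
  exact M.mem_graph_of_mem_dom hY hx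

/-- Elements of the algebraic direct sum are finite sums of single vectors, so an identity of
operators on it follows from a common value on single vectors. All the defining relations are
checked in this way. -/
lemma domRestrict_eq_of_single (hX : ∀ p h, (M.single p.2 h, v p h) ∈ X.graph)
    (hY : ∀ p h, (M.single p.2 h, v p h) ∈ Y.graph) :
    X.domRestrict M.dom = Y.domRestrict M.dom := by
  apply le_antisymm
  all_goals
    refine pmap_le fun x y hxy => ?_
    have h := (mem_graph_domRestrict _ _ _ _).1 hxy
    refine (mem_graph_domRestrict _ _ _ _).2 ⟨h.1, ?_⟩
  · exact LinearPMap.le_graph_of_le (M.domRestrict_le_of_single hX hY) hxy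
  · exact LinearPMap.le_graph_of_le (M.domRestrict_le_of_single hY hX) hxy

lemma dom_dense : Dense (M.dom : Set M.Space) :=
  dense_of_bsingle_mem M.idEquiv fun p h => M.single_mem_dom p.2 h

lemma dom_le_domain (hX : ∀ p h, (M.single p.2 h, v p h) ∈ X.graph) : M.dom ≤ X.domain :=
  fun _ hx => LinearPMap.mem_domain_of_mem_graph (M.mem_graph_of_mem_dom hX hx)

lemma map_mem_dom (hX : ∀ p h, (M.single p.2 h, v p h) ∈ X.graph) (hv : ∀ p h, v p h ∈ M.dom)
    (x : X.domain) (hx : (x : M.Space) ∈ M.dom) : X x ∈ M.dom := by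
  rw [LinearPMap.mem_graph_snd_inj _ (X.mem_graph x) (M.mem_graph_of_mem_dom hX hx) rfl]
  exact M.dom.sum_mem fun p _ => hv _ _

end Dom

lemma blk_single (j : Fin n) (p : Index n) (h : M.K p.1) :
    (M.single p.2 h, (weight q j p.2 : ℂ) • M.single (shift j p.2) (M.coeff p.1 h)) ∈
      (M.blk j).graph := by
  have := bsingle_mem_graph_blockOp (G := fun p : Index n => M.K p.1) M.idEquiv
    (s := id) (t := shiftIdx j) (T := fun p => M.entry j p) Function.injective_id (shiftIdx_injective j) p h
  rw [← map_smul]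
  exact this

lemma op_eq (j : Fin n) : M.op j = M.blk j := by
  refine closure_eq_blockOp (G := fun p : Index n => M.K p.1) M.idEquiv Function.injective_id
    (shiftIdx_injective j) ?_ (fun p h => M.single_mem_dom p.2 h)
  have hX : ∀ (p : Index n) (h : M.K p.1), (M.single p.2 h,
      (weight q j p.2 : ℂ) • M.single (shift j p.2) (M.coeff p.1 h)) ∈ (M.opCore j).graph := by
    intro p h
    rw [← opCore_single]
    exact (M.opCore j).mem_graph ⟨_, M.single_mem_dom p.2 h⟩
  refine le_trans ?_ (M.domRestrict_le_of_single hX (M.blk_single j))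
  refine pmap_le fun x y hxy => (mem_graph_domRestrict _ _ _ _).2 ⟨?_, hxy⟩
  exact LinearPMap.mem_domain_of_mem_graph hxy

lemma op_adjoint_eq (j : Fin n) : (M.op j).adjoint =
    blockOp (G := fun p : Index n => M.K p.1) M.idEquiv (shiftIdx j) id
      (fun p => M.entry j p) := by
  rw [op_eq]
  refine (blockOp_adjoint (G := fun p : Index n => M.K p.1) M.idEquiv (s := id)
    (t := shiftIdx j) (T := fun p => M.entry j p) Function.injective_id
    (shiftIdx_injective j)).trans ?_
  exact congrArg (blockOp (G := fun p : Index n => M.K p.1) M.idEquiv (shiftIdx j) id)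
    (funext fun p => M.entry_adjoint j p)

lemma op_single (j : Fin n) (p : Index n) (h : M.K p.1) :
    (M.single p.2 h, (weight q j p.2 : ℂ) • M.single (shift j p.2) (M.coeff p.1 h)) ∈
      (M.op j).graph := by
  rw [op_eq]
  exact M.blk_single j p h

lemma op_smul_single (j : Fin n) (p : Index n) (c : ℂ) (h : M.K p.1) :
    (c • M.single p.2 h, (c * weight q j p.2 : ℂ) • M.single (shift j p.2) (M.coeff p.1 h)) ∈
      (M.op j).graph := by
  have := (M.op j).graph.smul_mem c (M.op_single j p h)
  rwa [Prod.smul_mk, smul_smul] at this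

lemma op_adjoint_smul_single (j : Fin n) (p : Index n) (c : ℂ) (h : M.K p.1) :
    (c • M.single (shift j p.2) h, (c * weight q j p.2 : ℂ) • M.single p.2 (M.coeff p.1 h)) ∈
      (M.op j).adjoint.graph := by
  have := bsingle_mem_graph_blockOp (G := fun p : Index n => M.K p.1) M.idEquiv
    (s := shiftIdx j) (t := id)
    (T := fun p => M.entry j p) (shiftIdx_injective j) Function.injective_id p h
  rw [op_adjoint_eq, ← smul_smul, ← map_smul (M.single p.2)]
  exact Submodule.smul_mem _ c this

lemma op_adjoint_single (j : Fin n) (p : Index n) (h : M.K p.1) :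
    (M.single (shift j p.2) h, (weight q j p.2 : ℂ) • M.single p.2 (M.coeff p.1 h)) ∈
      (M.op j).adjoint.graph := by
  simpa using M.op_adjoint_smul_single j p 1 h

lemma op_adjoint_single_zero {j : Fin n} {p : Index n} (hp : p ∉ Set.range (shiftIdx j))
    (h : M.K p.1) : (M.single p.2 h, (0 : M.Space)) ∈ (M.op j).adjoint.graph := by
  rw [op_adjoint_eq]
  exact bsingle_mem_graph_blockOp_zero (G := fun p : Index n => M.K p.1) M.idEquiv hp h

open Classical in
/-- The value of `z_j*` on `h_{i_1,…,i_k}`. -/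
def adjointValue (j : Fin n) (p : Index n) (h : M.K p.1) : M.Space :=
  if hp : ∃ i, shift j i = p.2 then (weight q j hp.choose : ℂ) • M.single hp.choose (M.coeff p.1 h)
  else 0

lemma op_adjoint_single_value (j : Fin n) (p : Index n) (h : M.K p.1) :
    (M.single p.2 h, M.adjointValue j p h) ∈ (M.op j).adjoint.graph := by
  by_cases hp : ∃ i, shift j i = p.2
  · rw [adjointValue, dif_pos hp]
    have := M.op_adjoint_single j ⟨p.1, hp.choose⟩ h
    rwa [hp.choose_spec] at this
  · rw [adjointValue, dif_neg hp]
    refine M.op_adjoint_single_zero ?_ h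
    rintro ⟨⟨k, i⟩, hi⟩
    obtain rfl : k = p.1 := congrArg Sigma.fst hi
    exact hp ⟨i, eq_of_heq (Sigma.mk.inj hi).2⟩

lemma adjointValue_mem (j : Fin n) (p : Index n) (h : M.K p.1) : M.adjointValue j p h ∈ M.dom := by
  unfold adjointValue
  split_ifs
  · exact M.dom.smul_mem _ (M.single_mem_dom _ _)
  · exact M.dom.zero_mem

lemma pcomp_adjoint_op_single (j : Fin n) (p : Index n) (h : M.K p.1) :
    (M.single p.2 h, ((weight q j p.2 ^ 2 : ℝ) : ℂ) • M.single p.2 (M.coeff p.1 (M.coeff p.1 h))) ∈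
      (pcomp (M.op j).adjoint (M.op j)).graph := by
  refine (mem_graph_pcomp _ _ _ _).2 ⟨_, M.op_single j p h, ?_⟩
  have := M.op_adjoint_smul_single j p (weight q j p.2) (M.coeff p.1 h)
  convert this using 3
  push_cast
  ring

variable (hq : 0 < q) (hq1 : q < 1)

include hq hq1

lemma pcomp_op_adjoint_single (j : Fin n) (p : Index n) (h : M.K p.1) :
    (M.single p.2 h, ((q ^ 2 * level q j p - level q (j + 1) p : ℝ) : ℂ) •
      M.single p.2 (M.coeff p.1 (M.coeff p.1 h))) ∈
      (pcomp (M.op j) (M.op j).adjoint).graph := by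
  by_cases hp : p ∈ Set.range (shiftIdx j)
  · obtain ⟨r, rfl⟩ := hp
    rw [← weight_sq_shift hq hq1]
    refine (mem_graph_pcomp _ _ _ _).2 ⟨_, M.op_adjoint_single j r h, ?_⟩
    have := M.op_smul_single j r (weight q j r.2) (M.coeff r.1 h)
    rw [pow_two, Complex.ofReal_mul]
    exact this
  · rw [level_notMem_range hq hp, Complex.ofReal_zero, zero_smul]
    exact (mem_graph_pcomp _ _ _ _).2 ⟨0, M.op_adjoint_single_zero hp h, Submodule.zero_mem _⟩

lemma sum_pcomp_single (k : Fin n) (p : Index n) (h : M.K p.1) :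
    (M.single p.2 h, (level q k p : ℂ) • M.single p.2 (M.coeff p.1 (M.coeff p.1 h))) ∈
      (∑ l ∈ Finset.Ici k, pcomp (M.op l).adjoint (M.op l)).graph := by
  refine (mem_graph_sum _ _ _ _).2 ⟨_, fun l _ => M.pcomp_adjoint_op_single l p h, ?_⟩
  rw [← Finset.sum_smul, ← sum_weight_sq hq hq1]
  push_cast
  rfl

lemma sum_pcomp_single_Ioi (k : Fin n) (p : Index n) (h : M.K p.1) :
    (M.single p.2 h, (level q (k + 1) p : ℂ) • M.single p.2 (M.coeff p.1 (M.coeff p.1 h))) ∈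
      (∑ l ∈ Finset.Ioi k, pcomp (M.op l).adjoint (M.op l)).graph := by
  refine (mem_graph_sum _ _ _ _).2 ⟨_, fun l _ => M.pcomp_adjoint_op_single l p h, ?_⟩
  rw [← Finset.sum_smul, ← sum_weight_sq_Ioi hq hq1]
  push_cast
  rfl

lemma isStarRep : IsStarRep q M.op M.dom where
  dense := M.dom_dense
  isClosed j := by rw [op_eq]; exact blockOp_isClosed _ _ _ _
  le_domain j := M.dom_le_domain (M.op_single j)
  le_domain_adjoint j := M.dom_le_domain (M.op_adjoint_single_value j)
  map_mem j x hx := M.map_mem_dom (M.op_single j)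
    (fun p h => M.dom.smul_mem _ (M.single_mem_dom _ _)) x hx
  map_adjoint_mem j x hx := M.map_mem_dom (M.op_adjoint_single_value j)
    (M.adjointValue_mem j) x hx
  rel_zz i j hij := by
    refine M.domRestrict_eq_of_single (v := fun p h =>
      ((weight q i p.2 * weight q j (shiftIdx i p).2 : ℝ) : ℂ) •
        M.single (shift j (shift i p.2)) (M.coeff p.1 (M.coeff p.1 h))) (fun p h => ?_)
      (fun p h => ?_)
    · refine (mem_graph_pcomp _ _ _ _).2 ⟨_, M.op_single i p h, ?_⟩
      have := M.op_smul_single j (shiftIdx i p) (weight q i p.2) (M.coeff p.1 h)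
      rw [Complex.ofReal_mul]
      exact this
    · refine (mem_graph_smul _ _ _ _).2 ⟨_, (mem_graph_pcomp _ _ _ _).2
        ⟨_, M.op_single j p h, M.op_smul_single i (shiftIdx j p) (weight q j p.2)
          (M.coeff p.1 h)⟩, ?_⟩
      have hw := weight_mul_weight hq hij p
      rw [smul_smul, mul_comm (weight q i p.2), hw]
      simp only [shiftIdx, shift_comm i j p.2]
      push_cast
      congr 1
      ring
  rel_zz_adjoint i j hij := by
    classical
    have key : ∀ p : Index n, ∀ h : M.K p.1, ∃ v,
        (M.single p.2 h, v) ∈ (pcomp (M.op j) (M.op i).adjoint).graph ∧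
        (M.single p.2 h, v) ∈ ((q : ℂ) • pcomp (M.op i).adjoint (M.op j)).graph := by
      intro p h
      by_cases hp : p ∈ Set.range (shiftIdx i)
      · obtain ⟨r, rfl⟩ := hp
        have h1 := M.op_adjoint_smul_single i (shiftIdx j r) (weight q j (shiftIdx i r).2)
          (M.coeff r.1 h)
        simp only [shift_comm i j r.2] at h1
        refine ⟨_, (mem_graph_pcomp _ _ _ _).2 ⟨_, M.op_adjoint_single i r h,
          M.op_smul_single j r _ _⟩, (mem_graph_smul _ _ _ _).2
            ⟨_, (mem_graph_pcomp _ _ _ _).2 ⟨_, M.op_single j (shiftIdx i r) h, h1⟩, ?_⟩⟩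
        have hw := weight_mul_weight_shift hq hij r
        rw [smul_smul, ← Complex.ofReal_mul, mul_comm (weight q i r.2), hw]
        push_cast
        congr 1
        ring
      -- Where no edge of z_i arrives, z_i* vanishes, and z_j does not lead out of this set of
      -- summands; both products are zero.
      · refine ⟨0, (mem_graph_pcomp _ _ _ _).2 ⟨0, M.op_adjoint_single_zero hp h,
          Submodule.zero_mem _⟩, (mem_graph_smul _ _ _ _).2
            ⟨0, (mem_graph_pcomp _ _ _ _).2 ⟨_, M.op_single j p h, ?_⟩, by simp⟩⟩
        have h1 := M.op_adjoint_single_zero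
          (fun h' => hp (mem_range_shiftIdx_shiftIdx hij h')) (M.coeff p.1 h)
        have := Submodule.smul_mem _ (weight q j p.2 : ℂ) h1
        rw [Prod.smul_mk, smul_zero] at this
        exact this
    choose v hv1 hv2 using key
    exact M.domRestrict_eq_of_single hv1 hv2
  rel_diag i := by
    refine M.domRestrict_eq_of_single (M.pcomp_op_adjoint_single hq hq1 i) (fun p h => ?_)
    refine (mem_graph_sub _ _ _ _).2 ⟨_, _, (mem_graph_smul _ _ _ _).2
      ⟨_, M.pcomp_adjoint_op_single i p h, rfl⟩, (mem_graph_smul _ _ _ _).2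
      ⟨_, M.sum_pcomp_single_Ioi hq hq1 i p h, rfl⟩, ?_⟩
    rw [smul_smul, smul_smul, ← sub_smul, weight_sq hq hq1]
    congr 1
    push_cast
    ring

/-- The entries of `Q_{k+1}`. -/
lemma Q_eq (k : Fin n) : Q M.op M.dom k =
    diagOp (G := fun p : Index n => M.K p.1) M.idEquiv
      (fun p => (level q k p : ℂ) • (M.coeff p.1 ∘L M.coeff p.1)) := by
  refine closure_eq_blockOp (G := fun p : Index n => M.K p.1) M.idEquiv Function.injective_id
    Function.injective_id ?_ (fun p h => ⟨M.single_mem_dom p.2 h,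
      LinearPMap.mem_domain_of_mem_graph (M.sum_pcomp_single hq hq1 k p h)⟩)
  refine M.domRestrict_le_of_single (M.sum_pcomp_single hq hq1 k) (fun p h => ?_)
  have := bsingle_mem_graph_blockOp (G := fun p : Index n => M.K p.1) M.idEquiv
    (s := id) (t := id) (T := fun p => (level q k p : ℂ) • (M.coeff p.1 ∘L M.coeff p.1))
    Function.injective_id Function.injective_id p h
  rw [← map_smul]
  exact this

lemma isSelfAdjoint_Q (k : Fin n) : IsSelfAdjoint (Q M.op M.dom k) := by
  rw [LinearPMap.isSelfAdjoint_def, M.Q_eq hq hq1, diagOp,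
    blockOp_adjoint _ Function.injective_id Function.injective_id]
  congr 1
  funext p
  change (((level q k p : ℂ) • (M.coeff p.1 ∘L M.coeff p.1))).adjoint = _
  rw [map_smulₛₗ, Complex.conj_ofReal, ContinuousLinearMap.adjoint_comp, coeff_adjoint]

end Model

/-! ### Closures of products with diagonal operators -/

section

variable {H : Type u} [NormedAddCommGroup H] [InnerProductSpace ℂ H] [CompleteSpace H]

lemma PVM.hasInt_zero (E : PVM H) (f : ℝ → ℂ) : E.HasInt f 0 0 := by
  have h0 := E.hasInt_simple 0 (0 : H)
  rw [map_zero] at h0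
  refine h0.congr_ae ?_
  have : E.measure (0 : H) = 0 := by
    ext S hS
    simp [PVM.measure_apply _ _ hS]
  rw [this]
  rfl

/-- For bounded `g` the integral of g ∘ φ exists at every vector, so uniqueness of the
pushed-forward integral reverses `HasInt.map`. -/
lemma PVM.HasInt.of_map {E : PVM H} {φ : ℝ → ℝ} (hφ : Measurable φ) {g : ℝ → ℂ}
    (hg : Measurable g) (hgb : ∃ C, ∀ t, ‖g t‖ ≤ C) {v w : H} (h : (E.map φ hφ).HasInt g v w) :
    E.HasInt (fun t => g (φ t)) v w := by
  obtain ⟨C, hC⟩ := hgb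
  have h1 := PVM.hasInt_bint (E := E) (hg.comp hφ) ⟨C, fun t => hC (φ t)⟩ v
  rw [h.unique hg (PVM.HasInt.map hφ hg h1)]
  exact h1

end

section

set_option linter.unusedSectionVars false

variable {ι ε : Type*} {G : ι → Type*} [∀ i, NormedAddCommGroup (G i)]
  [∀ i, InnerProductSpace ℂ (G i)] [∀ i, CompleteSpace (G i)]
variable {H : Type u} [NormedAddCommGroup H] [InnerProductSpace ℂ H] [CompleteSpace H]
variable (e : H ≃ₗᵢ[ℂ] lp G 2) [DecidableEq ι] {s t : ε → ι}
  {T W : ∀ a, G (s a) →L[ℂ] G (t a)}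
  (hs : Function.Injective s) (ht : Function.Injective t) {C : ∀ i, G i →L[ℂ] G i}

lemma bsingle_mem_graph_diagOp (i : ι) (h : G i) :
    (bsingle e i h, bsingle e i (C i h)) ∈ (diagOp e C).graph :=
  bsingle_mem_graph_blockOp e (s := id) (t := id) (T := C) Function.injective_id
    Function.injective_id i h

include hs ht

/-- The natural domain of the product may be smaller than that of the operator with the multiplied
entries, but it contains the single components, and these determine the closure by
`closure_eq_blockOp`. -/
lemma closure_pcomp_diagOp_blockOp (h : ∀ a x, C (t a) (T a x) = W a x) :
    (pcomp (diagOp e C) (blockOp e s t T)).closure = blockOp e s t W := by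
  refine closure_eq_blockOp e hs ht (pmap_le fun x w hxw => ?_) fun i g => ?_
  · obtain ⟨y, h1, h2⟩ := (mem_graph_pcomp _ _ _ _).1 hxw
    rw [mem_graph_blockOp] at h1 ⊢
    rw [mem_graph_diagOp] at h2
    exact ⟨fun a => by rw [h2, h1.1, h], fun i hi => by rw [h2, h1.2 i hi, map_zero]⟩
  · by_cases hi : i ∈ Set.range s
    · obtain ⟨a, rfl⟩ := hi
      exact LinearPMap.mem_domain_of_mem_graph ((mem_graph_pcomp _ _ _ _).2
        ⟨_, bsingle_mem_graph_blockOp e hs ht a g, bsingle_mem_graph_diagOp e _ _⟩)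
    · exact LinearPMap.mem_domain_of_mem_graph ((mem_graph_pcomp _ _ _ _).2
        ⟨_, bsingle_mem_graph_blockOp_zero e hi g, Submodule.zero_mem _⟩)

lemma closure_pcomp_blockOp_diagOp (h : ∀ a x, T a (C (s a) x) = W a x) :
    (pcomp (blockOp e s t T) (diagOp e C)).closure = blockOp e s t W := by
  refine closure_eq_blockOp e hs ht (pmap_le fun x w hxw => ?_) fun i g => ?_
  · obtain ⟨y, h1, h2⟩ := (mem_graph_pcomp _ _ _ _).1 hxw
    rw [mem_graph_blockOp] at h2 ⊢
    rw [mem_graph_diagOp] at h1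
    exact ⟨fun a => by rw [h2.1, h1, h], h2.2⟩
  · exact LinearPMap.mem_domain_of_mem_graph ((mem_graph_pcomp _ _ _ _).2
      ⟨_, bsingle_mem_graph_diagOp e i g,
        (blockOp e s t T).mem_graph ⟨_, blockOp_bsingle_mem_domain e hs ht i (C i g)⟩⟩)

end

/-! ### Spectral measures of a model and its good behaviour -/

namespace Model

variable {n : ℕ} {q : ℝ} (M : Model.{u} n q)

/-- The case k = 0 is separated because the coefficient operator is zero there and its spectrum does
not lie in [q, 1]. -/
lemma exists_spectral_coeff (k : Fin (n + 1)) :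
    ∃ F : PVM (M.K k), (∀ x, F.HasInt (fun t => (t : ℂ)) x (M.coeff k x)) ∧
      F.proj (Set.Icc (if k = 0 then 0 else q) 1) = 1 := by
  obtain ⟨F, h1, h2⟩ := exists_spectral_measure (M.coeff_isSelfAdjoint k)
  refine ⟨F, h1, h2 _ measurableSet_Icc fun c hc => ?_⟩
  induction k using Fin.cases with
  | zero =>
    refine ⟨0, by simp, ?_⟩
    by_contra hne
    have hc0 : c ≠ 0 := fun h => hne (by simp [h])
    refine (spectrum.mem_iff.1 hc) ?_
    rw [coeff_zero, sub_zero]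
    exact (IsUnit.mk0 c hc0).map _
  | succ k =>
    rw [if_neg (Fin.succ_ne_zero k)]
    obtain ⟨t, ht, rfl⟩ := M.spectrum_subset k hc
    exact ⟨t, ht, rfl⟩

/-- A spectral measure of the coefficient operator. -/
def spec (k : Fin (n + 1)) : PVM (M.K k) := (M.exists_spectral_coeff k).choose

lemma spec_hasInt (k : Fin (n + 1)) (x : M.K k) :
    (M.spec k).HasInt (fun t => (t : ℂ)) x (M.coeff k x) :=
  (M.exists_spectral_coeff k).choose_spec.1 x

lemma spec_proj (k : Fin (n + 1)) : (M.spec k).proj (Set.Icc (if k = 0 then 0 else q) 1) = 1 :=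
  (M.exists_spectral_coeff k).choose_spec.2

lemma exists_coeff_inverse (hq : 0 < q) {k : Fin (n + 1)} (hk : 0 < (k : ℕ)) :
    ∃ B : M.K k →L[ℂ] M.K k, (∀ x, M.coeff k (B x) = x) ∧ (∀ x, B (M.coeff k x) = x) ∧
      ∀ x, (M.spec k).HasInt (fun t => ((t⁻¹ : ℝ) : ℂ)) x (B x) := by
  have h := M.spec_proj k
  rw [if_neg (by rintro rfl; simp at hk)] at h
  exact exists_inverse (M.spec_hasInt k) h hq

/-- The factor of `A_k²` in `Q_{l+1}` as a function of the spectral parameter of `A_k`. -/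
def levelMap (q : ℝ) (l : ℕ) (p : Index n) (t : ℝ) : ℝ := level q l p * t ^ 2

omit M in
lemma measurable_levelMap (l : ℕ) (p : Index n) : Measurable (levelMap q l p) := by
  unfold levelMap; fun_prop

/-- The spectral measure of `Q_{l+1}`. -/
def specQ (l : Fin n) : PVM M.Space :=
  sumPVM fun p : Index n => (M.spec p.1).map (levelMap q l p) (measurable_levelMap l p)

lemma hasInt_level (l : ℕ) (p : Index n) (x : M.K p.1) :
    ((M.spec p.1).map (levelMap q l p) (measurable_levelMap l p)).HasInt (fun t => (t : ℂ)) x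
      ((level q l p : ℂ) • M.coeff p.1 (M.coeff p.1 x)) := by
  refine PVM.HasInt.map _ Complex.measurable_ofReal ?_
  convert (hasInt_sq (M.spec_hasInt p.1) (M.spec_proj p.1) x).smul (level q l p) using 2
  simp [levelMap]

/-- Either the entry is zero, or the two level functions correspond to each other; in the latter
case the entry, a multiple of A_k, commutes with the spectral projections of A_k. -/
lemma hasInt_entry (l : ℕ) (j : Fin n) (p : Index n) (i : MultiIndex n p.1)
    {f g : ℝ → ℂ} (hf : Measurable f) (hg : Measurable g) (hgb : ∃ C, ∀ t, ‖g t‖ ≤ C)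
    (h : weight q j p.2 = 0 ∨ ∀ t, g (levelMap q l p t) = f (levelMap q l ⟨p.1, i⟩ t))
    {v w : M.K p.1} (hvw : ((M.spec p.1).map (levelMap q l p)
      (measurable_levelMap l p)).HasInt g v w) :
    ((M.spec p.1).map (levelMap q l ⟨p.1, i⟩) (measurable_levelMap l ⟨p.1, i⟩)).HasInt f
      (M.entry j p v) (M.entry j p w) := by
  rcases h with h | h
  · rw [entry_apply, entry_apply, h]
    simp only [Complex.ofReal_zero, zero_smul]
    exact PVM.hasInt_zero _ _
  · have h1 := hvw.of_map (measurable_levelMap l p) hg hgb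
    simp only [h] at h1
    refine PVM.HasInt.map _ hf (h1.of_commute (fun S hS x => ?_) (hf.comp
      (measurable_levelMap l ⟨p.1, i⟩)))
    rw [entry_apply, entry_apply, map_smul]
    exact congrArg ((weight q j p.2 : ℂ) • ·) (proj_commute_of_hasInt (M.spec_hasInt p.1) hS x)

lemma specQ_hasInt (k : Fin n) {f : ℝ → ℂ} (hf : Measurable f) {x y : M.Space} :
    (M.specQ k).HasInt f x y ↔ ∀ p : Index n,
      ((M.spec p.1).map (levelMap q k p) (measurable_levelMap k p)).HasInt f (x p) (y p) :=
  sumPVM_hasInt hf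

lemma pcomp_specQ_op_le (k j : Fin n) {f g : ℝ → ℂ} (hf : Measurable f) (hg : Measurable g)
    (hgb : ∃ C, ∀ t, ‖g t‖ ≤ C) (h : ∀ p : Index n, weight q j p.2 = 0 ∨
      ∀ t, g (levelMap q k p t) = f (levelMap q k (shiftIdx j p) t)) :
    pcomp ((M.specQ k).integral f hf) (M.op j) ≤
      pcomp (M.op j) ((M.specQ k).integral g hg) := by
  rw [op_eq]
  exact pcomp_integral_blockOp_le _ hf hg hgb fun p v w hvw =>
    M.hasInt_entry k j p (shift j p.2) hf hg hgb (h p) hvw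

lemma pcomp_specQ_adjoint_le (k j : Fin n) {f g : ℝ → ℂ} (hf : Measurable f) (hg : Measurable g)
    (hgb : ∃ C, ∀ t, ‖g t‖ ≤ C) (h : ∀ p : Index n, weight q j p.2 = 0 ∨
      ∀ t, g (levelMap q k (shiftIdx j p) t) = f (levelMap q k p t)) :
    pcomp ((M.specQ k).integral f hf) (M.op j).adjoint ≤
      pcomp (M.op j).adjoint ((M.specQ k).integral g hg) := by
  rw [op_adjoint_eq]
  refine pcomp_integral_blockOp_le _ hf hg hgb fun p v w hvw => ?_
  have h1 := hvw.of_map (measurable_levelMap (q := q) k (shiftIdx j p)) hg hgb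
  rcases h p with h | h
  · rw [entry_apply, entry_apply, h]
    simp only [Complex.ofReal_zero, zero_smul]
    exact PVM.hasInt_zero _ _
  · simp only [h] at h1
    refine PVM.HasInt.map _ hf (h1.of_commute (fun S hS x => ?_) (hf.comp
      (measurable_levelMap k p)))
    rw [entry_apply, entry_apply, map_smul]
    exact congrArg ((weight q j p.2 : ℂ) • ·) (proj_commute_of_hasInt (M.spec_hasInt p.1) hS x)

open Classical in
/-- The inverse of the coefficient operator. -/
def coeffInv (k : Fin (n + 1)) : M.K k →L[ℂ] M.K k :=
  if h : 0 < q ∧ 0 < (k : ℕ) then (M.exists_coeff_inverse h.1 h.2).choose else 0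

section

variable (hq : 0 < q) {k : Fin (n + 1)} (hk : 0 < (k : ℕ))

include hq hk

lemma coeffInv_spec : (∀ x, M.coeff k (M.coeffInv k x) = x) ∧
    (∀ x, M.coeffInv k (M.coeff k x) = x) ∧
    ∀ x, (M.spec k).HasInt (fun t => ((t⁻¹ : ℝ) : ℂ)) x (M.coeffInv k x) := by
  rw [coeffInv, dif_pos ⟨hq, hk⟩]
  exact (M.exists_coeff_inverse hq hk).choose_spec

lemma coeff_eq_zero {x : M.K k} (h : M.coeff k x = 0) : x = 0 := by
  rw [← (M.coeffInv_spec hq hk).2.1 x, h, map_zero]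

end

/-- The spectral parameter t of A_k satisfies t ≥ q > 0, so the square root of level · t² is √level
· t. Thus the inverse square root of Q acts on this summand as a multiple of the inverse of A_k. -/
lemma hasInt_inv_sqrt (hq : 0 < q) {l : ℕ} {p : Index n} (hl : l < p.1) (x : M.K p.1) :
    ((M.spec p.1).map (levelMap q l p) (measurable_levelMap l p)).HasInt
      (fun t => (((√t)⁻¹ : ℝ) : ℂ)) x (((√(level q l p))⁻¹ : ℝ) • M.coeffInv p.1 x) := by
  refine PVM.HasInt.map _ (by fun_prop) ?_
  have hp : 0 < (p.1 : ℕ) := by omega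
  have h := ((M.coeffInv_spec hq hp).2.2 x).smul ((√(level q l p))⁻¹ : ℝ)
  have h2 := M.spec_proj p.1
  rw [if_neg (by intro h0; rw [h0] at hp; simp at hp)] at h2
  refine PVM.HasInt.congr_ae h ?_
  filter_upwards [ae_mem_Icc h2 x] with t ht
  have ht0 : 0 ≤ t := hq.le.trans ht.1
  rw [levelMap, Real.sqrt_mul (level_nonneg hq _ _), Real.sqrt_sq ht0, mul_inv]
  push_cast
  rfl

variable (hq : 0 < q) (hq1 : q < 1)

lemma sub_idEquiv_part (S : Set (Fin (n + 1))) :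
    M.part S = sub (G := fun p : Index n => M.K p.1) M.idEquiv {p | p.1 ∈ S} := rfl

section

include hq hq1

lemma kernel_Q (k : Fin n) : kernel (Q M.op M.dom k) = M.part (Set.Iic k.castSucc) := by
  ext x
  rw [M.Q_eq hq hq1, mem_kernel_diagOp]
  constructor
  · intro h p hp
    have hp' : (k : ℕ) < p.1 := by
      simpa [Fin.lt_def] using hp
    have h1 : (level q k p : ℂ) • M.coeff p.1 (M.coeff p.1 (x p)) = 0 := h p
    rw [smul_eq_zero, Complex.ofReal_eq_zero] at h1
    have h2 := h1.resolve_left (level_pos hq hp').ne'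
    have h3 : 0 < (p.1 : ℕ) := by omega
    exact M.coeff_eq_zero hq h3 (M.coeff_eq_zero hq h3 h2)
  · intro h p
    change (level q k p : ℂ) • M.coeff p.1 (M.coeff p.1 (x p)) = 0
    rcases lt_or_ge (k : ℕ) p.1 with hk | hk
    · rw [h p (by simpa [Fin.lt_def] using hk), map_zero, map_zero, smul_zero]
    · rw [level_of_le hk, Complex.ofReal_zero, zero_smul]

lemma Q_eq_integral (k : Fin n) : Q M.op M.dom k =
    (M.specQ k).integral (fun t => (t : ℂ)) Complex.measurable_ofReal := by
  apply pmap_ext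
  intro x y
  rw [M.Q_eq hq hq1, mem_graph_diagOp, PVM.mem_graph_integral, specQ_hasInt _ _
    Complex.measurable_ofReal]
  refine forall_congr' fun p => ⟨fun h => ?_, fun h => ?_⟩
  · have h1 : y p = (level q k p : ℂ) • M.coeff p.1 (M.coeff p.1 (x p)) := h
    rw [h1]
    exact M.hasInt_level k p (x p)
  · exact h.unique Complex.measurable_ofReal (M.hasInt_level k p (x p))

end

section Restrict

variable {j : Fin n} {P : Set (Index n)} (hP : ∀ p : Index n, p ∈ P ↔ shiftIdx j p ∈ P)

/-- The edges of `z_j` between summands with index in `P`. -/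
abbrev edgeSource : {a : Index n // id a ∈ P} → P := fun a => ⟨a, a.2⟩

/-- The edges of `z_j` between summands with index in `P`. -/
abbrev edgeTarget (hP : ∀ p : Index n, p ∈ P ↔ shiftIdx j p ∈ P) :
    {a : Index n // id a ∈ P} → P := fun a => ⟨shiftIdx j a, (hP a).1 a.2⟩

/-- The vectors with components in `P`, as a Hilbert sum. -/
abbrev subIdEquiv (P : Set (Index n)) :
    sub (G := fun p : Index n => M.K p.1) M.idEquiv P ≃ₗᵢ[ℂ]
      lp (fun p : P => M.K p.1.1) 2 :=
  subEquiv (G := fun p : Index n => M.K p.1) M.idEquiv P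

omit M in
lemma edgeSource_injective : Function.Injective (edgeSource (P := P)) := by
  intro a b h
  exact Subtype.ext (congrArg (fun p : P => (p : Index n)) h)

omit M in
lemma edgeTarget_injective : Function.Injective (edgeTarget hP) := by
  intro a b h
  exact Subtype.ext (shiftIdx_injective j (congrArg (fun p : P => (p : Index n)) h))

omit M in
lemma notMem_range_edgeTarget {i : P} (hi : i ∉ Set.range (edgeTarget hP)) :
    (i : Index n) ∉ Set.range (shiftIdx j) := by
  rintro ⟨a, ha⟩
  exact hi ⟨⟨a, (hP a).2 (ha ▸ i.2)⟩, Subtype.ext ha⟩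

lemma restrict_op : restrict (M.op j) (sub (G := fun p : Index n => M.K p.1) M.idEquiv P) =
    blockOp (G := fun p : P => M.K p.1.1) (M.subIdEquiv P) edgeSource (edgeTarget hP)
      (fun a => M.entry j a) := by
  rw [op_eq]
  exact restrict_blockOp (G := fun p : Index n => M.K p.1) M.idEquiv hP

-- With the next level equal to zero, the squared weight is the level at `j` itself, which a shift
-- multiplies by q⁻². The term with (1 - q²) disappears and only the factor q² remains.
include hq hq1 hP in
lemma isQNormal_restrict (hl : ∀ p ∈ P, level q (j + 1) p = 0)
    {N : Submodule ℂ M.Space} [CompleteSpace N]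
    (hN : N = sub (G := fun p : Index n => M.K p.1) M.idEquiv P) :
    IsQNormal q (restrict (M.op j) N) := by
  subst hN
  rw [M.restrict_op hP]
  refine isQNormal_blockOp (G := fun p : P => M.K p.1.1) (M.subIdEquiv P) edgeSource_injective
    (edgeTarget_injective hP) hq.ne'
    (C := fun p => ((weight q j p.1.2 ^ 2 : ℝ) : ℂ) • (M.coeff p.1.1 ∘L M.coeff p.1.1)) ?_ ?_ ?_ ?_
  · intro a x
    rw [entry_adjoint, entry_apply, entry_apply, map_smul, smul_smul, ← Complex.ofReal_mul,
      ← pow_two]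
    rfl
  · intro i hi
    exact absurd ⟨⟨i.1, i.2⟩, rfl⟩ hi
  · intro a x
    have hw : weight q j a.1.2 * weight q j a.1.2 =
        q ^ 2 * weight q j (shiftIdx j a.1).2 ^ 2 := by
      rw [← pow_two, weight_sq_shift hq hq1, weight_sq hq hq1, hl _ ((hP a).1 a.2), sub_zero,
        sub_zero]
    rw [entry_adjoint, entry_apply, entry_apply, map_smul, smul_smul, ← Complex.ofReal_mul, hw]
    change (q : ℂ) ^ 2 • ((weight q j (shiftIdx j a).2 ^ 2 : ℝ) : ℂ) • M.coeff _ (M.coeff _ x) = _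
    rw [smul_smul]
    push_cast
    rfl
  · intro i hi x
    have h1 := level_notMem_range hq (notMem_range_edgeTarget hP hi)
    rw [hl _ i.2, sub_zero, mul_eq_zero] at h1
    have h2 := h1.resolve_left (by positivity)
    change ((weight q j i.1.2 ^ 2 : ℝ) : ℂ) • M.coeff _ (M.coeff _ x) = 0
    rw [weight_sq hq hq1, hl _ i.2, h2]
    simp

include hq hq1 in
lemma isQNormal_op (hl : ∀ p : Index n, level q (j + 1) p = 0) : IsQNormal q (M.op j) := by
  rw [op_eq]
  refine isQNormal_blockOp (G := fun p : Index n => M.K p.1) M.idEquiv (s := id)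
    (t := shiftIdx j) (T := fun p => M.entry j p) Function.injective_id
    (shiftIdx_injective j) hq.ne'
    (C := fun p => ((weight q j p.2 ^ 2 : ℝ) : ℂ) • (M.coeff p.1 ∘L M.coeff p.1)) ?_ ?_ ?_ ?_
  · intro a x
    change ((weight q j a.2 ^ 2 : ℝ) : ℂ) • M.coeff a.1 (M.coeff a.1 x) =
      (M.entry j a).adjoint (M.entry j a x)
    rw [entry_adjoint, entry_apply, entry_apply, map_smul, smul_smul, ← Complex.ofReal_mul,
      ← pow_two]
  · intro i hi
    exact absurd ⟨i, rfl⟩ hi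
  · intro a x
    change (q : ℂ) ^ 2 • ((weight q j (shiftIdx j a).2 ^ 2 : ℝ) : ℂ) •
      M.coeff a.1 (M.coeff a.1 x) = M.entry j a ((M.entry j a).adjoint x)
    have hw : weight q j a.2 * weight q j a.2 = q ^ 2 * weight q j (shiftIdx j a).2 ^ 2 := by
      rw [← pow_two, weight_sq_shift hq hq1, weight_sq hq hq1, hl, sub_zero, sub_zero]
    rw [entry_adjoint, entry_apply, entry_apply, map_smul, smul_smul, smul_smul,
      ← Complex.ofReal_mul, hw]
    push_cast
    rfl
  · intro i hi x
    have h1 := level_notMem_range hq hi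
    rw [hl, sub_zero, mul_eq_zero] at h1
    have h2 := h1.resolve_left (by positivity)
    change ((weight q j i.2 ^ 2 : ℝ) : ℂ) • M.coeff _ (M.coeff _ x) = 0
    rw [weight_sq hq hq1, hl, h2]
    simp

include hq in
lemma restrict_inv_sqrt {j' : Fin n} (hl : ∀ p ∈ P, (j' : ℕ) < p.1) :
    restrict ((M.specQ j').integral (fun t => (((√t)⁻¹ : ℝ) : ℂ)) (by fun_prop))
      (sub (G := fun p : Index n => M.K p.1) M.idEquiv P) =
    diagOp (G := fun p : P => M.K p.1.1) (M.subIdEquiv P)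
      (fun p => (((√(level q j' p.1))⁻¹ : ℝ) : ℂ) • M.coeffInv p.1.1) := by
  apply pmap_ext
  intro x y
  rw [mem_graph_restrict, mem_graph_diagOp, PVM.mem_graph_integral, specQ_hasInt _ _ (by fun_prop)]
  constructor
  · intro h p
    exact (h p).unique (by fun_prop) (M.hasInt_inv_sqrt hq (hl p p.2) _)
  · intro h p
    by_cases hp : p ∈ P
    · have h1 : (y : M.Space) p = (((√(level q j' p))⁻¹ : ℝ) : ℂ) •
          M.coeffInv p.1 ((x : M.Space) p) := h ⟨p, hp⟩
      rw [h1]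
      exact M.hasInt_inv_sqrt hq (hl p hp) _
    · have h1 : (x : M.Space) p = 0 := x.2 p hp
      have h2 : (y : M.Space) p = 0 := y.2 p hp
      rw [h1, h2]
      exact PVM.hasInt_zero _ _

omit M in
lemma weight_div_level (hq : 0 < q) {p : Index n} (h : (j : ℕ) + 1 < p.1) :
    (√(level q (j + 1) p))⁻¹ * weight q j p.2 = √(q ^ (-2 * p.2.1 j) - 1) := by
  rw [level_of_lt h, tailSum_Ioi, zpow_neg_two_mul, Real.sqrt_sq (by positivity), weight,
    if_pos h]
  have : q ^ (-∑ l ∈ Finset.Ioi j, p.2.1 l) ≠ 0 := by positivity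
  field_simp

-- Dividing by the square root of the next Q cancels both A_k and the common power of q. What is
-- left is the scalar weight √(q^(-2 i_j) - 1), for which the relation is q² (q^(-2(i_j + 1)) - 1) -
-- (1 - q²) = q^(-2 i_j) - 1, and where no edge arrives i_j = 1 gives q² (q⁻² - 1) = 1 - q².
include hq hq1 hP in
lemma exists_hyperbolic {j' : Fin n} (hj : (j : ℕ) + 1 = j') (hl : ∀ p ∈ P, (j' : ℕ) < p.1)
    {N : Submodule ℂ M.Space} [CompleteSpace N]
    (hN : N = sub (G := fun p : Index n => M.K p.1) M.idEquiv P) :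
    ∃ w : N →ₗ.[ℂ] N,
      (pcomp
        (restrict ((M.specQ j').integral (fun t => (((√t)⁻¹ : ℝ) : ℂ)) (by fun_prop)) N)
        (restrict (M.op j) N)).closure = w ∧
      (pcomp
        (restrict (M.op j) N)
        (restrict ((M.specQ j').integral (fun t => (((√t)⁻¹ : ℝ) : ℂ))
          (by fun_prop)) N)).closure = w ∧
      IsQHyperbolic q w := by
  subst hN
  have hl1 : ∀ p : P, (j : ℕ) + 1 < p.1.1 := fun p => by
    have := hl p p.2
    omega
  let ω : Index n → ℂ := fun p => (√(q ^ (-2 * p.2.1 j) - 1) : ℝ)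
  have hω : ∀ p : P, ω p * ω p = ((q ^ (-2 * p.1.2.1 j) - 1 : ℝ) : ℂ) := fun p => by
    have h1 := (p.1.2.2 j).1 (hl1 p)
    rw [← Complex.ofReal_mul, Real.mul_self_sqrt]
    exact sub_nonneg.2 (one_le_zpow_neg_two hq hq1 (by omega))
  refine ⟨blockOp (G := fun p : P => M.K p.1.1) (M.subIdEquiv P) edgeSource (edgeTarget hP)
    (fun a => ω a • ContinuousLinearMap.id ℂ (M.K a.1.1)), ?_, ?_, ?_⟩
  · rw [M.restrict_op hP, M.restrict_inv_sqrt hq hl]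
    refine closure_pcomp_diagOp_blockOp _ edgeSource_injective (edgeTarget_injective hP)
      fun a x => ?_
    change (((√(level q j' (shiftIdx j a)))⁻¹ : ℝ) : ℂ) • M.coeffInv _ (M.entry j a x) = ω a • x
    rw [entry_apply, map_smul, (M.coeffInv_spec hq (by have := hl a a.2; omega)).2.1, smul_smul,
      ← hj, level_shift_lt (Nat.lt_succ_self _), ← Complex.ofReal_mul,
      weight_div_level hq (hl1 ⟨a, a.2⟩)]
  · rw [M.restrict_op hP, M.restrict_inv_sqrt hq hl]
    refine closure_pcomp_blockOp_diagOp _ edgeSource_injective (edgeTarget_injective hP)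
      fun a x => ?_
    change M.entry j a ((((√(level q j' a.1))⁻¹ : ℝ) : ℂ) • M.coeffInv _ x) = ω a • x
    rw [entry_apply, map_smul, (M.coeffInv_spec hq (by have := hl a a.2; omega)).1, smul_smul,
      ← hj, mul_comm, ← Complex.ofReal_mul, weight_div_level hq (hl1 ⟨a, a.2⟩)]
  · have hadj : ∀ p : Index n, (ω p • ContinuousLinearMap.id ℂ (M.K p.1)).adjoint =
        ω p • ContinuousLinearMap.id ℂ (M.K p.1) := fun p => by
      rw [map_smulₛₗ, Complex.conj_ofReal, ContinuousLinearMap.adjoint_id]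
    refine isQHyperbolic_blockOp (G := fun p : P => M.K p.1.1) (M.subIdEquiv P)
      edgeSource_injective (edgeTarget_injective hP) hq.ne'
      (C := fun p => ((q ^ (-2 * p.1.2.1 j) - 1 : ℝ) : ℂ) • ContinuousLinearMap.id ℂ (M.K p.1.1))
      ?_ ?_ ?_ ?_
    · intro a x
      rw [hadj]
      change ((q ^ (-2 * a.1.2.1 j) - 1 : ℝ) : ℂ) • x = ω a • ω a • x
      rw [smul_smul, hω ⟨a, a.2⟩]
    · intro i hi
      exact absurd ⟨⟨i.1, i.2⟩, rfl⟩ hi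
    · intro a x
      rw [hadj]
      change (q : ℂ) ^ 2 • ((q ^ (-2 * (shift j a.1.2).1 j) - 1 : ℝ) : ℂ) • x - _ • x =
        ω a • ω a • x
      have h1 := hl1 ⟨a, a.2⟩
      rw [smul_smul, smul_smul, hω ⟨a, a.2⟩, ← sub_smul, shift_apply_self (by
        change (j : ℕ) + 1 < a.1.1 at h1
        omega), mul_add, zpow_add₀ hq.ne']
      congr 1
      rw [show (-2 * 1 : ℤ) = -(2 : ℕ) by norm_num, zpow_neg, zpow_natCast]
      have : (q : ℂ) ≠ 0 := by exact_mod_cast hq.ne'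
      push_cast
      field_simp
      ring
    · intro i hi x
      obtain ⟨-, h2⟩ := notMem_range_shiftIdx (notMem_range_edgeTarget hP hi)
      change (q : ℂ) ^ 2 • ((q ^ (-2 * i.1.2.1 j) - 1 : ℝ) : ℂ) • x = _
      rw [h2, smul_smul]
      congr 1
      rw [show (-2 * 1 : ℤ) = -(2 : ℕ) by norm_num, zpow_neg, zpow_natCast]
      have : (q : ℂ) ≠ 0 := by exact_mod_cast hq.ne'
      push_cast
      field_simp

end Restrict

include hq hq1

lemma spectralConditions : SpectralConditions q M.op M.dom M.specQ where
  eq_integral := M.Q_eq_integral hq hq1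
  commute j k s t hs ht := by
    refine ContinuousLinearMap.ext fun x => lp.ext (funext fun p => ?_)
    change (M.specQ j).proj s ((M.specQ k).proj t x) p = (M.specQ k).proj t ((M.specQ j).proj s x) p
    simp only [specQ, sumPVM_proj _ hs, sumPVM_proj _ ht]
    exact PVM.proj_comm (measurable_levelMap j p hs) (measurable_levelMap k p ht) _
  proj_mem j s hs x hx := by
    refine Set.Finite.subset hx fun p hp h => hp ?_
    simp only [specQ, sumPVM_proj _ hs]
    rw [h, map_zero]
  rel_lt f hf hb j k hjk := by
    have h : ∀ p : Index n, ∀ t, levelMap q k (shiftIdx j p) t = levelMap q k p t := fun p t => by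
      simp only [levelMap]
      rw [level_shift_lt hjk]
    exact ⟨M.pcomp_specQ_op_le k j hf hf hb fun p => Or.inr fun t => by rw [h],
      M.pcomp_specQ_adjoint_le k j hf hf hb fun p => Or.inr fun t => by rw [h]⟩
  rel_ge f hf hb j k hkj := by
    have h : ∀ p : Index n, weight q j p.2 = 0 ∨
        ∀ t, levelMap q k p t = q ^ 2 * levelMap q k (shiftIdx j p) t := fun p => by
      rcases lt_or_ge (j : ℕ) p.1 with hj | hj
      · right
        intro t
        rw [levelMap, levelMap, level_shift_le hq hkj hj]
        ring
      · exact Or.inl (weight_of_le hj)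
    obtain ⟨C, hC⟩ := hb
    refine ⟨M.pcomp_specQ_op_le k j hf _ ⟨C, fun t => hC _⟩ fun p => (h p).imp id fun h t => ?_,
      M.pcomp_specQ_adjoint_le k j hf _ ⟨C, fun t => hC _⟩ fun p => (h p).imp id fun h t => ?_⟩
    · rw [h, inv_mul_cancel_left₀ (by positivity)]
    · rw [h]
  hyperbolic j j' k hj hjk := by
    have hN : (kernel (Q M.op M.dom k))ᗮ =
        sub (G := fun p : Index n => M.K p.1) M.idEquiv {p | p.1 ∈ Set.Iic k.castSucc}ᶜ := by
      rw [M.kernel_Q hq hq1, sub_idEquiv_part, sub_orthogonal]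
    refine M.exists_hyperbolic hq hq1 (P := {p | p.1 ∈ Set.Iic k.castSucc}ᶜ) (fun p => Iff.rfl)
      hj (fun p hp => ?_) hN
    have h1 : (k : ℕ) < p.1 := by simpa [Fin.lt_def] using hp
    have h2 := Fin.lt_def.1 hjk
    omega

/-- Every model is a well-behaved representation. -/
lemma isWellBehaved : IsWellBehaved q M.op M.dom where
  toIsStarRep := M.isStarRep hq hq1
  core j := by
    have h := M.dom_le_domain (M.op_single j)
    rw [op_eq] at h ⊢
    exact blockOp_hasCore (G := fun p : Index n => M.K p.1) M.idEquiv (s := id)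
      (t := shiftIdx j) Function.injective_id (shiftIdx_injective j) h
      fun p h => M.single_mem_dom p.2 h
  core_adjoint j := by
    have h := M.dom_le_domain (M.op_adjoint_single_value j)
    rw [op_adjoint_eq] at h ⊢
    exact blockOp_hasCore (G := fun p : Index n => M.K p.1) M.idEquiv (s := shiftIdx j)
      (t := id) (shiftIdx_injective j) Function.injective_id h
      fun p h => M.single_mem_dom p.2 h
  isSelfAdjoint_Q := M.isSelfAdjoint_Q hq hq1
  exists_spectral := ⟨_, M.spectralConditions hq hq1⟩
  qnormal_last j hj := M.isQNormal_op hq hq1 fun p => level_of_le (by omega)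
  qnormal_kernel j j' hj := by
    let : CompleteSpace (kernel (Q M.op M.dom j')) :=
      kernel_complete (M.isSelfAdjoint_Q hq hq1 j').isClosed
    refine M.isQNormal_restrict (P := {p | p.1 ∈ Set.Iic j'.castSucc}) hq hq1
      (fun p => Iff.rfl) (fun p hp => level_of_le ?_) (M.kernel_Q hq hq1 j')
    have : (p.1 : ℕ) ≤ j' := by simpa [Fin.le_def] using hp
    omega

omit hq hq1

lemma reduces_part (S : Set (Fin (n + 1))) (j : Fin n) :
    Reduces (M.part S) (M.op j) ∧ Reduces (M.part S) (M.op j).adjoint := by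
  constructor
  · rw [op_eq]
    exact reduces_blockOp (G := fun p : Index n => M.K p.1) M.idEquiv (P := {p | p.1 ∈ S})
      fun p => Iff.rfl
  · rw [op_adjoint_eq]
    exact reduces_blockOp (G := fun p : Index n => M.K p.1) M.idEquiv (P := {p | p.1 ∈ S})
      fun p => Iff.rfl

end Model

/-! ### Invariant subspaces and reducing projections -/

section Scalar

variable {H : Type u} [NormedAddCommGroup H] [InnerProductSpace ℂ H] [CompleteSpace H]

/-- A self-adjoint operator without non-trivial closed invariant subspaces is a scalar. -/
lemma eq_smul_one_of_invariant {A : H →L[ℂ] H} (hA : IsSelfAdjoint A)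
    (h : ∀ N : Submodule ℂ H, IsClosed (N : Set H) → (∀ x ∈ N, A x ∈ N) → N = ⊥ ∨ N = ⊤) :
    ∃ c : ℝ, A = (c : ℂ) • (1 : H →L[ℂ] H) := by
  have hs : (spectrum ℝ A).Subsingleton := by
    have key : ∀ s ∈ spectrum ℝ A, ∀ t ∈ spectrum ℝ A, ¬ s < t := by
      intro s hs t ht hst
      -- Two spectral points are separated by functions with product zero, one non-zero at `s`, the
      -- other at `t`. The kernel of f(A) is closed and invariant, contains the range of g(A) ≠ 0,
      -- and is proper because f(A) ≠ 0.
      let f : ℝ → ℝ := fun x => max ((s + t) / 2 - x) 0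
      let g : ℝ → ℝ := fun x => max (x - (s + t) / 2) 0
      have hf : Continuous f := by fun_prop
      have hg : Continuous g := by fun_prop
      have hfg : cfc f A * cfc g A = 0 := by
        rw [← cfc_mul f g A hf.continuousOn hg.continuousOn]
        have : (fun x => f x * g x) = fun _ => 0 := by
          funext x
          simp only [f, g]
          rcases le_total x ((s + t) / 2) with hx | hx
          · rw [max_eq_right (sub_nonpos.2 hx), mul_zero]
          · rw [max_eq_right (sub_nonpos.2 hx), zero_mul]
        rw [this]
        exact cfc_const_zero ℝ A
      have hcomm : Commute (cfc f A) A := by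
        have := cfc_commute_cfc f id A
        rwa [cfc_id ℝ A] at this
      have hne : ∀ φ : ℝ → ℝ, Continuous φ → ∀ r ∈ spectrum ℝ A, φ r ≠ 0 → cfc φ A ≠ 0 := by
        intro φ hφ r hr hr0 h0
        have h1 := cfc_map_spectrum (R := ℝ) φ A (hf := hφ.continuousOn)
        have h2 : φ r ∈ spectrum ℝ (cfc φ A) := h1 ▸ ⟨r, hr, rfl⟩
        rw [h0] at h2
        refine (spectrum.mem_iff.1 h2) ?_
        rw [sub_zero]
        exact (IsUnit.mk0 _ hr0).map _
      have hf0 := hne f hf s hs (by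
        have : 0 < (s + t) / 2 - s := by linarith
        simp only [f]
        rw [max_eq_left this.le]
        exact this.ne')
      have hg0 := hne g hg t ht (by
        have : 0 < t - (s + t) / 2 := by linarith
        simp only [g]
        rw [max_eq_left this.le]
        exact this.ne')
      rcases h (LinearMap.ker ((cfc f A : H →L[ℂ] H) : H →ₗ[ℂ] H)) (ContinuousLinearMap.isClosed_ker (cfc f A)) (fun x hx => by
        have h1 : (cfc f A) x = 0 := hx
        have h2 : (cfc f A) (A x) = A (cfc f A x) := congrArg (fun T : H →L[ℂ] H => T x) hcomm.eq
        change (cfc f A) (A x) = 0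
        rw [h2, h1, map_zero]) with h1 | h1
      · refine hg0 (ContinuousLinearMap.ext fun x => ?_)
        have : cfc g A x ∈ LinearMap.ker ((cfc f A : H →L[ℂ] H) : H →ₗ[ℂ] H) :=
          congrArg (fun T : H →L[ℂ] H => T x) hfg
        rw [h1] at this
        exact this
      · refine hf0 (ContinuousLinearMap.ext fun x => ?_)
        have : x ∈ LinearMap.ker ((cfc f A : H →L[ℂ] H) : H →ₗ[ℂ] H) := h1 ▸ Submodule.mem_top
        exact this
    intro s hs t ht
    exact le_antisymm (not_lt.1 (key t ht s hs)) (not_lt.1 (key s hs t ht))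
  obtain ⟨c, hc⟩ : ∃ c : ℝ, ∀ s ∈ spectrum ℝ A, s = c := by
    rcases (spectrum ℝ A).eq_empty_or_nonempty with h0 | ⟨c, hc⟩
    · exact ⟨0, by simp [h0]⟩
    · exact ⟨c, fun s hs' => hs hs' hc⟩
  refine ⟨c, ?_⟩
  have hid := cfc_id ℝ A
  rw [cfc_congr (f := id) (g := fun _ => c) (fun s hs => hc s hs), cfc_const c A,
    Algebra.algebraMap_eq_smul_one] at hid
  rw [← hid]
  ext x
  simp

omit [CompleteSpace H] in
lemma Reduces.starProjection_mem {N : Submodule ℂ H} {T : H →ₗ.[ℂ] H} [N.HasOrthogonalProjection] (h : Reduces N T) {x y : H}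
    (hxy : (x, y) ∈ T.graph) : (N.starProjection x, N.starProjection y) ∈ T.graph := by
  obtain ⟨a, ha, b, hb, h1, h2, h3⟩ := h.2 x y hxy
  rwa [Submodule.eq_starProjection_of_mem_orthogonal ha h1,
    Submodule.eq_starProjection_of_mem_orthogonal hb h2]

lemma starProjection_commute {N : Submodule ℂ H} [N.HasOrthogonalProjection] {A : H →L[ℂ] H}
    (hA : A.adjoint = A) (hN : ∀ x ∈ N, A x ∈ N) (x : H) :
    N.starProjection (A x) = A (N.starProjection x) := by
  refine Submodule.eq_starProjection_of_mem_orthogonal (hN _ (N.starProjection_apply_mem x))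
    fun y hy => ?_
  rw [← map_sub, ← hA, ContinuousLinearMap.adjoint_inner_right]
  exact (N.sub_starProjection_mem_orthogonal x) _ (hN y hy)

end Scalar

/-! ### Irreducibility of models -/

namespace Model

variable {n : ℕ} {q : ℝ} (M : Model.{u} n q)

/-- The vectors with components in given subspaces of the `K_k`. -/
def sumOf (N : ∀ k, Submodule ℂ (M.K k)) : Submodule ℂ M.Space where
  carrier := {f | ∀ p : Index n, f p ∈ N p.1}
  zero_mem' := fun p => (N p.1).zero_mem
  add_mem' := fun hf hg p => (N p.1).add_mem (hf p) (hg p)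
  smul_mem' := fun c _ hf p => (N p.1).smul_mem c (hf p)

/-- The projection acts componentwise. It commutes with the entries because a self-adjoint operator
preserving a closed subspace commutes with the projection onto it, so it maps the graph of z_j,
described by componentwise equations, into itself. -/
lemma reduces_sumOf {N : ∀ k, Submodule ℂ (M.K k)} (hc : ∀ k, IsClosed (N k : Set (M.K k)))
    (hN : ∀ k, ∀ x ∈ N k, M.coeff k x ∈ N k) (j : Fin n) :
    Reduces (M.sumOf N) (M.op j) ∧ Reduces (M.sumOf N) (M.op j).adjoint := by
  have inst : ∀ k, CompleteSpace (N k) := fun k => (hc k).completeSpace_coe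
  let R : M.Space → M.Space := fun f => ⟨fun p => (N p.1).starProjection (f p),
    (lp.memℓp f).mono' fun p => (N p.1).norm_starProjection_apply_le _⟩
  have hR : ∀ f p, R f p = (N p.1).starProjection (f p) := fun _ _ => rfl
  have hmem : ∀ f, R f ∈ M.sumOf N := fun f p => (N p.1).starProjection_apply_mem _
  have horth : ∀ f, f - R f ∈ (M.sumOf N)ᗮ := fun f g hg => by
    have h1 := lp.hasSum_inner (𝕜 := ℂ) g (f - R f)
    refine h1.unique ?_
    convert hasSum_zero with p
    exact (N p.1).sub_starProjection_mem_orthogonal (f p) _ (hg p)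
  have hcl : IsClosed (M.sumOf N : Set M.Space) := by
    have : (M.sumOf N : Set M.Space) = ⋂ p : Index n, {f | f p ∈ N p.1} := by
      ext f
      simp only [Set.mem_iInter]
      rfl
    rw [this]
    exact isClosed_iInter fun p => (hc p.1).preimage
      (continuous_coord (G := fun p : Index n => M.K p.1) M.idEquiv p)
  have hcomm : ∀ p : Index n, ∀ x, (N p.1).starProjection (M.entry j p x) =
      M.entry j p ((N p.1).starProjection x) := fun p x => by
    rw [entry_apply, entry_apply, map_smul, starProjection_commute (M.coeff_adjoint _) (hN _)]
  constructor
  · refine ⟨hcl, fun x y hxy => ⟨R x, hmem x, R y, hmem y, horth x, horth y, ?_⟩⟩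
    rw [op_eq, mem_graph_blockOp] at hxy ⊢
    refine ⟨fun p => ?_, fun p hp => ?_⟩
    · have h1 : y (shiftIdx j p) = M.entry j p (x p) := hxy.1 p
      change (N p.1).starProjection (y (shiftIdx j p)) = M.entry j p ((N p.1).starProjection (x p))
      rw [h1, hcomm]
    · have h1 : y p = 0 := hxy.2 p hp
      change (N p.1).starProjection (y p) = 0
      rw [h1, map_zero]
  · refine ⟨hcl, fun x y hxy => ⟨R x, hmem x, R y, hmem y, horth x, horth y, ?_⟩⟩
    rw [op_adjoint_eq, mem_graph_blockOp] at hxy ⊢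
    refine ⟨fun p => ?_, fun p hp => absurd ⟨p, rfl⟩ hp⟩
    have h1 : y p = M.entry j p (x (shiftIdx j p)) := hxy.1 p
    change (N p.1).starProjection (y p) =
      M.entry j p ((N p.1).starProjection (x (shiftIdx j p)))
    rw [h1, hcomm]

lemma single_apply_self (p : Index n) (h : M.K p.1) : M.single p.2 h p = h :=
  coord_bsingle_self (G := fun p : Index n => M.K p.1) M.idEquiv p h

lemma single_apply_ne {p r : Index n} (hr : r ≠ p) (h : M.K p.1) : M.single p.2 h r = 0 :=
  coord_bsingle_ne (G := fun p : Index n => M.K p.1) M.idEquiv hr h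

/-- A non-zero vector singles out some `k`, and then the reducing subspace H_k must be everything.
Closed subspaces of K_k invariant under the coefficient operator also give reducing subspaces, so
that operator is a scalar. -/
lemma finrank_eq_one_of_isIrreducible (h : IsIrreducible M.op) :
    ∃ k : Fin (n + 1), (∀ l, l ≠ k → Subsingleton (M.K l)) ∧ Module.finrank ℂ (M.K k) = 1 := by
  obtain ⟨hnt, hred⟩ := h
  obtain ⟨f, hf⟩ := exists_ne (0 : M.Space)
  obtain ⟨p, hp⟩ : ∃ p, f p ≠ 0 := by
    by_contra! hcon
    exact hf (lp.ext (funext hcon))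
  obtain ⟨k, i⟩ := p
  refine ⟨k, ?_, ?_⟩
  · have h1 := (hred (M.part {k}) (M.reduces_part {k})).resolve_left fun hbot => by
      have h2 : M.single i (f ⟨k, i⟩) ∈ M.part {k} := fun r hr => M.single_apply_ne (p := ⟨k, i⟩)
        (by rintro rfl; exact hr rfl) _
      rw [hbot, Submodule.mem_bot] at h2
      refine hp ?_
      rw [← M.single_apply_self ⟨k, i⟩ (f ⟨k, i⟩)]
      change M.single i (f ⟨k, i⟩) ⟨k, i⟩ = 0
      rw [h2]
      rfl
    intro l hl
    refine subsingleton_of_forall_eq 0 fun x => ?_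
    have h2 : M.single (baseIndex l) x ∈ M.part {k} := h1 ▸ Submodule.mem_top
    have h3 := h2 ⟨l, baseIndex l⟩ hl
    rwa [M.single_apply_self ⟨l, baseIndex l⟩] at h3
  · have key : ∀ N : Submodule ℂ (M.K k), IsClosed (N : Set (M.K k)) →
        (∀ x ∈ N, M.coeff k x ∈ N) → N = ⊥ ∨ N = ⊤ := by
      intro N hc hN
      classical
      let N' : ∀ l, Submodule ℂ (M.K l) := Function.update (fun _ => ⊤) k N
      have hk : N' k = N := Function.update_self ..
      have hl : ∀ l, l ≠ k → N' l = ⊤ := fun l hl => Function.update_of_ne hl ..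
      have hc' : ∀ l, IsClosed (N' l : Set (M.K l)) := by
        intro l
        by_cases h : l = k
        · subst h; rwa [hk]
        · rw [hl l h]; exact isClosed_univ
      have hN' : ∀ l, ∀ x ∈ N' l, M.coeff l x ∈ N' l := by
        intro l
        by_cases h : l = k
        · subst h; rwa [hk]
        · rw [hl l h]; simp
      rcases hred (M.sumOf N') (M.reduces_sumOf hc' hN') with h1 | h1
      · left
        rw [eq_bot_iff]
        intro x hx
        have h2 : M.single i x ∈ M.sumOf N' := by
          intro r
          by_cases hr : r = ⟨k, i⟩
          · subst hr
            rw [M.single_apply_self ⟨k, i⟩, hk]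
            exact hx
          · rw [M.single_apply_ne (p := ⟨k, i⟩) hr]
            exact Submodule.zero_mem _
        rw [h1, Submodule.mem_bot] at h2
        rw [Submodule.mem_bot, ← M.single_apply_self ⟨k, i⟩ x]
        change M.single i x ⟨k, i⟩ = 0
        rw [h2]
        rfl
      · right
        rw [eq_top_iff]
        intro x _
        have h2 : M.single i x ∈ M.sumOf N' := h1 ▸ Submodule.mem_top
        have h3 := h2 ⟨k, i⟩
        rwa [M.single_apply_self ⟨k, i⟩, hk] at h3
    obtain ⟨c, hc⟩ := eq_smul_one_of_invariant (M.coeff_isSelfAdjoint k) key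
    -- A scalar preserves every line, so the line through a non-zero vector is already all of K_k.
    have h1 : Submodule.span ℂ {f ⟨k, i⟩} = ⊤ := by
      refine (key _ (Submodule.closed_of_finiteDimensional _) fun x hx => ?_).resolve_left ?_
      · rw [hc]
        exact Submodule.smul_mem _ _ hx
      · rw [Submodule.span_singleton_eq_bot]
        exact hp
    rw [← finrank_top, ← h1]
    exact finrank_span_singleton hp

lemma coeff_scalar {k : Fin n} (h : Module.finrank ℂ (M.K k.succ) = 1) :
    ∃ a : ℝ, q < a ∧ a ≤ 1 ∧ M.A k = (a : ℂ) • ContinuousLinearMap.id ℂ (M.K k.succ) := by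
  obtain ⟨v, hv, hw⟩ := finrank_eq_one_iff'.1 h
  obtain ⟨c, hc⟩ := hw (M.A k v)
  have hs : c ∈ spectrum ℂ (M.A k) := by
    rw [spectrum.mem_iff]
    rintro ⟨u, hu⟩
    have h1 : (u : M.K k.succ →L[ℂ] M.K k.succ) v = 0 := by
      rw [hu]
      change (algebraMap ℂ (M.K k.succ →L[ℂ] M.K k.succ) c) v - M.A k v = 0
      rw [← hc, Algebra.algebraMap_eq_smul_one]
      exact sub_self _
    have h2 : (↑u⁻¹ * ↑u : M.K k.succ →L[ℂ] M.K k.succ) v = 0 := by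
      change (↑u⁻¹ : M.K k.succ →L[ℂ] M.K k.succ) ((u : M.K k.succ →L[ℂ] M.K k.succ) v) = 0
      rw [h1, map_zero]
    rw [Units.inv_mul] at h2
    exact hv h2
  obtain ⟨a, ha, rfl⟩ := M.spectrum_subset k hs
  refine ⟨a, lt_of_le_of_ne ha.1 ?_, ha.2, ?_⟩
  · rintro rfl
    exact hv (M.not_eigenvalue k v hc.symm)
  · ext w
    obtain ⟨d, rfl⟩ := hw w
    rw [map_smul, ← hc]
    change d • (a : ℂ) • v = (a : ℂ) • d • v
    rw [smul_comm]

omit M in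
-- Sums of squared weights are the levels q^(-2 N_l), which determine the tail sums N_l and hence,
-- by differences, the entries.
lemma eq_of_weight_sq (hq : 0 < q) (hq1 : q < 1) {k : Fin (n + 1)} {i i' : MultiIndex n k}
    (h : ∀ j : Fin n, (j : ℕ) < k → weight q j i ^ 2 = weight q j i' ^ 2) : i = i' := by
  have h0 : ∀ j : Fin n, weight q j i ^ 2 = weight q j i' ^ 2 := by
    intro j
    rcases lt_or_ge (j : ℕ) k with hj | hj
    · exact h j hj
    · rw [weight_of_le (p := ⟨k, i⟩) hj, weight_of_le (p := ⟨k, i'⟩) hj]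
  have h1 : ∀ l : ℕ, tailSum l i.1 = tailSum l i'.1 := by
    intro l
    rcases lt_or_ge l k with hl | hl
    · have hln : l < n := by omega
      have e1 := sum_weight_sq hq hq1 ⟨l, hln⟩ ⟨k, i⟩
      have e2 := sum_weight_sq hq hq1 ⟨l, hln⟩ ⟨k, i'⟩
      rw [level_of_lt hl] at e1 e2
      have e3 : q ^ (-2 * tailSum l i.1) = q ^ (-2 * tailSum l i'.1) := by
        rw [← e1, ← e2]
        exact Finset.sum_congr rfl fun j _ => h0 j
      have := zpow_right_injective₀ hq hq1.ne e3
      omega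
    · have hz : ∀ r : MultiIndex n k, tailSum l r.1 = 0 := fun r =>
        Finset.sum_eq_zero fun (m : Fin n) hm => (r.2 m).2 (by
          have := (Finset.mem_filter.1 hm).2
          omega)
      rw [hz, hz]
  apply Subtype.ext
  funext j
  have e1 := tailSum_eq j i.1
  have e2 := tailSum_eq j i'.1
  rw [h1] at e1
  rw [h1 (j + 1)] at e1
  omega

lemma isIrreducible_of_finrank_eq_one (hn : 1 ≤ n) (hq : 0 < q) (hq1 : q < 1) {k : Fin (n + 1)}
    (hk : ∀ l, l ≠ k → Subsingleton (M.K l)) (h1 : Module.finrank ℂ (M.K k) = 1) :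
    IsIrreducible M.op := by
  obtain ⟨v, hv, hw⟩ := finrank_eq_one_iff'.1 h1
  obtain ⟨a, ha⟩ := hw (M.coeff k v)
  have ha0 : 0 < (k : ℕ) → a ≠ 0 := by
    rintro hk0 rfl
    rw [zero_smul] at ha
    exact hv (M.coeff_eq_zero hq hk0 ha.symm)
  have hav : ∀ c : ℂ, M.coeff k (c • v) = (a * c) • v := fun c => by
    rw [map_smul, ← ha, smul_smul, mul_comm]
  refine ⟨⟨⟨M.single (baseIndex k) v, 0, fun h => hv ?_⟩⟩, fun N hN => ?_⟩
  · have := M.single_apply_self ⟨k, baseIndex k⟩ v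
    change M.single (baseIndex k) v ⟨k, baseIndex k⟩ = v at this
    rw [h] at this
    exact this.symm
  -- Closedness of `N` is read off from its reducing the first generator, which exists as n ≥ 1.
  have hcl : IsClosed (N : Set M.Space) := (hN ⟨0, hn⟩).1.1
  have : CompleteSpace N := hcl.completeSpace_coe
  let e : MultiIndex n k → M.Space := fun i => M.single i v
  have hcoord : ∀ x : M.Space, ∀ r : MultiIndex n k, ∃ c : ℂ, x ⟨k, r⟩ = c • v := fun x r => by
    obtain ⟨c, hc⟩ := hw (x ⟨k, r⟩)
    exact ⟨c, hc.symm⟩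
  choose F hF using fun p : MultiIndex n k => hcoord (N.starProjection (e p))
  have hinj : ∀ {c d : ℂ}, c • v = d • v → c = d := fun h => smul_left_injective ℂ hv h
  -- `r1` and `r2` express that the projection onto `N` commutes with z_j and z_j*, in terms of its
  -- matrix entries `F p r`. The common factor `a` is non-zero for k ≥ 1 and is cancelled.
  have r1 : ∀ (j : Fin n) (p r : MultiIndex n k), (j : ℕ) < k →
      (weight q j p : ℂ) * F (shift j p) (shift j r) = weight q j r * F p r := by
    intro j p r hj
    have h2 := (hN j).1.starProjection_mem (M.op_single j ⟨k, p⟩ v)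
    rw [op_eq, mem_graph_blockOp, map_smul] at h2
    have h3 : (weight q j p : ℂ) • N.starProjection (M.single (shift j p) (M.coeff k v))
        ⟨k, shift j r⟩ = M.entry j ⟨k, r⟩ (N.starProjection (e p) ⟨k, r⟩) := h2.1 ⟨k, r⟩
    rw [← ha, map_smul, map_smul, entry_apply, hF] at h3
    change (weight q j p : ℂ) • a • (N.starProjection (e (shift j p)) ⟨k, shift j r⟩) =
      (weight q j r : ℂ) • M.coeff k (F p r • v) at h3
    rw [hF, hav, smul_smul, smul_smul, smul_smul] at h3
    have h4 := hinj h3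
    have := ha0 (by omega)
    refine mul_left_cancel₀ this ?_
    linear_combination h4
  have r2 : ∀ (j : Fin n) (p r : MultiIndex n k), (j : ℕ) < k →
      (weight q j p : ℂ) * F p r = weight q j r * F (shift j p) (shift j r) := by
    intro j p r hj
    have h2 := (hN j).2.starProjection_mem (M.op_adjoint_single j ⟨k, p⟩ v)
    rw [op_adjoint_eq, mem_graph_blockOp, map_smul] at h2
    have h3 : (weight q j p : ℂ) • N.starProjection (M.single p (M.coeff k v))
        ⟨k, r⟩ = M.entry j ⟨k, r⟩ (N.starProjection (e (shift j p)) ⟨k, shift j r⟩) := h2.1 ⟨k, r⟩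
    rw [← ha, map_smul, map_smul, entry_apply, hF] at h3
    change (weight q j p : ℂ) • a • (N.starProjection (e p) ⟨k, r⟩) =
      (weight q j r : ℂ) • M.coeff k (F (shift j p) (shift j r) • v) at h3
    rw [hF, hav, smul_smul, smul_smul, smul_smul] at h3
    have h4 := hinj h3
    have := ha0 (by omega)
    refine mul_left_cancel₀ this ?_
    linear_combination h4
  -- Combining both relations, the entry at (p, r) is multiplied by the squared weight at `p` and by
  -- that at `r` with the same result, for each `j`; a non-zero entry thus forces equal squares.
  have hdiag : ∀ p r : MultiIndex n k, p ≠ r → F p r = 0 := by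
    intro p r hpr
    by_contra h0
    refine hpr (eq_of_weight_sq hq hq1 fun j hj => ?_)
    have e1 := r1 j p r hj
    have e2 := r2 j p r hj
    have e3 : ((weight q j p : ℂ)) ^ 2 = (weight q j r : ℂ) ^ 2 := by
      refine mul_right_cancel₀ h0 ?_
      linear_combination (weight q j p : ℂ) * e2 + (weight q j r : ℂ) * e1
    exact_mod_cast e3
  have hproj : ∀ p : MultiIndex n k, N.starProjection (e p) = F p p • e p := by
    intro p
    refine lp.ext (funext fun r => ?_)
    by_cases hr : r.1 = k
    · obtain ⟨l, r⟩ := r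
      obtain rfl : l = k := hr
      rw [hF]
      by_cases hpr : p = r
      · subst hpr
        change _ = F p p • M.single p v ⟨l, p⟩
        rw [M.single_apply_self ⟨l, p⟩]
      · rw [hdiag p r hpr, zero_smul]
        change _ = F p p • M.single p v ⟨l, r⟩
        rw [M.single_apply_ne (p := ⟨l, p⟩) (fun h => hpr (eq_of_heq (Sigma.mk.inj h).2).symm),
          smul_zero]
    · have := hk _ hr
      exact Subsingleton.elim _ _
  -- On the diagonal `r1` has the same non-zero weight on both sides, so a shift does not change the
  -- entry, and the projection is a multiple of the identity.
  have hconst : ∀ p : MultiIndex n k, F p p = F (baseIndex k) (baseIndex k) := by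
    refine multiIndex_induction (b := baseIndex k) (fun l => rfl) rfl fun j hj i => ?_
    have hpos : (weight q j i : ℂ) ≠ 0 := by
      exact_mod_cast (weight_pos hq hq1 (p := ⟨k, i⟩) hj).ne'
    rw [mul_left_cancel₀ hpos (r1 j i i hj)]
  have hall : ∀ p : MultiIndex n k, N.starProjection (e p) =
      F (baseIndex k) (baseIndex k) • e p := fun p => by rw [hproj, hconst]
  have hsingle : ∀ (p : Index n) (h : M.K p.1), N.starProjection (M.single p.2 h) =
      F (baseIndex k) (baseIndex k) • M.single p.2 h := by
    rintro ⟨l, p⟩ h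
    by_cases hl : l = k
    · subst hl
      obtain ⟨c, rfl⟩ := hw h
      change N.starProjection (M.single p (c • v)) = _ • M.single p (c • v)
      rw [map_smul, map_smul, smul_comm]
      exact congrArg (c • ·) (hall p)
    · have := hk _ hl
      rw [Subsingleton.elim h 0]
      change N.starProjection (M.single p 0) = _ • M.single p 0
      rw [map_zero, map_zero, smul_zero]
  have hglobal : ∀ x : M.Space, N.starProjection x = F (baseIndex k) (baseIndex k) • x := by
    intro x
    have e1 : HasSum (fun p : Index n => M.single p.2 (x p)) x := hasSum_bsingle M.idEquiv x
    have e2 := e1.mapL N.starProjection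
    simp only [hsingle] at e2
    exact e2.unique (e1.const_smul _)
  by_cases h0 : F (baseIndex k) (baseIndex k) = 0
  · left
    rw [eq_bot_iff]
    intro x hx
    rw [← N.starProjection_eq_self_iff.2 hx, hglobal, h0, zero_smul]
    exact Submodule.zero_mem _
  · right
    rw [eq_top_iff]
    intro x _
    have := N.starProjection_apply_mem x
    rw [hglobal] at this
    exact (N.smul_mem_iff h0).1 this

end Model

/-! ### A partition of the half-line adapted to scaling by `q²` -/

section Slices

variable {q : ℝ}

/-- The real number `θ` with `t = q^(-2θ)` for `t > 0`. -/
def qlog (q t : ℝ) : ℝ := Real.log t / (-2 * Real.log q)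

/-- The partition of `[0, ∞)` into `{0}` and the intervals `(q^(2-2N), q^(-2N)]`. -/
def slice (q : ℝ) : Option ℤ → Set ℝ
  | none => {0}
  | some N => {t | 0 < t ∧ ⌈qlog q t⌉ = N}

/-- The function with `t = q^(-2N) (phase q t)²` for `t ∈ (q^(2-2N), q^(-2N)]`. -/
def phase (q t : ℝ) : ℝ := q ^ ((⌈qlog q t⌉ : ℝ) - qlog q t)

lemma measurable_qlog : Measurable (qlog q) := by unfold qlog; fun_prop

lemma measurable_phase (hq : 0 < q) : Measurable (phase q) := by
  have h1 : Measurable fun t => (⌈qlog q t⌉ : ℝ) - qlog q t :=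
    (measurable_from_top.comp (Int.measurable_ceil.comp measurable_qlog)).sub measurable_qlog
  have h2 : Continuous fun t : ℝ => q ^ t := Real.continuous_const_rpow hq.ne'
  exact h2.measurable.comp h1

lemma measurableSet_slice (o : Option ℤ) : MeasurableSet (slice q o) := by
  cases o with
  | none => exact measurableSet_singleton 0
  | some N =>
    exact measurableSet_Ioi.inter
      ((Int.measurable_ceil.comp measurable_qlog) (measurableSet_singleton N))

lemma disjoint_slice {o o' : Option ℤ} (h : o ≠ o') : Disjoint (slice q o) (slice q o') := by
  rw [Set.disjoint_left]
  intro t h1 h2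
  cases o with
  | none =>
    cases o' with
    | none => exact h rfl
    | some N =>
      have h3 : t = 0 := h1
      exact h2.1.ne' h3
  | some N =>
    cases o' with
    | none =>
      have h3 : t = 0 := h2
      exact h1.1.ne' h3
    | some N' => exact h (congrArg some (h1.2.symm.trans h2.2))

lemma iUnion_slice : ⋃ o, slice q o = Set.Ici 0 := by
  ext t
  simp only [Set.mem_iUnion, Set.mem_Ici]
  constructor
  · rintro ⟨o, ho⟩
    cases o with
    | none => exact (show t = 0 from ho).ge
    | some N => exact ho.1.le
  · intro h
    rcases h.eq_or_lt with h | h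
    · exact ⟨none, h.symm⟩
    · exact ⟨some _, h, rfl⟩

section

variable (hq : 0 < q) (hq1 : q < 1)

include hq hq1

lemma qlog_mul {t : ℝ} (ht : t ≠ 0) : qlog q (q ^ 2 * t) = qlog q t - 1 := by
  have hl : Real.log q ≠ 0 := (Real.log_neg hq hq1).ne
  rw [qlog, qlog, Real.log_mul (by positivity) ht, Real.log_pow]
  field_simp
  push_cast
  ring

lemma mem_slice_map_add_one {o : Option ℤ} {t : ℝ} :
    t ∈ slice q (o.map (· + 1)) ↔ q ^ 2 * t ∈ slice q o := by
  cases o with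
  | none =>
    change t = 0 ↔ q ^ 2 * t = 0
    simp [hq.ne']
  | some N =>
    change (0 < t ∧ ⌈qlog q t⌉ = N + 1) ↔ (0 < q ^ 2 * t ∧ ⌈qlog q (q ^ 2 * t)⌉ = N)
    have : 0 < q ^ 2 * t ↔ 0 < t := by
      rw [mul_pos_iff_of_pos_left (by positivity)]
    rw [this]
    refine and_congr_right fun ht => ?_
    rw [qlog_mul hq hq1 ht.ne', Int.ceil_sub_one]
    omega

/-- Scaling by q² changes the exponent and its ceiling by the same integer. This invariance is what
makes the coefficient operator commute with the generators. -/
lemma phase_mul (t : ℝ) : phase q (q ^ 2 * t) = phase q t := by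
  rcases eq_or_ne t 0 with rfl | ht
  · rw [mul_zero]
  · rw [phase, phase, qlog_mul hq hq1 ht, Int.ceil_sub_one]
    congr 1
    push_cast
    ring

lemma lt_phase (t : ℝ) : q < phase q t := by
  conv_lhs => rw [← Real.rpow_one q]
  refine Real.rpow_lt_rpow_of_exponent_gt hq hq1 ?_
  have := Int.ceil_lt_add_one (qlog q t)
  linarith

lemma phase_le_one (t : ℝ) : phase q t ≤ 1 := by
  refine Real.rpow_le_one hq.le hq1.le ?_
  have := Int.le_ceil (qlog q t)
  linarith

lemma phase_sq {N : ℤ} {t : ℝ} (ht : t ∈ slice q (some N)) :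
    q ^ (-2 * N) * phase q t ^ 2 = t := by
  obtain ⟨h0, hN⟩ := ht
  have hl : Real.log q ≠ 0 := (Real.log_neg hq hq1).ne
  have h1 : q ^ (-2 * N) = q ^ (-2 * (N : ℝ)) := by
    rw [← Real.rpow_intCast]
    push_cast
    rfl
  rw [phase, hN, h1, ← Real.rpow_natCast, ← Real.rpow_mul hq.le, ← Real.rpow_add hq,
    Real.rpow_def_of_pos hq]
  conv_rhs => rw [← Real.exp_log h0]
  congr 1
  rw [qlog]
  push_cast
  field_simp
  ring

lemma lt_of_mem_slice {N : ℤ} {t : ℝ} (ht : t ∈ slice q (some N)) :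
    q ^ 2 * q ^ (-2 * N) < t ∧ t ≤ q ^ (-2 * N) := by
  have h1 := phase_sq hq hq1 ht
  have h2 := lt_phase hq hq1 t
  have h3 := phase_le_one hq hq1 t
  have h4 : 0 < q ^ (-2 * N) := by positivity
  have h5 : q ^ 2 < phase q t ^ 2 := pow_lt_pow_left₀ h2 hq.le (by norm_num)
  have h6 : phase q t ^ 2 ≤ 1 := pow_le_one₀ (hq.le.trans h2.le) h3
  constructor
  · conv_rhs => rw [← h1]
    rw [mul_comm]
    gcongr
  · conv_lhs => rw [← h1]
    nlinarith

end

/-- Truncation of the identity function to a slice. -/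
def sliceId (q : ℝ) (o : Option ℤ) : ℝ → ℝ := (slice q o).indicator id

lemma measurable_sliceId (o : Option ℤ) : Measurable (sliceId q o) :=
  measurable_id.indicator (measurableSet_slice o)

lemma sliceId_none (t : ℝ) : sliceId q none t = 0 := by
  by_cases h : t ∈ slice q none
  · rw [sliceId, Set.indicator_of_mem h]
    exact h
  · rw [sliceId, Set.indicator_of_notMem h]

lemma sliceId_bound (hq : 0 < q) (hq1 : q < 1) (o : Option ℤ) :
    ∃ C, ∀ t, ‖sliceId q o t‖ ≤ C := by
  cases o with
  | none => exact ⟨0, fun t => by rw [sliceId_none]; simp⟩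
  | some N =>
    refine ⟨q ^ (-2 * N), fun t => ?_⟩
    by_cases h : t ∈ slice q (some N)
    · rw [sliceId, Set.indicator_of_mem h, id, Real.norm_of_nonneg h.1.le]
      exact (lt_of_mem_slice hq hq1 h).2
    · rw [sliceId, Set.indicator_of_notMem h, norm_zero]
      positivity

lemma sliceId_mul (hq : 0 < q) (hq1 : q < 1) (o : Option ℤ) (t : ℝ) :
    sliceId q o (q ^ 2 * t) = q ^ 2 * sliceId q (o.map (· + 1)) t := by
  by_cases h : q ^ 2 * t ∈ slice q o
  · rw [sliceId, Set.indicator_of_mem h, sliceId,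
      Set.indicator_of_mem ((mem_slice_map_add_one hq hq1).2 h)]
    rfl
  · rw [sliceId, Set.indicator_of_notMem h, sliceId,
      Set.indicator_of_notMem (fun h' => h ((mem_slice_map_add_one hq hq1).1 h')), mul_zero]

end Slices

/-! ### Values of unbounded operators and bounded compositions -/

section Apply

set_option linter.unusedSectionVars false

variable {H : Type u} [NormedAddCommGroup H] [InnerProductSpace ℂ H]

open Classical in
/-- The value of an unbounded operator, extended by zero. -/
def app (T : H →ₗ.[ℂ] H) (x : H) : H := if h : x ∈ T.domain then T ⟨x, h⟩ else 0

lemma mem_graph_app {T : H →ₗ.[ℂ] H} {x : H} (h : x ∈ T.domain) : (x, app T x) ∈ T.graph := by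
  rw [app, dif_pos h]
  exact T.mem_graph ⟨x, h⟩

lemma app_eq {T : H →ₗ.[ℂ] H} {x y : H} (h : (x, y) ∈ T.graph) : app T x = y :=
  LinearPMap.mem_graph_snd_inj _ (mem_graph_app (LinearPMap.mem_domain_of_mem_graph h)) h rfl

lemma inner_graph_adjoint [CompleteSpace H] {T : H →ₗ.[ℂ] H} (hT : Dense (T.domain : Set H))
    {x y u v : H} (h : (x, y) ∈ T.graph) (h' : (u, v) ∈ T.adjoint.graph) :
    ⟪v, x⟫_ℂ = ⟪u, y⟫_ℂ := by
  rw [LinearPMap.adjoint_graph_eq_graph_adjoint hT, Submodule.mem_adjoint_iff] at h'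
  have h1 := h' x y h
  rw [sub_eq_zero] at h1
  rw [← inner_conj_symm v x, ← inner_conj_symm u y, h1]

/-- A closed operator that is bounded on the image of a dense subspace under a bounded operator. -/
lemma exists_bounded_comp [CompleteSpace H] {T : H →ₗ.[ℂ] H} (hT : T.IsClosed)
    {D : Submodule ℂ H} (hD : Dense (D : Set H)) (P : H →L[ℂ] H) {C : ℝ}
    (h : ∀ x ∈ D, ∃ y, (P x, y) ∈ T.graph ∧ ‖y‖ ≤ C * ‖x‖) :
    ∃ B : H →L[ℂ] H, ∀ x, (P x, B x) ∈ T.graph := by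
  choose! f hf hC using h
  have huniq : ∀ {x y y' : H}, (x, y) ∈ T.graph → (x, y') ∈ T.graph → y = y' := fun h1 h2 =>
    LinearPMap.mem_graph_snd_inj _ h1 h2 rfl
  let B₀ : D →L[ℂ] H := LinearMap.mkContinuous
    { toFun := fun x => f x
      map_add' := fun x y => huniq (hf _ (x + y).2) (by
        have := T.graph.add_mem (hf _ x.2) (hf _ y.2)
        rw [Prod.mk_add_mk, ← map_add] at this
        exact this)
      map_smul' := fun c x => huniq (hf _ (c • x).2) (by
        have := T.graph.smul_mem c (hf _ x.2)
        rw [Prod.smul_mk, ← map_smul] at this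
        exact this) } C (fun x => hC x x.2)
  have hd : DenseRange (D.subtypeL) := by
    have : Set.range (D.subtypeL) = D := by simp
    rw [DenseRange, this]
    exact hD
  have hB : ∀ x : D, B₀.extend D.subtypeL x = B₀ x := fun x =>
    ContinuousLinearMap.extend_eq B₀ hd (isometry_subtype_coe.isUniformInducing) x
  refine ⟨B₀.extend D.subtypeL, fun x => ?_⟩
  have hcl : IsClosed {x : H | (P x, B₀.extend D.subtypeL x) ∈ T.graph} :=
    IsClosed.preimage (P.continuous.prodMk (B₀.extend D.subtypeL).continuous) hT
  have hsub : (D : Set H) ⊆ {x : H | (P x, B₀.extend D.subtypeL x) ∈ T.graph} := fun x hx => by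
    change (P x, B₀.extend D.subtypeL x) ∈ T.graph
    have := hB ⟨x, hx⟩
    rw [show B₀.extend D.subtypeL x = f x from this]
    exact hf x hx
  exact hcl.closure_subset_iff.2 hsub (hD x)

end Apply

/-! ### Joint spectral subspaces of commuting spectral measures -/

section Slicing

variable {H : Type u} [NormedAddCommGroup H] [InnerProductSpace ℂ H] [CompleteSpace H]
variable {n : ℕ} (q : ℝ) (E : Fin n → PVM H)

/-- The joint spectral subspace of commuting spectral measures for a product of slices. -/
def joint (s : Fin n → Option ℤ) : Submodule ℂ H where
  carrier := {x | ∀ l, (E l).proj (slice q (s l)) x = x}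
  zero_mem' := fun l => map_zero _
  add_mem' := fun hx hy l => by rw [map_add, hx l, hy l]
  smul_mem' := fun c x hx l => by rw [map_smul, hx l]

/-- The product of the spectral projections for the slices. -/
def jointProj (L : List (Fin n)) (s : Fin n → Option ℤ) : H →L[ℂ] H :=
  (L.map fun l => (E l).proj (slice q (s l))).prod

variable {q E}

lemma jointProj_cons (l : Fin n) (L : List (Fin n)) (s : Fin n → Option ℤ) (x : H) :
    jointProj q E (l :: L) s x = (E l).proj (slice q (s l)) (jointProj q E L s x) := by
  rw [jointProj, List.map_cons, List.prod_cons]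
  rfl

lemma jointProj_of_mem (L : List (Fin n)) {s : Fin n → Option ℤ} {x : H}
    (hx : x ∈ joint q E s) : jointProj q E L s x = x := by
  induction L with
  | nil => rfl
  | cons l L ih => rw [jointProj_cons, ih, hx l]

lemma inner_jointProj (L : List (Fin n)) {s : Fin n → Option ℤ} (x : H) {y : H}
    (hy : y ∈ joint q E s) : ⟪jointProj q E L s x, y⟫_ℂ = ⟪x, y⟫_ℂ := by
  induction L with
  | nil => rfl
  | cons l L ih => rw [jointProj_cons, PVM.inner_proj_comm (measurableSet_slice _), hy l, ih]

lemma jointProj_mem_of_proj_mem {D : Submodule ℂ H}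
    (hD : ∀ j, ∀ s : Set ℝ, MeasurableSet s → ∀ x ∈ D, (E j).proj s x ∈ D)
    (L : List (Fin n)) (s : Fin n → Option ℤ) {x : H} (hx : x ∈ D) : jointProj q E L s x ∈ D := by
  induction L with
  | nil => exact hx
  | cons l L ih => rw [jointProj_cons]; exact hD l _ (measurableSet_slice _) _ ih

lemma joint_isClosed (s : Fin n → Option ℤ) : IsClosed (joint q E s : Set H) := by
  have : (joint q E s : Set H) = ⋂ l, {x | (E l).proj (slice q (s l)) x = x} := by
    ext x
    simp only [Set.mem_iInter]
    rfl
  rw [this]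
  exact isClosed_iInter fun l => isClosed_eq (ContinuousLinearMap.continuous _) continuous_id

lemma joint_orthogonal {s s' : Fin n → Option ℤ} (h : s ≠ s') {x y : H} (hx : x ∈ joint q E s)
    (hy : y ∈ joint q E s') : ⟪x, y⟫_ℂ = 0 := by
  obtain ⟨l, hl⟩ := Function.ne_iff.1 h
  rw [← hx l, ← hy l, (E l).inner_proj (measurableSet_slice _) (measurableSet_slice _),
    (disjoint_slice hl).inter_eq, (E l).proj_empty]
  simp

lemma joint_ae {s : Fin n → Option ℤ} {x : H} (hx : x ∈ joint q E s) (l : Fin n) :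
    ∀ᵐ t ∂(E l).measure x, t ∈ slice q (s l) :=
  PVM.ae_mem (measurableSet_slice _) (hx l)

section

variable (hc : ∀ j k, ∀ s t : Set ℝ, MeasurableSet s → MeasurableSet t →
  Commute ((E j).proj s) ((E k).proj t))

include hc

lemma proj_proj_comm (j k : Fin n) {s t : Set ℝ} (hs : MeasurableSet s) (ht : MeasurableSet t)
    (x : H) : (E j).proj s ((E k).proj t x) = (E k).proj t ((E j).proj s x) :=
  congrArg (fun T : H →L[ℂ] H => T x) (hc j k s t hs ht).eq

lemma proj_jointProj (L : List (Fin n)) (s : Fin n → Option ℤ) (x : H) {l : Fin n} (hl : l ∈ L) :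
    (E l).proj (slice q (s l)) (jointProj q E L s x) = jointProj q E L s x := by
  induction L with
  | nil => simp at hl
  | cons m L ih =>
    rw [jointProj_cons]
    by_cases hlm : l = m
    · subst hlm
      rw [← mul_apply_eq_comp, ← (E l).inter _ _ (measurableSet_slice _) (measurableSet_slice _),
        Set.inter_self]
    · rw [proj_proj_comm hc _ _ (measurableSet_slice _) (measurableSet_slice _),
        ih (by simpa [hlm] using hl)]

lemma jointProj_mem (s : Fin n → Option ℤ) (x : H) :
    jointProj q E (List.finRange n) s x ∈ joint q E s :=
  fun l => proj_jointProj hc _ s x (List.mem_finRange l)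

omit hc in
lemma jointProj_congr {L : List (Fin n)} {s s' : Fin n → Option ℤ} (h : ∀ l ∈ L, s l = s' l)
    (x : H) : jointProj q E L s x = jointProj q E L s' x := by
  induction L with
  | nil => rfl
  | cons m L ih =>
    rw [jointProj_cons, jointProj_cons, h m (by simp),
      ih fun l hl => h l (List.mem_cons_of_mem _ hl)]

-- Induction on the list: for each spectral measure the countably many slices and the negative
-- half-line, which is null, cover the line. A vector annihilated by the projections for all these
-- sets has scalar measure zero.
omit hc in
lemma eq_zero_of_jointProj (hE : ∀ l, (E l).proj (Set.Iio 0) = 0) {L : List (Fin n)}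
    (hL : L.Nodup) {x : H} (h : ∀ s, jointProj q E L s x = 0) : x = 0 := by
  induction L with
  | nil => exact h fun _ => none
  | cons l L ih =>
    refine ih (List.nodup_cons.1 hL).2 fun s => ?_
    have h1 : ∀ o, (E l).proj (slice q o) (jointProj q E L s x) = 0 := by
      intro o
      have h2 := h (Function.update s l o)
      rw [jointProj_cons, Function.update_self] at h2
      rwa [jointProj_congr (s := Function.update s l o) (s' := s) (fun m hm => by
        rw [Function.update_of_ne]
        rintro rfl
        exact (List.nodup_cons.1 hL).1 hm)] at h2
    set y := jointProj q E L s x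
    have h3 : (E l).measure y Set.univ = 0 := by
      have : (Set.univ : Set ℝ) = Set.Iio 0 ∪ ⋃ o, slice q o := by
        rw [iUnion_slice, Set.Iio_union_Ici]
      rw [this, measure_union_null_iff]
      refine ⟨?_, measure_iUnion_null fun o => ?_⟩
      · rw [(E l).measure_apply _ measurableSet_Iio, hE]
        simp
      · rw [(E l).measure_apply _ (measurableSet_slice _), h1]
        simp
    rw [PVM.measure_univ] at h3
    have h4 : ‖y‖ ^ 2 ≤ 0 := by simpa using h3
    have h5 : ‖y‖ = 0 := by
      have := sq_nonneg ‖y‖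
      exact pow_eq_zero_iff (two_ne_zero) |>.1 (le_antisymm h4 this)
    exact norm_eq_zero.1 h5

lemma bint_mem_joint (k : Fin n) {f : ℝ → ℂ} (hf : Measurable f) (hb : ∃ C, ∀ t, ‖f t‖ ≤ C)
    {s : Fin n → Option ℤ} {x : H} (hx : x ∈ joint q E s) : (E k).bint f hf hb x ∈ joint q E s := by
  intro l
  rw [← PVM.bint_transfer (L := (E l).proj (slice q (s l))) (fun S hS y =>
    proj_proj_comm hc k l hS (measurableSet_slice _) y), hx l]

end

end Slicing

/-! ### Bounds for quadratic forms of spectral integrals -/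

section RintBounds

variable {H : Type u} [NormedAddCommGroup H] [InnerProductSpace ℂ H] [CompleteSpace H]
variable {E : PVM H} {f : ℝ → ℝ} (hf : Measurable f) (hb : ∃ C, ∀ t, ‖f t‖ ≤ C) {x : H} {c : ℝ}

include hf hb in
lemma PVM.integrable_of_bounded : Integrable f (E.measure x) := by
  obtain ⟨C, hC⟩ := hb
  exact Integrable.of_bound hf.aestronglyMeasurable C (Eventually.of_forall hC)

lemma PVM.integral_const_measure : ∫ _, c ∂E.measure x = c * ‖x‖ ^ 2 := by
  rw [integral_const, smul_eq_mul, mul_comm, Measure.real, PVM.measure_univ,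
    ENNReal.toReal_ofReal (by positivity)]

lemma PVM.re_inner_rint : (⟪x, E.rint f hf hb x⟫_ℂ).re = ∫ t, f t ∂E.measure x := by
  rw [PVM.inner_rint, Complex.ofReal_re]

lemma PVM.re_inner_rint_le (h : ∀ᵐ t ∂E.measure x, f t ≤ c) :
    (⟪x, E.rint f hf hb x⟫_ℂ).re ≤ c * ‖x‖ ^ 2 := by
  rw [PVM.re_inner_rint, ← PVM.integral_const_measure]
  exact integral_mono_ae (PVM.integrable_of_bounded hf hb) (integrable_const c) h

/-- Equality would force f = c almost everywhere against the strict inequality, so the scalar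
measure, of total mass ‖x‖², would vanish. -/
lemma PVM.lt_re_inner_rint (h : ∀ᵐ t ∂E.measure x, c < f t) (hx : x ≠ 0) :
    c * ‖x‖ ^ 2 < (⟪x, E.rint f hf hb x⟫_ℂ).re := by
  rw [PVM.re_inner_rint, ← PVM.integral_const_measure]
  have hi := PVM.integrable_of_bounded (E := E) (x := x) hf hb
  refine lt_of_le_of_ne (integral_mono_ae (integrable_const c) hi (h.mono fun t ht => ht.le)) ?_
  intro heq
  have h1 : ∫ t, (f t - c) ∂E.measure x = 0 := by
    rw [integral_sub hi (integrable_const c), heq, sub_self]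
  have h2 := (integral_eq_zero_iff_of_nonneg_ae (h.mono fun t ht => (sub_pos.2 ht).le)
    (hi.sub (integrable_const c))).1 h1
  have h3 : ∀ᵐ t ∂E.measure x, False := by
    filter_upwards [h, h2] with t ht ht'
    have : f t - c = 0 := ht'
    linarith
  have h4 : E.measure x Set.univ = 0 := by
    simpa using h3
  rw [PVM.measure_univ] at h4
  have h5 : 0 < ‖x‖ := norm_pos_iff.2 hx
  have : ‖x‖ ^ 2 ≤ 0 := by simpa using h4
  nlinarith

end RintBounds

/-! ### Action of the generators on the joint spectral subspaces -/

section Representation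

variable {H : Type u} [NormedAddCommGroup H] [InnerProductSpace ℂ H] [CompleteSpace H]
variable {n : ℕ} {q : ℝ} {z : Fin n → H →ₗ.[ℂ] H} {D : Submodule ℂ H} {E : Fin n → PVM H}

section OnDomain

variable (h : IsStarRep q z D)

include h

lemma IsStarRep.dense_domain (j : Fin n) : Dense ((z j).domain : Set H) :=
  h.dense.mono (h.le_domain j)

lemma IsStarRep.op_mem (j : Fin n) {x : H} (hx : x ∈ D) :
    (x, app (z j) x) ∈ (z j).graph ∧ app (z j) x ∈ D := by
  refine ⟨mem_graph_app (h.le_domain j hx), ?_⟩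
  rw [app, dif_pos (h.le_domain j hx)]
  exact h.map_mem j _ hx

lemma IsStarRep.adjoint_mem (j : Fin n) {x : H} (hx : x ∈ D) :
    (x, app (z j).adjoint x) ∈ (z j).adjoint.graph ∧ app (z j).adjoint x ∈ D := by
  refine ⟨mem_graph_app (h.le_domain_adjoint j hx), ?_⟩
  rw [app, dif_pos (h.le_domain_adjoint j hx)]
  exact h.map_adjoint_mem j _ hx

lemma IsStarRep.adjoint_isClosed (j : Fin n) : (z j).adjoint.IsClosed :=
  LinearPMap.adjoint_isClosed (h.dense_domain j)

lemma IsStarRep.inner_adjoint_op (j : Fin n) {x y w : H} (h1 : (x, y) ∈ (z j).graph)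
    (h2 : (y, w) ∈ (z j).adjoint.graph) : (⟪x, w⟫_ℂ).re = ‖y‖ ^ 2 := by
  have h3 := inner_graph_adjoint (h.dense_domain j) h1 h2
  rw [inner_self_eq_norm_sq_to_K] at h3
  rw [← inner_conj_symm, h3]
  simp [← Complex.ofReal_pow]

lemma IsStarRep.inner_op_adjoint (j : Fin n) {x y w : H} (h1 : (x, y) ∈ (z j).adjoint.graph)
    (h2 : (y, w) ∈ (z j).graph) : (⟪x, w⟫_ℂ).re = ‖y‖ ^ 2 := by
  have h3 := inner_graph_adjoint (h.dense_domain j) h2 h1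
  rw [inner_self_eq_norm_sq_to_K] at h3
  rw [← h3]
  simp [← Complex.ofReal_pow]

lemma IsStarRep.pcomp_adjoint_op (j : Fin n) {x : H} (hx : x ∈ D) :
    (x, app (z j).adjoint (app (z j) x)) ∈ (pcomp (z j).adjoint (z j)).graph :=
  (mem_graph_pcomp _ _ _ _).2 ⟨_, (h.op_mem j hx).1, (h.adjoint_mem j (h.op_mem j hx).2).1⟩

lemma IsStarRep.op_adjoint_eq (j : Fin n) {x : H} (hx : x ∈ D) :
    app (z j) (app (z j).adjoint x) = (q : ℂ) ^ 2 • app (z j).adjoint (app (z j) x) -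
      (1 - (q : ℂ) ^ 2) • ∑ l ∈ Finset.Ioi j, app (z l).adjoint (app (z l) x) := by
  have h1 : (x, app (z j) (app (z j).adjoint x)) ∈
      ((pcomp (z j) (z j).adjoint).domRestrict D).graph :=
    (mem_graph_domRestrict _ _ _ _).2 ⟨hx, (mem_graph_pcomp _ _ _ _).2
      ⟨_, (h.adjoint_mem j hx).1, (h.op_mem j (h.adjoint_mem j hx).2).1⟩⟩
  rw [h.rel_diag j] at h1
  refine LinearPMap.mem_graph_snd_inj _ h1 ((mem_graph_domRestrict _ _ _ _).2 ⟨hx, ?_⟩) rfl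
  refine (mem_graph_sub _ _ _ _).2 ⟨_, _, (mem_graph_smul _ _ _ _).2
    ⟨_, h.pcomp_adjoint_op j hx, rfl⟩, (mem_graph_smul _ _ _ _).2
    ⟨_, (mem_graph_sum _ _ _ _).2 ⟨_, fun l _ => h.pcomp_adjoint_op l hx, rfl⟩, rfl⟩, rfl⟩

variable (hE : SpectralConditions q z D E)

include hE

lemma IsStarRep.hasInt_Q (k : Fin n) {x : H} (hx : x ∈ D) :
    (E k).HasInt (fun t => (t : ℂ)) x (∑ l ∈ Finset.Ici k, app (z l).adjoint (app (z l) x)) := by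
  rw [← PVM.mem_graph_integral Complex.measurable_ofReal, ← hE.eq_integral k]
  refine LinearPMap.le_graph_of_le (LinearPMap.le_closure _) ?_
  exact (mem_graph_domRestrict _ _ _ _).2 ⟨hx, (mem_graph_sum _ _ _ _).2
    ⟨_, fun l _ => h.pcomp_adjoint_op l hx, rfl⟩⟩

/-- On `D` the form of Q_k is a sum of squares. For a negative spectral projection of a vector of
`D`, again in `D`, it is also the integral of a negative function, so that vector is zero; density
does the rest. -/
lemma IsStarRep.proj_Iio (k : Fin n) : (E k).proj (Set.Iio 0) = 0 := by
  refine ContinuousLinearMap.ext fun x => ?_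
  refine congrFun (Continuous.ext_on h.dense (((E k).proj (Set.Iio 0)).continuous)
    continuous_const (g := fun _ => (0 : H)) fun x hx => ?_) x
  have hy := hE.proj_mem k (Set.Iio 0) measurableSet_Iio x hx
  set y := (E k).proj (Set.Iio 0) x with hy_def
  by_contra hne
  have hyy : (E k).proj (Set.Iio 0) y = y := by
    rw [hy_def, ← mul_apply_eq_comp, ← (E k).inter _ _ measurableSet_Iio measurableSet_Iio,
      Set.inter_self]
  have h1 := h.hasInt_Q hE k hy
  have h2 := congrArg Complex.re (h1.inner_eq Complex.measurable_ofReal)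
  rw [inner_sum, Complex.re_sum, integral_complex_ofReal, Complex.ofReal_re] at h2
  have h3 : 0 ≤ ∫ t, t ∂(E k).measure y := by
    rw [← h2]
    refine Finset.sum_nonneg fun l _ => ?_
    rw [h.inner_adjoint_op l (h.op_mem l hy).1 (h.adjoint_mem l (h.op_mem l hy).2).1]
    positivity
  have hae := PVM.ae_mem measurableSet_Iio hyy
  have hint : Integrable (fun t : ℝ => t) ((E k).measure y) := by
    have := (h1.integrable Complex.measurable_ofReal).re
    simpa using this
  have h4 : ∫ t, -t ∂(E k).measure y = 0 := by
    refine le_antisymm ?_ (integral_nonneg_of_ae ?_)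
    · rw [integral_neg]
      linarith
    · filter_upwards [hae] with t ht
      exact (neg_pos.2 ht).le
  have h5 := (integral_eq_zero_iff_of_nonneg_ae (by
    filter_upwards [hae] with t ht
    exact (neg_pos.2 ht).le) hint.neg).1 h4
  have h6 : ∀ᵐ t ∂(E k).measure y, False := by
    filter_upwards [hae, h5] with t ht ht'
    have h7 : -t = 0 := ht'
    have h8 : t < 0 := ht
    linarith
  have h7 : (E k).measure y Set.univ = 0 := by simpa using h6
  rw [PVM.measure_univ] at h7
  have h8 : 0 < ‖y‖ := norm_pos_iff.2 hne
  have : ‖y‖ ^ 2 ≤ 0 := by simpa using h7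
  nlinarith

end OnDomain

section Relations

variable (hE : SpectralConditions q z D E)

include hE

/-- The operator inclusions restated for pairs in the graph, with both cases of the index comparison
in one statement. A vector at which `g` can be integrated has only one value, which removes the
existential from the product. -/
lemma SpectralConditions.hasInt_op {f g : ℝ → ℂ} (hf : Measurable f) (hg : Measurable g)
    (hb : ∃ C, ∀ t, ‖f t‖ ≤ C) {j k : Fin n}
    (hfg : ∀ t, g t = if j < k then f t else f ((q ^ 2)⁻¹ * t)) {x y u w : H}
    (hxy : (x, y) ∈ (z j).graph) (hw : (E k).HasInt f y w) (hu : (E k).HasInt g x u) :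
    (u, w) ∈ (z j).graph := by
  have h1 : (x, w) ∈ (pcomp ((E k).integral f hf) (z j)).graph :=
    (mem_graph_pcomp _ _ _ _).2 ⟨y, hxy, (PVM.mem_graph_integral hf).2 hw⟩
  have h2 : ∃ u', (E k).HasInt g x u' ∧ (u', w) ∈ (z j).graph := by
    by_cases hjk : j < k
    · obtain rfl : g = f := funext fun t => by rw [hfg, if_pos hjk]
      obtain ⟨u', h3, h4⟩ := (mem_graph_pcomp _ _ _ _).1
        (LinearPMap.le_graph_of_le (hE.rel_lt g hf hb j k hjk).1 h1)
      exact ⟨u', (PVM.mem_graph_integral _).1 h3, h4⟩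
    · obtain rfl : g = fun t => f ((q ^ 2)⁻¹ * t) := funext fun t => by rw [hfg, if_neg hjk]
      obtain ⟨u', h3, h4⟩ := (mem_graph_pcomp _ _ _ _).1
        (LinearPMap.le_graph_of_le (hE.rel_ge f hf hb j k (not_lt.1 hjk)).1 h1)
      exact ⟨u', (PVM.mem_graph_integral _).1 h3, h4⟩
  obtain ⟨u', h3, h4⟩ := h2
  rwa [hu.unique hg h3]

lemma SpectralConditions.hasInt_adjoint {f g : ℝ → ℂ} (hf : Measurable f) (hg : Measurable g)
    (hb : ∃ C, ∀ t, ‖f t‖ ≤ C) {j k : Fin n}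
    (hfg : ∀ t, g t = if j < k then f t else f (q ^ 2 * t)) {x y u w : H}
    (hxy : (x, y) ∈ (z j).adjoint.graph) (hw : (E k).HasInt f y w) (hu : (E k).HasInt g x u) :
    (u, w) ∈ (z j).adjoint.graph := by
  have h1 : (x, w) ∈ (pcomp ((E k).integral f hf) (z j).adjoint).graph :=
    (mem_graph_pcomp _ _ _ _).2 ⟨y, hxy, (PVM.mem_graph_integral hf).2 hw⟩
  have h2 : ∃ u', (E k).HasInt g x u' ∧ (u', w) ∈ (z j).adjoint.graph := by
    by_cases hjk : j < k
    · obtain rfl : g = f := funext fun t => by rw [hfg, if_pos hjk]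
      obtain ⟨u', h3, h4⟩ := (mem_graph_pcomp _ _ _ _).1
        (LinearPMap.le_graph_of_le (hE.rel_lt g hf hb j k hjk).2 h1)
      exact ⟨u', (PVM.mem_graph_integral _).1 h3, h4⟩
    · obtain rfl : g = fun t => f (q ^ 2 * t) := funext fun t => by rw [hfg, if_neg hjk]
      obtain ⟨u', h3, h4⟩ := (mem_graph_pcomp _ _ _ _).1
        (LinearPMap.le_graph_of_le (hE.rel_ge f hf hb j k (not_lt.1 hjk)).2 h1)
      exact ⟨u', (PVM.mem_graph_integral _).1 h3, h4⟩
  obtain ⟨u', h3, h4⟩ := h2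
  rwa [hu.unique hg h3]

/-- Functions that are invariant under the scaling by `q²` commute with the generators. -/
lemma SpectralConditions.rint_op {f : ℝ → ℝ} (hf : Measurable f) (hb : ∃ C, ∀ t, ‖f t‖ ≤ C)
    (hq : q ≠ 0) (hper : ∀ t, f (q ^ 2 * t) = f t) {j : Fin n} (k : Fin n) {x y : H}
    (hxy : (x, y) ∈ (z j).graph) : ((E k).rint f hf hb x, (E k).rint f hf hb y) ∈ (z j).graph := by
  refine hE.hasInt_op (PVM.measurable_coe hf) (PVM.measurable_coe hf) (by simpa using hb)
    (fun t => ?_) hxy (PVM.hasInt_rint hf hb y) (PVM.hasInt_rint hf hb x)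
  rw [← hper ((q ^ 2)⁻¹ * t), mul_inv_cancel_left₀ (by positivity), ite_self]

end Relations

/-- The effect of `z_j` on the slices. -/
def raise (j : Fin n) (s : Fin n → Option ℤ) (l : Fin n) : Option ℤ :=
  if j < l then s l else (s l).map (· + 1)

/-- The effect of `z_j*` on the slices. -/
def lower (j : Fin n) (s : Fin n → Option ℤ) (l : Fin n) : Option ℤ :=
  if j < l then s l else (s l).map (· - 1)

lemma raise_lower (j : Fin n) (s : Fin n → Option ℤ) : raise j (lower j s) = s := by
  funext l
  simp only [raise, lower]
  split_ifs <;> cases s l <;> simp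

lemma lower_raise (j : Fin n) (s : Fin n → Option ℤ) : lower j (raise j s) = s := by
  funext l
  simp only [raise, lower]
  split_ifs <;> cases s l <;> simp

section OnSlices

variable (h : IsStarRep q z D) (hE : SpectralConditions q z D E) (hq : 0 < q) (hq1 : q < 1)

include hE hq hq1

/-- The commutation rule is applied to the indicator of the target slice. It becomes the indicator
of the source slice, which fixes `x`, so the corresponding projection fixes `y` by uniqueness of the
value. -/
lemma SpectralConditions.mem_joint_raise {j : Fin n} {s : Fin n → Option ℤ} {x y : H}
    (hx : x ∈ joint q E s) (hxy : (x, y) ∈ (z j).graph) : y ∈ joint q E (raise j s) := by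
  intro l
  have hm : ∀ o, MeasurableSet (slice q o) := measurableSet_slice
  have h1 := hE.hasInt_op (f := (slice q (raise j s l)).indicator fun _ => 1)
    (g := (slice q (s l)).indicator fun _ => 1) (measurable_const.indicator (hm _))
    (measurable_const.indicator (hm _)) ⟨1, fun t => ?_⟩ (fun t => ?_) hxy
    (PVM.hasInt_indicator (E := E l) (hm (raise j s l)) y)
    (PVM.hasInt_indicator (E := E l) (hm (s l)) x)
  · rw [hx l] at h1
    exact LinearPMap.mem_graph_snd_inj _ h1 hxy rfl
  · by_cases ht : t ∈ slice q (raise j s l) <;> simp [ht]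
  · unfold raise
    split_ifs with hjl
    · rfl
    · have h2 : ((q ^ 2)⁻¹ * t ∈ slice q ((s l).map (· + 1))) ↔ t ∈ slice q (s l) := by
        rw [mem_slice_map_add_one hq hq1, mul_inv_cancel_left₀ (by positivity)]
      by_cases ht : t ∈ slice q (s l)
      · rw [Set.indicator_of_mem ht, Set.indicator_of_mem (h2.2 ht)]
      · rw [Set.indicator_of_notMem ht, Set.indicator_of_notMem (fun h' => ht (h2.1 h'))]

lemma SpectralConditions.mem_joint_lower {j : Fin n} {s : Fin n → Option ℤ} {x y : H}
    (hx : x ∈ joint q E s) (hxy : (x, y) ∈ (z j).adjoint.graph) : y ∈ joint q E (lower j s) := by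
  intro l
  have hm : ∀ o, MeasurableSet (slice q o) := measurableSet_slice
  have h1 := hE.hasInt_adjoint (f := (slice q (lower j s l)).indicator fun _ => 1)
    (g := (slice q (s l)).indicator fun _ => 1) (measurable_const.indicator (hm _))
    (measurable_const.indicator (hm _)) ⟨1, fun t => ?_⟩ (fun t => ?_) hxy
    (PVM.hasInt_indicator (E := E l) (hm (lower j s l)) y)
    (PVM.hasInt_indicator (E := E l) (hm (s l)) x)
  · rw [hx l] at h1
    exact LinearPMap.mem_graph_snd_inj _ h1 hxy rfl
  · by_cases ht : t ∈ slice q (lower j s l) <;> simp [ht]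
  · have hrl := congrFun (raise_lower j s) l
    split_ifs with hjl
    · have : lower j s l = s l := by rw [lower, if_pos hjl]
      rw [this]
    · rw [raise, if_neg hjl] at hrl
      have h2 : (q ^ 2 * t ∈ slice q (lower j s l)) ↔ t ∈ slice q (s l) := by
        conv_rhs => rw [← hrl]
        exact (mem_slice_map_add_one hq hq1).symm
      by_cases ht : t ∈ slice q (s l)
      · rw [Set.indicator_of_mem ht, Set.indicator_of_mem (h2.2 ht)]
      · rw [Set.indicator_of_notMem ht, Set.indicator_of_notMem (fun h' => ht (h2.1 h'))]

omit hE hq hq1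

open Classical in
variable (q E) in
/-- The bounded operator that coincides with `Q_{l+1}` on `joint q E s`; zero for `l = n`. -/
def sliceQ (s : Fin n → Option ℤ) (l : ℕ) : H →L[ℂ] H :=
  if h : (0 < q ∧ q < 1) ∧ l < n then
    (E ⟨l, h.2⟩).rint (sliceId q (s ⟨l, h.2⟩)) (measurable_sliceId _)
      (sliceId_bound h.1.1 h.1.2 _)
  else 0

include hq hq1 in
lemma sliceQ_fin (s : Fin n → Option ℤ) (l : Fin n) : sliceQ q E s l =
    (E l).rint (sliceId q (s l)) (measurable_sliceId _) (sliceId_bound hq hq1 _) := by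
  rw [sliceQ, dif_pos ⟨⟨hq, hq1⟩, l.2⟩]

lemma sliceQ_of_le (s : Fin n → Option ℤ) {l : ℕ} (hl : n ≤ l) : sliceQ q E s l = 0 := by
  rw [sliceQ, dif_neg (fun h' => by omega)]

include hq hq1 in
lemma sliceQ_none {s : Fin n → Option ℤ} {l : Fin n} (hl : s l = none) (x : H) :
    sliceQ q E s l x = 0 := by
  rw [sliceQ_fin hq hq1]
  have h0 := PVM.HasInt.smul (PVM.hasInt_rint (E := E l) (measurable_sliceId (q := q) (s l))
    (sliceId_bound hq hq1 _) x) (0 : ℂ)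
  rw [zero_smul] at h0
  refine (PVM.hasInt_rint (measurable_sliceId (s l)) (sliceId_bound hq hq1 _) x).unique
    (PVM.measurable_coe (measurable_sliceId _)) (h0.congr_ae (Eventually.of_forall fun t => ?_))
  simp only [hl, sliceId_none]
  simp

include hq hq1 in
lemma hasInt_sliceQ {s : Fin n → Option ℤ} {x : H} (hx : x ∈ joint q E s) (l : Fin n) :
    (E l).HasInt (fun t => (t : ℂ)) x (sliceQ q E s l x) := by
  rw [sliceQ_fin hq hq1]
  refine (PVM.hasInt_rint (measurable_sliceId _) (sliceId_bound hq hq1 _) x).congr_ae ?_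
  filter_upwards [joint_ae hx l] with t ht
  rw [sliceId, Set.indicator_of_mem ht]
  rfl

include hE in
lemma SpectralConditions.sliceQ_mem {s : Fin n → Option ℤ} {x : H} (hx : x ∈ joint q E s)
    (l : ℕ) : sliceQ q E s l x ∈ joint q E s := by
  rw [sliceQ]
  split_ifs
  · exact bint_mem_joint hE.commute _ _ _ hx
  · exact Submodule.zero_mem _

include h hE hq hq1

lemma IsStarRep.sum_Ioi_eq {s : Fin n → Option ℤ} {x : H} (hxD : x ∈ D) (hx : x ∈ joint q E s)
    (k : Fin n) :
    ∑ l ∈ Finset.Ioi k, app (z l).adjoint (app (z l) x) = sliceQ q E s (k + 1) x := by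
  by_cases hk : (k : ℕ) + 1 < n
  · have h1 := (h.hasInt_Q hE ⟨k + 1, hk⟩ hxD).unique Complex.measurable_ofReal
      (hasInt_sliceQ hq hq1 hx ⟨k + 1, hk⟩)
    rw [← h1]
    refine Finset.sum_congr ?_ fun _ _ => rfl
    ext m
    simp only [Finset.mem_Ioi, Finset.mem_Ici, Fin.lt_def, Fin.le_def]
    omega
  · rw [sliceQ_of_le s (not_lt.1 hk)]
    refine Finset.sum_eq_zero fun l hl => ?_
    have := Fin.lt_def.1 (Finset.mem_Ioi.1 hl)
    omega

lemma IsStarRep.adjoint_op_slice {s : Fin n → Option ℤ} {x : H} (hxD : x ∈ D)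
    (hx : x ∈ joint q E s) (k : Fin n) : app (z k).adjoint (app (z k) x) =
      sliceQ q E s k x - sliceQ q E s (k + 1) x := by
  have h1 := (h.hasInt_Q hE k hxD).unique Complex.measurable_ofReal (hasInt_sliceQ hq hq1 hx k)
  rw [← h1, ← h.sum_Ioi_eq hE hq hq1 hxD hx, ← Finset.Ioi_insert, Finset.sum_insert (by simp),
    add_sub_cancel_right]

lemma IsStarRep.op_adjoint_slice {s : Fin n → Option ℤ} {x : H} (hxD : x ∈ D)
    (hx : x ∈ joint q E s) (k : Fin n) : app (z k) (app (z k).adjoint x) =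
      (q : ℂ) ^ 2 • sliceQ q E s k x - sliceQ q E s (k + 1) x := by
  rw [h.op_adjoint_eq k hxD, h.adjoint_op_slice hE hq hq1 hxD hx,
    h.sum_Ioi_eq hE hq hq1 hxD hx]
  module

/-- On the projection of a vector of `D` one has ‖z_k P x‖² = ⟪P x, (Q_k - Q_{k+1}) P x⟫, and the
Q's are bounded on a slice. A closed operator that is bounded on a dense set of such vectors is
defined on the whole slice. -/
lemma IsStarRep.exists_op_slice (k : Fin n) (s : Fin n → Option ℤ) : ∃ B : H →L[ℂ] H,
    ∀ x, (jointProj q E (List.finRange n) s x, B x) ∈ (z k).graph := by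
  set P := jointProj q E (List.finRange n) s
  refine exists_bounded_comp (h.isClosed k) h.dense P
    (C := √(‖sliceQ q E s k - sliceQ q E s (k + 1)‖ * ‖P‖ ^ 2)) fun x hx => ?_
  have hPD : P x ∈ D := jointProj_mem_of_proj_mem hE.proj_mem _ s hx
  have hPs : P x ∈ joint q E s := jointProj_mem hE.commute s x
  obtain ⟨h1, h2⟩ := h.op_mem k hPD
  refine ⟨_, h1, ?_⟩
  have h3 := h.inner_adjoint_op k h1 (h.adjoint_mem k h2).1
  rw [h.adjoint_op_slice hE hq hq1 hPD hPs] at h3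
  refine le_of_sq_le_sq ?_ (by positivity)
  rw [mul_pow, Real.sq_sqrt (by positivity), ← h3]
  refine (Complex.re_le_norm _).trans ((norm_inner_le_norm _ _).trans ?_)
  have h4 := P.le_opNorm x
  have h5 := (sliceQ q E s k - sliceQ q E s (k + 1)).le_opNorm (P x)
  calc ‖P x‖ * ‖sliceQ q E s k (P x) - sliceQ q E s (k + 1) (P x)‖
      ≤ (‖P‖ * ‖x‖) * (‖sliceQ q E s k - sliceQ q E s (k + 1)‖ * (‖P‖ * ‖x‖)) := by
        refine mul_le_mul h4 (h5.trans ?_) (norm_nonneg _) (by positivity)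
        gcongr
    _ = _ := by ring

lemma IsStarRep.exists_adjoint_slice (k : Fin n) (s : Fin n → Option ℤ) : ∃ B : H →L[ℂ] H,
    ∀ x, (jointProj q E (List.finRange n) s x, B x) ∈ (z k).adjoint.graph := by
  set P := jointProj q E (List.finRange n) s
  set T := (q : ℂ) ^ 2 • sliceQ q E s k - sliceQ q E s (k + 1) with hT
  refine exists_bounded_comp (h.adjoint_isClosed k) h.dense P
    (C := √(‖T‖ * ‖P‖ ^ 2)) fun x hx => ?_
  have hPD : P x ∈ D := jointProj_mem_of_proj_mem hE.proj_mem _ s hx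
  have hPs : P x ∈ joint q E s := jointProj_mem hE.commute s x
  obtain ⟨h1, h2⟩ := h.adjoint_mem k hPD
  refine ⟨_, h1, ?_⟩
  have h3 := h.inner_op_adjoint k h1 (h.op_mem k h2).1
  rw [h.op_adjoint_slice hE hq hq1 hPD hPs] at h3
  refine le_of_sq_le_sq ?_ (by positivity)
  rw [mul_pow, Real.sq_sqrt (by positivity), ← h3]
  refine (Complex.re_le_norm _).trans ((norm_inner_le_norm _ _).trans ?_)
  have h4 := P.le_opNorm x
  have h5 := T.le_opNorm (P x)
  calc ‖P x‖ * ‖T (P x)‖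
      ≤ (‖P‖ * ‖x‖) * (‖T‖ * (‖P‖ * ‖x‖)) := by
        refine mul_le_mul h4 (h5.trans ?_) (norm_nonneg _) (by positivity)
        gcongr
    _ = _ := by ring

/-- Vectors of a slice need not lie in `D`. The formula for z_k* z_k is an identity between bounded
operators composed with the joint projection; it holds on `D`, hence everywhere, and the projection
is the identity on the slice. -/
lemma IsStarRep.exists_op_of_mem_joint (k : Fin n) {s : Fin n → Option ℤ} {x : H}
    (hx : x ∈ joint q E s) : ∃ y ∈ joint q E (raise k s), (x, y) ∈ (z k).graph ∧
      (y, sliceQ q E s k x - sliceQ q E s (k + 1) x) ∈ (z k).adjoint.graph := by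
  obtain ⟨B, hB⟩ := h.exists_op_slice hE hq hq1 k s
  obtain ⟨C, hC⟩ := h.exists_adjoint_slice hE hq hq1 k (raise k s)
  have hPx : ∀ x, jointProj q E (List.finRange n) s x ∈ joint q E s := jointProj_mem hE.commute s
  have hBx : ∀ x, B x ∈ joint q E (raise k s) := fun x =>
    hE.mem_joint_raise hq hq1 (hPx x) (hB x)
  have hCB : ∀ x, (B x, C (B x)) ∈ (z k).adjoint.graph := fun x => by
    have := hC (B x)
    rwa [jointProj_of_mem _ (hBx x)] at this
  have key : (fun x => C (B x)) = fun x => sliceQ q E s k (jointProj q E (List.finRange n) s x) -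
      sliceQ q E s (k + 1) (jointProj q E (List.finRange n) s x) := by
    refine Continuous.ext_on h.dense (by fun_prop) (by fun_prop) fun x hxD => ?_
    have hPD := jointProj_mem_of_proj_mem (q := q) hE.proj_mem (List.finRange n) s hxD
    change C (B x) = _
    rw [← h.adjoint_op_slice hE hq hq1 hPD (hPx x), app_eq (hB x), app_eq (hCB x)]
  have h1 := hB x
  have h2 := hCB x
  rw [congrFun key x, jointProj_of_mem _ hx] at h2
  rw [jointProj_of_mem _ hx] at h1
  exact ⟨B x, hBx x, h1, h2⟩

lemma IsStarRep.exists_adjoint_of_mem_joint (k : Fin n) {s : Fin n → Option ℤ} {x : H}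
    (hx : x ∈ joint q E s) : ∃ y ∈ joint q E (lower k s), (x, y) ∈ (z k).adjoint.graph ∧
      (y, (q : ℂ) ^ 2 • sliceQ q E s k x - sliceQ q E s (k + 1) x) ∈ (z k).graph := by
  obtain ⟨B, hB⟩ := h.exists_adjoint_slice hE hq hq1 k s
  obtain ⟨C, hC⟩ := h.exists_op_slice hE hq hq1 k (lower k s)
  have hPx : ∀ x, jointProj q E (List.finRange n) s x ∈ joint q E s := jointProj_mem hE.commute s
  have hBx : ∀ x, B x ∈ joint q E (lower k s) := fun x =>
    hE.mem_joint_lower hq hq1 (hPx x) (hB x)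
  have hCB : ∀ x, (B x, C (B x)) ∈ (z k).graph := fun x => by
    have := hC (B x)
    rwa [jointProj_of_mem _ (hBx x)] at this
  have key : (fun x => C (B x)) = fun x =>
      (q : ℂ) ^ 2 • sliceQ q E s k (jointProj q E (List.finRange n) s x) -
      sliceQ q E s (k + 1) (jointProj q E (List.finRange n) s x) := by
    refine Continuous.ext_on h.dense (by fun_prop) (by fun_prop) fun x hxD => ?_
    have hPD := jointProj_mem_of_proj_mem (q := q) hE.proj_mem (List.finRange n) s hxD
    change C (B x) = _
    rw [← h.op_adjoint_slice hE hq hq1 hPD (hPx x), app_eq (hB x), app_eq (hCB x)]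
  have h1 := hB x
  have h2 := hCB x
  rw [congrFun key x, jointProj_of_mem _ hx] at h2
  rw [jointProj_of_mem _ hx] at h1
  exact ⟨B x, hBx x, h1, h2⟩

end OnSlices

end Representation

/-! ### Admissible slices and the form of the `Q`'s on them -/

section Shape

variable {H : Type u} [NormedAddCommGroup H] [InnerProductSpace ℂ H] [CompleteSpace H]
variable {n : ℕ} {q : ℝ} {z : Fin n → H →ₗ.[ℂ] H} {D : Submodule ℂ H} {E : Fin n → PVM H}

section Energy

variable (hq : 0 < q) (hq1 : q < 1)

include hq hq1

lemma sliceQ_energy_le {s : Fin n → Option ℤ} {x : H} (hx : x ∈ joint q E s) {l : Fin n} {N : ℤ}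
    (hs : s l = some N) : (⟪x, sliceQ q E s l x⟫_ℂ).re ≤ q ^ (-2 * N) * ‖x‖ ^ 2 := by
  rw [sliceQ_fin hq hq1]
  refine PVM.re_inner_rint_le _ _ ?_
  filter_upwards [joint_ae hx l] with t ht
  rw [sliceId, Set.indicator_of_mem ht]
  rw [hs] at ht
  exact (lt_of_mem_slice hq hq1 ht).2

lemma lt_sliceQ_energy {s : Fin n → Option ℤ} {x : H} (hx : x ∈ joint q E s) {l : Fin n} {N : ℤ}
    (hs : s l = some N) (h0 : x ≠ 0) :
    q ^ 2 * q ^ (-2 * N) * ‖x‖ ^ 2 < (⟪x, sliceQ q E s l x⟫_ℂ).re := by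
  rw [sliceQ_fin hq hq1]
  refine PVM.lt_re_inner_rint _ _ ?_ h0
  filter_upwards [joint_ae hx l] with t ht
  rw [sliceId, Set.indicator_of_mem ht]
  rw [hs] at ht
  exact (lt_of_mem_slice hq hq1 ht).1

lemma sliceQ_energy_nonneg (s : Fin n → Option ℤ) (x : H) (l : ℕ) :
    0 ≤ (⟪x, sliceQ q E s l x⟫_ℂ).re := by
  rcases lt_or_ge l n with hl | hl
  · rw [show l = ((⟨l, hl⟩ : Fin n) : ℕ) from rfl, sliceQ_fin hq hq1, PVM.re_inner_rint]
    refine integral_nonneg fun t => ?_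
    rw [sliceId]
    refine Set.indicator_nonneg (fun t ht => ?_) t
    generalize s ⟨l, hl⟩ = o at ht
    cases o with
    | none => exact le_of_eq (Eq.symm ht)
    | some N => exact ht.1.le
  · rw [sliceQ_of_le s hl]
    simp

end Energy

section Slices

variable (h : IsStarRep q z D) (hE : SpectralConditions q z D E) (hq : 0 < q) (hq1 : q < 1)
variable {s : Fin n → Option ℤ} {x : H} (hx : x ∈ joint q E s)

include h hE hq hq1 hx

lemma IsStarRep.sliceQ_energy_succ_le (k : Fin n) :
    (⟪x, sliceQ q E s (k + 1) x⟫_ℂ).re ≤ (⟪x, sliceQ q E s k x⟫_ℂ).re := by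
  obtain ⟨y, -, h1, h2⟩ := h.exists_op_of_mem_joint hE hq hq1 k hx
  have h3 := h.inner_adjoint_op k h1 h2
  rw [inner_sub_right, Complex.sub_re] at h3
  nlinarith [sq_nonneg ‖y‖]

/-- Positivity of z_k z_k*. The factor q², absent from the companion bound given by z_k* z_k, is
what makes the exponents decrease strictly. -/
lemma IsStarRep.sliceQ_energy_succ_le_mul (k : Fin n) :
    (⟪x, sliceQ q E s (k + 1) x⟫_ℂ).re ≤ q ^ 2 * (⟪x, sliceQ q E s k x⟫_ℂ).re := by
  obtain ⟨y, -, h1, h2⟩ := h.exists_adjoint_of_mem_joint hE hq hq1 k hx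
  have h3 := h.inner_op_adjoint k h1 h2
  rw [inner_sub_right, inner_smul_right, ← Complex.ofReal_pow, Complex.sub_re,
    Complex.re_ofReal_mul] at h3
  nlinarith [sq_nonneg ‖y‖]

lemma IsStarRep.sliceQ_energy_antitone :
    Antitone fun l : ℕ => (⟪x, sliceQ q E s l x⟫_ℂ).re := by
  refine antitone_nat_of_succ_le fun l => ?_
  rcases lt_or_ge l n with hl | hl
  · exact h.sliceQ_energy_succ_le hE hq hq1 hx ⟨l, hl⟩
  · rw [sliceQ_of_le s hl, sliceQ_of_le s (by omega)]

/-- The energies decrease with the index and vanish at `k`, whereas on a slice away from 0 the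
energy of a non-zero vector is positive. -/
lemma IsStarRep.slice_eq_none_of_le (h0 : x ≠ 0) {k l : Fin n} (hk : s k = none) (hkl : k ≤ l) :
    s l = none := by
  cases hl : s l with
  | none => rfl
  | some N =>
    have h1 := h.sliceQ_energy_antitone hE hq hq1 hx (Fin.le_def.1 hkl)
    have h2 := lt_sliceQ_energy hq hq1 hx hl h0
    have h3 : (⟪x, sliceQ q E s k x⟫_ℂ).re = 0 := by simp [sliceQ_none hq hq1 hk]
    have h4 : 0 ≤ q ^ 2 * q ^ (-2 * N) * ‖x‖ ^ 2 := by positivity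
    simp only at h1
    linarith

lemma IsStarRep.op_eq_zero_of_slice_eq_none {k : Fin n} (hk : s k = none) :
    (x, (0 : H)) ∈ (z k).graph ∧ (x, (0 : H)) ∈ (z k).adjoint.graph := by
  have h3 : (⟪x, sliceQ q E s k x⟫_ℂ).re = 0 := by simp [sliceQ_none hq hq1 hk]
  have h4 := sliceQ_energy_nonneg (E := E) hq hq1 s x (k + 1)
  constructor
  · obtain ⟨y, -, h1, h2⟩ := h.exists_op_of_mem_joint hE hq hq1 k hx
    have h5 := h.inner_adjoint_op k h1 h2
    rw [inner_sub_right, Complex.sub_re] at h5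
    have h6 : ‖y‖ ^ 2 ≤ 0 := by linarith
    have h7 : y = 0 := by
      rw [← norm_le_zero_iff]
      nlinarith [norm_nonneg y]
    rwa [h7] at h1
  · obtain ⟨y, -, h1, h2⟩ := h.exists_adjoint_of_mem_joint hE hq hq1 k hx
    have h5 := h.inner_op_adjoint k h1 h2
    rw [inner_sub_right, inner_smul_right, ← Complex.ofReal_pow, Complex.sub_re,
      Complex.re_ofReal_mul, h3] at h5
    have h6 : ‖y‖ ^ 2 ≤ 0 := by linarith
    have h7 : y = 0 := by
      rw [← norm_le_zero_iff]
      nlinarith [norm_nonneg y]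
    rwa [h7] at h1

/-- The energy at the next index exceeds q² q^(-2b) ‖x‖² and is at most q² times the energy at `l`,
hence at most q² q^(-2a) ‖x‖². The half-open form of the slices makes one of these bounds strict. -/
lemma IsStarRep.slice_succ_lt (h0 : x ≠ 0) {l l' : Fin n} (hl : (l : ℕ) + 1 = l') {a b : ℤ}
    (ha : s l = some a) (hb : s l' = some b) : b < a := by
  have h1 := h.sliceQ_energy_succ_le_mul hE hq hq1 hx l
  rw [hl] at h1
  have h2 := lt_sliceQ_energy hq hq1 hx hb h0
  have h3 := sliceQ_energy_le hq hq1 hx ha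
  have h4 : 0 < ‖x‖ := norm_pos_iff.2 h0
  have h5 : q ^ 2 * ‖x‖ ^ 2 * q ^ (-2 * b) < q ^ 2 * ‖x‖ ^ 2 * q ^ (-2 * a) := by
    nlinarith [sq_nonneg q]
  have h6 := lt_of_mul_lt_mul_left h5 (by positivity)
  have h7 := (zpow_lt_zpow_iff_right_of_lt_one₀ hq hq1).1 h6
  omega

omit hx

/-- The rigidity of the representation: lowering with z_l* reduces the gap between the two exponents
down to its minimal value 1, where z_l* vanishes. The vector is generalized in the induction because
the step passes to its image under z_l*. -/
lemma IsStarRep.sliceQ_eq_smul_aux {l l' : Fin n} (hl : (l : ℕ) + 1 = l') (i : ℕ) :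
    ∀ (s : Fin n → Option ℤ) {x : H}, x ∈ joint q E s → ∀ b : ℤ, s l = some (b + 1 + i) →
      s l' = some b →
      sliceQ q E s l x = ((q ^ (-2 * (1 + (i : ℤ))) : ℝ) : ℂ) • sliceQ q E s l' x := by
  have hll' : l < l' := Fin.lt_def.2 (by omega)
  have hqc : (q : ℂ) ≠ 0 := Complex.ofReal_ne_zero.2 hq.ne'
  induction i with
  | zero =>
    intro s x hx b ha hb
    obtain ⟨y, hy, h1, h2⟩ := h.exists_adjoint_of_mem_joint hE hq hq1 l hx
    -- After lowering, both exponents would equal `b`, which is impossible for a non-zero vector.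
    -- Hence z_l z_l* vanishes at `x`, that is, q² Q_l x equals the next Q applied to x.
    have hy0 : y = 0 := by
      by_contra hne
      have := h.slice_succ_lt hE hq hq1 hy hne hl (a := b) (b := b)
        (by simp [lower, ha]) (by simp [lower, hll', hb])
      omega
    rw [hy0, hl] at h2
    have h3 := LinearPMap.mem_graph_snd_inj _ h2 (Submodule.zero_mem _) rfl
    have h4 : sliceQ q E s l' x = (q : ℂ) ^ 2 • sliceQ q E s l x := (sub_eq_zero.1 h3).symm
    rw [h4, smul_smul]
    have : ((q ^ (-2 * (1 + ((0 : ℕ) : ℤ))) : ℝ) : ℂ) * (q : ℂ) ^ 2 = 1 := by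
      push_cast
      rw [← zpow_natCast, ← zpow_add₀ hqc]
      norm_num
    rw [this, one_smul]
  | succ i ih =>
    intro s x hx b ha hb
    obtain ⟨y, hy, h1, h2⟩ := h.exists_adjoint_of_mem_joint hE hq hq1 l hx
    have hla : lower l s l = some (b + 1 + i) := by
      simp only [lower, lt_irrefl, if_false, ha, Option.map_some]
      congr 1
      push_cast
      ring
    have hlb : lower l s l' = some b := by simp [lower, hll', hb]
    have h3 := ih (lower l s) hy b hla hlb
    have h4 : ((q : ℂ) ^ 2 • sliceQ q E s l x, sliceQ q E (lower l s) l y) ∈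
        (z l).adjoint.graph := by
      rw [sliceQ_fin hq hq1, sliceQ_fin hq hq1]
      refine hE.hasInt_adjoint (PVM.measurable_coe (measurable_sliceId _))
        ((PVM.measurable_coe (measurable_sliceId (q := q) (s l))).const_mul ((q : ℂ) ^ 2))
        (by simpa using sliceId_bound hq hq1 _) (fun t => ?_) h1
        (PVM.hasInt_rint (measurable_sliceId _) (sliceId_bound hq hq1 _) y)
        (PVM.HasInt.smul (PVM.hasInt_rint (measurable_sliceId _) (sliceId_bound hq hq1 _) x) _)
      rw [if_neg (lt_irrefl _), sliceId_mul hq hq1, hla, ha]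
      push_cast
      simp only [Option.map_some, add_assoc]
    have h5 : (sliceQ q E s l' x, sliceQ q E (lower l s) l' y) ∈ (z l).adjoint.graph := by
      rw [sliceQ_fin hq hq1, sliceQ_fin hq hq1]
      refine hE.hasInt_adjoint (PVM.measurable_coe (measurable_sliceId _))
        (PVM.measurable_coe (measurable_sliceId (q := q) (s l')))
        (by simpa using sliceId_bound hq hq1 _) (fun t => ?_) h1
        (PVM.hasInt_rint (measurable_sliceId _) (sliceId_bound hq hq1 _) y)
        (PVM.hasInt_rint (measurable_sliceId _) (sliceId_bound hq hq1 _) x)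
      rw [if_pos hll', hlb, hb]
    -- The induction hypothesis at z_l* x, pulled back with the commutation rules, says that z_l*
    -- kills `v`. The factor q² in `v` comes from moving Q_l past z_l*.
    set c : ℝ := q ^ (-2 * (1 + (i : ℤ))) with hc
    set v := (q : ℂ) ^ 2 • sliceQ q E s l x - (c : ℂ) • sliceQ q E s l' x with hv
    have hvs : v ∈ joint q E s := Submodule.sub_mem _
      (Submodule.smul_mem _ _ (hE.sliceQ_mem hx l)) (Submodule.smul_mem _ _ (hE.sliceQ_mem hx l'))
    have hv0 : (v, (0 : H)) ∈ (z l).adjoint.graph := by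
      have h6 := Submodule.sub_mem _ h4 (Submodule.smul_mem _ (c : ℂ) h5)
      rw [h3, Prod.smul_mk, Prod.mk_sub_mk, sub_self] at h6
      exact h6
    -- On this slice the gap is at least 2, so z_l* is injective: q² times the energy at `l` exceeds
    -- q^(-2b) q^(-2i) ‖v‖² ≥ q^(-2b) ‖v‖², which bounds the energy at the next index.
    have hv1 : v = 0 := by
      by_contra hne
      obtain ⟨y', -, h6, h7⟩ := h.exists_adjoint_of_mem_joint hE hq hq1 l hvs
      have h8 := h.inner_op_adjoint l h6 h7
      rw [LinearPMap.mem_graph_snd_inj _ h6 hv0 rfl, norm_zero, inner_sub_right, inner_smul_right,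
        ← Complex.ofReal_pow, Complex.sub_re, Complex.re_ofReal_mul, hl] at h8
      have h9 := lt_sliceQ_energy hq hq1 hvs ha hne
      have h10 := sliceQ_energy_le hq hq1 hvs hb
      have h11 : 0 < ‖v‖ := norm_pos_iff.2 hne
      have h12 : q ^ 2 * (q ^ 2 * q ^ (-2 * (b + 1 + ((i + 1 : ℕ) : ℤ)))) =
          q ^ (-2 * b) * q ^ (-2 * (i : ℤ)) := by
        rw [← zpow_natCast, ← zpow_add₀ hq.ne', ← zpow_add₀ hq.ne', ← zpow_add₀ hq.ne']
        congr 1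
        push_cast
        ring
      have h13 : 1 ≤ q ^ (-2 * (i : ℤ)) := one_le_zpow_neg_two hq hq1 (by omega)
      have h14 : 0 < q ^ (-2 * b) * ‖v‖ ^ 2 := by positivity
      have h15 : q ^ 2 * (q ^ 2 * q ^ (-2 * (b + 1 + ((i + 1 : ℕ) : ℤ))) * ‖v‖ ^ 2) <
          q ^ 2 * (⟪v, sliceQ q E s l v⟫_ℂ).re := mul_lt_mul_of_pos_left h9 (by positivity)
      rw [← mul_assoc, h12] at h15
      nlinarith
    have h6 : (q : ℂ) ^ 2 • sliceQ q E s l x = (c : ℂ) • sliceQ q E s l' x := sub_eq_zero.1 hv1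
    have h7 : sliceQ q E s l x = ((q : ℂ) ^ 2)⁻¹ • ((q : ℂ) ^ 2 • sliceQ q E s l x) := by
      rw [smul_smul, inv_mul_cancel₀ (by positivity), one_smul]
    rw [h7, h6, smul_smul]
    congr 1
    rw [hc]
    push_cast
    rw [← zpow_natCast, ← zpow_neg, ← zpow_add₀ hqc]
    congr 1
    push_cast
    ring

end Slices

/-- The slices that correspond to a multi-index. -/
def sliceOf (p : Index n) (l : Fin n) : Option ℤ :=
  if (l : ℕ) < p.1 then some (tailSum l p.2.1) else none

lemma sliceOf_of_lt {p : Index n} {l : Fin n} (hl : (l : ℕ) < p.1) :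
    sliceOf p l = some (tailSum l p.2.1) := if_pos hl

lemma sliceOf_of_le {p : Index n} {l : Fin n} (hl : (p.1 : ℕ) ≤ l) : sliceOf p l = none :=
  if_neg (by omega)

lemma tailSum_of_le {l : ℕ} (hl : n ≤ l) (i : Fin n → ℤ) : tailSum l i = 0 :=
  Finset.sum_eq_zero fun m hm => by
    have := (Finset.mem_filter.1 hm).2
    omega

lemma tailSum_eq_zero {m : Fin (n + 1)} (i : MultiIndex n m) {l : ℕ} (hl : (m : ℕ) ≤ l) :
    tailSum l i.1 = 0 :=
  Finset.sum_eq_zero fun k hk => (i.2 k).2 (by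
    have := (Finset.mem_filter.1 hk).2
    omega)

lemma sliceOf_injective : Function.Injective (sliceOf : Index n → Fin n → Option ℤ) := by
  rintro ⟨m, i⟩ ⟨m', i'⟩ hs
  have hm : m = m' := by
    by_contra hne
    wlog hlt : m < m' generalizing m m'
    · exact this m' i' m i hs.symm (Ne.symm hne) (lt_of_le_of_ne (not_lt.1 hlt) (Ne.symm hne))
    have h1 := Fin.lt_def.1 hlt
    have h2 := congrFun hs ⟨m, by omega⟩
    rw [sliceOf_of_le (by simp), sliceOf_of_lt (by simpa using h1)] at h2
    exact absurd h2 (by simp)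
  subst hm
  congr 1
  have hN : ∀ l : ℕ, tailSum l i.1 = tailSum l i'.1 := by
    intro l
    rcases lt_or_ge l m with hl | hl
    · have h2 := congrFun hs ⟨l, by omega⟩
      rw [sliceOf_of_lt (by simpa using hl), sliceOf_of_lt (by simpa using hl)] at h2
      exact Option.some.inj h2
    · rw [tailSum_eq_zero i hl, tailSum_eq_zero i' hl]
  apply Subtype.ext
  funext l
  have h1 := tailSum_eq l i.1
  have h2 := tailSum_eq l i'.1
  rw [hN, hN] at h1
  omega

lemma raise_sliceOf {j : Fin n} {p : Index n} (hj : (j : ℕ) < p.1) :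
    raise j (sliceOf p) = sliceOf (shiftIdx j p) := by
  funext l
  simp only [raise, sliceOf, shiftIdx, shift_val hj, tailSum_add_single, Fin.lt_def]
  by_cases hjl : (j : ℕ) < l
  · simp [hjl, show ¬ (l : ℕ) ≤ j by omega]
  · simp [hjl, show (l : ℕ) ≤ j by omega, show (l : ℕ) < p.1 by omega]

/-- `m` is the first position with the piece {0}, and the entries are the differences of consecutive
exponents; they are ≥ 1 by strict decrease, except for the last one, which may be any integer. -/
lemma exists_sliceOf_eq {s : Fin n → Option ℤ}
    (h1 : ∀ k l : Fin n, s k = none → k ≤ l → s l = none)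
    (h2 : ∀ (l l' : Fin n) (a b : ℤ), (l : ℕ) + 1 = l' → s l = some a → s l' = some b → b < a) :
    ∃ p : Index n, sliceOf p = s := by
  classical
  have hex : ∃ m : ℕ, ∀ l : Fin n, m ≤ l → s l = none := ⟨n, fun l hl => by omega⟩
  set m := Nat.find hex with hm
  have hmn : m ≤ n := Nat.find_min' hex fun l hl => by omega
  have hlt : ∀ l : Fin n, (l : ℕ) < m → s l ≠ none := fun l hl hs =>
    Nat.find_min hex hl fun l' hl' => h1 l l' hs (Fin.le_def.2 hl')
  -- The exponents are continued by 0 from position `m` on, so that the last entry is the last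
  -- exponent itself and the tail sums telescope.
  set N : ℕ → ℤ := fun l => if hl : l < n then (s ⟨l, hl⟩).getD 0 else 0 with hN
  have hN0 : ∀ l, m ≤ l → N l = 0 := fun l hl => by
    simp only [hN]
    split_ifs with h3
    · rw [Nat.find_spec hex ⟨l, h3⟩ hl]
      rfl
    · rfl
  have hNs : ∀ l : Fin n, (l : ℕ) < m → s l = some (N l) := fun l hl => by
    obtain ⟨a, ha⟩ := Option.ne_none_iff_exists'.1 (hlt l hl)
    simp only [hN, l.2, dif_pos, Fin.eta, ha, Option.getD_some]
  have hsum : ∀ d l : ℕ, l + d = n → tailSum l (fun l : Fin n => N l - N (l + 1)) = N l := by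
    intro d
    induction d with
    | zero =>
      intro l hl
      rw [tailSum_of_le (by omega), hN0 _ (by omega)]
    | succ d ih =>
      intro l hl
      have := tailSum_eq ⟨l, by omega⟩ (fun l : Fin n => N l - N (l + 1))
      simp only at this
      rw [this, ih _ (by omega)]
      ring
  refine ⟨⟨⟨m, by omega⟩, ⟨fun l => N l - N (l + 1), fun l => ⟨fun hl => ?_, fun hl => ?_⟩⟩⟩, ?_⟩
  · have h3 := h2 l ⟨l + 1, by simp only at hl; omega⟩ _ _ rfl (hNs l (by simp only at hl; omega))
      (hNs ⟨l + 1, by simp only at hl; omega⟩ (by simpa using hl))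
    simp only at h3 ⊢
    omega
  · simp only at hl ⊢
    rw [hN0 _ (by omega), hN0 _ (by omega), sub_zero]
  · funext l
    rcases lt_or_ge (l : ℕ) m with hl | hl
    · rw [sliceOf_of_lt (by simpa using hl), hNs l hl, hsum (n - l) l (by omega)]
    · rw [sliceOf_of_le (by simpa using hl), Nat.find_spec hex l hl]

section Summands

variable (h : IsStarRep q z D) (hE : SpectralConditions q z D E) (hq : 0 < q) (hq1 : q < 1)

include h hE hq hq1

lemma IsStarRep.exists_sliceOf {s : Fin n → Option ℤ} {x : H} (hx : x ∈ joint q E s)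
    (h0 : x ≠ 0) : ∃ p : Index n, sliceOf p = s :=
  exists_sliceOf_eq (fun _ _ hk hkl => h.slice_eq_none_of_le hE hq hq1 hx h0 hk hkl)
    fun _ _ _ _ hl ha hb => h.slice_succ_lt hE hq hq1 hx h0 hl ha hb

/-- A non-zero joint projection of `x` lies in a slice given by a multi-index, and its inner product
with `x` is its own squared norm. Hence all joint projections vanish. -/
lemma IsStarRep.eq_zero_of_inner {x : H}
    (hx : ∀ p : Index n, ∀ y ∈ joint q E (sliceOf p), ⟪x, y⟫_ℂ = 0) : x = 0 := by
  refine eq_zero_of_jointProj (q := q) (fun l => h.proj_Iio hE l) (List.nodup_finRange n) fun s => ?_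
  have hm := jointProj_mem hE.commute (q := q) s x
  by_contra hne
  obtain ⟨p, rfl⟩ := h.exists_sliceOf hE hq hq1 hm hne
  have h1 := inner_jointProj (List.finRange n) x hm
  rw [hx p _ hm, inner_self_eq_zero] at h1
  exact hne h1

omit h hE

lemma phase_bound : ∃ C, ∀ t, ‖phase q t‖ ≤ C :=
  ⟨1, fun t => by
    rw [Real.norm_of_nonneg (hq.trans (lt_phase hq hq1 t)).le]
    exact phase_le_one hq hq1 t⟩

lemma phase_inv_bound : ∃ C, ∀ t, ‖(phase q t)⁻¹‖ ≤ C :=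
  ⟨q⁻¹, fun t => by
    have h1 := lt_phase hq hq1 t
    rw [Real.norm_of_nonneg (inv_nonneg.2 (hq.trans h1).le)]
    exact inv_anti₀ hq h1.le⟩

omit hq hq1

open Classical in
variable (q E) in
/-- The operator whose restrictions to the summands with first index `m` are the coefficient
operators of the model. -/
def coefOp (m : Fin (n + 1)) : H →L[ℂ] H :=
  if hq : 0 < q ∧ q < 1 then
    Fin.cases 0 (fun k => (E k).rint (phase q) (measurable_phase hq.1) (phase_bound hq.1 hq.2)) m
  else 0

open Classical in
variable (q E) in
/-- The inverse of `coefOp q E m` for `m ≠ 0`. -/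
def coefInv (m : Fin (n + 1)) : H →L[ℂ] H :=
  if hq : 0 < q ∧ q < 1 then
    Fin.cases 0 (fun k => (E k).rint (fun t => (phase q t)⁻¹) (measurable_phase hq.1).inv
      (phase_inv_bound hq.1 hq.2)) m
  else 0

lemma coefOp_zero : coefOp q E 0 = 0 := by
  unfold coefOp
  split_ifs <;> simp

lemma coefInv_zero : coefInv q E 0 = 0 := by
  unfold coefInv
  split_ifs <;> simp

include hq hq1 in
lemma coefOp_succ (k : Fin n) : coefOp q E k.succ =
    (E k).rint (phase q) (measurable_phase hq) (phase_bound hq hq1) := by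
  rw [coefOp, dif_pos ⟨hq, hq1⟩, Fin.cases_succ]

include hq hq1 in
lemma coefInv_succ (k : Fin n) : coefInv q E k.succ =
    (E k).rint (fun t => (phase q t)⁻¹) (measurable_phase hq).inv (phase_inv_bound hq hq1) := by
  rw [coefInv, dif_pos ⟨hq, hq1⟩, Fin.cases_succ]

lemma rint_one (k : Fin n) (hb : ∃ C, ∀ t : ℝ, ‖(fun _ : ℝ => (1 : ℝ)) t‖ ≤ C) (x : H) :
    (E k).rint (fun _ => 1) measurable_const hb x = x := by
  refine PVM.bint_eq _ _ ?_
  have h1 := PVM.hasInt_indicator (E := E k) MeasurableSet.univ x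
  rw [(E k).univ] at h1
  refine h1.congr_ae (Eventually.of_forall fun t => ?_)
  simp

include hq hq1 in
lemma coefOp_coefInv {m : Fin (n + 1)} (hm : m ≠ 0) (x : H) :
    coefOp q E m (coefInv q E m x) = x := by
  obtain ⟨k, rfl⟩ := Fin.exists_succ_eq.2 hm
  have h1 : ∀ t, phase q t * (phase q t)⁻¹ = 1 := fun t =>
    mul_inv_cancel₀ (hq.trans (lt_phase hq hq1 t)).ne'
  rw [coefOp_succ hq hq1, coefInv_succ hq hq1,
    PVM.rint_mul _ _ _ _ ⟨1, fun t => by rw [h1]; simp⟩]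
  simp only [h1]
  exact rint_one _ _ _

include hq hq1 in
lemma coefInv_coefOp {m : Fin (n + 1)} (hm : m ≠ 0) (x : H) :
    coefInv q E m (coefOp q E m x) = x := by
  obtain ⟨k, rfl⟩ := Fin.exists_succ_eq.2 hm
  have h1 : ∀ t, (phase q t)⁻¹ * phase q t = 1 := fun t =>
    inv_mul_cancel₀ (hq.trans (lt_phase hq hq1 t)).ne'
  rw [coefOp_succ hq hq1, coefInv_succ hq hq1,
    PVM.rint_mul _ _ _ _ ⟨1, fun t => by rw [h1]; simp⟩]
  simp only [h1]
  exact rint_one _ _ _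

include hq hq1 in
lemma coefOp_inner_left (m : Fin (n + 1)) (x y : H) :
    ⟪coefOp q E m x, y⟫_ℂ = ⟪x, coefOp q E m y⟫_ℂ := by
  induction m using Fin.cases with
  | zero => simp [coefOp_zero]
  | succ k =>
    rw [coefOp_succ hq hq1]
    exact PVM.inner_rint_left _ _ x y

include hE hq hq1 in
lemma SpectralConditions.coefOp_mem (m : Fin (n + 1)) {s : Fin n → Option ℤ} {x : H}
    (hx : x ∈ joint q E s) : coefOp q E m x ∈ joint q E s := by
  induction m using Fin.cases with
  | zero =>
    rw [coefOp_zero]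
    exact Submodule.zero_mem _
  | succ k =>
    rw [coefOp_succ hq hq1]
    exact bint_mem_joint hE.commute _ _ _ hx

include hE hq hq1 in
lemma SpectralConditions.coefInv_mem (m : Fin (n + 1)) {s : Fin n → Option ℤ} {x : H}
    (hx : x ∈ joint q E s) : coefInv q E m x ∈ joint q E s := by
  induction m using Fin.cases with
  | zero =>
    rw [coefInv_zero]
    exact Submodule.zero_mem _
  | succ k =>
    rw [coefInv_succ hq hq1]
    exact bint_mem_joint hE.commute _ _ _ hx

include hq hq1 in
lemma coefOp_energy_le (k : Fin n) (x : H) :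
    (⟪x, coefOp q E k.succ x⟫_ℂ).re ≤ ‖x‖ ^ 2 := by
  rw [coefOp_succ hq hq1, ← one_mul (‖x‖ ^ 2)]
  exact PVM.re_inner_rint_le _ _ (Eventually.of_forall (phase_le_one hq hq1))

include hq hq1 in
lemma lt_coefOp_energy (k : Fin n) {x : H} (hx : x ≠ 0) :
    q * ‖x‖ ^ 2 < (⟪x, coefOp q E k.succ x⟫_ℂ).re := by
  rw [coefOp_succ hq hq1]
  exact PVM.lt_re_inner_rint _ _ (Eventually.of_forall (lt_phase hq hq1)) hx

include hE hq hq1 in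
lemma SpectralConditions.coefOp_op (m : Fin (n + 1)) {j : Fin n} {x y : H}
    (hxy : (x, y) ∈ (z j).graph) : (coefOp q E m x, coefOp q E m y) ∈ (z j).graph := by
  induction m using Fin.cases with
  | zero =>
    rw [coefOp_zero]
    exact Submodule.zero_mem _
  | succ k =>
    rw [coefOp_succ hq hq1]
    exact hE.rint_op _ _ hq.ne' (phase_mul hq hq1) k hxy

include hE hq hq1 in
lemma SpectralConditions.coefInv_op (m : Fin (n + 1)) {j : Fin n} {x y : H}
    (hxy : (x, y) ∈ (z j).graph) : (coefInv q E m x, coefInv q E m y) ∈ (z j).graph := by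
  induction m using Fin.cases with
  | zero =>
    rw [coefInv_zero]
    exact Submodule.zero_mem _
  | succ k =>
    rw [coefInv_succ hq hq1]
    exact hE.rint_op _ _ hq.ne' (fun t => by rw [phase_mul hq hq1]) k hxy

include hq hq1 in
lemma sliceQ_eq_coefOp_sq {k : Fin n} {s : Fin n → Option ℤ} {N : ℤ} (hs : s k = some N) {x : H}
    (hx : x ∈ joint q E s) : sliceQ q E s k x =
      ((q ^ (-2 * N) : ℝ) : ℂ) • coefOp q E k.succ (coefOp q E k.succ x) := by
  have hb2 : ∃ C, ∀ t, ‖phase q t * phase q t‖ ≤ C := by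
    obtain ⟨C, hC⟩ := phase_bound hq hq1
    exact ⟨C * C, fun t => by
      rw [norm_mul]
      exact mul_le_mul (hC t) (hC t) (norm_nonneg _) ((norm_nonneg _).trans (hC t))⟩
  rw [sliceQ_fin hq hq1, coefOp_succ hq hq1, PVM.rint_mul _ _ _ _ hb2]
  have h1 := PVM.HasInt.smul (PVM.hasInt_rint (E := E k)
    ((measurable_phase hq).mul (measurable_phase hq)) hb2 x) ((q ^ (-2 * N) : ℝ) : ℂ)
  refine PVM.bint_eq _ _ (h1.congr_ae ?_)
  filter_upwards [joint_ae hx k] with t ht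
  rw [sliceId, Set.indicator_of_mem ht]
  rw [hs] at ht
  conv_rhs => rw [id, ← phase_sq hq hq1 ht]
  simp only [Pi.mul_apply]
  push_cast
  ring

include h hE hq hq1

/-- Descending induction from the last position of the multi-index. There the claim is the
definition of `phase`; each step down multiplies by the power of q given by `sliceQ_eq_smul_aux`.
Beyond the last position the piece is {0}. -/
lemma IsStarRep.sliceQ_eq_level {p : Index n} {x : H} (hx : x ∈ joint q E (sliceOf p)) (l : ℕ) :
    sliceQ q E (sliceOf p) l x =
      (level q l p : ℂ) • coefOp q E p.1 (coefOp q E p.1 x) := by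
  rcases lt_or_ge l p.1 with hl | hl
  · obtain ⟨d, hd⟩ : ∃ d, l + d + 1 = (p.1 : ℕ) := ⟨p.1 - l - 1, by omega⟩
    induction d generalizing l with
    | zero =>
      have hln : l < n := by omega
      have hk : p.1 = (⟨l, hln⟩ : Fin n).succ := by
        ext
        simp only [Fin.val_succ]
        omega
      have h1 := sliceQ_eq_coefOp_sq (E := E) hq hq1 (k := ⟨l, hln⟩)
        (sliceOf_of_lt (p := p) (l := ⟨l, hln⟩) hl) hx
      rw [← hk] at h1
      rw [level_of_lt hl]
      exact h1
    | succ d ih =>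
      have hln : l + 1 < n := by omega
      have h1 := ih (l + 1) (by omega) (by omega)
      have h0 : x = 0 ∨ x ≠ 0 := eq_or_ne x 0
      rcases h0 with rfl | h0
      · simp
      have ha := sliceOf_of_lt (p := p) (l := ⟨l, by omega⟩) hl
      have hb := sliceOf_of_lt (p := p) (l := ⟨l + 1, hln⟩) (show l + 1 < (p.1 : ℕ) by omega)
      have hlt := h.slice_succ_lt hE hq hq1 hx h0 (l := ⟨l, by omega⟩) (l' := ⟨l + 1, hln⟩) rfl
        ha hb
      simp only at ha hb hlt
      obtain ⟨i, hi⟩ := Int.le.dest (Int.add_one_le_iff.2 hlt)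
      have h2 := h.sliceQ_eq_smul_aux hE hq hq1 (l := ⟨l, by omega⟩) (l' := ⟨l + 1, hln⟩) rfl i
        (sliceOf p) hx (tailSum (l + 1) p.2.1) (by rw [ha, hi]) hb
      simp only at h2
      rw [h2, h1, smul_smul, level_of_lt hl, level_of_lt (show l + 1 < (p.1 : ℕ) by omega), ← hi]
      congr 1
      norm_cast
      rw [← zpow_add₀ hq.ne']
      congr 1
      push_cast
      ring
  · rw [level_of_le hl]
    rcases lt_or_ge l n with hn | hn
    · have := sliceQ_none (E := E) hq hq1 (l := ⟨l, hn⟩) (sliceOf_of_le (p := p) hl) x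
      simpa using this
    · rw [sliceQ_of_le _ hn]
      simp

lemma IsStarRep.exists_op_shift {j : Fin n} {p : Index n} (hj : (j : ℕ) < p.1) {x : H}
    (hx : x ∈ joint q E (sliceOf p)) : ∃ y ∈ joint q E (sliceOf (shiftIdx j p)),
      (x, y) ∈ (z j).graph ∧
      (y, ((weight q j p.2 ^ 2 : ℝ) : ℂ) • coefOp q E p.1 (coefOp q E p.1 x)) ∈
        (z j).adjoint.graph := by
  obtain ⟨y, hy, h1, h2⟩ := h.exists_op_of_mem_joint hE hq hq1 j hx
  rw [raise_sliceOf hj] at hy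
  refine ⟨y, hy, h1, ?_⟩
  rw [h.sliceQ_eq_level hE hq hq1 hx, h.sliceQ_eq_level hE hq hq1 hx, ← sub_smul,
    ← Complex.ofReal_sub, ← weight_sq hq hq1] at h2
  exact h2

lemma IsStarRep.exists_adjoint_shift {j : Fin n} {p : Index n} (hj : (j : ℕ) < p.1) {x : H}
    (hx : x ∈ joint q E (sliceOf (shiftIdx j p))) : ∃ y ∈ joint q E (sliceOf p),
      (x, y) ∈ (z j).adjoint.graph ∧
      (y, ((weight q j p.2 ^ 2 : ℝ) : ℂ) • coefOp q E p.1 (coefOp q E p.1 x)) ∈ (z j).graph := by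
  obtain ⟨y, hy, h1, h2⟩ := h.exists_adjoint_of_mem_joint hE hq hq1 j hx
  rw [← raise_sliceOf hj, lower_raise] at hy
  refine ⟨y, hy, h1, ?_⟩
  rw [h.sliceQ_eq_level hE hq hq1 hx, h.sliceQ_eq_level hE hq hq1 hx, smul_smul, ← sub_smul,
    ← Complex.ofReal_pow, ← Complex.ofReal_mul, ← Complex.ofReal_sub,
    ← weight_sq_shift hq hq1] at h2
  exact h2

lemma IsStarRep.op_eq_zero_of_le {j : Fin n} {p : Index n} (hj : (p.1 : ℕ) ≤ j) {x : H}
    (hx : x ∈ joint q E (sliceOf p)) :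
    (x, (0 : H)) ∈ (z j).graph ∧ (x, (0 : H)) ∈ (z j).adjoint.graph :=
  h.op_eq_zero_of_slice_eq_none hE hq hq1 hx (sliceOf_of_le hj)

/-- Here z_j z_j* = q² Q_j - Q_{j+1} has coefficient zero by `level_notMem_range`, so ‖z_j* x‖² = 0.
-/
lemma IsStarRep.adjoint_eq_zero_of_notMem_range {j : Fin n} {p : Index n}
    (hp : p ∉ Set.range (shiftIdx j)) {x : H} (hx : x ∈ joint q E (sliceOf p)) :
    (x, (0 : H)) ∈ (z j).adjoint.graph := by
  obtain ⟨y, hy, h1, h2⟩ := h.exists_adjoint_of_mem_joint hE hq hq1 j hx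
  rw [h.sliceQ_eq_level hE hq hq1 hx, h.sliceQ_eq_level hE hq hq1 hx, smul_smul, ← sub_smul,
    ← Complex.ofReal_pow, ← Complex.ofReal_mul, ← Complex.ofReal_sub,
    level_notMem_range hq hp] at h2
  have h3 := h.inner_op_adjoint j h1 h2
  simp only [Complex.ofReal_zero, zero_smul, inner_zero_right, Complex.zero_re] at h3
  have h4 : y = 0 := norm_eq_zero.1 (pow_eq_zero_iff (two_ne_zero)|>.1 h3.symm)
  rwa [h4] at h1

end Summands

end Shape

/-! ### Coherent identifications along commuting shifts -/

section Trivialization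

variable {n : ℕ} {k : Fin (n + 1)}

/-- Commuting self-maps of a type that are invertible where the multi-indices are unbounded below
generate an action of the shifts. -/
lemma exists_shift_family {T : Type*} [Monoid T] (f : Fin n → T) (hc : ∀ i j, Commute (f i) (f j))
    (hu : ∀ j : Fin n, (j : ℕ) + 1 = k → IsUnit (f j)) : ∃ V : MultiIndex n k → T,
      V (baseIndex k) = 1 ∧ ∀ j : Fin n, (j : ℕ) < k → ∀ i, V (shift j i) = f j * V i := by
  classical
  -- One commuting factor per position: powers with exponent a - 1 where the entries start at 1,
  -- integral powers of a unit at the last position, and 1 beyond it. All factors are 1 at the base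
  -- index.
  obtain ⟨g, hg0, hg1, hg2, hg⟩ : ∃ g : Fin n → ℤ → T,
      (∀ j, g j (if (j : ℕ) + 1 < k then 1 else 0) = 1) ∧
      (∀ (j : Fin n) a, (j : ℕ) + 1 < k → 1 ≤ a → g j (a + 1) = f j * g j a) ∧
      (∀ (j : Fin n) a, (j : ℕ) + 1 = k → g j (a + 1) = f j * g j a) ∧
      ∀ i j a b, i ≠ j → Commute (g i a) (g j b) := by
    refine ⟨fun j a => if (j : ℕ) + 1 < k then f j ^ (a - 1).toNat
      else if h : (j : ℕ) + 1 = k then ((hu j h).unit ^ a : Tˣ) else 1, fun j => ?_,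
      fun j a hj ha => ?_, fun j a hj => ?_, fun i j a b hij => ?_⟩
    · by_cases hj : (j : ℕ) + 1 < k
      · simp [hj]
      · by_cases hj' : (j : ℕ) + 1 = k <;> simp [hj, hj']
    · simp only [if_pos hj]
      rw [show (a + 1 - 1).toNat = (a - 1).toNat + 1 by omega, pow_succ']
    · simp only [if_neg (show ¬ (j : ℕ) + 1 < k by omega), dif_pos hj]
      rw [add_comm, zpow_one_add, Units.val_mul, IsUnit.unit_spec]
    · have key : ∀ (j : Fin n) (b : ℤ) (x : T), (∀ l, Commute x (f l)) →
          Commute x (if (j : ℕ) + 1 < k then f j ^ (b - 1).toNat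
            else if h : (j : ℕ) + 1 = k then ((hu j h).unit ^ b : Tˣ) else 1) := by
        intro j b x hx
        split_ifs with h1 h2
        · exact (hx j).pow_right _
        · exact Commute.units_zpow_right (by simpa using hx j) b
        · exact Commute.one_right x
      exact key j b _ fun l => (key i a _ fun l' => hc l l').symm
  have hcomm : ∀ (s : Finset (Fin n)) (i : MultiIndex n k),
      (s : Set (Fin n)).Pairwise (Function.onFun Commute fun j => g j (i.1 j)) :=
    fun s i a _ b _ hab => hg a b _ _ hab
  refine ⟨fun i => Finset.univ.noncommProd (fun j => g j (i.1 j)) (hcomm _ i), ?_, fun j hj i => ?_⟩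
  · exact (Finset.noncommProd_eq_pow_card _ _ _ 1 fun j _ => hg0 j).trans (one_pow _)
  · simp only
    rw [← Finset.mul_noncommProd_erase _ (Finset.mem_univ j), ← Finset.mul_noncommProd_erase
      Finset.univ (Finset.mem_univ j) (fun j => g j (i.1 j)), ← mul_assoc]
    congr 1
    · rw [shift_apply_self hj]
      rcases lt_or_ge ((j : ℕ) + 1) k with h1 | h1
      · exact hg1 j _ h1 ((i.2 j).1 h1)
      · exact hg2 j _ (by omega)
    · exact Finset.noncommProd_congr rfl (fun l hl => by
        rw [shift_apply_ne (Finset.ne_of_mem_erase hl)]) _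

variable {H : Type u} [NormedAddCommGroup H] [InnerProductSpace ℂ H]

/-- A family of subspaces with commuting isomorphisms along the shifts can be trivialized. -/
lemma exists_trivialization (G : MultiIndex n k → Submodule ℂ H)
    (F : ∀ j : Fin n, (j : ℕ) < k → ∀ i, G i ≃ₗᵢ[ℂ] G (shift j i))
    (hF : ∀ i j hi hj p x, (F i hi _ (F j hj p x) : H) = F j hj _ (F i hi p x)) :
    ∃ L : ∀ i, G (baseIndex k) ≃ₗᵢ[ℂ] G i, L (baseIndex k) = LinearIsometryEquiv.refl ℂ _ ∧
      ∀ j hj i x, L (shift j i) x = F j hj i (L i x) := by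
  -- The shift maps have varying sources and targets. Composition with them becomes a family of
  -- self-maps of this one type of pairs, to which `exists_shift_family` applies; the result is
  -- evaluated at the identity of the base subspace.
  let T := Σ i : MultiIndex n k, G (baseIndex k) ≃ₗᵢ[ℂ] G i
  have hT : ∀ t t' : T, t.1 = t'.1 → (∀ x, (t.2 x : H) = t'.2 x) → t = t' := by
    rintro ⟨i, L⟩ ⟨i', L'⟩ h1 h2
    obtain rfl : i = i' := h1
    congr 1
    exact LinearIsometryEquiv.ext fun x => Subtype.ext (h2 x)
  let f : Fin n → Function.End T := fun j t =>
    if hj : (j : ℕ) < k then ⟨shift j t.1, t.2.trans (F j hj t.1)⟩ else t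
  have hf : ∀ (j : Fin n) (hj : (j : ℕ) < k) t, f j t = ⟨shift j t.1, t.2.trans (F j hj t.1)⟩ :=
    fun j hj t => dif_pos hj
  have hf' : ∀ (j : Fin n) (hj : ¬ (j : ℕ) < k) t, f j t = t := fun j hj t => dif_neg hj
  have hc : ∀ i j, Commute (f i) (f j) := by
    intro i j
    refine funext fun t => ?_
    change f i (f j t) = f j (f i t)
    by_cases hi : (i : ℕ) < k
    · by_cases hj : (j : ℕ) < k
      · rw [hf i hi, hf j hj, hf j hj, hf i hi]
        exact hT _ _ (shift_comm i j t.1) fun x => hF i j hi hj t.1 (t.2 x)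
      · rw [hf' j hj, hf' j hj]
    · rw [hf' i hi, hf' i hi]
  -- At the last position the index runs through all integers, so every multi-index is a shift and
  -- the self-map can be undone.
  have hu : ∀ j : Fin n, (j : ℕ) + 1 = k → IsUnit (f j) := by
    intro j hjk
    have hj : (j : ℕ) < k := by omega
    have hb : Function.Bijective (f j : T → T) := by
      constructor
      · rintro ⟨i, L⟩ ⟨i', L'⟩ h
        rw [hf j hj, hf j hj] at h
        obtain rfl : i = i' := shift_injective j (congrArg Sigma.fst h)
        have h2 : L.trans (F j hj i) = L'.trans (F j hj i) := eq_of_heq (Sigma.mk.inj h).2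
        congr 1
        exact LinearIsometryEquiv.ext fun x => (F j hj i).injective (DFunLike.congr_fun h2 x)
      · rintro ⟨i', L'⟩
        obtain ⟨i, rfl⟩ := mem_range_shift (j := j) i' (fun h => by omega)
        refine ⟨⟨i, L'.trans (F j hj i).symm⟩, ?_⟩
        rw [hf j hj]
        exact hT _ _ rfl fun x => by simp
    let e := Equiv.ofBijective _ hb
    exact ⟨⟨f j, fun t => e.symm t, funext fun t => e.apply_symm_apply t, funext fun t =>
      e.symm_apply_apply t⟩, rfl⟩
  obtain ⟨V, hV1, hV2⟩ := exists_shift_family f hc hu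
  let t₀ : T := ⟨baseIndex k, LinearIsometryEquiv.refl ℂ _⟩
  have hL : ∀ i, ∃ L, V i t₀ = ⟨i, L⟩ := by
    have h1 : ∀ i, (V i t₀).1 = i := by
      refine multiIndex_induction (b := baseIndex k) (fun l => rfl) ?_ fun j hj i => ?_
      · rw [hV1]
        rfl
      · rw [hV2 j hj]
        change _ ↔ (f j (V i t₀)).1 = _
        rw [hf j hj]
        exact (shift_injective j).eq_iff.symm
    intro i
    generalize hV : V i t₀ = t
    obtain ⟨i', L⟩ := t
    obtain rfl : i' = i := by
      have := h1 i
      rw [hV] at this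
      exact this
    exact ⟨L, rfl⟩
  choose L hL using hL
  refine ⟨L, ?_, fun j hj i x => ?_⟩
  · have h1 := hL (baseIndex k)
    rw [hV1] at h1
    exact (eq_of_heq (Sigma.mk.inj h1).2).symm
  have h1 := hL (shift j i)
  rw [hV2 j hj] at h1
  change f j (V i t₀) = _ at h1
  rw [hL, hf j hj] at h1
  have h2 : (L i).trans (F j hj i) = L (shift j i) := eq_of_heq (Sigma.mk.inj h1).2
  rw [← h2]
  rfl

end Trivialization

/-! ### Unitary shifts between the joint spectral subspaces -/

section ShiftEquiv

variable {H : Type u} [NormedAddCommGroup H] [InnerProductSpace ℂ H] [CompleteSpace H]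
variable {n : ℕ} {q : ℝ} {z : Fin n → H →ₗ.[ℂ] H} {D : Submodule ℂ H} {E : Fin n → PVM H}
variable (h : IsStarRep q z D) (hE : SpectralConditions q z D E) (hq : 0 < q) (hq1 : q < 1)

include h hE hq hq1

/-- The relation is known on `D` only. Composed with the joint projection, both products are bounded
operators that agree on `D`, hence everywhere, and in particular at the vectors of the slice. -/
lemma IsStarRep.op_op_of_mem_joint {i j : Fin n} (hij : i < j) {s : Fin n → Option ℤ}
    {x a b c d : H} (hx : x ∈ joint q E s) (ha : (x, a) ∈ (z i).graph) (hb : (a, b) ∈ (z j).graph)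
    (hc : (x, c) ∈ (z j).graph) (hd : (c, d) ∈ (z i).graph) : b = (q : ℂ) • d := by
  set P := jointProj q E (List.finRange n)
  obtain ⟨Bi, hBi⟩ := h.exists_op_slice hE hq hq1 i s
  obtain ⟨Bj, hBj⟩ := h.exists_op_slice hE hq hq1 j s
  obtain ⟨Cj, hCj⟩ := h.exists_op_slice hE hq hq1 j (raise i s)
  obtain ⟨Ci, hCi⟩ := h.exists_op_slice hE hq hq1 i (raise j s)
  have hP : ∀ x, P s x ∈ joint q E s := jointProj_mem hE.commute s
  have h1 : ∀ x, (Bi x, Cj (Bi x)) ∈ (z j).graph := fun x => by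
    have := hCj (Bi x)
    rwa [jointProj_of_mem _ (hE.mem_joint_raise hq hq1 (hP x) (hBi x))] at this
  have h2 : ∀ x, (Bj x, Ci (Bj x)) ∈ (z i).graph := fun x => by
    have := hCi (Bj x)
    rwa [jointProj_of_mem _ (hE.mem_joint_raise hq hq1 (hP x) (hBj x))] at this
  have key : (fun x => Cj (Bi x)) = fun x => (q : ℂ) • Ci (Bj x) := by
    refine Continuous.ext_on h.dense (by fun_prop) (by fun_prop) fun x hxD => ?_
    have hPD : P s x ∈ D := jointProj_mem_of_proj_mem hE.proj_mem _ s hxD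
    have h3 : (P s x, Cj (Bi x)) ∈ ((pcomp (z j) (z i)).domRestrict D).graph :=
      (mem_graph_domRestrict _ _ _ _).2 ⟨hPD, (mem_graph_pcomp _ _ _ _).2 ⟨_, hBi x, h1 x⟩⟩
    rw [h.rel_zz i j hij] at h3
    exact LinearPMap.mem_graph_snd_inj _ h3 ((mem_graph_domRestrict _ _ _ _).2 ⟨hPD,
      (mem_graph_smul _ _ _ _).2 ⟨_, (mem_graph_pcomp _ _ _ _).2 ⟨_, hBj x, h2 x⟩, rfl⟩⟩) rfl
  have hPx : P s x = x := jointProj_of_mem _ hx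
  have e1 : Bi x = a := LinearPMap.mem_graph_snd_inj _ (hBi x) ha hPx
  have e2 : Bj x = c := LinearPMap.mem_graph_snd_inj _ (hBj x) hc hPx
  have e3 : Cj (Bi x) = b := LinearPMap.mem_graph_snd_inj _ (h1 x) hb e1
  have e4 : Ci (Bj x) = d := LinearPMap.mem_graph_snd_inj _ (h2 x) hd e2
  rw [← e3, ← e4]
  exact congrFun key x

/-- With A the coefficient operator and w the weight, the unitary is w⁻¹ z_j A⁻¹. It is isometric
because z_j* z_j = w² A² on the source, and A⁻¹ is moved across the inner product by
self-adjointness. -/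
lemma IsStarRep.exists_shift_equiv {j : Fin n} {p : Index n} (hj : (j : ℕ) < p.1) :
    ∃ F : joint q E (sliceOf p) ≃ₗᵢ[ℂ] joint q E (sliceOf (shiftIdx j p)),
      ∀ x : joint q E (sliceOf p), (coefInv q E p.1 x, (weight q j p.2 : ℂ) • (F x : H)) ∈ (z j).graph ∧
        ((F x : H), (weight q j p.2 : ℂ) • coefOp q E p.1 x) ∈ (z j).adjoint.graph := by
  set w : ℝ := weight q j p.2 with hw
  have hw0 : 0 < w := weight_pos hq hq1 hj
  have hwc : (w : ℂ) ≠ 0 := Complex.ofReal_ne_zero.2 hw0.ne'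
  have hp0 : p.1 ≠ 0 := fun h0 => by simp [h0] at hj
  have hex : ∀ x : joint q E (sliceOf p), ∃ y : joint q E (sliceOf (shiftIdx j p)),
      (coefInv q E p.1 x, (w : ℂ) • (y : H)) ∈ (z j).graph ∧
        ((y : H), (w : ℂ) • coefOp q E p.1 x) ∈ (z j).adjoint.graph := by
    intro x
    obtain ⟨y, hy, h1, h2⟩ := h.exists_op_shift hE hq hq1 hj (hE.coefInv_mem hq hq1 p.1 x.2)
    refine ⟨⟨(w : ℂ)⁻¹ • y, Submodule.smul_mem _ _ hy⟩, ?_, ?_⟩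
    · simpa only [smul_inv_smul₀ hwc] using h1
    · have h3 := Submodule.smul_mem _ (w : ℂ)⁻¹ h2
      rw [Prod.smul_mk, coefOp_coefInv hq hq1 hp0, smul_smul, ← hw] at h3
      convert h3 using 3
      push_cast
      field_simp
  choose f hf1 hf2 using hex
  have huniq : ∀ {x : joint q E (sliceOf p)} {y : joint q E (sliceOf (shiftIdx j p))} {u : H},
      u = coefInv q E p.1 x → (u, (w : ℂ) • (y : H)) ∈ (z j).graph → f x = y := by
    intro x y u hu hy
    have := LinearPMap.mem_graph_snd_inj _ (hf1 x) hy hu.symm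
    exact Subtype.ext (smul_right_injective H hwc this)
  let F₀ : joint q E (sliceOf p) →ₗᵢ[ℂ] joint q E (sliceOf (shiftIdx j p)) :=
    { toFun := f
      map_add' := fun x y => huniq (map_add _ _ _).symm (by
        have := Submodule.add_mem _ (hf1 x) (hf1 y)
        rwa [Prod.mk_add_mk, ← smul_add] at this)
      map_smul' := fun c x => huniq (map_smul _ _ _).symm (by
        have := Submodule.smul_mem _ c (hf1 x)
        rwa [Prod.smul_mk, smul_comm] at this)
      norm_map' := fun x => by
        have h1 := inner_graph_adjoint (h.dense_domain j) (hf1 x) (hf2 x)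
        rw [inner_smul_left, inner_smul_right, Complex.conj_ofReal, coefOp_inner_left hq hq1,
          coefOp_coefInv hq hq1 hp0, inner_self_eq_norm_sq_to_K, inner_self_eq_norm_sq_to_K] at h1
        have h2 := mul_left_cancel₀ hwc h1
        have h3 : ‖(x : H)‖ ^ 2 = ‖(f x : H)‖ ^ 2 := by exact_mod_cast h2
        exact ((sq_eq_sq₀ (norm_nonneg _) (norm_nonneg _)).1 h3).symm }
  refine ⟨LinearIsometryEquiv.ofSurjective F₀ fun y => ?_, fun x => ⟨hf1 x, hf2 x⟩⟩
  obtain ⟨u, hu, h1, h2⟩ := h.exists_adjoint_shift hE hq hq1 hj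
    (hE.coefInv_mem hq hq1 p.1 (hE.coefInv_mem hq hq1 p.1 y.2))
  rw [coefOp_coefInv hq hq1 hp0, coefOp_coefInv hq hq1 hp0, ← hw] at h2
  -- With u = z_j* A⁻² y one has z_j u = w² y, so w⁻¹ A u is a preimage of `y`.
  refine ⟨⟨(w : ℂ)⁻¹ • coefOp q E p.1 u, Submodule.smul_mem _ _ (hE.coefOp_mem hq hq1 _ hu)⟩, ?_⟩
  refine huniq (u := (w : ℂ)⁻¹ • u) ?_ ?_
  · rw [map_smul, coefInv_coefOp hq hq1 hp0]
  · have h3 := Submodule.smul_mem _ (w : ℂ)⁻¹ h2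
    rw [Prod.smul_mk, smul_smul] at h3
    convert h3 using 3
    push_cast
    field_simp

/-- The unitary shifts commute with the coefficient operator, since z_j does, and with one another,
so they trivialize coherently. Undoing the normalization recovers z_j with its weight and the
coefficient operator. -/
lemma IsStarRep.exists_summand_equiv (m : Fin (n + 1)) :
    ∃ L : ∀ i : MultiIndex n m,
        joint q E (sliceOf ⟨m, baseIndex m⟩) ≃ₗᵢ[ℂ] joint q E (sliceOf ⟨m, i⟩),
      (∀ i (x : joint q E (sliceOf ⟨m, baseIndex m⟩)), (L i ⟨coefOp q E m x, hE.coefOp_mem hq hq1 m x.2⟩ : H) = coefOp q E m (L i x)) ∧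
      ∀ (j : Fin n) (_ : (j : ℕ) < m) i (x : joint q E (sliceOf ⟨m, baseIndex m⟩)),
        ((L i x : H), (weight q j i : ℂ) • coefOp q E m (L (shift j i) x)) ∈ (z j).graph ∧
        ((L (shift j i) x : H), (weight q j i : ℂ) • coefOp q E m (L i x)) ∈
          (z j).adjoint.graph := by
  have hFex : ∀ (j : Fin n) (hj : (j : ℕ) < m) (i : MultiIndex n m), _ :=
    fun j hj i => h.exists_shift_equiv hE hq hq1 (j := j) (p := ⟨m, i⟩) hj
  choose F hF using hFex
  have hFA : ∀ j hj i (x : joint q E (sliceOf ⟨m, i⟩)), (F j hj i ⟨coefOp q E m x, hE.coefOp_mem hq hq1 m x.2⟩ : H) =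
      coefOp q E m (F j hj i x) := by
    intro j hj i x
    have hm : m ≠ 0 := fun h0 => by simp [h0] at hj
    have h1 := (hF j hj i ⟨coefOp q E m x, hE.coefOp_mem hq hq1 m x.2⟩).1
    have h2 := hE.coefOp_op hq hq1 m (hF j hj i x).1
    rw [map_smul] at h2
    have h3 := LinearPMap.mem_graph_snd_inj _ h1 h2 (by
      simp only
      rw [coefInv_coefOp hq hq1 hm, coefOp_coefInv hq hq1 hm])
    exact smul_right_injective H
      (Complex.ofReal_ne_zero.2 (weight_pos hq hq1 (p := ⟨m, i⟩) hj).ne') h3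
  have hFc : ∀ i j hi hj p (x : joint q E (sliceOf ⟨m, p⟩)), (F i hi _ (F j hj p x) : H) = F j hj _ (F i hi p x) := by
    intro i j hi hj p x
    wlog hij : i < j generalizing i j
    · rcases (not_lt.1 hij).eq_or_lt with rfl | hlt
      · rfl
      · exact (this j i hj hi hlt).symm
    -- The weights satisfy the same `q`-relation as the generators, so the factor q cancels and the
    -- normalized shifts commute exactly.
    have hw := weight_mul_weight hq hij ⟨m, p⟩
    have hwp : 0 < weight q i (shift j p) * weight q j p :=
      mul_pos (weight_pos hq hq1 (p := ⟨m, _⟩) hi) (weight_pos hq hq1 (p := ⟨m, _⟩) hj)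
    have ha := hE.coefInv_op hq hq1 m (hF i hi p x).1
    have hb := Submodule.smul_mem _ (weight q i p : ℂ) (hF j hj _ (F i hi p x)).1
    have hc := hE.coefInv_op hq hq1 m (hF j hj p x).1
    have hd := Submodule.smul_mem _ (weight q j p : ℂ) (hF i hi _ (F j hj p x)).1
    rw [map_smul] at ha hc
    have key := h.op_op_of_mem_joint hE hq hq1 hij
      (hE.coefInv_mem hq hq1 m (hE.coefInv_mem hq hq1 m x.2)) ha hb hc hd
    rw [smul_smul, smul_smul, smul_smul, mul_comm] at key
    have hw' : (weight q j (shift i p) : ℂ) * weight q i p =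
        q * ((weight q j p : ℂ) * weight q i (shift j p)) := by
      rw [mul_comm (weight q j p : ℂ)]
      exact_mod_cast hw
    rw [hw', mul_assoc] at key
    refine (smul_right_injective H ?_ key).symm
    rw [mul_comm (weight q j p : ℂ)]
    exact mul_ne_zero (Complex.ofReal_ne_zero.2 hq.ne') (by exact_mod_cast hwp.ne')
  obtain ⟨L, hL0, hL⟩ := exists_trivialization (fun i => joint q E (sliceOf ⟨m, i⟩)) F hFc
  have hLA : ∀ i (x : joint q E (sliceOf ⟨m, baseIndex m⟩)), (L i ⟨coefOp q E m x, hE.coefOp_mem hq hq1 m x.2⟩ : H) =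
      coefOp q E m (L i x) := by
    refine multiIndex_induction (b := baseIndex m) (fun l => rfl) (fun x => by
      rw [hL0]
      rfl) fun j hj i => ?_
    refine forall_congr' fun x => ?_
    rw [hL j hj, hL j hj, ← hFA]
    constructor
    · intro h1
      congr 2
      exact Subtype.ext h1
    · intro h1
      exact congrArg Subtype.val ((F j hj i).injective (Subtype.ext h1))
  refine ⟨L, hLA, fun j hj i x => ?_⟩
  have hm : m ≠ 0 := fun h0 => by simp [h0] at hj
  rw [hL j hj]
  have h1 := (hF j hj i ⟨coefOp q E m (L i x), hE.coefOp_mem hq hq1 m (L i x).2⟩).1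
  rw [hFA] at h1
  simp only [coefInv_coefOp hq hq1 hm] at h1
  exact ⟨h1, (hF j hj i (L i x)).2⟩

end ShiftEquiv

/-! ### Recognizing a closed operator from its components -/

section BlockCriterion

variable {ι : Type*} {ε : Type*} {G : ι → Type*} [∀ i, NormedAddCommGroup (G i)]
  [∀ i, InnerProductSpace ℂ (G i)] [∀ i, CompleteSpace (G i)] [DecidableEq ι]
variable {H : Type u} [NormedAddCommGroup H] [InnerProductSpace ℂ H] [CompleteSpace H]
variable (e : H ≃ₗᵢ[ℂ] lp G 2) {s t : ε → ι} {T : ∀ a, G (s a) →L[ℂ] G (t a)}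

/-- A closed operator is determined by its values on the components and those of its adjoint. -/
lemma eq_blockOp (hs : Function.Injective s) (ht : Function.Injective t) {S : H →ₗ.[ℂ] H}
    (hSc : S.IsClosed) (hS : ∀ i h, bsingle e i h ∈ S.domain)
    (h1 : ∀ a g, (bsingle e (t a) g, bsingle e (s a) ((T a).adjoint g)) ∈ S.adjoint.graph)
    (h2 : ∀ i, i ∉ Set.range t → ∀ g, (bsingle e i g, (0 : H)) ∈ S.adjoint.graph) :
    S = blockOp e s t T := by
  have hd : Dense (S.domain : Set H) := dense_of_bsingle_mem e hS
  -- Pairing a pair of the graph with the known values of the adjoint yields the componentwise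
  -- equations, without any assumption that `S` is generated by its components. Equality follows
  -- because `S` is closed and contains a core.
  have hle : S ≤ blockOp e s t T := by
    refine pmap_le fun x y hxy => (mem_graph_blockOp e s t T).2 ⟨fun a => ?_, fun i hi => ?_⟩
    · refine ext_inner_left ℂ fun g => ?_
      rw [← inner_bsingle, ← inner_graph_adjoint hd hxy (h1 a g), inner_bsingle,
        ContinuousLinearMap.adjoint_inner_left]
    · refine ext_inner_left ℂ fun g => ?_
      rw [← inner_bsingle, ← inner_graph_adjoint hd hxy (h2 i hi g), inner_zero_left,
        inner_zero_right]
  rw [← closure_eq_blockOp e hs ht hle hS]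
  apply LinearPMap.eq_of_eq_graph
  rw [← hSc.isClosable.graph_closure_eq_closure_graph]
  exact (IsClosed.submodule_topologicalClosure_eq hSc).symm

end BlockCriterion

/-! ### Spectrum and quadratic form -/

section Coefficients

variable {K : Type u} [NormedAddCommGroup K] [InnerProductSpace ℂ K] [CompleteSpace K]

/-- The bounds on the form are the operator inequalities a ≤ A ≤ b, and the continuous functional
calculus converts these into bounds on the real spectrum. -/
lemma spectrum_subset_of_energy {A : K →L[ℂ] K} (hA : IsSelfAdjoint A) {a b : ℝ}
    (ha : ∀ x, a * ‖x‖ ^ 2 ≤ (⟪x, A x⟫_ℂ).re) (hb : ∀ x, (⟪x, A x⟫_ℂ).re ≤ b * ‖x‖ ^ 2) :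
    spectrum ℂ A ⊆ (fun t : ℝ => (t : ℂ)) '' Set.Icc a b := by
  have hscal : ∀ (r : ℝ) (x : K), (⟪x, algebraMap ℝ (K →L[ℂ] K) r x⟫_ℂ).re = r * ‖x‖ ^ 2 := by
    intro r x
    rw [Algebra.algebraMap_eq_smul_one]
    change (⟪x, r • x⟫_ℂ).re = _
    rw [inner_smul_right_eq_smul, Complex.smul_re, inner_self_eq_norm_sq_to_K, smul_eq_mul]
    norm_cast
  have hsa : ∀ r : ℝ, IsSelfAdjoint (algebraMap ℝ (K →L[ℂ] K) r) :=
    fun r => IsSelfAdjoint.algebraMap _ (IsSelfAdjoint.all r)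
  have h1 : algebraMap ℝ (K →L[ℂ] K) a ≤ A := by
    rw [ContinuousLinearMap.le_def, ContinuousLinearMap.isPositive_def]
    refine ⟨ContinuousLinearMap.isSelfAdjoint_iff_isSymmetric.1 (hA.sub (hsa a)), fun x => ?_⟩
    rw [ContinuousLinearMap.reApplyInnerSelf, inner_re_symm]
    change 0 ≤ (⟪x, A x - algebraMap ℝ (K →L[ℂ] K) a x⟫_ℂ).re
    rw [inner_sub_right, Complex.sub_re, hscal]
    linarith [ha x]
  have h2 : A ≤ algebraMap ℝ (K →L[ℂ] K) b := by
    rw [ContinuousLinearMap.le_def, ContinuousLinearMap.isPositive_def]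
    refine ⟨ContinuousLinearMap.isSelfAdjoint_iff_isSymmetric.1 ((hsa b).sub hA), fun x => ?_⟩
    rw [ContinuousLinearMap.reApplyInnerSelf, inner_re_symm]
    change 0 ≤ (⟪x, algebraMap ℝ (K →L[ℂ] K) b x - A x⟫_ℂ).re
    rw [inner_sub_right, Complex.sub_re, hscal]
    linarith [hb x]
  rw [← hA.spectrumRestricts.algebraMap_image]
  rintro _ ⟨t, ht, rfl⟩
  exact ⟨t, ⟨(algebraMap_le_iff_le_spectrum (a := A) hA).1 h1 t ht,
    (le_algebraMap_iff_spectrum_le (a := A) hA).1 h2 t ht⟩, rfl⟩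

end Coefficients

/-! ### The model attached to a representation -/

section Classification

variable {H : Type u} [NormedAddCommGroup H] [InnerProductSpace ℂ H] [CompleteSpace H]
variable {n : ℕ} {q : ℝ} {z : Fin n → H →ₗ.[ℂ] H} {D : Submodule ℂ H} {E : Fin n → PVM H}
variable (h : IsStarRep q z D) (hE : SpectralConditions q z D E) (hq : 0 < q) (hq1 : q < 1)

/-- The summand with first index `m` and lowest remaining indices. -/
abbrev baseSummand (q : ℝ) (E : Fin n → PVM H) (m : Fin (n + 1)) : Submodule ℂ H :=
  joint q E (sliceOf ⟨m, baseIndex m⟩)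

/-- The restriction of `coefOp` to the summand with lowest indices. -/
def coefRestrict (m : Fin (n + 1)) (hmem : ∀ x ∈ baseSummand q E m, coefOp q E m x ∈
    baseSummand q E m) : baseSummand q E m →L[ℂ] baseSummand q E m :=
  ((coefOp q E m).comp (baseSummand q E m).subtypeL).codRestrict _ fun x => hmem x x.2

instance (m : Fin (n + 1)) : CompleteSpace (baseSummand q E m) :=
  (joint_isClosed _).completeSpace_coe

lemma coefRestrict_isSelfAdjoint (hq : 0 < q) (hq1 : q < 1) (m : Fin (n + 1))
    (hmem : ∀ x ∈ baseSummand q E m, coefOp q E m x ∈ baseSummand q E m) :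
    IsSelfAdjoint (coefRestrict m hmem) :=
  ContinuousLinearMap.isSelfAdjoint_iff_isSymmetric.2 fun x y =>
    coefOp_inner_left hq hq1 m (x : H) y

/-- The model of a well-behaved representation. -/
def modelOf (hE : SpectralConditions q z D E) (hq : 0 < q) (hq1 : q < 1) : Model.{u} n q where
  K m := baseSummand q E m
  A k := coefRestrict k.succ fun _ hx => hE.coefOp_mem hq hq1 k.succ hx
  isSelfAdjoint k := coefRestrict_isSelfAdjoint hq hq1 k.succ _
  spectrum_subset k := by
    refine spectrum_subset_of_energy (coefRestrict_isSelfAdjoint hq hq1 k.succ _)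
      (fun x => ?_) fun x => ?_
    · rcases eq_or_ne (x : H) 0 with h0 | h0
      · rw [show x = 0 from Subtype.ext h0]
        simp
      · exact (lt_coefOp_energy hq hq1 k h0).le
    · rw [one_mul]
      exact coefOp_energy_le hq hq1 k (x : H)
  not_eigenvalue k x hx := by
    -- `phase` exceeds `q` everywhere, so the form of the coefficient operator strictly exceeds q
    -- ‖x‖² at a non-zero vector; an eigenvector for `q` would give equality.
    by_contra h0
    have h1 : (x : H) ≠ 0 := fun h' => h0 (Subtype.ext h')
    have h2 := lt_coefOp_energy (E := E) hq hq1 k h1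
    have h3 : coefOp q E k.succ (x : H) = (q : ℂ) • (x : H) := congrArg Subtype.val hx
    rw [h3, inner_smul_right, inner_self_eq_norm_sq_to_K, Complex.re_ofReal_mul] at h2
    norm_cast at h2
    exact lt_irrefl _ h2

lemma coe_modelOf_coeff (m : Fin (n + 1)) (x : baseSummand q E m) :
    (show baseSummand q E m from (modelOf hE hq hq1).coeff m x : H) = coefOp q E m x := by
  induction m using Fin.cases with
  | zero =>
    rw [coefOp_zero]
    rfl
  | succ k => rfl

/-- The norm of ∫ t dE x is the `L²` norm of the identity function, so it vanishes exactly when the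
scalar measure of `x` is concentrated at 0. -/
lemma SpectralConditions.mem_kernel_Q_iff (hE : SpectralConditions q z D E) (k : Fin n) (x : H) :
    x ∈ kernel (Q z D k) ↔ (E k).proj {0} x = x := by
  rw [mem_kernel_iff, hE.eq_integral, PVM.mem_graph_integral]
  constructor
  · intro h1
    have h2 := h1.enorm_eq Complex.measurable_ofReal
    rw [enorm_zero, eq_comm, eLpNorm_eq_zero_iff
      Complex.measurable_ofReal.aestronglyMeasurable two_ne_zero] at h2
    have h3 : (E k).measure x {0}ᶜ = 0 := by
      refine measure_mono_null (fun t ht => ?_) h2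
      exact fun h4 => ht (Complex.ofReal_eq_zero.1 h4)
    rw [PVM.measure_apply _ _ (measurableSet_singleton 0).compl, ENNReal.ofReal_eq_zero] at h3
    have h4 : (E k).proj {0}ᶜ x = 0 := by
      rw [← norm_le_zero_iff]
      nlinarith [norm_nonneg ((E k).proj {0}ᶜ x)]
    have h5 := (E k).proj_union (measurableSet_singleton 0) (measurableSet_singleton 0).compl
      disjoint_compl_right x
    rw [Set.union_compl_self, (E k).univ, h4, add_zero] at h5
    exact h5.symm
  · intro h1
    have h2 := PVM.hasInt_indicator (E := E k) MeasurableSet.empty x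
    rw [(E k).proj_empty] at h2
    refine h2.congr_ae ?_
    filter_upwards [PVM.ae_mem (measurableSet_singleton 0) h1] with t ht
    rw [Set.mem_singleton_iff.1 ht]
    simp

end Classification

/-! ### Decomposition of a representation and its identification with a model -/

section Decomposition

variable {H : Type u} [NormedAddCommGroup H] [InnerProductSpace ℂ H] [CompleteSpace H]
variable {n : ℕ} {q : ℝ} {z : Fin n → H →ₗ.[ℂ] H} {D : Submodule ℂ H} {E : Fin n → PVM H}

/-- Distinct multi-indices give distinct, hence orthogonal, slices; completeness is
`IsStarRep.eq_zero_of_inner`. -/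
lemma IsStarRep.isHilbertSum (h : IsStarRep q z D) (hE : SpectralConditions q z D E) (hq : 0 < q)
    (hq1 : q < 1) {K : Index n → Type*} [∀ p, NormedAddCommGroup (K p)]
    [∀ p, InnerProductSpace ℂ (K p)] [∀ p, CompleteSpace (K p)]
    (L : ∀ p, K p ≃ₗᵢ[ℂ] joint q E (sliceOf p)) :
    IsHilbertSum ℂ K fun p => (joint q E (sliceOf p)).subtypeₗᵢ.comp (L p).toLinearIsometry := by
  refine IsHilbertSum.mk (fun p p' hp v w => joint_orthogonal (sliceOf_injective.ne hp) (L p v).2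
    (L p' w).2) (top_le_iff.2 ((Submodule.topologicalClosure_eq_top_iff).2 ?_))
  rw [eq_bot_iff]
  intro x hx
  refine (Submodule.mem_bot ℂ).2 (h.eq_zero_of_inner hE hq hq1 fun p y hy => ?_)
  refine (Submodule.mem_orthogonal' _ _).1 hx y (Submodule.mem_iSup_of_mem p ?_)
  exact ⟨(L p).symm ⟨y, hy⟩, by simp⟩

/-- Every representation satisfying the spectral conditions is equivalent to a model. -/
theorem IsStarRep.exists_model (h : IsStarRep q z D) (hE : SpectralConditions q z D E)
    (hq : 0 < q) (hq1 : q < 1) : ∃ (M : Model.{u} n q) (U : H ≃ₗᵢ[ℂ] M.Space),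
      (∀ j, z j = blockOp (G := fun p : Index n => M.K p.1) U id (shiftIdx j)
        (fun p => M.entry j p)) ∧
      ∀ k : Fin n, kernel (Q z D k) =
        (M.part (Set.Iic k.castSucc)).comap U.toLinearEquiv.toLinearMap := by
  set M := modelOf hE hq hq1 with hM
  choose L hLA hL using fun m => h.exists_summand_equiv hE hq hq1 m
  let L' : ∀ p : Index n, M.K p.1 ≃ₗᵢ[ℂ] joint q E (sliceOf p) := fun p => L p.1 p.2
  have hV := h.isHilbertSum hE hq hq1 L'
  let U : H ≃ₗᵢ[ℂ] lp (fun p : Index n => M.K p.1) 2 := hV.linearIsometryEquiv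
  have hU : ∀ p g, bsingle (G := fun p : Index n => M.K p.1) U p g = (L' p g : H) := fun p g =>
    hV.linearIsometryEquiv_symm_apply_single g
  have hmem : ∀ p g, bsingle (G := fun p : Index n => M.K p.1) U p g ∈ joint q E (sliceOf p) :=
    fun p g => by
      rw [hU]
      exact (L' p g).2
  have hentry : ∀ j (p : Index n) (g : M.K p.1),
      bsingle (G := fun p : Index n => M.K p.1) U p (M.entry j p g) =
        (weight q j p.2 : ℂ) • coefOp q E p.1 (L' p g : H) := by
    intro j p g
    rw [hU, Model.entry_apply, map_smul]
    refine congrArg ((weight q j p.2 : ℂ) • ·) ?_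
    refine Eq.trans ?_ (hLA p.1 p.2 g)
    refine congrArg (fun v => (L p.1 p.2 v : H)) ?_
    exact Subtype.ext (coe_modelOf_coeff hE hq hq1 p.1 g)
  refine ⟨M, U, fun j => ?_, fun k => ?_⟩
  · refine eq_blockOp (G := fun p : Index n => M.K p.1) U Function.injective_id
      (shiftIdx_injective j) (h.isClosed j) (fun p g => ?_) (fun p g => ?_) fun p hp g =>
        h.adjoint_eq_zero_of_notMem_range hE hq hq1 hp (hmem p g)
    · rcases lt_or_ge (j : ℕ) p.1 with hj | hj
      · rw [hU]
        exact LinearPMap.mem_domain_of_mem_graph (hL p.1 j hj p.2 g).1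
      · exact LinearPMap.mem_domain_of_mem_graph
          (h.op_eq_zero_of_le hE hq hq1 hj (hmem p g)).1
    · have h1 : (M.entry j p).adjoint = M.entry j p := M.entry_adjoint j p
      rw [h1]
      change (_, bsingle (G := fun p : Index n => M.K p.1) U p (M.entry j p g)) ∈ _
      rw [hentry]
      rcases lt_or_ge (j : ℕ) p.1 with hj | hj
      · rw [hU]
        exact (hL p.1 j hj p.2 g).2
      · rw [weight_of_le hj, Complex.ofReal_zero, zero_smul]
        exact (h.op_eq_zero_of_le hE hq hq1 (p := shiftIdx j p) hj (hmem (shiftIdx j p) g)).2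
  · ext x
    rw [hE.mem_kernel_Q_iff]
    change _ ↔ ∀ p : Index n, p.1 ∉ Set.Iic k.castSucc → U x p = 0
    have hlt : ∀ p : Index n, p.1 ∉ Set.Iic k.castSucc → (k : ℕ) < p.1 := fun p hp => by
      simpa [Fin.lt_def] using hp
    constructor
    -- These summands lie in a slice of the `k`-th spectral measure that misses 0, so they are
    -- orthogonal to the range of the projection for {0}.
    · intro hx p hp
      refine ext_inner_left ℂ fun g => ?_
      have h1 := hmem p g k
      have hdisj : slice q (some (tailSum k p.2.1)) ∩ {0} = ∅ :=
        (disjoint_slice (o := some _) (o' := none) (by simp)).inter_eq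
      rw [sliceOf_of_lt (hlt p hp)] at h1
      refine (inner_bsingle (G := fun p : Index n => M.K p.1) U p g x).symm.trans ?_
      rw [inner_zero_right, ← hx, ← h1, (E k).inner_proj (measurableSet_slice _)
        (measurableSet_singleton 0), hdisj, (E k).proj_empty]
      simp
    · intro hx
      have h1 := hasSum_bsingle (G := fun p : Index n => M.K p.1) U x
      refine (h1.mapL ((E k).proj {0})).unique ?_
      convert h1 using 2 with p
      -- For the remaining summands the `k`-th piece is {0} itself, so the projection fixes every
      -- term of the expansion.
      by_cases hp : p.1 ∈ Set.Iic k.castSucc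
      · have h2 := hmem p (U x p) k
        rwa [sliceOf_of_le (by simpa [Fin.le_def] using hp)] at h2
      · rw [hx p hp, bsingle_zero, map_zero]

end Decomposition

/-! ### Transport of the model structure along the unitary -/

section Transport

variable {H : Type u} [NormedAddCommGroup H] [InnerProductSpace ℂ H] [CompleteSpace H]
variable {n : ℕ} {q : ℝ} (M : Model.{u} n q) (U : H ≃ₗᵢ[ℂ] M.Space)

omit [CompleteSpace H] in
lemma Model.intertwines_blockOp (j : Fin n) :
    Intertwines U (blockOp (G := fun p : Index n => M.K p.1) U id (shiftIdx j)
      (fun p => M.entry j p)) (M.op j) := by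
  intro x y
  rw [M.op_eq, mem_graph_blockOp, mem_graph_blockOp]
  rfl

lemma Model.reduces_comap_part (S : Set (Fin (n + 1))) (j : Fin n) :
    Reduces ((M.part S).comap U.toLinearEquiv.toLinearMap)
        (blockOp (G := fun p : Index n => M.K p.1) U id (shiftIdx j) (fun p => M.entry j p)) ∧
      Reduces ((M.part S).comap U.toLinearEquiv.toLinearMap)
        (blockOp (G := fun p : Index n => M.K p.1) U id (shiftIdx j)
          (fun p => M.entry j p)).adjoint := by
  constructor
  · exact reduces_blockOp (G := fun p : Index n => M.K p.1) U (P := {p | p.1 ∈ S}) fun p => Iff.rfl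
  · rw [blockOp_adjoint (G := fun p : Index n => M.K p.1) U (s := id) (t := shiftIdx j)
      (T := fun p => M.entry j p) Function.injective_id (shiftIdx_injective j)]
    exact reduces_blockOp (G := fun p : Index n => M.K p.1) U (P := {p | p.1 ∈ S}) fun p => Iff.rfl

end Transport

end QuantumPlane

end

theorem theorem1 (n : ℕ) (hn : 1 ≤ n) (q : ℝ) (hq0 : 0 < q) (hq1 : q < 1) :
    (∀ (H : Type u) [NormedAddCommGroup H] [InnerProductSpace ℂ H] [CompleteSpace H]
        (z : Fin n → H →ₗ.[ℂ] H) (D : Submodule ℂ H),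
        QuantumPlane.IsWellBehaved q z D →
        ∃ (M : QuantumPlane.Model.{u} n q) (U : H ≃ₗᵢ[ℂ] M.Space),
          (∀ j, QuantumPlane.Intertwines U (z j) (M.op j)) ∧
          (∀ k : Fin n, QuantumPlane.kernel (QuantumPlane.Q z D k) =
            (M.part (Set.Iic k.castSucc)).comap U.toLinearEquiv.toLinearMap) ∧
          (∀ (k : Fin (n + 1)) (j : Fin n),
            QuantumPlane.Reduces ((M.part {k}).comap U.toLinearEquiv.toLinearMap) (z j) ∧
            QuantumPlane.Reduces ((M.part {k}).comap U.toLinearEquiv.toLinearMap)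
              (z j).adjoint)) ∧
    (∀ M : QuantumPlane.Model.{u} n q,
      QuantumPlane.IsWellBehaved q M.op M.dom ∧
      (∀ k : Fin n, QuantumPlane.kernel (QuantumPlane.Q M.op M.dom k) =
        M.part (Set.Iic k.castSucc)) ∧
      (∀ (k : Fin (n + 1)) (j : Fin n),
        QuantumPlane.Reduces (M.part {k}) (M.op j) ∧
        QuantumPlane.Reduces (M.part {k}) (M.op j).adjoint) ∧
      (QuantumPlane.IsIrreducible M.op ↔
        ∃ k : Fin (n + 1), (∀ l, l ≠ k → Subsingleton (M.K l)) ∧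
          Module.finrank ℂ (M.K k) = 1) ∧
      (∀ k : Fin n, Module.finrank ℂ (M.K k.succ) = 1 →
        ∃ a : ℝ, q < a ∧ a ≤ 1 ∧ M.A k = (a : ℂ) • ContinuousLinearMap.id ℂ (M.K k.succ))) := by
  refine ⟨fun H _ _ _ z D h => ?_, fun M => ⟨M.isWellBehaved hq0 hq1, M.kernel_Q hq0 hq1,
    fun k j => M.reduces_part {k} j, ⟨M.finrank_eq_one_of_isIrreducible, fun ⟨_, hk, h1⟩ =>
      M.isIrreducible_of_finrank_eq_one hn hq0 hq1 hk h1⟩, fun _ => M.coeff_scalar⟩⟩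
  obtain ⟨E, hE⟩ := h.exists_spectral
  obtain ⟨M, U, h1, h2⟩ := h.toIsStarRep.exists_model hE hq0 hq1
  refine ⟨M, U, fun j => ?_, h2, fun k j => ?_⟩
  · rw [h1]
    exact M.intertwines_blockOp U j
  · rw [h1]
    exact M.reduces_comap_part U {k} j
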